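/- **Setting.** Let $(\mathbb X,\lambda)$ be a measurable space with a $\sigma$-finite measure $\mathrm dx=\lambda(\mathrm dx)$ and a measurable time $t:\mathbb X\to\mathbb R_+$ whose image measure is absolutely continuous with respect to Lebesgue measure; put $\mathbb X^t=\{x: t(x)<t\}$. A chain is a finite set $\varkappa=\{x_1,\dots,x_n\}\subset\mathbb X$ with $t(x_1)<\dots<t(x_n)$. The set $\mathcal X$ of chains carries the measure $\mathrm d\varkappa$ which is the direct sum over $n\ge 0$ of $\lambda^{\otimes n}$ on time-ordered $n$-tuples, with unit mass at $\emptyset$; $\mathcal X^t$ is the set of chains in $\mathbb X^t$. Let $\mathfrak h$ be a complex Hilbert space and $(\mathfrak k_x)_{x\in\mathbb X}$ a measurable field of separable Hilbert spaces, given through a measurable orthonormal basis, $\mathfrak k_x=\ell^2(J_x)$, $J_x\subset\mathbb N$; write $\mathfrak k^\otimes(\upsilon)=\bigotimes_{x\in\upsilon}\mathfrak k_x$. For a function $q$ on $\mathbb X$ put $q(\varkappa)=\prod_{x\in\varkappa}q(x)$. For $q>0$ let $G_\star(q)$ be the Hilbert space of (classes of) measurable $\chi$ with $\chi(\varkappa)\in\mathfrak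 h\otimes\mathfrak k^\otimes(\varkappa)$ and $\|\chi\|(q)^2=\int\|\chi(\varkappa)\|^2q(\varkappa)\,\mathrm d\varkappa<\infty$. Let $\mathfrak p_0\ni 0$ be an additive semigroup of essentially measurable functions $\mathbb X\to\mathbb R_+$, $\mathfrak p_1=1+\mathfrak p_0$, $G_+=\bigcap_{q\in\mathfrak p_1}G_\star(q)$, $G_-=\bigcup_{q\in\mathfrak p_1}G_\star(q^{-1})$, paired by $\langle\eta\mid\chi\rangle=\int\langle\eta(\varkappa)\mid\chi(\varkappa)\rangle\,\mathrm d\varkappa$. An operator $T:G_+\to G_-$ is called continuous if for some $p\in\mathfrak p_1$ it is bounded from the norm $\|\cdot\|(p)$ to the norm $\|\cdot\|(p^{-1})$; for an operator with domain $V\otimes G_\star(p)$ and values in $V'\otimes G_\star(p^{-1})$, where $V,V'$ are Hilbert spaces, $\|T\|_p$ is its operator norm. The point split is $\mathring\chi(\upsilon)=\chi(\upsilon\sqcup\cdot)\in\mathfrak k^\otimes(\upsilon)\otimes G$. A multi-integrand assigns to each table of chains $\boldsymbol\upsilon=\begin{pmatrix}\upsilon^-_+&\upsilon^-_\circ\\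 \upsilon^\circ_+&\upsilon^\circ_\circ\end{pmatrix}$ a bounded operator $$\mathrm M(\boldsymbol\upsilon):\mathfrak k^\otimes(\upsilon^-_\circ)\otimes\mathfrak k^\otimes(\upsilon^\circ_\circ)\otimes G_\star(q)\to\mathfrak k^\otimes(\upsilon^\circ_\circ)\otimes\mathfrak k^\otimes(\upsilon^\circ_+)\otimes G_\star(q^{-1}),$$ with a fixed $q\in\mathfrak p_1$. It is assumed measurable: $\mathrm M$, the field $\mathrm M^\star$ below and, for almost every $x$, the point derivatives $\dot{\mathrm M}(\mathbf x^\mu_\nu)(\boldsymbol\upsilon)=\mathrm M(\boldsymbol\upsilon\sqcup\mathbf x^\mu_\nu)$ take measurable fields of vectors to measurable fields of vectors, and $\boldsymbol\upsilon\mapsto\|\mathrm M(\boldsymbol\upsilon)\|_q$ is measurable. Here $\mathbf x^\mu_\nu$ ($\mu=-,\circ$; $\nu=\circ,+$) is the table whose only nonempty entry is $\{x\}$, at the place $(\mu,\nu)$. Its multiple QS integral is $$[\imath_0^t(\mathrm M)\chi](\vartheta)=\sum_{\upsilon^\circ_\circ\sqcup\upsilon^\circ_+\subseteq\vartheta\cap\mathbb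 X^t}\int_{\mathcal X^t}\int_{\mathcal X^t}[\mathrm M(\boldsymbol\upsilon)\mathring\chi(\upsilon^-_\circ\sqcup\upsilon^\circ_\circ)](\vartheta\setminus(\upsilon^\circ_\circ\sqcup\upsilon^\circ_+))\,\mathrm d\upsilon^-_+\,\mathrm d\upsilon^-_\circ ,$$ computed with jointly measurable representatives of the integrand; for $\dot{\mathrm M}(\mathbf x^\mu_\nu)$ the same formula is used with the additional tensor factor $\mathfrak k_x$ in the argument if $\nu=\circ$ and in the value if $\mu=\circ$. For a quadruple $\mathbf D=(\mathrm D^\mu_\nu)$ of operator functions, with $\mathrm D^\mu_\nu(x)$ having these tensor factors, the single QS integral is $$[i_0^t(\mathbf D)\chi](\vartheta)=\int_{\mathbb X^t}\big([\mathrm D^-_+(x)\chi](\vartheta)+[\mathrm D^-_\circ(x)\mathring\chi(x)](\vartheta)\big)\mathrm dx+\sum_{x\in\vartheta\cap\mathbb X^t}\big([\mathrm D^\circ_+(x)\chi](\vartheta\setminus x)+[\mathrm D^\circ_\circ(x)\mathring\chi(x)](\vartheta\setminus x)\big).$$ **Theorem.** Let $r,s:\mathbb X\to(0,\infty)$ with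 $r^{-1},s^{-1}\in\mathfrak p_0$, and let $\mathrm M$ be a multi-integrand as above with, for all $t<\infty$, $$\|\mathrm M\|^s_{q,t}(r)=\int_{\mathcal X^t}\Big(\int_{\mathcal X^t}\int_{\mathcal X^t}\operatorname*{ess\,sup}_{\upsilon^\circ_\circ\in\mathcal X^t}\big(s(\upsilon^\circ_\circ)\|\mathrm M(\boldsymbol\upsilon)\|_q\big)^2\,r(\upsilon^\circ_+)\,r(\upsilon^-_\circ)\,\mathrm d\upsilon^\circ_+\,\mathrm d\upsilon^-_\circ\Big)^{1/2}\mathrm d\upsilon^-_+<\infty .$$ Then the following holds for all $t\in\mathbb R_+$ and all essentially measurable $p\ge r^{-1}+q+s^{-1}$. 1. The integral $\mathrm T_t=\imath_0^t(\mathrm M)$ converges absolutely almost everywhere and defines a continuous operator $G_+\to G_-$. It is given by the same formula as a bounded operator $G_\star(p)\to G_\star(p^{-1})$, and $\|\mathrm T_t\|_p\le\|\mathrm M\|^s_{q,t}(r)$. 2. Let $\mathrm M^\star(\boldsymbol\upsilon)=\mathrm M(\boldsymbol\upsilon')^*$, where $\boldsymbol\upsilon'$ is $\boldsymbol\upsilon$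 with $\upsilon^-_\circ$ and $\upsilon^\circ_+$ interchanged and $*$ is the adjoint with respect to the pairing. Then $\|\mathrm M^\star\|^s_{q,t}(r)=\|\mathrm M\|^s_{q,t}(r)$, and $\mathrm T_t^*=\imath_0^t(\mathrm M^\star)$ is a continuous operator $G_+\to G_-$ with $\langle\eta\mid\mathrm T_t\chi\rangle=\langle\mathrm T_t^*\eta\mid\chi\rangle$ on $G_+$ and on $G_\star(p)$, and $\|\mathrm T_t^*\|_p=\|\mathrm T_t\|_p$. 3. For almost every $x$ the QS derivatives $\mathrm D^\mu_\nu(x)=\imath_0^{t(x)}(\dot{\mathrm M}(\mathbf x^\mu_\nu))$ are bounded operators from $G_\star(p)$ to $G_\star(p^{-1})$ (tensored with $\mathfrak k_x$ as above), and $$\int_{\mathbb X^t}\|\mathrm D^-_+(x)\|_p\,\mathrm dx,\quad\Big(\int_{\mathbb X^t}\|\mathrm D(x)\|_p^2\,r(x)\,\mathrm dx\Big)^{1/2}\ (\mathrm D=\mathrm D^-_\circ,\ \mathrm D^\circ_+),\quad\operatorname*{ess\,sup}_{x\in\mathbb X^t}s(x)\|\mathrm D^\circ_\circ(x)\|_p$$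 are all at most $\|\mathrm M\|^s_{q,t}(r)$ (upper integrals, if the norms are not measurable functions of $x$). If moreover $p\in\mathfrak p_1$, then $\mathrm T_t\chi=\mathrm M(\emptyset)\chi+i_0^t(\mathbf D)\chi$ for all $\chi\in G_+$. -/

import Mathlib

open MeasureTheory
open scoped NNReal ENNReal

noncomputable section

/-! ### Finite chains of a space with a time function -/

/-- Finite subsets of `Z`.  The chains among them are those on which the time `τ` is injective,
i.e. the sets `{z₁ < ⋯ < zₙ}` with `τ z₁ < ⋯ < τ zₙ`; all other finite sets will be null. -/
def Conf {Z : Type*} (_τ : Z → ℝ≥0) : Type _ := Finset Z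

namespace Conf

variable {Z : Type*}

open Classical in
/-- The chain `{z₁ < ⋯ < zₙ}` of a time-ordered `n`-tuple. -/
def ofTuple (τ : Z → ℝ≥0) (n : ℕ) (z : {z : Fin n → Z // StrictMono fun i => τ (z i)}) :
    Conf τ :=
  Finset.univ.image z.1

/-- The `σ`-algebra of the disjoint union of the spaces of time-ordered `n`-tuples. -/
instance instMeasurableSpace [MeasurableSpace Z] (τ : Z → ℝ≥0) : MeasurableSpace (Conf τ) :=
  ⨅ n, MeasurableSpace.map (ofTuple τ n) inferInstance

/-- The measure `dϰ = ∏_{z ∈ ϰ} dz` on chains: the direct sum over `n` of the product measures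
`μ^{⊗ n}` on time-ordered `n`-tuples (with unit mass at the empty chain). -/
def vol [MeasurableSpace Z] (μ : Measure Z) (τ : Z → ℝ≥0) : Measure (Conf τ) :=
  Measure.sum fun n => ((Measure.pi fun _ : Fin n => μ).comap Subtype.val).map (ofTuple τ n)

/-- The chains contained in `{z | τ z < t}`. -/
def before (τ : Z → ℝ≥0) (t : ℝ≥0) : Set (Conf τ) := {ϰ | ∀ z ∈ (show Finset Z from ϰ), τ z < t}

end Conf

/-! ### The base space and the field of Hilbert spaces -/

/-- An essentially ordered space `(X, vol)`, with the order induced by a time `X → ℝ₊` whose law is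
absolutely continuous, together with a measurable field of separable Hilbert spaces over it.  The
field is given through a measurable orthonormal basis: the fibre at `x` is the Hilbert
space `𝔨ₓ = ℓ²(idx x)`, with `idx x ⊆ ℕ` depending measurably on `x` (of any cardinality, so the
dimension of `𝔨ₓ` may be any of `0, 1, 2, …, ∞` and may vary with `x`). -/
structure EssOrderedSpace (X : Type*) [MeasurableSpace X] where
  vol : Measure X
  sigmaFinite_vol : SigmaFinite vol
  time : X → ℝ≥0
  measurable_time : Measurable time
  time_ac : vol.map (fun x => (time x : ℝ)) ≪ (volume : Measure ℝ)
  idx : X → Set ℕ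
  measurable_idx : ∀ j, MeasurableSet {x | j ∈ idx x}

/-- Finite sets of marked points `(x, j)`, used as basis indices of tensor products
`⊗_{x ∈ υ} 𝔨ₓ`; a discrete measurable space. -/
def Marking (X : Type*) : Type _ := Finset (X × ℕ)

instance (X : Type*) : MeasurableSpace (Marking X) := ⊤

/-- The positions of a finite set of marked points. -/
def positions {X : Type*} (a : Finset (X × ℕ)) : Finset X :=
  open Classical in a.image Prod.fst

namespace EssOrderedSpace

variable {X : Type*} [MeasurableSpace X] (S : EssOrderedSpace X)

/-- `X^t = {x | t(x) < t}`. -/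
def past (t : ℝ≥0) : Set X := {x | S.time x < t}

/-- Chains `υ` in `X`. -/
abbrev Chain : Type _ := Conf S.time

/-- The measure `dυ` on chains in `X`. -/
def dChain : Measure S.Chain := Conf.vol S.vol S.time

/-- The chains contained in `X^t`. -/
abbrev chainsBefore (t : ℝ≥0) : Set S.Chain := Conf.before S.time t

/-- The measure on marked points `(x, j)`, `j ∈ idx x`; its `L²`-space is the space of
square-integrable sections of the field `x ↦ ℓ²(idx x) = 𝔨ₓ`. -/
def markedVol : Measure (X × ℕ) :=
  (S.vol.prod Measure.count).restrict {y | y.2 ∈ S.idx y.1}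

/-- Chains of marked points.  A function `ψ` on marked chains is a section
`ϰ ↦ ψ(ϰ) ∈ ⊗_{x ∈ ϰ} 𝔨ₓ ⊗ 𝔥` over the chains of `X`: the value of `ψ` at `{(x₁, j₁), …, (xₙ, jₙ)}`
is the coefficient in `𝔥` of `ψ({x₁, …, xₙ})` at the basis vector `e_{j₁} ⊗ ⋯ ⊗ e_{jₙ}`. -/
abbrev MChain : Type _ := Conf fun y : X × ℕ => S.time y.1

/-- The measure on marked chains: `dϰ` together with the counting measure on the marks. -/
def dMChain : Measure S.MChain := Conf.vol S.markedVol fun y => S.time y.1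

/-- The measure `q(ϰ) dϰ`, `q(ϰ) = ∏_{x ∈ ϰ} q(x)`, on marked chains. -/
def weighted (q : X → ℝ≥0) : Measure S.MChain :=
  S.dMChain.withDensity fun ω => ((∏ y ∈ (show Finset (X × ℕ) from ω), q y.1 : ℝ≥0) : ℝ≥0∞)

/-- The points of a marked chain before time `t`. -/
def pastPart (t : ℝ≥0) (ω : Finset (X × ℕ)) : Finset (X × ℕ) :=
  open Classical in ω.filter fun y => S.time y.1 < t

/-- `a` is a basis index of `⊗_{x ∈ υ} 𝔨ₓ`: it has exactly one point `(x, j)`, with `j ∈ idx x`,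
for each `x ∈ υ`. -/
def IsMarking (υ : Finset X) (a : Finset (X × ℕ)) : Prop :=
  positions a = υ ∧ Set.InjOn Prod.fst (a : Set (X × ℕ)) ∧ ∀ y ∈ a, y.2 ∈ S.idx y.1

/-- The counting measure on the basis indices of `⊗_{x ∈ υ} 𝔨ₓ`. -/
def markCount (υ : Finset X) : Measure (Marking X) :=
  Measure.count.restrict {a | S.IsMarking υ a}

/-- The measure whose `L²`-space is `⊗_{x ∈ υ} 𝔨ₓ ⊗ G_⋆(q)`. -/
def coeffMeasure (υ : Finset X) (q : X → ℝ≥0) : Measure (Marking X × S.MChain) :=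
  (S.markCount υ).prod (S.weighted q)

/-! ### The Fock scale -/

/-- The Hilbert space `G_⋆(q) = 𝔥 ⊗ F_⋆(q)`, with `‖χ‖(q)² = ∫ ‖χ(ϰ)‖² q(ϰ) dϰ`. -/
abbrev G (h : Type*) [NormedAddCommGroup h] (q : X → ℝ≥0) : Type _ := Lp h 2 (S.weighted q)

/-- The Hilbert space `⊗_{x ∈ υ} 𝔨ₓ ⊗ G_⋆(q)`, i.e. the `ℓ²`-families of elements of `G_⋆(q)`
indexed by the orthonormal basis of `⊗_{x ∈ υ} 𝔨ₓ`. -/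
abbrev GT (h : Type*) [NormedAddCommGroup h] (υ : Finset X) (q : X → ℝ≥0) : Type _ :=
  Lp h 2 (S.coeffMeasure υ q)

section Scale

variable (h : Type*) [NormedAddCommGroup h] [InnerProductSpace ℂ h]

theorem weighted_ac (q : X → ℝ≥0) : S.weighted q ≪ S.dMChain :=
  withDensity_absolutelyContinuous _ _

theorem weighted_mono {p q : X → ℝ≥0} (hpq : p ≤ q) : S.weighted p ≤ S.weighted q := by
  refine withDensity_mono (Filter.Eventually.of_forall fun ω => ?_)
  simp only [ENNReal.coe_le_coe]
  exact Finset.prod_le_prod' fun y _ => hpq y.1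

/-- `G_+ = ⋂ G_⋆(q)`, `q ∈ 𝔭₁ = 1 + 𝔭₀`. -/
def Gplus (P₀ : AddSubmonoid (X → ℝ≥0)) : Submodule ℂ (S.MChain →ₘ[S.dMChain] h) where
  carrier := {χ | ∀ q₀ ∈ P₀, MemLp χ 2 (S.weighted (1 + q₀))}
  zero_mem' := fun _ _ =>
    (memLp_congr_ae ((S.weighted_ac _).ae_le AEEqFun.coeFn_zero)).2 MemLp.zero
  add_mem' := fun {a b} ha hb q₀ hq =>
    (memLp_congr_ae ((S.weighted_ac _).ae_le (AEEqFun.coeFn_add a b))).2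
      ((ha q₀ hq).add (hb q₀ hq))
  smul_mem' := fun c a ha q₀ hq =>
    (memLp_congr_ae ((S.weighted_ac _).ae_le (AEEqFun.coeFn_smul c a))).2
      ((ha q₀ hq).const_smul c)

/-- `G_- = ⋃ G_⋆(q⁻¹)`, `q ∈ 𝔭₁ = 1 + 𝔭₀`. -/
def Gminus (P₀ : AddSubmonoid (X → ℝ≥0)) : Submodule ℂ (S.MChain →ₘ[S.dMChain] h) where
  carrier := {χ | ∃ q₀ ∈ P₀, MemLp χ 2 (S.weighted (1 + q₀)⁻¹)}
  zero_mem' := ⟨0, P₀.zero_mem,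
    (memLp_congr_ae ((S.weighted_ac _).ae_le AEEqFun.coeFn_zero)).2 MemLp.zero⟩
  add_mem' := by
    rintro a b ⟨q₀, hq₀, ha⟩ ⟨q₁, hq₁, hb⟩
    refine ⟨q₀ + q₁, P₀.add_mem hq₀ hq₁, ?_⟩
    refine (memLp_congr_ae ((S.weighted_ac _).ae_le (AEEqFun.coeFn_add a b))).2 (.add ?_ ?_)
    · refine ha.mono_measure (S.weighted_mono fun x => ?_)
      simp only [Pi.inv_apply, Pi.add_apply, Pi.one_apply]
      gcongr
      simp
    · refine hb.mono_measure (S.weighted_mono fun x => ?_)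
      simp only [Pi.inv_apply, Pi.add_apply, Pi.one_apply]
      gcongr
      simp
  smul_mem' := fun c a ⟨q₀, hq, ha⟩ => ⟨q₀, hq,
    (memLp_congr_ae ((S.weighted_ac _).ae_le (AEEqFun.coeFn_smul c a))).2 (ha.const_smul c)⟩

variable {h}

/-- Continuity of an operator `G_+ → G_-`: for some `p ∈ 𝔭₁` it is bounded from `G_⋆(p)` to
`G_⋆(p⁻¹)`. -/
def IsContinuousOp {P₀ : AddSubmonoid (X → ℝ≥0)} (T : S.Gplus h P₀ →ₗ[ℂ] S.Gminus h P₀) : Prop :=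
  ∃ p₀ ∈ P₀, ∃ C : ℝ≥0, ∀ χ : S.Gplus h P₀,
    eLpNorm (T χ).1 2 (S.weighted (1 + p₀)⁻¹) ≤ C * eLpNorm χ.1 2 (S.weighted (1 + p₀))

/-- `Tp : G_⋆(p) → G_⋆(p⁻¹)` agrees with `T : G_+ → G_-` on `G_+ ∩ G_⋆(p)`. -/
def IsExtension {P₀ : AddSubmonoid (X → ℝ≥0)} {p : X → ℝ≥0}
    (T : S.Gplus h P₀ →ₗ[ℂ] S.Gminus h P₀) (Tp : S.G h p →L[ℂ] S.G h p⁻¹) : Prop :=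
  ∀ (χ : S.Gplus h P₀) (hχ : MemLp χ.1 2 (S.weighted p)), Tp hχ.toLp =ᵐ[S.dMChain] (T χ).1

/-- The pairing `⟨η ∣ χ⟩ = ∫ ⟨η(ϰ) ∣ χ(ϰ)⟩ dϰ`, in which `G_⋆(p)` and `G_⋆(p⁻¹)` are dual. -/
def pairing (η χ : S.MChain → h) : ℂ := ∫ ω, inner ℂ (η ω) (χ ω) ∂S.dMChain

/-- The pairing of `⊗_{x ∈ υ} 𝔨ₓ ⊗ G_⋆(q)` with `⊗_{x ∈ υ} 𝔨ₓ ⊗ G_⋆(q⁻¹)`. -/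
def pairingT (υ : Finset X) (η χ : Marking X × S.MChain → h) : ℂ :=
  ∫ z, inner ℂ (η z) (χ z) ∂((S.markCount υ).prod S.dMChain)

/-- The adjoint, with respect to the pairings, of an operator
`⊗_{υ} 𝔨 ⊗ G_⋆(q) → ⊗_{υ'} 𝔨 ⊗ G_⋆(q⁻¹)`. -/
def IsAdjoint {υ υ' : Finset X} {q : X → ℝ≥0} (A : S.GT h υ q →L[ℂ] S.GT h υ' q⁻¹)
    (A' : S.GT h υ' q →L[ℂ] S.GT h υ q⁻¹) : Prop :=
  ∀ (η : S.GT h υ' q) (ξ : S.GT h υ q), S.pairingT υ' η (A ξ) = S.pairingT υ (A' η) ξ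

open Classical in
/-- The operator adjoint to `A` with respect to the pairings. -/
def adjoint {υ υ' : Finset X} {q : X → ℝ≥0} (A : S.GT h υ q →L[ℂ] S.GT h υ' q⁻¹) :
    S.GT h υ' q →L[ℂ] S.GT h υ q⁻¹ :=
  if H : ∃ A', S.IsAdjoint A A' then H.choose else 0

open Classical in
/-- The action of an operator between the spaces `⊗_{υ} 𝔨 ⊗ G_⋆(q)` on functions representing
elements of these spaces. -/
def app {υ υ' : Finset X} {q q' : X → ℝ≥0} (A : S.GT h υ q →L[ℂ] S.GT h υ' q')
    (f : Marking X × S.MChain → h) : Marking X × S.MChain → h :=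
  if hf : MemLp f 2 (S.coeffMeasure υ q) then A hf.toLp else 0

open Classical in
/-- The multiple point split `ξ ↦ ξ̊(υ)`, for `ξ ∈ ⊗_{x ∈ α} 𝔨ₓ ⊗ G_+`: the function
`ϰ ↦ ξ(υ ⊔ ϰ)`, with coefficients in `⊗_{x ∈ α ⊔ υ} 𝔨ₓ` indexed by the markings `a` of `α ⊔ υ`. The
part of `a` over `α` is the index of `ξ`, and the part of `a` over `υ` joins the argument. -/
def split (α : Finset X) (ξ : Marking X × S.MChain → h) : Marking X × S.MChain → h := fun z =>
  let a : Finset (X × ℕ) := z.1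
  let ω : Finset (X × ℕ) := z.2
  let b : Finset (X × ℕ) := a.filter fun y => y.1 ∈ α
  let ω' : Finset (X × ℕ) := a.filter (fun y => y.1 ∉ α) ∪ ω
  ξ (b, ω')

/-- An element of `G_⋆(q)` as an element of `⊗_{x ∈ ∅} 𝔨ₓ ⊗ G_⋆(q)`. -/
def lift (χ : S.MChain → h) : Marking X × S.MChain → h := fun z => χ z.2

end Scale

end EssOrderedSpace

/-! ### Tables and multi-integrands -/

/-- The four indices `(μ, ν)`, `μ ∈ {-, ∘}`, `ν ∈ {∘, +}`. -/
inductive QSIndex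
  | minusPlus
  | minusCirc
  | circPlus
  | circCirc

/-- A table `𝛖 = (υ^μ_ν)` of four finite sets, `mp = υ⁻₊`, `mc = υ⁻∘`, `cp = υ^∘₊`,
`cc = υ^∘∘`. -/
structure Table (X : Type*) where
  mp : Finset X
  mc : Finset X
  cp : Finset X
  cc : Finset X

namespace Table

variable {X : Type*}

/-- The empty table. -/
def empty : Table X := ⟨∅, ∅, ∅, ∅⟩

/-- The atomic table with the single point `x` at the place `(μ, ν)`. -/
def atom : QSIndex → X → Table X
  | .minusPlus, x => ⟨{x}, ∅, ∅, ∅⟩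
  | .minusCirc, x => ⟨∅, {x}, ∅, ∅⟩
  | .circPlus, x => ⟨∅, ∅, {x}, ∅⟩
  | .circCirc, x => ⟨∅, ∅, ∅, {x}⟩

open Classical in
/-- The union of tables, entry by entry. -/
def union (u v : Table X) : Table X := ⟨u.mp ∪ v.mp, u.mc ∪ v.mc, u.cp ∪ v.cp, u.cc ∪ v.cc⟩

/-- The reflected table `(υ^μ_ν)' = υ^{-ν}_{-μ}`. -/
def reflect (u : Table X) : Table X := ⟨u.mp, u.cp, u.mc, u.cc⟩

open Classical in
/-- `υ⁻∘ ⊔ υ^∘∘`. -/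
def inp (u : Table X) : Finset X := u.mc ∪ u.cc

open Classical in
/-- `υ^∘₊ ⊔ υ^∘∘`. -/
def out (u : Table X) : Finset X := u.cp ∪ u.cc

end Table

variable {X : Type*} [MeasurableSpace X]

/-- A multi-integrand: operators
`M(𝛖) : 𝔨^⊗(υ⁻∘) ⊗ 𝔨^⊗(υ^∘∘) ⊗ G_⋆(q) → 𝔨^⊗(υ^∘∘) ⊗ 𝔨^⊗(υ^∘₊) ⊗ G_⋆(q⁻¹)`. -/
def MultiIntegrand (S : EssOrderedSpace X) (h : Type*) [NormedAddCommGroup h]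
    [InnerProductSpace ℂ h] (q : X → ℝ≥0) : Type _ :=
  ∀ u : Table X, S.GT h u.inp q →L[ℂ] S.GT h u.out q⁻¹

namespace MultiIntegrand

variable {S : EssOrderedSpace X} {h : Type*} [NormedAddCommGroup h] [InnerProductSpace ℂ h]
  {q : X → ℝ≥0}

/-- The multi-integrand `M⋆(𝛖) = M(𝛖')*`. -/
def star (M : MultiIntegrand S h q) : MultiIntegrand S h q := fun u => S.adjoint (M u.reflect)

open Classical in
/-- The union of three sets of marked points, as a marking. -/
def join (a b c : Finset (X × ℕ)) : Marking X := show Finset (X × ℕ) from a ∪ b ∪ c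

/-- The measure on `(υ⁻₊, υ⁻∘, ω^∘∘, ω^∘₊)`, where `ω^∘_ν` is a marked chain over `υ^∘_ν`. -/
def baseMeasure (S : EssOrderedSpace X) :
    Measure (S.Chain × S.Chain × S.MChain × S.MChain) :=
  S.dChain.prod (S.dChain.prod (S.dMChain.prod S.dMChain))

/-- The table of unmarked chains under `(υ⁻₊, υ⁻∘, ω^∘∘, ω^∘₊)`. -/
def outTable (z : S.Chain × S.Chain × S.MChain × S.MChain) : Table X :=
  ⟨z.1, z.2.1, positions z.2.2.2, positions z.2.2.1⟩

/-- For a field of vectors `f(𝛖) ∈ ⊗_{(𝛖 ⊔ B).inp} 𝔨 ⊗ G_⋆(q)`, the function `F` is a jointly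
measurable representative of the field of vectors `M(𝛖 ⊔ B) f(𝛖)`: its value at
`d`, `(υ⁻₊, υ⁻∘, ω^∘∘, ω^∘₊)` and `ω` is the coefficient of `[M(𝛖 ⊔ B) f(𝛖)](ω)` at the basis index
`d ⊔ ω^∘∘ ⊔ ω^∘₊`. -/
def IsVersion (M : MultiIntegrand S h q) (B : Table X)
    (f : Table X → Marking X × S.MChain → h)
    (F : Marking X → (S.Chain × S.Chain × S.MChain × S.MChain) × S.MChain → h) : Prop :=
  ∀ d, S.IsMarking B.out d →
    AEStronglyMeasurable (F d) ((baseMeasure S).prod S.dMChain) ∧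
    ∀ᵐ z ∂(baseMeasure S), ∀ᵐ ω ∂S.dMChain,
      F d (z, ω) =
        S.app (M ((outTable z).union B)) (f (outTable z)) (join d z.2.2.1 z.2.2.2, ω)

/-- The field of vectors `f(𝛖) ∈ ⊗_{(𝛖 ⊔ B).inp} 𝔨 ⊗ G_⋆(q)` is jointly measurable in
`υ⁻₊, ω⁻∘, ω^∘∘, υ^∘₊, ω`, where `ω^μ_∘` is a marked chain over `υ^μ_∘`. -/
def IsMeasurableInput (S : EssOrderedSpace X) (B : Table X)
    (f : Table X → Marking X × S.MChain → h) : Prop :=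
  ∀ e, S.IsMarking B.inp e →
    AEStronglyMeasurable
      (fun z : S.Chain × S.MChain × S.MChain × S.Chain × S.MChain =>
        f ⟨z.1, positions z.2.1, z.2.2.2.1, positions z.2.2.1⟩ (join e z.2.1 z.2.2.1, z.2.2.2.2))
      (S.dChain.prod (S.dMChain.prod (S.dMChain.prod (S.dChain.prod S.dMChain))))

/-- The measure on the tables of chains in `X`. -/
def tableMeasure (S : EssOrderedSpace X) : Measure (S.Chain × S.Chain × S.Chain × S.Chain) :=
  S.dChain.prod (S.dChain.prod (S.dChain.prod S.dChain))

/-- The table `(υ⁻₊, υ⁻∘, υ^∘₊, υ^∘∘)`. -/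
def toTable (z : S.Chain × S.Chain × S.Chain × S.Chain) : Table X :=
  ⟨z.1, z.2.1, z.2.2.1, z.2.2.2⟩

/-- `𝛖 ↦ M(𝛖 ⊔ B)` is a measurable field of operators: it takes measurable fields of vectors to
measurable fields of vectors. -/
def IsMeasurableField (M : MultiIntegrand S h q) (B : Table X) : Prop :=
  ∀ f : Table X → Marking X × S.MChain → h, IsMeasurableInput S B f →
    (∀ᵐ z ∂(tableMeasure S),
      MemLp (f (toTable z)) 2 (S.coeffMeasure ((toTable z).union B).inp q)) →
    ∃ F, M.IsVersion B f F

/-- Measurability of a multi-integrand: `M` and, almost everywhere, its point derivatives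
`Ṁ(𝐱)(𝛖) = M(𝛖 ⊔ 𝐱)` are measurable fields of operators, so is `M⋆`, and `‖M(𝛖)‖_q` is measurable.
(When the `L²`-spaces involved are separable, everything follows from the first property; in
general the adjoint, the sections and the norm of a measurable field need not be measurable.) -/
structure IsMeasurable (M : MultiIntegrand S h q) : Prop where
  field : M.IsMeasurableField Table.empty
  derivative : ∀ k : QSIndex, ∀ᵐ x ∂S.vol, M.IsMeasurableField (Table.atom k x)
  field_star : M.star.IsMeasurableField Table.empty
  norm : AEMeasurable (fun z => ‖M (toTable z)‖ₑ) (tableMeasure S)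

/-- The integrand norm
`‖M‖^s_{q,t}(r) = ∫ (∬ ess sup (s(υ^∘∘) ‖M(𝛖)‖_q)² r(υ^∘₊ ⊔ υ⁻∘) dυ^∘₊ dυ⁻∘)^{1/2} dυ⁻₊`, all chains
being in `X^t`. -/
def polyNorm (M : MultiIntegrand S h q) (r s : X → ℝ≥0) (t : ℝ≥0) : ℝ≥0∞ :=
  ∫⁻ mp in S.chainsBefore t,
    (∫⁻ cp in S.chainsBefore t, ∫⁻ mc in S.chainsBefore t,
      (essSup (fun cc : S.Chain =>
          ((∏ x ∈ (show Finset X from cc), s x : ℝ≥0) : ℝ≥0∞) * ‖M ⟨mp, mc, cp, cc⟩‖ₑ)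
        (S.dChain.restrict (S.chainsBefore t))) ^ 2
      * (((∏ x ∈ (show Finset X from cp), r x) * ∏ x ∈ (show Finset X from mc), r x : ℝ≥0) : ℝ≥0∞)
      ∂S.dChain ∂S.dChain) ^ (1 / 2 : ℝ) ∂S.dChain

open Classical in
/-- The summand of the multiple integral at the parts `b = ω^∘∘` and `c = ω^∘₊` of the marked chain
`ϑ`, as a function of `(υ⁻₊, υ⁻∘)`. -/
def summand (F : (S.Chain × S.Chain × S.MChain × S.MChain) × S.MChain → h)
    (ϑ b c : Finset (X × ℕ)) (z : S.Chain × S.Chain) : h :=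
  F ((z.1, z.2, b, c), show Finset (X × ℕ) from ϑ \ (b ∪ c))

/-- The function `ψ` represents the multiple quantum stochastic integral `ı₀ᵗ(M(· ⊔ B)) ξ`,
`[ı₀ᵗ(M(· ⊔ B)) ξ](ϑ) = ∑_{υ^∘∘ ⊔ υ^∘₊ ⊆ ϑᵗ} ∬ [M(𝛖 ⊔ B) ξ̊(υ⁻∘ ⊔ υ^∘∘)](υ^∘₋) dυ⁻₊ dυ⁻∘`,
`υ^∘₋ = ϑ ∖ (υ^∘∘ ⊔ υ^∘₊)`, where `ξ ∈ ⊗_{x ∈ B.inp} 𝔨ₓ ⊗ G` and the values are in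
`⊗_{x ∈ B.out} 𝔨ₓ ⊗ G`.  It is required that the integrand has a jointly measurable representative,
that the integrals converge absolutely for almost every `ϑ`, and that the formula holds for every
such representative.  For the empty table `B` this is the integral of `M`, and for an atomic
table `B = 𝐱` it is the integral of the point derivative `Ṁ(𝐱)`. -/
def IsIntegral (M : MultiIntegrand S h q) (B : Table X) (t : ℝ≥0)
    (ξ ψ : Marking X × S.MChain → h) : Prop :=
  (∃ F, M.IsVersion B (fun _ => S.split B.inp ξ) F) ∧
  ∀ F, M.IsVersion B (fun _ => S.split B.inp ξ) F →
    ∀ d, S.IsMarking B.out d → ∀ᵐ ϑ ∂S.dMChain,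
      (∀ b c : Finset (X × ℕ), b ⊆ S.pastPart t ϑ → c ⊆ S.pastPart t ϑ → Disjoint b c →
        IntegrableOn (summand (F d) ϑ b c) (S.chainsBefore t ×ˢ S.chainsBefore t)
          (S.dChain.prod S.dChain)) ∧
      ψ (d, ϑ) =
        open Classical in
        ∑ b ∈ (S.pastPart t ϑ).powerset, ∑ c ∈ (S.pastPart t ϑ \ b).powerset,
          ∫ z in S.chainsBefore t ×ˢ S.chainsBefore t, summand (F d) ϑ b c z
            ∂(S.dChain.prod S.dChain)

end MultiIntegrand

/-! ### Single integrals -/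

/-- A quadruple `𝐃 = (D^μ_ν)` of operator-valued functions on `X`: `D⁻₊(x) : G_⋆(p) → G_⋆(p⁻¹)`,
`D⁻∘(x) : 𝔨ₓ ⊗ G_⋆(p) → G_⋆(p⁻¹)`, `D^∘₊(x) : G_⋆(p) → 𝔨ₓ ⊗ G_⋆(p⁻¹)` and
`D^∘∘(x) : 𝔨ₓ ⊗ G_⋆(p) → 𝔨ₓ ⊗ G_⋆(p⁻¹)`. -/
def QSIntegrand (S : EssOrderedSpace X) (h : Type*) [NormedAddCommGroup h]
    [InnerProductSpace ℂ h] (p : X → ℝ≥0) : Type _ :=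
  ∀ (k : QSIndex) (x : X), S.GT h (Table.atom k x).inp p →L[ℂ] S.GT h (Table.atom k x).out p⁻¹

/-- The upper integral of a nonnegative function (the integral, if the function is measurable). -/
def upperLIntegral (μ : Measure X) (f : X → ℝ≥0∞) : ℝ≥0∞ :=
  ⨅ (g : X → ℝ≥0∞) (_ : Measurable g) (_ : f ≤ᵐ[μ] g), ∫⁻ x, g x ∂μ

namespace QSIntegrand

variable {S : EssOrderedSpace X} {h : Type*} [NormedAddCommGroup h] [InnerProductSpace ℂ h]
  {p : X → ℝ≥0}

/-- `‖D‖^{(1)}_{p,t} = ∫_{X^t} ‖D(x)‖_p dx`. -/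
def normOne (D : QSIntegrand S h p) (k : QSIndex) (t : ℝ≥0) : ℝ≥0∞ :=
  upperLIntegral (S.vol.restrict (S.past t)) fun x => ‖D k x‖ₑ

/-- `‖D‖^{(2)}_{p,t}(r) = (∫_{X^t} ‖D(x)‖_p² r(x) dx)^{1/2}`. -/
def normTwo (D : QSIntegrand S h p) (k : QSIndex) (r : X → ℝ≥0) (t : ℝ≥0) : ℝ≥0∞ :=
  (upperLIntegral (S.vol.restrict (S.past t)) fun x => ‖D k x‖ₑ ^ 2 * r x) ^ (1 / 2 : ℝ)

/-- `‖D‖^{(∞)}_{p,t}(s) = ess sup_{x ∈ X^t} s(x) ‖D(x)‖_p`. -/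
def normTop (D : QSIntegrand S h p) (k : QSIndex) (s : X → ℝ≥0) (t : ℝ≥0) : ℝ≥0∞ :=
  essSup (fun x => s x * ‖D k x‖ₑ) (S.vol.restrict (S.past t))

/-- `E` is a jointly measurable representative of `(x, ϑ) ↦ [D(x) f(x)](ϑ)`, for `D(x)` with values
in `G_⋆(p⁻¹)`. -/
def IsScalarVersion (D : QSIntegrand S h p) (k : QSIndex) (f : Marking X × S.MChain → h)
    (E : X × S.MChain → h) : Prop :=
  AEStronglyMeasurable E (S.vol.prod S.dMChain) ∧
  ∀ᵐ x ∂S.vol, ∀ᵐ ϑ ∂S.dMChain, E (x, ϑ) = S.app (D k x) f ((∅ : Finset (X × ℕ)), ϑ)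

/-- `E` is a jointly measurable representative of `(x, ϑ) ↦ [D(x) f(x)](ϑ)`, for `D(x)` with values
in `𝔨ₓ ⊗ G_⋆(p⁻¹)`, in terms of coefficients: `E((x, j), ϑ)` is the coefficient at the `j`-th basis
vector of `𝔨ₓ`. -/
def IsVectorVersion (D : QSIntegrand S h p) (k : QSIndex) (f : Marking X × S.MChain → h)
    (E : (X × ℕ) × S.MChain → h) : Prop :=
  AEStronglyMeasurable E (S.markedVol.prod S.dMChain) ∧
  ∀ᵐ y ∂S.markedVol, ∀ᵐ ϑ ∂S.dMChain,
    E (y, ϑ) = S.app (D k y.1) f (({y} : Finset (X × ℕ)), ϑ)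

/-- The function `ψ` represents the single quantum stochastic integral `i₀ᵗ(𝐃) χ`,
`[i₀ᵗ(𝐃)χ](ϑ) = ∫_{X^t} ([D⁻₊(x) χ](ϑ) + [D⁻∘(x) χ̊(x)](ϑ)) dx`
`+ ∑_{x ∈ ϑᵗ} ([D^∘₊(x) χ](ϑ ∖ x) + [D^∘∘(x) χ̊(x)](ϑ ∖ x))`,
where `χ̊(x) = χ(x ⊔ ·)`.  It is required that the integrands have jointly measurable
representatives, that the integrals converge absolutely for almost every `ϑ`, and that the formula
holds for all such representatives. -/
def IsIntegral (D : QSIntegrand S h p) (t : ℝ≥0) (χ ψ : S.MChain → h) : Prop :=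
  let χ₀ := S.lift χ
  let χ₁ := S.split ∅ (S.lift χ)
  (∃ E, D.IsScalarVersion .minusPlus χ₀ E) ∧ (∃ E, D.IsScalarVersion .minusCirc χ₁ E) ∧
  (∃ E, D.IsVectorVersion .circPlus χ₀ E) ∧ (∃ E, D.IsVectorVersion .circCirc χ₁ E) ∧
  ∀ E₁ E₂ E₃ E₄, D.IsScalarVersion .minusPlus χ₀ E₁ → D.IsScalarVersion .minusCirc χ₁ E₂ →
    D.IsVectorVersion .circPlus χ₀ E₃ → D.IsVectorVersion .circCirc χ₁ E₄ →
    ∀ᵐ ϑ ∂S.dMChain,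
      IntegrableOn (fun x => E₁ (x, ϑ)) (S.past t) S.vol ∧
      IntegrableOn (fun x => E₂ (x, ϑ)) (S.past t) S.vol ∧
      ψ ϑ = (∫ x in S.past t, E₁ (x, ϑ) ∂S.vol) + (∫ x in S.past t, E₂ (x, ϑ) ∂S.vol) +
        open Classical in
        ∑ y ∈ S.pastPart t ϑ,
          (E₃ (y, (show Finset (X × ℕ) from ϑ).erase y) +
            E₄ (y, (show Finset (X × ℕ) from ϑ).erase y))

end QSIntegrand

end

noncomputable section

set_option linter.unusedSectionVars false

namespace Conf

variable {Z : Type*}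

/-- The finite set underlying a configuration. -/
def fin {τ : Z → ℝ≥0} (a : Conf τ) : Finset Z := a

open Classical in
/-- The configuration formed by the values of a family of points. -/
def image (τ : Z → ℝ≥0) {n : ℕ} (z : Fin n → Z) : Conf τ := Finset.univ.image z

open Classical in
/-- The union of two configurations. -/
def un {τ : Z → ℝ≥0} (a b : Conf τ) : Conf τ := (a.fin ∪ b.fin : Finset Z)

open Classical in
/-- The difference of two configurations. -/
def sdiff {τ : Z → ℝ≥0} (a b : Conf τ) : Conf τ := (a.fin \ b.fin : Finset Z)

open Classical in
/-- The configuration `a` with the point `x` added. -/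
def ins {τ : Z → ℝ≥0} (x : Z) (a : Conf τ) : Conf τ := (insert x a.fin : Finset Z)

/-- The empty configuration. -/
def nil (τ : Z → ℝ≥0) : Conf τ := (∅ : Finset Z)

/-- The latest time of a configuration. -/
def last {τ : Z → ℝ≥0} (a : Conf τ) : ℝ≥0 := a.fin.sup τ

/-- Time-ordered tuples. -/
abbrev Tup (τ : Z → ℝ≥0) (n : ℕ) : Type _ := {z : Fin n → Z // StrictMono fun i => τ (z i)}

theorem mem_ofTuple {τ : Z → ℝ≥0} {n : ℕ} (z : Tup τ n) (x : Z) :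
    x ∈ (ofTuple τ n z).fin ↔ ∃ i, z.1 i = x := by
  simp [ofTuple, fin]

theorem tup_injective {τ : Z → ℝ≥0} {n : ℕ} (z : Tup τ n) : Function.Injective z.1 :=
  fun i j hij => z.2.injective (by simp [hij])

theorem card_ofTuple {τ : Z → ℝ≥0} {n : ℕ} (z : Tup τ n) : (ofTuple τ n z).fin.card = n := by
  classical
  unfold ofTuple fin
  rw [Finset.card_image_of_injective _ (tup_injective z)]
  simp

theorem ofTuple_injective (τ : Z → ℝ≥0) (n : ℕ) : Function.Injective (ofTuple τ n) := by
  intro z w hzw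
  have hm : ∀ x, (∃ i, z.1 i = x) ↔ ∃ i, w.1 i = x := fun x => by
    rw [← mem_ofTuple, ← mem_ofTuple, hzw]
  have hr : Set.range (fun i => τ (z.1 i)) = Set.range fun i => τ (w.1 i) := by
    ext c
    constructor
    · rintro ⟨i, rfl⟩
      obtain ⟨j, hj⟩ := (hm _).1 ⟨i, rfl⟩
      exact ⟨j, by simp [hj]⟩
    · rintro ⟨i, rfl⟩
      obtain ⟨j, hj⟩ := (hm _).2 ⟨i, rfl⟩
      exact ⟨j, by simp [hj]⟩
  have hf := (StrictMono.range_inj z.2 w.2).1 hr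
  apply Subtype.ext
  funext i
  obtain ⟨j, hj⟩ := (hm _).1 ⟨i, rfl⟩
  have h1 := congrFun hf i
  have : τ (w.1 j) = τ (w.1 i) := by rw [hj]; exact h1
  rw [← hj, w.2.injective this]

variable [MeasurableSpace Z] {τ : Z → ℝ≥0}

theorem measurable_ofTuple (τ : Z → ℝ≥0) (n : ℕ) : Measurable (ofTuple τ n) := by
  intro s hs
  exact (MeasurableSpace.measurableSet_iInf.1 hs) n

theorem measurable_of_comp {Y : Type*} [MeasurableSpace Y] {f : Conf τ → Y}
    (hf : ∀ n, Measurable fun z => f (ofTuple τ n z)) : Measurable f := by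
  intro s hs
  exact MeasurableSpace.measurableSet_iInf.2 fun n => hf n hs

theorem measurableEmbedding_ofTuple (τ : Z → ℝ≥0) (n : ℕ) :
    MeasurableEmbedding (ofTuple τ n) where
  injective := ofTuple_injective τ n
  measurable := measurable_ofTuple τ n
  measurableSet_image' := by
    intro s hs
    refine MeasurableSpace.measurableSet_iInf.2 fun m => ?_
    change MeasurableSet (ofTuple τ m ⁻¹' _)
    by_cases hmn : m = n
    · subst hmn
      rwa [Set.preimage_image_eq _ (ofTuple_injective τ m)]
    · convert MeasurableSet.empty
      ext z
      simp only [Set.mem_preimage, Set.mem_image, Set.mem_empty_iff_false, iff_false]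
      rintro ⟨w, -, hw⟩
      exact hmn (by rw [← card_ofTuple z, ← card_ofTuple w, hw])

theorem measurable_card : Measurable fun a : Conf τ => a.fin.card :=
  measurable_of_comp fun n => by simp only [card_ofTuple]; exact measurable_const

theorem last_ofTuple {n : ℕ} (z : Tup τ n) :
    (ofTuple τ n z).last = Finset.univ.sup fun i => τ (z.1 i) := by
  classical
  unfold last fin ofTuple
  rw [Finset.sup_image]
  rfl

theorem measurable_last (hτ : Measurable τ) : Measurable (last (τ := τ)) :=
  measurable_of_comp fun n => by
    simp only [last_ofTuple]
    have h : ∀ s : Finset (Fin n), Measurable fun z : Tup τ n => s.sup fun i => τ (z.1 i) := by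
      intro s
      induction s using Finset.cons_induction with
      | empty => simp
      | cons i s hi ih =>
        simp only [Finset.sup_cons]
        exact (hτ.comp ((measurable_pi_apply i).comp measurable_subtype_coe)).sup ih
    exact h _

theorem mem_before {t : ℝ≥0} {a : Conf τ} : a ∈ before τ t ↔ ∀ z ∈ a.fin, τ z < t := Iff.rfl

theorem mem_before_iff {t : ℝ≥0} {a : Conf τ} :
    a ∈ before τ t ↔ a.fin.card = 0 ∨ a.last < t := by
  rw [mem_before]
  constructor
  · intro h
    by_cases h0 : a.fin.card = 0
    · exact Or.inl h0
    · right
      obtain ⟨z, hz⟩ := Finset.card_pos.1 (Nat.pos_of_ne_zero h0)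
      exact (Finset.sup_lt_iff (lt_of_le_of_lt zero_le (h z hz))).2 h
  · rintro (h | h) z hz
    · rw [Finset.card_eq_zero] at h
      simp [h] at hz
    · exact lt_of_le_of_lt (Finset.le_sup (f := τ) hz) h

theorem measurableSet_before_pair (hτ : Measurable τ) {Y : Type*} [MeasurableSpace Y]
    {f : Y → ℝ≥0} {g : Y → Conf τ} (hf : Measurable f) (hg : Measurable g) :
    MeasurableSet {y | g y ∈ before τ (f y)} := by
  have h1 : MeasurableSet {y | (g y).fin.card = 0} :=
    measurableSet_eq_fun (measurable_card.comp hg) measurable_const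
  have h2 : MeasurableSet {y | (g y).last < f y} :=
    measurableSet_lt ((measurable_last hτ).comp hg) hf
  convert h1.union h2 using 1
  ext y
  exact mem_before_iff

theorem measurableSet_before (hτ : Measurable τ) (t : ℝ≥0) : MeasurableSet (before τ t) :=
  measurableSet_before_pair hτ measurable_const measurable_id

theorem measurableSet_strictMono (hτ : Measurable τ) (n : ℕ) :
    MeasurableSet {z : Fin n → Z | StrictMono fun i => τ (z i)} := by
  have : {z : Fin n → Z | StrictMono fun i => τ (z i)} =
      ⋂ i, ⋂ j, {z | i < j → τ (z i) < τ (z j)} := by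
    ext z
    simp only [Set.mem_ofPred_eq, Set.mem_iInter]
    exact ⟨fun h i j hij => h hij, fun h i j hij => h i j hij⟩
  rw [this]
  refine MeasurableSet.iInter fun i => MeasurableSet.iInter fun j => ?_
  by_cases hij : i < j
  · simp only [hij, forall_const]
    exact measurableSet_lt (hτ.comp (measurable_pi_apply i)) (hτ.comp (measurable_pi_apply j))
  · simp [hij]

/-- The product measure on time-ordered tuples. -/
def tupVol (μ : Measure Z) (τ : Z → ℝ≥0) (n : ℕ) : Measure (Tup τ n) :=
  (Measure.pi fun _ : Fin n => μ).comap Subtype.val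

instance (μ : Measure Z) [SigmaFinite μ] (n : ℕ) : SigmaFinite (Measure.pi fun _ : Fin n => μ) :=
  inferInstance

instance sigmaFinite_tupVol (μ : Measure Z) [SigmaFinite μ] (n : ℕ) :
    SigmaFinite (tupVol μ τ n) := by
  classical
  refine Measure.sigmaFinite_of_countable (S := Set.range fun k =>
    (Subtype.val ⁻¹' spanningSets (Measure.pi fun _ : Fin n => μ) k)) (Set.countable_range _) ?_ ?_
  · rintro _ ⟨k, rfl⟩
    refine lt_of_le_of_lt (Measure.comap_apply_le _ _ ?_) (lt_of_le_of_lt (measure_mono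
      (Set.image_preimage_subset _ _)) (measure_spanningSets_lt_top
        (Measure.pi fun _ : Fin n => μ) k))
    exact ((measurableSet_spanningSets _ k).preimage measurable_subtype_coe).nullMeasurableSet
  · rw [Set.sUnion_range, ← Set.preimage_iUnion, iUnion_spanningSets, Set.preimage_univ]

theorem vol_eq (μ : Measure Z) (τ : Z → ℝ≥0) :
    vol μ τ = Measure.sum fun n => (tupVol μ τ n).map (ofTuple τ n) := rfl

theorem ae_vol_iff {μ : Measure Z} {P : Conf τ → Prop} :
    (∀ᵐ a ∂vol μ τ, P a) ↔ ∀ n, ∀ᵐ z ∂tupVol μ τ n, P (ofTuple τ n z) := by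
  rw [vol_eq, Measure.ae_sum_iff]
  simp only [(measurableEmbedding_ofTuple τ _).ae_map_iff]

theorem measurableEmbedding_val (hτ : Measurable τ) (n : ℕ) :
    MeasurableEmbedding (Subtype.val : Tup τ n → Fin n → Z) :=
  MeasurableEmbedding.subtype_coe (measurableSet_strictMono hτ n)

theorem map_val_tupVol (hτ : Measurable τ) {μ : Measure Z} {n : ℕ} :
    (tupVol μ τ n).map Subtype.val =
      (Measure.pi fun _ : Fin n => μ).restrict {z | StrictMono fun i => τ (z i)} :=
  map_comap_subtype_coe (measurableSet_strictMono hτ n) _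

theorem ae_tupVol_iff (hτ : Measurable τ) {μ : Measure Z} {n : ℕ} {P : (Fin n → Z) → Prop} :
    (∀ᵐ z ∂tupVol μ τ n, P z.1) ↔
      ∀ᵐ z ∂(Measure.pi fun _ : Fin n => μ), StrictMono (fun i => τ (z i)) → P z := by
  have h := measurableEmbedding_val hτ n
  refine (h.ae_map_iff (p := P) (μ := tupVol μ τ n)).symm.trans ?_
  rw [map_val_tupVol hτ, ae_restrict_iff' (measurableSet_strictMono hτ n)]
  rfl

theorem ae_isChain {μ : Measure Z} :
    ∀ᵐ a ∂vol μ τ, Set.InjOn τ (a.fin : Set Z) := by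
  refine ae_vol_iff.2 fun n => Filter.Eventually.of_forall fun z => ?_
  intro x hx y hy hxy
  obtain ⟨i, rfl⟩ := (mem_ofTuple z x).1 hx
  obtain ⟨j, rfl⟩ := (mem_ofTuple z y).1 hy
  rw [z.2.injective hxy]

theorem ae_forall_mem (hτ : Measurable τ) {μ : Measure Z} [SigmaFinite μ] {P : Z → Prop}
    (hP : ∀ᵐ z ∂μ, P z) : ∀ᵐ a ∂vol μ τ, ∀ z ∈ a.fin, P z := by
  refine ae_vol_iff.2 fun n => ?_
  have h : ∀ i : Fin n, ∀ᵐ z ∂(Measure.pi fun _ : Fin n => μ), P (z i) := fun i =>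
    (Measure.quasiMeasurePreserving_eval (fun _ : Fin n => μ) i).ae hP
  have h2 : ∀ᵐ z ∂tupVol μ τ n, ∀ i, P (z.1 i) := by
    rw [ae_tupVol_iff hτ (P := fun z => ∀ i, P (z i))]
    filter_upwards [ae_all_iff.2 h] with z hz _ i using hz i
  filter_upwards [h2] with z hz x hx
  obtain ⟨i, rfl⟩ := (mem_ofTuple z x).1 hx
  exact hz i

instance sigmaFinite_vol (μ : Measure Z) [SigmaFinite μ] : SigmaFinite (vol μ τ) := by
  refine Measure.sigmaFinite_of_countable (S := insert (⋃ n, Set.range (ofTuple τ n))ᶜ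
    (Set.range fun p : ℕ × ℕ => ofTuple τ p.1 '' spanningSets (tupVol μ τ p.1) p.2))
    ((Set.countable_range _).insert _) ?_ ?_
  · rintro s (rfl | ⟨⟨n, k⟩, rfl⟩)
    · have : vol μ τ (⋃ n, Set.range (ofTuple τ n))ᶜ = 0 := by
        change ∀ᵐ a ∂vol μ τ, a ∈ ⋃ n, Set.range (ofTuple τ n)
        refine ae_vol_iff.2 fun n => Filter.Eventually.of_forall fun z => ?_
        exact Set.mem_iUnion.2 ⟨n, z, rfl⟩
      rw [this]; exact ENNReal.zero_lt_top
    · have hm := (measurableEmbedding_ofTuple τ n).measurableSet_image.2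
        (measurableSet_spanningSets (tupVol μ τ n) k)
      simp only
      rw [vol_eq, Measure.sum_apply _ hm, tsum_eq_single n]
      · rw [(measurableEmbedding_ofTuple τ n).map_apply,
          Set.preimage_image_eq _ (ofTuple_injective τ n)]
        exact measure_spanningSets_lt_top _ k
      · intro m hm'
        rw [(measurableEmbedding_ofTuple τ m).map_apply]
        convert measure_empty
        · ext z
          simp only [Set.mem_preimage, Set.mem_image, Set.mem_empty_iff_false, iff_false]
          rintro ⟨w, -, hw⟩
          exact hm' (by rw [← card_ofTuple z, ← card_ofTuple w, hw])
        · infer_instance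
  · rw [Set.sUnion_insert, Set.sUnion_range]
    refine Set.eq_univ_of_forall fun a => ?_
    by_cases ha : a ∈ ⋃ n, Set.range (ofTuple τ n)
    · obtain ⟨n, z, rfl⟩ := Set.mem_iUnion.1 ha
      obtain ⟨k, hk⟩ := Set.mem_iUnion.1
        ((iUnion_spanningSets (tupVol μ τ n)).symm ▸ Set.mem_univ z)
      exact Or.inr (Set.mem_iUnion.2 ⟨(n, k), z, hk, rfl⟩)
    · exact Or.inl ha

theorem lintegral_vol_eq (μ : Measure Z) (f : Conf τ → ℝ≥0∞) :
    ∫⁻ a, f a ∂vol μ τ = ∑' n, ∫⁻ z, f (ofTuple τ n z) ∂tupVol μ τ n := by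
  rw [vol_eq, lintegral_sum_measure]
  simp only [(measurableEmbedding_ofTuple τ _).lintegral_map]

section Product

variable {Y : Type*} [MeasurableSpace Y] {ν : Measure Y} [SFinite ν] {μ : Measure Z}
  [SigmaFinite μ]

theorem prod_vol_eq : ν.prod (vol μ τ) =
    Measure.sum fun n => (ν.prod (tupVol μ τ n)).map (Prod.map id (ofTuple τ n)) := by
  rw [vol_eq, Measure.prod_sum_right]
  congr 1
  funext n
  rw [← Measure.map_prod_map _ _ measurable_id (measurable_ofTuple τ n), Measure.map_id]

theorem measurableEmbedding_prodMap (n : ℕ) :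
    MeasurableEmbedding (Prod.map (id : Y → Y) (ofTuple τ n)) :=
  MeasurableEmbedding.prodMap .id (measurableEmbedding_ofTuple τ n)

theorem ae_prod_vol_iff {P : Y × Conf τ → Prop} :
    (∀ᵐ p ∂ν.prod (vol μ τ), P p) ↔
      ∀ n, ∀ᵐ p ∂ν.prod (tupVol μ τ n), P (p.1, ofTuple τ n p.2) := by
  rw [prod_vol_eq, Measure.ae_sum_iff]
  simp only [(measurableEmbedding_prodMap _).ae_map_iff]
  rfl

theorem aemeasurable_prod_vol_iff {W : Type*} [MeasurableSpace W] {f : Y × Conf τ → W} :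
    AEMeasurable f (ν.prod (vol μ τ)) ↔
      ∀ n, AEMeasurable (fun p => f (p.1, ofTuple τ n p.2)) (ν.prod (tupVol μ τ n)) := by
  rw [prod_vol_eq, aemeasurable_sum_measure_iff]
  simp only [(measurableEmbedding_prodMap _).aemeasurable_map_iff]
  rfl

theorem aestronglyMeasurable_prod_vol_iff {W : Type*} [PseudoEMetricSpace W]
    {f : Y × Conf τ → W} :
    AEStronglyMeasurable f (ν.prod (vol μ τ)) ↔
      ∀ n, AEStronglyMeasurable (fun p => f (p.1, ofTuple τ n p.2)) (ν.prod (tupVol μ τ n)) := by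
  let _ := (PseudoEMetricSpace.toUniformSpace : UniformSpace W)
  rw [prod_vol_eq, aestronglyMeasurable_sum_measure_iff]
  simp only [(measurableEmbedding_prodMap _).aestronglyMeasurable_map_iff]
  rfl

end Product

end Conf

namespace Conf

variable {Z : Type*} [MeasurableSpace Z] {τ : Z → ℝ≥0}

/-- The set of chains. -/
def chains (τ : Z → ℝ≥0) : Set (Conf τ) := ⋃ n, Set.range (ofTuple τ n)

theorem ofTuple_mem_chains {n : ℕ} (z : Tup τ n) : ofTuple τ n z ∈ chains τ :=
  Set.mem_iUnion.2 ⟨n, z, rfl⟩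

theorem ae_mem_chains {μ : Measure Z} : ∀ᵐ a ∂vol μ τ, a ∈ chains τ :=
  ae_vol_iff.2 fun _ => Filter.Eventually.of_forall fun z => ofTuple_mem_chains z

theorem measurable_of_prod_comp {Y W : Type*} [MeasurableSpace Y] [MeasurableSpace W]
    {f : Y × Conf τ → W} (c : W) (hf : ∀ n, Measurable fun p : Y × Tup τ n =>
      f (p.1, ofTuple τ n p.2)) (hc : ∀ y a, a ∉ chains τ → f (y, a) = c) : Measurable f := by
  intro s hs
  have h1 : MeasurableSet (⋃ n, Prod.map (id : Y → Y) (ofTuple τ n) ''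
      ((fun p : Y × Tup τ n => f (p.1, ofTuple τ n p.2)) ⁻¹' s)) :=
    MeasurableSet.iUnion fun n => (measurableEmbedding_prodMap n).measurableSet_image' (hf n hs)
  have h2 : MeasurableSet ((Set.univ : Set Y) ×ˢ (chains τ)ᶜ) := by
    refine MeasurableSet.univ.prod (MeasurableSet.iUnion fun n => ?_).compl
    exact (measurableEmbedding_ofTuple τ n).measurableSet_range
  have h3 : f ⁻¹' s = (⋃ n, Prod.map (id : Y → Y) (ofTuple τ n) ''
      ((fun p : Y × Tup τ n => f (p.1, ofTuple τ n p.2)) ⁻¹' s)) ∪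
      {p | p ∈ (Set.univ : Set Y) ×ˢ (chains τ)ᶜ ∧ c ∈ s} := by
    ext ⟨y, a⟩
    constructor
    · intro h
      by_cases ha : a ∈ chains τ
      · obtain ⟨n, z, rfl⟩ := Set.mem_iUnion.1 ha
        exact Or.inl (Set.mem_iUnion.2 ⟨n, (y, z), h, rfl⟩)
      · refine Or.inr ⟨⟨trivial, ha⟩, ?_⟩
        rw [← hc y a ha]; exact h
    · rintro (h | ⟨h, h'⟩)
      · obtain ⟨n, ⟨y', z⟩, hz, he⟩ := Set.mem_iUnion.1 h
        simp only [Prod.map_apply, id_eq, Prod.mk.injEq] at he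
        rw [← he.1, ← he.2]
        exact hz
      · change f (y, a) ∈ s
        rw [hc y a h.2]; exact h'
  rw [h3]
  refine h1.union ?_
  by_cases hcs : c ∈ s
  · have : {p | p ∈ (Set.univ : Set Y) ×ˢ (chains τ)ᶜ ∧ c ∈ s} = Set.univ ×ˢ (chains τ)ᶜ := by
      ext p
      exact and_iff_left hcs
    rw [this]; exact h2
  · have : {p | p ∈ (Set.univ : Set Y) ×ˢ (chains τ)ᶜ ∧ c ∈ s} = ∅ := by
      ext p
      exact iff_of_false (fun h => hcs h.2) (fun h => h)
    rw [this]; exact MeasurableSet.empty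

open Classical in
/-- The chain `a` with a later point `x` added. -/
def snoc (p : Z × Conf τ) : Conf τ :=
  if p.2 ∈ chains τ ∧ p.2 ∈ before τ (τ p.1) then ins p.1 p.2 else nil τ

theorem image_snoc {n : ℕ} (z : Fin n → Z) (x : Z) :
    image τ (Fin.snoc (α := fun _ => Z) z x) = ins x (image τ z) := by
  classical
  refine Finset.ext (α := Z) fun y => ?_
  unfold image ins fin
  simp only [Finset.mem_image, Finset.mem_univ, true_and, Finset.mem_insert]
  constructor
  · rintro ⟨i, rfl⟩
    induction i using Fin.lastCases with
    | last => simp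
    | cast i => right; exact ⟨i, by simp⟩
  · rintro (rfl | ⟨i, rfl⟩)
    · exact ⟨Fin.last n, by simp⟩
    · exact ⟨i.castSucc, by simp⟩

theorem strictMono_snoc_iff {n : ℕ} (z : Fin n → Z) (x : Z) :
    StrictMono (fun i => τ (Fin.snoc (α := fun _ => Z) z x i)) ↔
      StrictMono (fun i => τ (z i)) ∧ image τ z ∈ before τ (τ x) := by
  classical
  have hb : image τ z ∈ before τ (τ x) ↔ ∀ i, τ (z i) < τ x := by
    rw [mem_before]
    simp [image, fin]
  rw [hb]
  constructor
  · intro h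
    refine ⟨fun i j hij => ?_, fun i => ?_⟩
    · have := h (show i.castSucc < j.castSucc from hij)
      simpa using this
    · have := h (Fin.castSucc_lt_last i)
      simpa using this
  · rintro ⟨h1, h2⟩ i j hij
    induction j using Fin.lastCases with
    | last =>
      induction i using Fin.lastCases with
      | last => exact absurd hij (lt_irrefl _)
      | cast i => simpa using h2 i
    | cast j =>
      induction i using Fin.lastCases with
      | last => exact absurd hij (not_lt.2 (Fin.le_last _))
      | cast i => simpa using h1 (show i < j from hij)

theorem measurable_image {Y : Type*} [MeasurableSpace Y] {n : ℕ} {u : Y → Fin n → Z}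
    (hu : Measurable u) (hs : ∀ y, StrictMono fun i => τ (u y i)) :
    Measurable fun y => image τ (u y) :=
  (measurable_ofTuple τ n).comp (hu.subtype_mk (h := hs))

theorem measurable_snoc (hτ : Measurable τ) : Measurable (snoc (τ := τ)) := by
  classical
  refine measurable_of_prod_comp (nil τ) (fun n => ?_) fun y a ha => by simp [snoc, ha]
  have hC : MeasurableSet {p : Z × Tup τ n | ofTuple τ n p.2 ∈ before τ (τ p.1)} :=
    measurableSet_before_pair hτ (hτ.comp measurable_fst)
      ((measurable_ofTuple τ n).comp measurable_snd)
  refine measurable_of_restrict_of_restrict_compl hC ?_ ?_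
  · have h : ∀ p : {p : Z × Tup τ n | ofTuple τ n p.2 ∈ before τ (τ p.1)},
        StrictMono fun i => τ (Fin.snoc (α := fun _ => Z) p.1.2.1 p.1.1 i) := fun p =>
      (strictMono_snoc_iff _ _).2 ⟨p.1.2.2, p.2⟩
    have hm : Measurable fun p : {p : Z × Tup τ n | ofTuple τ n p.2 ∈ before τ (τ p.1)} =>
        (Fin.snoc (α := fun _ => Z) p.1.2.1 p.1.1 : Fin (n + 1) → Z) := by
      refine measurable_pi_iff.2 fun i => ?_
      induction i using Fin.lastCases with
      | last =>
        simp only [Fin.snoc_last]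
        exact measurable_fst.comp measurable_subtype_coe
      | cast i =>
        simp only [Fin.snoc_castSucc]
        exact (measurable_pi_apply i).comp (measurable_subtype_coe.comp
          (measurable_snd.comp measurable_subtype_coe))
    convert measurable_image hm h using 1
    funext p
    rw [image_snoc]
    simp only [Set.domRestrict_apply, snoc]
    rw [if_pos ⟨ofTuple_mem_chains _, p.2⟩]
    rfl
  · have : (Set.domRestrict {p : Z × Tup τ n | ofTuple τ n p.2 ∈ before τ (τ p.1)}ᶜ
        fun p : Z × Tup τ n => snoc (p.1, ofTuple τ n p.2)) = fun _ => nil τ := by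
      funext p
      exact if_neg fun h => p.2 h.2
    rw [this]
    exact measurable_const

theorem snoc_eq {x : Z} {a : Conf τ} (ha : a ∈ chains τ) (hb : a ∈ before τ (τ x)) :
    snoc (x, a) = ins x a := if_pos ⟨ha, hb⟩

theorem fin_ins (x : Z) (a : Conf τ) [i : DecidableEq Z] : (ins x a).fin = insert x a.fin := by
  rw [Subsingleton.elim i fun a b => Classical.propDecidable (a = b)]
  rfl

theorem notMem_of_before {x : Z} {a : Conf τ} (hb : a ∈ before τ (τ x)) : x ∉ a.fin :=
  fun h => lt_irrefl _ (hb x h)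

theorem card_ins {x : Z} {a : Conf τ} (hb : a ∈ before τ (τ x)) :
    (ins x a).fin.card = a.fin.card + 1 := by
  classical
  rw [fin_ins, Finset.card_insert_of_notMem (notMem_of_before hb)]

theorem last_ins {x : Z} {a : Conf τ} (hb : a ∈ before τ (τ x)) : (ins x a).last = τ x := by
  classical
  unfold last
  rw [fin_ins, Finset.sup_insert, sup_eq_left]
  exact Finset.sup_le fun z hz => (hb z hz).le

theorem ins_mem_before {x : Z} {a : Conf τ} {t : ℝ≥0} :
    ins x a ∈ before τ t ↔ τ x < t ∧ a ∈ before τ t := by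
  classical
  simp only [mem_before, fin_ins, Finset.forall_mem_insert]

theorem measurable_indicator_image (hτ : Measurable τ) {f : Conf τ → ℝ≥0∞} (hf : Measurable f)
    (n : ℕ) : Measurable ({z : Fin n → Z | StrictMono fun i => τ (z i)}.indicator
      fun z => f (image τ z)) := by
  refine measurable_of_restrict_of_restrict_compl (measurableSet_strictMono hτ n) ?_ ?_
  · have : Measurable fun z : Tup τ n => f (ofTuple τ n z) := hf.comp (measurable_ofTuple τ n)
    have h2 : ({z : Fin n → Z | StrictMono fun i => τ (z i)}.domRestrict
        ({z : Fin n → Z | StrictMono fun i => τ (z i)}.indicator fun z => f (image τ z))) =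
        fun z : Tup τ n => f (ofTuple τ n z) := by
      funext z
      rw [Set.domRestrict_apply, Set.indicator_of_mem z.2]
      rfl
    rw [h2]
    exact this
  · have h2 : ({z : Fin n → Z | StrictMono fun i => τ (z i)}ᶜ.domRestrict
        ({z : Fin n → Z | StrictMono fun i => τ (z i)}.indicator fun z => f (image τ z))) =
        fun _ => 0 := by
      funext z
      rw [Set.domRestrict_apply, Set.indicator_of_notMem z.2]
    rw [h2]
    exact measurable_const

theorem lintegral_tupVol (hτ : Measurable τ) {μ : Measure Z} (f : Conf τ → ℝ≥0∞) (n : ℕ) :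
    ∫⁻ z, f (ofTuple τ n z) ∂tupVol μ τ n = ∫⁻ z,
      {z : Fin n → Z | StrictMono fun i => τ (z i)}.indicator (fun z => f (image τ z)) z
        ∂(Measure.pi fun _ : Fin n => μ) := by
  rw [lintegral_indicator (measurableSet_strictMono hτ n), ← map_val_tupVol hτ,
    (measurableEmbedding_val hτ n).lintegral_map]
  rfl

variable {μ : Measure Z} [SigmaFinite μ]

theorem lintegral_tupVol_succ (hτ : Measurable τ) {f : Conf τ → ℝ≥0∞} (hf : Measurable f)
    (n : ℕ) : ∫⁻ z, f (ofTuple τ (n + 1) z) ∂tupVol μ τ (n + 1) =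
      ∫⁻ x, ∫⁻ z, (before τ (τ x)).indicator (fun a => f (snoc (x, a))) (ofTuple τ n z)
        ∂tupVol μ τ n ∂μ := by
  classical
  rw [lintegral_tupVol hτ]
  have h := (measurePreserving_piFinSuccAbove (fun _ : Fin (n + 1) => μ) (Fin.last n)).symm
  rw [← h.lintegral_comp (measurable_indicator_image hτ hf (n + 1)), lintegral_prod]
  · refine lintegral_congr fun x => ?_
    rw [lintegral_tupVol hτ (fun a => (before τ (τ x)).indicator (fun a => f (snoc (x, a))) a)]
    refine lintegral_congr fun z => ?_
    have he : (MeasurableEquiv.piFinSuccAbove (fun _ : Fin (n + 1) => Z) (Fin.last n)).symm (x, z)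
        = Fin.snoc (α := fun _ => Z) z x := by
      change Fin.insertNth (α := fun _ => Z) (Fin.last n) x z = _
      rw [Fin.insertNth_last']
    rw [he]
    simp only [Set.indicator_apply, Set.mem_ofPred_eq, strictMono_snoc_iff, image_snoc]
    by_cases h1 : StrictMono fun i => τ (z i)
    · by_cases h2 : image τ z ∈ before τ (τ x)
      · have h3 : snoc (x, image τ z) = ins x (image τ z) :=
          snoc_eq (ofTuple_mem_chains ⟨z, h1⟩) h2
        have h4 : ofTuple τ n ⟨z, h1⟩ = image τ z := rfl
        simp [h1, h2, h3]
      · simp [h1, h2]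
    · simp [h1]
  · exact ((measurable_indicator_image hτ hf (n + 1)).comp
      (MeasurableEquiv.measurable _)).aemeasurable

theorem ofTuple_zero (z : Tup τ 0) : ofTuple τ 0 z = nil τ := by
  classical
  unfold ofTuple nil
  rw [Finset.univ_eq_empty, Finset.image_empty]

theorem lintegral_tupVol_zero (hτ : Measurable τ) (f : Conf τ → ℝ≥0∞) :
    ∫⁻ z, f (ofTuple τ 0 z) ∂tupVol μ τ 0 = f (nil τ) := by
  simp only [ofTuple_zero, lintegral_const]
  have h : tupVol μ τ 0 Set.univ = 1 := by
    have h1 := lintegral_tupVol hτ (μ := μ) (fun _ => 1) 0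
    simp only [lintegral_one] at h1
    rw [h1]
    have : ({z : Fin 0 → Z | StrictMono fun i => τ (z i)}) = Set.univ := by
      ext z
      simp [Subsingleton.strictMono]
    rw [this]
    simp
  rw [h, mul_one]

theorem measurable_indicator_snoc (hτ : Measurable τ) {f : Conf τ → ℝ≥0∞} (hf : Measurable f) :
    Measurable fun p : Z × Conf τ => (before τ (τ p.1)).indicator (fun a => f (snoc (p.1, a))) p.2 := by
  classical
  have hC : MeasurableSet {p : Z × Conf τ | p.2 ∈ before τ (τ p.1)} :=
    measurableSet_before_pair hτ (hτ.comp measurable_fst) measurable_snd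
  exact (hf.comp (measurable_snoc hτ)).indicator hC

/-- Disintegration of the measure on chains with respect to the latest point. -/
theorem lintegral_vol (hτ : Measurable τ) {f : Conf τ → ℝ≥0∞} (hf : Measurable f) :
    ∫⁻ a, f a ∂vol μ τ = f (nil τ) +
      ∫⁻ x, ∫⁻ a in before τ (τ x), f (snoc (x, a)) ∂vol μ τ ∂μ := by
  rw [lintegral_vol_eq, tsum_eq_zero_add' ENNReal.summable, lintegral_tupVol_zero hτ]
  congr 1
  simp only [lintegral_tupVol_succ hτ hf]
  rw [← lintegral_tsum]
  · refine lintegral_congr fun x => ?_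
    rw [← lintegral_indicator (measurableSet_before hτ _), lintegral_vol_eq]
  · intro n
    have := ((measurable_indicator_snoc hτ hf).comp
      ((measurableEmbedding_prodMap (Y := Z) (τ := τ) n).measurable)).lintegral_prod_right'
      (ν := tupVol μ τ n)
    exact this.aemeasurable

end Conf

namespace Conf

variable {Z : Type*} [MeasurableSpace Z] {τ : Z → ℝ≥0} {μ : Measure Z} [SigmaFinite μ]

theorem fin_nil : (nil τ).fin = ∅ := rfl

theorem nil_mem_before (t : ℝ≥0) : nil τ ∈ before τ t := by simp [mem_before, fin_nil]

theorem setLIntegral_before_congr (hτ : Measurable τ) {f g : Conf τ → ℝ≥0∞} {t : ℝ≥0}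
    (h : ∀ a ∈ chains τ, a ∈ before τ t → f a = g a) :
    ∫⁻ a in before τ t, f a ∂vol μ τ = ∫⁻ a in before τ t, g a ∂vol μ τ := by
  refine setLIntegral_congr_fun_ae (measurableSet_before hτ t) ?_
  filter_upwards [ae_mem_chains (μ := μ)] with a ha hb using h a ha hb

theorem eq_nil_of_card {a : Conf τ} (h : a.fin.card = 0) : a = nil τ := Finset.card_eq_zero.1 h

theorem lintegral_of_card_ne_zero (hτ : Measurable τ) {f : Conf τ → ℝ≥0∞} (hf : Measurable f)
    (h : ∀ a, a.fin.card ≠ 0 → f a = 0) : ∫⁻ a, f a ∂vol μ τ = f (nil τ) := by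
  rw [lintegral_vol hτ hf]
  have : ∀ x, ∫⁻ a in before τ (τ x), f (snoc (x, a)) ∂vol μ τ = 0 := fun x => by
    rw [setLIntegral_before_congr hτ (g := fun _ => 0)]
    · simp
    · intro a ha hb
      rw [snoc_eq ha hb]
      exact h _ (by rw [card_ins hb]; omega)
  simp [this]

/-- The pairs of chains in which the latest point lies in the first one. -/
def laterLeft (τ : Z → ℝ≥0) : Set (Conf τ × Conf τ) :=
  {p | p.1.fin.card ≠ 0 ∧ p.2 ∈ before τ p.1.last}

theorem measurableSet_laterLeft (hτ : Measurable τ) : MeasurableSet (laterLeft τ) := by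
  refine MeasurableSet.inter (s₁ := {p : Conf τ × Conf τ | p.1.fin.card ≠ 0}) ?_
    (measurableSet_before_pair hτ ((measurable_last hτ).comp measurable_fst) measurable_snd)
  exact (measurableSet_eq_fun (measurable_card.comp measurable_fst) measurable_const).compl

theorem lintegral_laterLeft (hτ : Measurable τ) {G : Conf τ × Conf τ → ℝ≥0∞}
    (hG : Measurable G) :
    ∫⁻ a, ∫⁻ b, (laterLeft τ).indicator G (a, b) ∂vol μ τ ∂vol μ τ =
      ∫⁻ x, ∫⁻ a in before τ (τ x), ∫⁻ b in before τ (τ x), G (snoc (x, a), b)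
        ∂vol μ τ ∂vol μ τ ∂μ := by
  rw [lintegral_vol hτ ((hG.indicator (measurableSet_laterLeft hτ)).lintegral_prod_right')]
  have h0 : ∫⁻ b, (laterLeft τ).indicator G (nil τ, b) ∂vol μ τ = 0 := by
    simp [laterLeft, fin_nil]
  rw [h0, zero_add]
  refine lintegral_congr fun x => setLIntegral_before_congr hτ fun a ha hb => ?_
  rw [← lintegral_indicator (measurableSet_before hτ _), snoc_eq ha hb]
  refine lintegral_congr fun b => ?_
  have : (ins x a, b) ∈ laterLeft τ ↔ b ∈ before τ (τ x) := by
    change (ins x a).fin.card ≠ 0 ∧ b ∈ before τ (ins x a).last ↔ _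
    rw [card_ins hb, last_ins hb]
    simp
  by_cases hbb : b ∈ before τ (τ x)
  · rw [Set.indicator_of_mem hbb, Set.indicator_of_mem (this.2 hbb)]
  · rw [Set.indicator_of_notMem hbb, Set.indicator_of_notMem (fun h => hbb (this.1 h))]

theorem exists_mem_last {a : Conf τ} (h : a.fin.card ≠ 0) : ∃ z ∈ a.fin, τ z = a.last := by
  obtain ⟨z, hz, he⟩ := Finset.exists_mem_eq_sup a.fin
    (Finset.card_pos.1 (Nat.pos_of_ne_zero h)) τ
  exact ⟨z, hz, he.symm⟩

/-- Almost surely, the latest points of two chains are not simultaneous. -/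
theorem ae_laterLeft_cases (hτ : Measurable τ) (hnt : ∀ c, μ {z | τ z = c} = 0)
    (G : Conf τ × Conf τ → ℝ≥0∞) (a : Conf τ) : ∀ᵐ b ∂vol μ τ,
    G (a, b) = ({(nil τ, nil τ)} : Set (Conf τ × Conf τ)).indicator G (a, b) +
      ((laterLeft τ).indicator G (a, b) +
        (laterLeft τ).indicator (fun p => G p.swap) (b, a)) := by
  have h : ∀ᵐ z ∂μ, τ z ≠ a.last := by
    rw [ae_iff]; simpa using hnt a.last
  filter_upwards [ae_forall_mem hτ h] with b hb
  by_cases ha0 : a.fin.card = 0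
  · by_cases hb0 : b.fin.card = 0
    · rw [eq_nil_of_card ha0, eq_nil_of_card hb0]
      simp [laterLeft, fin_nil]
    · have hbn : b ≠ nil τ := fun h => hb0 (by rw [h]; rfl)
      have h1 : (b, a) ∈ laterLeft τ := ⟨hb0, mem_before_iff.2 (Or.inl ha0)⟩
      have h2 : (a, b) ∉ laterLeft τ := fun h => h.1 ha0
      rw [Set.indicator_of_mem h1, Set.indicator_of_notMem h2, Set.indicator_of_notMem]
      · simp
      · simp [hbn]
  · have han : a ≠ nil τ := fun h => ha0 (by rw [h]; rfl)
    have h0 : (a, b) ∉ ({(nil τ, nil τ)} : Set (Conf τ × Conf τ)) := by simp [han]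
    rw [Set.indicator_of_notMem h0]
    by_cases hlt : b ∈ before τ a.last
    · have h1 : (a, b) ∈ laterLeft τ := ⟨ha0, hlt⟩
      have h2 : (b, a) ∉ laterLeft τ := by
        rintro ⟨h3, h4⟩
        rcases mem_before_iff.1 hlt with h5 | h5
        · exact h3 h5
        · rcases mem_before_iff.1 h4 with h6 | h6
          · exact ha0 h6
          · exact lt_asymm h5 h6
      rw [Set.indicator_of_mem h1, Set.indicator_of_notMem h2]
      simp
    · have h1 : (a, b) ∉ laterLeft τ := fun h => hlt h.2
      have h3 : ¬ (b.fin.card = 0 ∨ b.last < a.last) := fun h => hlt (mem_before_iff.2 h)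
      push Not at h3
      obtain ⟨z, hz, hz'⟩ := exists_mem_last h3.1
      have h4 : a.last < b.last := lt_of_le_of_ne h3.2 fun h => hb z hz (by rw [hz', h])
      have h2 : (b, a) ∈ laterLeft τ := ⟨h3.1, mem_before_iff.2 (Or.inr h4)⟩
      rw [Set.indicator_of_mem h2, Set.indicator_of_notMem h1]
      simp

/-- The part of pairs of chains preceding `t`. -/
abbrev before₂ (τ : Z → ℝ≥0) (t : ℝ≥0) : Set (Conf τ × Conf τ) := before τ t ×ˢ before τ t

theorem setLIntegral_prod_before (t : ℝ≥0) {G : Conf τ × Conf τ → ℝ≥0∞} (hG : Measurable G) :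
    ∫⁻ p in before₂ τ t, G p ∂(vol μ τ).prod (vol μ τ) =
      ∫⁻ a in before τ t, ∫⁻ b in before τ t, G (a, b) ∂vol μ τ ∂vol μ τ := by
  rw [← Measure.prod_restrict, lintegral_prod _ hG.aemeasurable]

theorem measurable_snoc_left (hτ : Measurable τ) (x : Z) :
    Measurable fun p : Conf τ × Conf τ => (snoc (x, p.1), p.2) :=
  ((measurable_snoc hτ).comp (measurable_const.prodMk measurable_fst)).prodMk measurable_snd

theorem measurable_snoc_right (hτ : Measurable τ) (x : Z) :
    Measurable fun p : Conf τ × Conf τ => (p.1, snoc (x, p.2)) :=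
  measurable_fst.prodMk ((measurable_snoc hτ).comp (measurable_const.prodMk measurable_snd))

theorem measurableSet_nilnil :
    MeasurableSet ({(nil τ, nil τ)} : Set (Conf τ × Conf τ)) := by
  have h : ({(nil τ, nil τ)} : Set (Conf τ × Conf τ)) =
      {p | p.1.fin.card = 0} ∩ {p | p.2.fin.card = 0} := by
    ext ⟨a, b⟩
    simp only [Set.mem_singleton_iff, Prod.mk.injEq, Set.mem_inter_iff, Set.mem_ofPred_eq]
    exact ⟨fun h => ⟨by rw [h.1]; rfl, by rw [h.2]; rfl⟩, fun h =>
      ⟨eq_nil_of_card h.1, eq_nil_of_card h.2⟩⟩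
  rw [h]
  exact (measurableSet_eq_fun (measurable_card.comp measurable_fst) measurable_const).inter
    (measurableSet_eq_fun (measurable_card.comp measurable_snd) measurable_const)

/-- Disintegration of the measure on pairs of chains with respect to the latest point. -/
theorem lintegral_prod_vol (hτ : Measurable τ) (hnt : ∀ c, μ {z | τ z = c} = 0)
    {G : Conf τ × Conf τ → ℝ≥0∞} (hG : Measurable G) :
    ∫⁻ p, G p ∂(vol μ τ).prod (vol μ τ) = G (nil τ, nil τ) + ∫⁻ x,
      ∫⁻ p in before₂ τ (τ x), (G (snoc (x, p.1), p.2) + G (p.1, snoc (x, p.2)))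
        ∂(vol μ τ).prod (vol μ τ) ∂μ := by
  have hL := measurableSet_laterLeft hτ
  have hG' : Measurable fun p : Conf τ × Conf τ => G p.swap := hG.comp measurable_swap
  have hN := measurableSet_nilnil (τ := τ)
  rw [lintegral_prod _ hG.aemeasurable]
  have h1 : ∀ a, ∫⁻ b, G (a, b) ∂vol μ τ =
      ∫⁻ b, ({(nil τ, nil τ)} : Set (Conf τ × Conf τ)).indicator G (a, b) ∂vol μ τ +
      (∫⁻ b, (laterLeft τ).indicator G (a, b) ∂vol μ τ +
        ∫⁻ b, (laterLeft τ).indicator (fun p => G p.swap) (b, a) ∂vol μ τ) := fun a => by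
    rw [lintegral_congr_ae (ae_laterLeft_cases hτ hnt G a), lintegral_add_left, lintegral_add_left]
    · exact (hG.indicator hL).comp measurable_prodMk_left
    · exact (hG.indicator hN).comp measurable_prodMk_left
  simp only [h1]
  rw [lintegral_add_left (hG.indicator hN).lintegral_prod_right',
    lintegral_add_left (hG.indicator hL).lintegral_prod_right', lintegral_laterLeft hτ hG]
  congr 1
  · have hm : Measurable fun b => ({(nil τ, nil τ)} : Set (Conf τ × Conf τ)).indicator G
        (nil τ, b) := (hG.indicator hN).comp measurable_prodMk_left
    rw [lintegral_of_card_ne_zero hτ (hG.indicator hN).lintegral_prod_right',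
      lintegral_of_card_ne_zero hτ hm]
    · simp
    · intro b hb
      rw [Set.indicator_of_notMem]
      simp only [Set.mem_singleton_iff, Prod.mk.injEq, not_and]
      rintro - rfl
      exact hb rfl
    · intro a ha
      have : ∀ b, ({(nil τ, nil τ)} : Set (Conf τ × Conf τ)).indicator G (a, b) = 0 := fun b => by
        rw [Set.indicator_of_notMem]
        simp only [Set.mem_singleton_iff, Prod.mk.injEq, not_and]
        rintro rfl
        exact absurd rfl ha
      simp [this]
  · rw [lintegral_lintegral_swap, lintegral_laterLeft hτ hG', ← lintegral_add_left']
    · refine lintegral_congr fun x => ?_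
      have hl : Measurable fun p : Conf τ × Conf τ => G (snoc (x, p.1), p.2) :=
        hG.comp (measurable_snoc_left hτ x)
      have hr : Measurable fun p : Conf τ × Conf τ => G (p.1, snoc (x, p.2)) :=
        hG.comp (measurable_snoc_right hτ x)
      rw [lintegral_add_left hl, setLIntegral_prod_before _ hl, setLIntegral_prod_before _ hr]
      congr 1
      rw [lintegral_lintegral_swap]
      · rfl
      · exact ((hG.comp (measurable_snoc_right hτ x)).comp measurable_swap).aemeasurable
    · have hm : Measurable fun q : (Z × Conf τ) × Conf τ =>
          {q : (Z × Conf τ) × Conf τ | q.1.2 ∈ before τ (τ q.1.1)}.indicator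
          ({q : (Z × Conf τ) × Conf τ | q.2 ∈ before τ (τ q.1.1)}.indicator
            fun q => G (snoc q.1, q.2)) q := by
        refine Measurable.indicator (Measurable.indicator ?_ ?_) ?_
        · exact hG.comp (((measurable_snoc hτ).comp measurable_fst).prodMk measurable_snd)
        · exact measurableSet_before_pair hτ (hτ.comp (measurable_fst.comp measurable_fst))
            measurable_snd
        · exact measurableSet_before_pair hτ (hτ.comp (measurable_fst.comp measurable_fst))
            (measurable_snd.comp measurable_fst)
      refine Measurable.aemeasurable ?_
      convert (hm.lintegral_prod_right' (ν := vol μ τ)).lintegral_prod_right' (ν := vol μ τ)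
        using 1
      funext x
      rw [← lintegral_indicator (measurableSet_before hτ _)]
      refine lintegral_congr fun a => ?_
      by_cases ha : a ∈ before τ (τ x)
      · rw [Set.indicator_of_mem ha, ← lintegral_indicator (measurableSet_before hτ _)]
        refine lintegral_congr fun b => ?_
        rw [Set.indicator_of_mem (show ((x, a), b) ∈ {q : (Z × Conf τ) × Conf τ |
          q.1.2 ∈ before τ (τ q.1.1)} from ha)]
        rfl
      · rw [Set.indicator_of_notMem ha]
        symm
        refine lintegral_eq_zero_of_ae_eq_zero (Filter.Eventually.of_forall fun b => ?_)
        exact Set.indicator_of_notMem (M := ℝ≥0∞) (a := ((x, a), b)) (s := {q : (Z × Conf τ) ×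
          Conf τ | q.1.2 ∈ before τ (τ q.1.1)}) ha _
    · exact ((hG'.indicator hL).comp measurable_swap).aemeasurable

end Conf

namespace Conf

variable {Z : Type*} [MeasurableSpace Z] {τ : Z → ℝ≥0} {μ : Measure Z} [SigmaFinite μ]

open Classical in
/-- The configuration of the points of a tuple with indices in `I`. -/
def sub (τ : Z → ℝ≥0) {n : ℕ} (z : Fin n → Z) (I : Finset (Fin n)) : Conf τ := I.image z

theorem mem_fin_sdiff {a b : Conf τ} {x : Z} : x ∈ (sdiff a b).fin ↔ x ∈ a.fin ∧ x ∉ b.fin := by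
  classical
  exact Finset.mem_sdiff

theorem mem_fin_un {a b : Conf τ} {x : Z} : x ∈ (un a b).fin ↔ x ∈ a.fin ∨ x ∈ b.fin := by
  classical
  exact Finset.mem_union

theorem mem_fin_ins {a : Conf τ} {x y : Z} : y ∈ (ins x a).fin ↔ y = x ∨ y ∈ a.fin := by
  classical
  rw [fin_ins, Finset.mem_insert]

theorem conf_ext {a b : Conf τ} (h : ∀ x, x ∈ a.fin ↔ x ∈ b.fin) : a = b := Finset.ext h

theorem fin_ofTuple {n : ℕ} (z : Tup τ n) [i : DecidableEq Z] :
    (ofTuple τ n z).fin = Finset.univ.image z.1 := by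
  rw [Subsingleton.elim i fun a b => Classical.propDecidable (a = b)]
  rfl

theorem mem_sub {n : ℕ} {z : Fin n → Z} {I : Finset (Fin n)} {x : Z} :
    x ∈ (sub τ z I).fin ↔ ∃ i ∈ I, z i = x := by
  classical
  exact Finset.mem_image

theorem sdiff_ins_ins {x : Z} {ϑ a : Conf τ} (hx : x ∉ ϑ.fin) :
    sdiff (ins x ϑ) (ins x a) = sdiff ϑ a := by
  refine conf_ext fun y => ?_
  simp only [mem_fin_sdiff, mem_fin_ins]
  constructor
  · rintro ⟨h | h, h'⟩
    · exact absurd (Or.inl h) h'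
    · exact ⟨h, fun h'' => h' (Or.inr h'')⟩
  · rintro ⟨h, h'⟩
    refine ⟨Or.inr h, ?_⟩
    rintro (rfl | h'')
    · exact hx h
    · exact h' h''

theorem sdiff_ins {x : Z} {ϑ a : Conf τ} (hx : x ∉ a.fin) :
    sdiff (ins x ϑ) a = ins x (sdiff ϑ a) := by
  refine conf_ext fun y => ?_
  simp only [mem_fin_sdiff, mem_fin_ins]
  constructor
  · rintro ⟨h | h, h'⟩
    · exact Or.inl h
    · exact Or.inr ⟨h, h'⟩
  · rintro (rfl | h)
    · exact ⟨Or.inl rfl, hx⟩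
    · exact ⟨Or.inr h.1, h.2⟩

/-- The sum over all decompositions of a configuration into two parts. -/
def splitSum {E : Type*} [AddCommMonoid E] (G : Conf τ × Conf τ → E) (ϑ : Conf τ) : E :=
  ∑ a ∈ ϑ.fin.powerset, G (a, sdiff ϑ a)

theorem measurable_sub {n : ℕ} (I : Finset (Fin n)) :
    Measurable fun z : Tup τ n => sub τ z.1 I := by
  classical
  have h : (fun z : Tup τ n => sub τ z.1 I) =
      fun z => image τ fun i => z.1 (I.orderEmbOfFin rfl i) := by
    funext z
    refine Finset.ext (α := Z) fun x => ?_
    simp only [sub, image, Finset.mem_image, Finset.mem_univ, true_and]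
    constructor
    · rintro ⟨i, hi, rfl⟩
      have : i ∈ Set.range (I.orderEmbOfFin rfl) := by
        rw [Finset.range_orderEmbOfFin]; exact hi
      obtain ⟨j, rfl⟩ := this
      exact ⟨j, rfl⟩
    · rintro ⟨j, rfl⟩
      exact ⟨_, Finset.orderEmbOfFin_mem I rfl j, rfl⟩
  rw [h]
  refine measurable_image (measurable_pi_iff.2 fun i =>
    (measurable_pi_apply _).comp measurable_subtype_coe) fun z i j hij => z.2 ?_
  exact (I.orderEmbOfFin rfl).strictMono hij

theorem splitSum_ofTuple {E : Type*} [AddCommMonoid E] (G : Conf τ × Conf τ → E) {n : ℕ}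
    (z : Tup τ n) : splitSum G (ofTuple τ n z) =
      ∑ I ∈ (Finset.univ : Finset (Fin n)).powerset, G (sub τ z.1 I, sub τ z.1 Iᶜ) := by
  classical
  unfold splitSum
  rw [fin_ofTuple, Finset.powerset_image, Finset.sum_image]
  · refine Finset.sum_congr rfl fun I _ => ?_
    have h1 : (Finset.image z.1 I : Finset Z) = sub τ z.1 I := by
      refine conf_ext (τ := τ) fun x => ?_
      rw [mem_sub]
      exact Finset.mem_image
    have h2 : sdiff (ofTuple τ n z) (sub τ z.1 I) = sub τ z.1 Iᶜ := by
      refine conf_ext fun x => ?_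
      simp only [mem_fin_sdiff, mem_sub, mem_ofTuple, Finset.mem_compl]
      constructor
      · rintro ⟨⟨i, rfl⟩, h⟩
        exact ⟨i, fun hi => h ⟨i, hi, rfl⟩, rfl⟩
      · rintro ⟨i, hi, rfl⟩
        refine ⟨⟨i, rfl⟩, ?_⟩
        rintro ⟨j, hj, hij⟩
        exact hi (tup_injective z hij ▸ hj)
    rw [← h2, h1]
  · intro I _ J _ h
    exact Finset.image_injective (tup_injective z) h

theorem measurable_splitSum {G : Conf τ × Conf τ → ℝ≥0∞} (hG : Measurable G) :
    Measurable (splitSum G) := by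
  refine measurable_of_comp fun n => ?_
  simp only [splitSum_ofTuple]
  exact Finset.measurable_sum _ fun I _ => hG.comp ((measurable_sub I).prodMk (measurable_sub _))

theorem splitSum_ins {E : Type*} [AddCommMonoid E] (G : Conf τ × Conf τ → E) {x : Z}
    {ϑ : Conf τ} (hx : x ∉ ϑ.fin) : splitSum G (ins x ϑ) =
      splitSum (fun p => G (ins x p.1, p.2) + G (p.1, ins x p.2)) ϑ := by
  classical
  unfold splitSum
  rw [fin_ins, Finset.sum_powerset_insert hx, Finset.sum_add_distrib, add_comm]
  congr 1
  · refine Finset.sum_congr rfl fun a ha => ?_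
    have h1 : (insert x a : Finset Z) = ins (τ := τ) x a := (fin_ins (τ := τ) x a).symm
    rw [h1]
    exact congrArg (fun b => G (ins (τ := τ) x a, b)) (sdiff_ins_ins hx)
  · refine Finset.sum_congr rfl fun a ha => ?_
    exact congrArg (fun b => G (a, b)) (sdiff_ins fun h => hx (Finset.mem_powerset.1 ha h))

theorem mem_chains_subset {a ϑ : Conf τ} (hϑ : ϑ ∈ chains τ) (h : a.fin ⊆ ϑ.fin) :
    a ∈ chains τ := by
  classical
  obtain ⟨n, z, rfl⟩ := Set.mem_iUnion.1 hϑ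
  let I : Finset (Fin n) := Finset.univ.filter fun i => z.1 i ∈ a.fin
  refine Set.mem_iUnion.2 ⟨I.card, ⟨fun i => z.1 (I.orderEmbOfFin rfl i), fun i j hij =>
    z.2 ((I.orderEmbOfFin rfl).strictMono hij)⟩, conf_ext fun x => ?_⟩
  rw [mem_ofTuple]
  constructor
  · rintro ⟨i, rfl⟩
    exact (Finset.mem_filter.1 (Finset.orderEmbOfFin_mem I rfl i)).2
  · intro hx
    obtain ⟨i, rfl⟩ := (mem_ofTuple z x).1 (h hx)
    have : i ∈ Set.range (I.orderEmbOfFin rfl) := by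
      rw [Finset.range_orderEmbOfFin]; simpa [I] using hx
    obtain ⟨j, rfl⟩ := this
    exact ⟨j, rfl⟩

theorem before_subset {a ϑ : Conf τ} {t : ℝ≥0} (hϑ : ϑ ∈ before τ t) (h : a.fin ⊆ ϑ.fin) :
    a ∈ before τ t := fun z hz => hϑ z (h hz)

theorem sdiff_subset {a ϑ : Conf τ} : (sdiff ϑ a).fin ⊆ ϑ.fin := fun _ h => (mem_fin_sdiff.1 h).1

open Classical in
theorem lintegral_splitSum_card (hτ : Measurable τ) (hnt : ∀ c, μ {z | τ z = c} = 0) (N : ℕ) :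
    ∀ G : Conf τ × Conf τ → ℝ≥0∞, Measurable G →
      ∫⁻ ϑ, (if ϑ.fin.card = N then splitSum G ϑ else 0) ∂vol μ τ =
        ∫⁻ p, (if p.1.fin.card + p.2.fin.card = N then G p else 0) ∂(vol μ τ).prod (vol μ τ) := by
  induction N with
  | zero =>
    intro G hG
    rw [lintegral_of_card_ne_zero hτ, lintegral_prod_vol hτ hnt]
    · have : ∀ x, ∀ p ∈ before₂ τ (τ x),
          p ∈ chains τ ×ˢ chains τ → ((if (snoc (x, p.1)).fin.card + p.2.fin.card = 0 then
          G (snoc (x, p.1), p.2) else 0) + (if p.1.fin.card + (snoc (x, p.2)).fin.card = 0 then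
          G (p.1, snoc (x, p.2)) else 0)) = 0 := by
        rintro x ⟨a, b⟩ ⟨ha, hb⟩ ⟨ha', hb'⟩
        simp only
        rw [snoc_eq ha' ha, snoc_eq hb' hb, card_ins ha, card_ins hb, if_neg (by omega),
          if_neg (by omega), add_zero]
      have h2 : ∀ x, ∫⁻ p in before₂ τ (τ x), ((if (snoc (x, p.1)).fin.card + p.2.fin.card = 0 then
          G (snoc (x, p.1), p.2) else 0) + (if p.1.fin.card + (snoc (x, p.2)).fin.card = 0 then
          G (p.1, snoc (x, p.2)) else 0)) ∂(vol μ τ).prod (vol μ τ) = 0 := fun x => by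
        rw [setLIntegral_congr_fun_ae (g := fun _ => 0)
          ((measurableSet_before hτ _).prod (measurableSet_before hτ _))]
        · simp
        · have h3 : ∀ᵐ p ∂(vol μ τ).prod (vol μ τ), p ∈ chains τ ×ˢ chains τ := by
            filter_upwards [Measure.quasiMeasurePreserving_fst.ae (ae_mem_chains (τ := τ) (μ := μ)),
              Measure.quasiMeasurePreserving_snd.ae (ae_mem_chains (τ := τ) (μ := μ))]
              with p h1 h2 using ⟨h1, h2⟩
          filter_upwards [h3] with p hp hp' using this x p hp' hp
      simp only [h2]
      simp [splitSum, fin_nil]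
      congr 1
    · exact Measurable.ite (measurableSet_eq_fun ((measurable_card.comp measurable_fst).add
        (measurable_card.comp measurable_snd)) measurable_const) hG measurable_const
    · exact Measurable.ite (measurableSet_eq_fun measurable_card measurable_const)
        (measurable_splitSum hG) measurable_const
    · intro a ha
      exact if_neg ha
  | succ N ih =>
    intro G hG
    have hm1 : Measurable fun ϑ : Conf τ => if ϑ.fin.card = N + 1 then splitSum G ϑ else 0 :=
      Measurable.ite (measurableSet_eq_fun measurable_card measurable_const)
        (measurable_splitSum hG) measurable_const
    have hm2 : Measurable fun p : Conf τ × Conf τ =>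
        if p.1.fin.card + p.2.fin.card = N + 1 then G p else 0 :=
      Measurable.ite (measurableSet_eq_fun ((measurable_card.comp measurable_fst).add
        (measurable_card.comp measurable_snd)) measurable_const) hG measurable_const
    rw [lintegral_vol hτ hm1, lintegral_prod_vol hτ hnt hm2]
    have hn : (nil τ).fin.card ≠ N + 1 := by simp [fin_nil]
    have hn2 : (nil τ).fin.card + (nil τ).fin.card ≠ N + 1 := by simp [fin_nil]
    rw [if_neg hn]
    simp only [if_neg hn2, zero_add]
    refine lintegral_congr fun x => ?_
    have hB : MeasurableSet (before₂ τ (τ x)) :=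
      (measurableSet_before hτ _).prod (measurableSet_before hτ _)
    set Gx : Conf τ × Conf τ → ℝ≥0∞ := (before₂ τ (τ x)).indicator
      fun p => G (snoc (x, p.1), p.2) + G (p.1, snoc (x, p.2)) with hGx
    have hGxm : Measurable Gx := ((hG.comp (measurable_snoc_left hτ x)).add
      (hG.comp (measurable_snoc_right hτ x))).indicator hB
    have h3 : ∀ᵐ p ∂(vol μ τ).prod (vol μ τ), p ∈ chains τ ×ˢ chains τ := by
      filter_upwards [Measure.quasiMeasurePreserving_fst.ae (ae_mem_chains (τ := τ) (μ := μ)),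
        Measure.quasiMeasurePreserving_snd.ae (ae_mem_chains (τ := τ) (μ := μ))]
        with p h1 h2 using ⟨h1, h2⟩
    have hL := ih Gx hGxm
    rw [← lintegral_indicator (measurableSet_before hτ _), ← lintegral_indicator hB]
    rw [lintegral_congr_ae (g := fun ϑ => if ϑ.fin.card = N then splitSum Gx ϑ else 0), hL]
    · refine lintegral_congr_ae ?_
      filter_upwards [h3] with p hp
      by_cases hpb : p ∈ before₂ τ (τ x)
      · simp only [hGx, Set.indicator_of_mem hpb]
        rw [snoc_eq hp.1 hpb.1, snoc_eq hp.2 hpb.2, card_ins hpb.1, card_ins hpb.2]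
        by_cases hc : p.1.fin.card + p.2.fin.card = N
        · rw [if_pos hc, if_pos (by omega), if_pos (by omega)]
        · rw [if_neg hc, if_neg (by omega), if_neg (by omega), add_zero]
      · simp only [hGx, Set.indicator_of_notMem hpb]
        simp
    · filter_upwards [ae_mem_chains (τ := τ) (μ := μ)] with ϑ hϑ
      by_cases hb : ϑ ∈ before τ (τ x)
      · rw [Set.indicator_of_mem hb, snoc_eq hϑ hb, card_ins hb]
        by_cases hc : ϑ.fin.card = N
        · rw [if_pos (by omega), if_pos hc, splitSum_ins _ (notMem_of_before hb)]
          refine Finset.sum_congr rfl fun a ha => ?_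
          have ha' : (fin (τ := τ) a) ⊆ ϑ.fin := Finset.mem_powerset.1 ha
          have h5 : ((a, sdiff ϑ a) : Conf τ × Conf τ) ∈ before₂ τ (τ x) :=
            ⟨before_subset hb ha', before_subset hb sdiff_subset⟩
          rw [hGx, Set.indicator_of_mem h5]
          simp only
          rw [snoc_eq (mem_chains_subset hϑ ha') h5.1,
            snoc_eq (mem_chains_subset hϑ sdiff_subset) h5.2]
        · rw [if_neg (by omega), if_neg hc]
      · rw [Set.indicator_of_notMem hb]
        have : splitSum Gx ϑ = 0 := by
          refine Finset.sum_eq_zero fun a ha => ?_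
          rw [hGx, Set.indicator_of_notMem]
          rintro ⟨h1, h2⟩
          refine hb fun z hz => ?_
          by_cases hza : z ∈ fin (τ := τ) a
          · exact h1 z hza
          · exact h2 z (mem_fin_sdiff.2 ⟨hz, hza⟩)
        rw [this, ite_self]

/-- The sum-integral formula: integrating over all decompositions of a chain into two parts
amounts to integrating over pairs of chains. -/
theorem lintegral_splitSum (hτ : Measurable τ) (hnt : ∀ c, μ {z | τ z = c} = 0)
    {G : Conf τ × Conf τ → ℝ≥0∞} (hG : Measurable G) :
    ∫⁻ ϑ, splitSum G ϑ ∂vol μ τ = ∫⁻ p, G p ∂(vol μ τ).prod (vol μ τ) := by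
  classical
  have h1 : ∀ ϑ : Conf τ, splitSum G ϑ = ∑' N, if ϑ.fin.card = N then splitSum G ϑ else 0 :=
    fun ϑ => by rw [tsum_ite_eq']
  have h2 : ∀ p : Conf τ × Conf τ, G p =
      ∑' N, if p.1.fin.card + p.2.fin.card = N then G p else 0 :=
    fun p => by rw [tsum_ite_eq']
  rw [lintegral_congr h1, lintegral_congr h2, lintegral_tsum, lintegral_tsum]
  · exact tsum_congr fun N => lintegral_splitSum_card hτ hnt N G hG
  · exact fun N => (Measurable.ite (measurableSet_eq_fun ((measurable_card.comp measurable_fst).add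
      (measurable_card.comp measurable_snd)) measurable_const) hG measurable_const).aemeasurable
  · exact fun N => (Measurable.ite (measurableSet_eq_fun measurable_card measurable_const)
      (measurable_splitSum hG) measurable_const).aemeasurable

end Conf

/-- An almost everywhere measurable map that pulls null sets back to null sets. -/
structure NonsingularMap {α β : Type*} [MeasurableSpace α] [MeasurableSpace β] (f : α → β)
    (μ : Measure α) (ν : Measure β) : Prop where
  aemeasurable : AEMeasurable f μ
  ac : μ.map f ≪ ν

namespace NonsingularMap

variable {α β γ δ : Type*} [MeasurableSpace α] [MeasurableSpace β] [MeasurableSpace γ]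
  [MeasurableSpace δ] {μ : Measure α} {ν : Measure β} {ρ : Measure γ} {σ : Measure δ}
  {f : α → β} {g : β → γ}

theorem ae (hf : NonsingularMap f μ ν) {P : β → Prop} (h : ∀ᵐ b ∂ν, P b) : ∀ᵐ a ∂μ, P (f a) :=
  ae_of_ae_map hf.aemeasurable (hf.ac.ae_le h)

theorem of_quasi (hf : Measure.QuasiMeasurePreserving f μ ν) : NonsingularMap f μ ν :=
  ⟨hf.measurable.aemeasurable, hf.absolutelyContinuous⟩

theorem of_ae (hf : AEMeasurable f μ) (h : ∀ s, MeasurableSet s → ν s = 0 → ∀ᵐ a ∂μ, f a ∉ s) :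
    NonsingularMap f μ ν := by
  refine ⟨hf, Measure.AbsolutelyContinuous.mk fun s hs h0 => ?_⟩
  rw [Measure.map_apply_of_aemeasurable hf hs]
  have := ae_iff.1 (h s hs h0)
  simp only [not_not] at this
  exact this

theorem comp (hg : NonsingularMap g ν ρ) (hf : NonsingularMap f μ ν) :
    NonsingularMap (g ∘ f) μ ρ := by
  have h1 : AEMeasurable g (μ.map f) := hg.aemeasurable.mono_ac hf.ac
  refine of_ae (h1.comp_aemeasurable hf.aemeasurable) fun s hs h0 => ?_
  have h2 : ∀ᵐ c ∂ρ, c ∉ s := by rw [ae_iff]; simpa using h0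
  exact hf.ae (hg.ae h2)

theorem aestronglyMeasurable_comp {E : Type*} [TopologicalSpace E] {u : β → E}
    (hf : NonsingularMap f μ ν) (hu : AEStronglyMeasurable u ν) :
    AEStronglyMeasurable (fun a => u (f a)) μ :=
  (hu.mono_ac hf.ac).comp_aemeasurable hf.aemeasurable

theorem aemeasurable_comp {E : Type*} [MeasurableSpace E] {u : β → E}
    (hf : NonsingularMap f μ ν) (hu : AEMeasurable u ν) : AEMeasurable (fun a => u (f a)) μ :=
  (hu.mono_ac hf.ac).comp_aemeasurable hf.aemeasurable

theorem congr {f' : α → β} (hf : NonsingularMap f μ ν) (h : f =ᵐ[μ] f') :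
    NonsingularMap f' μ ν :=
  ⟨hf.aemeasurable.congr h, by rw [← Measure.map_congr h]; exact hf.ac⟩

theorem exists_quasi (hf : NonsingularMap f μ ν) :
    ∃ f' : α → β, Measure.QuasiMeasurePreserving f' μ ν ∧ f =ᵐ[μ] f' :=
  ⟨hf.aemeasurable.mk f, ⟨hf.aemeasurable.measurable_mk, by
    rw [← Measure.map_congr hf.aemeasurable.ae_eq_mk]; exact hf.ac⟩, hf.aemeasurable.ae_eq_mk⟩

theorem prodMap [SFinite μ] [SFinite ν] [SFinite ρ] [SFinite σ] {k : γ → δ}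
    (hf : NonsingularMap f μ ν) (hk : NonsingularMap k ρ σ) :
    NonsingularMap (Prod.map f k) (μ.prod ρ) (ν.prod σ) := by
  obtain ⟨f', hf', hff⟩ := hf.exists_quasi
  obtain ⟨k', hk', hkk⟩ := hk.exists_quasi
  refine (of_quasi (QuasiMeasurePreserving.prodMap hf' hk')).congr ?_
  filter_upwards [Measure.quasiMeasurePreserving_fst.ae hff,
    Measure.quasiMeasurePreserving_snd.ae hkk] with p h1 h2
  simp [Prod.map, h1, h2]

protected theorem id : NonsingularMap id μ μ := of_quasi (Measure.QuasiMeasurePreserving.id μ)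

theorem restrict (hf : NonsingularMap f μ ν) (s : Set α) : NonsingularMap f (μ.restrict s) ν :=
  of_ae hf.aemeasurable.restrict fun t _ h0 => by
    have h2 : ∀ᵐ c ∂ν, c ∉ t := by rw [ae_iff]; simpa using h0
    exact ae_restrict_of_ae (hf.ae h2)

theorem fst [SFinite μ] [SFinite ρ] : NonsingularMap Prod.fst (μ.prod ρ) μ :=
  of_quasi Measure.quasiMeasurePreserving_fst

theorem snd [SFinite μ] [SFinite ρ] : NonsingularMap Prod.snd (μ.prod ρ) ρ :=
  of_quasi Measure.quasiMeasurePreserving_snd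

theorem swap [SFinite μ] [SFinite ρ] : NonsingularMap Prod.swap (μ.prod ρ) (ρ.prod μ) :=
  of_quasi Measure.measurePreserving_swap.quasiMeasurePreserving

theorem assoc [SFinite μ] [SFinite ρ] [SFinite σ] :
    NonsingularMap (fun p : (α × γ) × δ => (p.1.1, (p.1.2, p.2))) ((μ.prod ρ).prod σ)
      (μ.prod (ρ.prod σ)) :=
  of_quasi (measurePreserving_prodAssoc μ ρ σ).quasiMeasurePreserving

theorem assoc_symm [SFinite μ] [SFinite ρ] [SFinite σ] :
    NonsingularMap (fun p : α × (γ × δ) => ((p.1, p.2.1), p.2.2)) (μ.prod (ρ.prod σ))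
      ((μ.prod ρ).prod σ) :=
  of_quasi (measurePreserving_prodAssoc μ ρ σ).symm.quasiMeasurePreserving

end NonsingularMap

namespace Conf

variable {Z : Type*} [MeasurableSpace Z] {τ : Z → ℝ≥0} {μ : Measure Z} [SigmaFinite μ]

/-- The decomposition of a tuple into the points with indices inside and outside `I`. -/
def subPair (τ : Z → ℝ≥0) (i : Σ n, Finset (Fin n)) (z : Tup τ i.1) : Conf τ × Conf τ :=
  (sub τ z.1 i.2, sub τ z.1 i.2ᶜ)

theorem measurable_subPair (i : Σ n, Finset (Fin n)) : Measurable (subPair τ i) :=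
  (measurable_sub _).prodMk (measurable_sub _)

theorem vol_prod_vol_eq_sum (hτ : Measurable τ) (hnt : ∀ c, μ {z | τ z = c} = 0) :
    (vol μ τ).prod (vol μ τ) =
      Measure.sum fun i : Σ n, Finset (Fin n) => (tupVol μ τ i.1).map (subPair τ i) := by
  refine Measure.ext fun s hs => ?_
  rw [Measure.sum_apply _ hs, ← lintegral_indicator_one hs, ← lintegral_splitSum hτ hnt
    (measurable_one.indicator hs), lintegral_vol_eq, ENNReal.tsum_sigma']
  refine tsum_congr fun n => ?_
  simp only [splitSum_ofTuple]
  rw [lintegral_finsetSum, tsum_fintype, Finset.powerset_univ]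
  · refine Finset.sum_congr rfl fun I _ => ?_
    rw [Measure.map_apply (measurable_subPair ⟨n, I⟩) hs,
      ← lintegral_indicator_one (measurable_subPair ⟨n, I⟩ hs)]
    rfl
  · exact fun I _ => (measurable_one.indicator hs).comp (measurable_subPair ⟨n, I⟩)

section Param

variable {Y : Type*} [MeasurableSpace Y] {ν : Measure Y} [SFinite ν]

theorem prod_vol_vol_eq_sum (hτ : Measurable τ) (hnt : ∀ c, μ {z | τ z = c} = 0) :
    ν.prod ((vol μ τ).prod (vol μ τ)) = Measure.sum fun i : Σ n, Finset (Fin n) =>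
      (ν.prod (tupVol μ τ i.1)).map (Prod.map id (subPair τ i)) := by
  rw [vol_prod_vol_eq_sum hτ hnt, Measure.prod_sum_right]
  congr 1
  funext i
  rw [← Measure.map_prod_map _ _ measurable_id (measurable_subPair i), Measure.map_id]

theorem aemeasurable_prodMap_subPair (i : Σ n, Finset (Fin n)) :
    AEMeasurable (Prod.map (id : Y → Y) (subPair τ i)) (ν.prod (tupVol μ τ i.1)) :=
  (measurable_id.prodMap (measurable_subPair i)).aemeasurable

theorem ae_splits (hτ : Measurable τ) (hnt : ∀ c, μ {z | τ z = c} = 0)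
    {P : Y × (Conf τ × Conf τ) → Prop} (h : ∀ᵐ q ∂ν.prod ((vol μ τ).prod (vol μ τ)), P q) :
    ∀ᵐ p ∂ν.prod (vol μ τ), ∀ a : Conf τ, a.fin ⊆ p.2.fin → P (p.1, (a, sdiff p.2 a)) := by
  classical
  rw [prod_vol_vol_eq_sum hτ hnt, Measure.ae_sum_iff] at h
  refine ae_prod_vol_iff.2 fun n => ?_
  have h2 : ∀ᵐ p ∂ν.prod (tupVol μ τ n), ∀ I : Finset (Fin n), P (p.1, subPair τ ⟨n, I⟩ p.2) :=
    ae_all_iff.2 fun I => ae_of_ae_map (aemeasurable_prodMap_subPair _) (h ⟨n, I⟩)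
  filter_upwards [h2] with p hp
  have h3 := splitSum_ofTuple (E := Multiset (Conf τ × Conf τ)) (fun q => {q}) p.2
  intro a ha
  have h4 : (a, sdiff (ofTuple τ n p.2) a) ∈
      splitSum (E := Multiset (Conf τ × Conf τ)) (fun q => {q}) (ofTuple τ n p.2) := by
    unfold splitSum
    rw [Multiset.mem_sum]
    exact ⟨a, Finset.mem_powerset.2 ha, Multiset.mem_singleton.2 rfl⟩
  rw [h3, Multiset.mem_sum] at h4
  obtain ⟨I, -, hI⟩ := h4
  rw [Multiset.mem_singleton.1 hI]
  exact hp I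

theorem aestronglyMeasurable_splitSum (hτ : Measurable τ) (hnt : ∀ c, μ {z | τ z = c} = 0)
    {E : Type*} [NormedAddCommGroup E] {f : Y × (Conf τ × Conf τ) → E}
    (hf : AEStronglyMeasurable f (ν.prod ((vol μ τ).prod (vol μ τ)))) :
    AEStronglyMeasurable (fun p : Y × Conf τ => splitSum (fun q => f (p.1, q)) p.2)
      (ν.prod (vol μ τ)) := by
  rw [prod_vol_vol_eq_sum hτ hnt, aestronglyMeasurable_sum_measure_iff] at hf
  refine aestronglyMeasurable_prod_vol_iff.2 fun n => ?_
  simp only [splitSum_ofTuple]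
  refine Finset.aestronglyMeasurable_fun_sum _ fun I _ => ?_
  exact (hf ⟨n, I⟩).comp_aemeasurable (aemeasurable_prodMap_subPair _)

theorem aemeasurable_splitSum (hτ : Measurable τ) (hnt : ∀ c, μ {z | τ z = c} = 0)
    {f : Y × (Conf τ × Conf τ) → ℝ≥0∞}
    (hf : AEMeasurable f (ν.prod ((vol μ τ).prod (vol μ τ)))) :
    AEMeasurable (fun p : Y × Conf τ => splitSum (fun q => f (p.1, q)) p.2)
      (ν.prod (vol μ τ)) := by
  rw [prod_vol_vol_eq_sum hτ hnt, aemeasurable_sum_measure_iff] at hf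
  refine aemeasurable_prod_vol_iff.2 fun n => ?_
  simp only [splitSum_ofTuple]
  refine Finset.aemeasurable_fun_sum _ fun I _ => ?_
  exact (hf ⟨n, I⟩).comp_aemeasurable (aemeasurable_prodMap_subPair _)

theorem lintegral_prod_splitSum (hτ : Measurable τ) (hnt : ∀ c, μ {z | τ z = c} = 0)
    {f : Y × (Conf τ × Conf τ) → ℝ≥0∞}
    (hf : AEMeasurable f (ν.prod ((vol μ τ).prod (vol μ τ)))) :
    ∫⁻ p, splitSum (fun q => f (p.1, q)) p.2 ∂ν.prod (vol μ τ) =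
      ∫⁻ q, f q ∂ν.prod ((vol μ τ).prod (vol μ τ)) := by
  rw [prod_vol_vol_eq_sum hτ hnt, aemeasurable_sum_measure_iff] at hf
  rw [prod_vol_vol_eq_sum hτ hnt, prod_vol_eq, lintegral_sum_measure, lintegral_sum_measure,
    ENNReal.tsum_sigma']
  refine tsum_congr fun n => ?_
  rw [(measurableEmbedding_prodMap n).lintegral_map, tsum_fintype]
  simp only [Prod.map, splitSum_ofTuple]
  rw [lintegral_finsetSum', Finset.powerset_univ]
  · refine Finset.sum_congr rfl fun I _ => ?_
    rw [lintegral_map' (hf ⟨n, I⟩) (aemeasurable_prodMap_subPair _)]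
    rfl
  · exact fun I _ => (hf ⟨n, I⟩).comp_aemeasurable (aemeasurable_prodMap_subPair _)

theorem enorm_splitSum_le {E : Type*} [NormedAddCommGroup E] (f : Conf τ × Conf τ → E)
    (ϑ : Conf τ) : ‖splitSum f ϑ‖ₑ ≤ splitSum (fun q => ‖f q‖ₑ) ϑ :=
  enorm_sum_le _ _

theorem integrable_splitSum (hτ : Measurable τ) (hnt : ∀ c, μ {z | τ z = c} = 0)
    {E : Type*} [NormedAddCommGroup E] {f : Y × (Conf τ × Conf τ) → E}
    (hf : Integrable f (ν.prod ((vol μ τ).prod (vol μ τ)))) :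
    Integrable (fun p : Y × Conf τ => splitSum (fun q => f (p.1, q)) p.2)
      (ν.prod (vol μ τ)) := by
  refine ⟨aestronglyMeasurable_splitSum hτ hnt hf.1, ?_⟩
  refine lt_of_le_of_lt (lintegral_mono fun p => enorm_splitSum_le _ _) ?_
  rw [lintegral_prod_splitSum hτ hnt (f := fun q => ‖f q‖ₑ) hf.1.enorm]
  exact hf.2

theorem integral_prod_splitSum (hτ : Measurable τ) (hnt : ∀ c, μ {z | τ z = c} = 0)
    {E : Type*} [NormedAddCommGroup E] [NormedSpace ℝ E] {f : Y × (Conf τ × Conf τ) → E}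
    (hf : Integrable f (ν.prod ((vol μ τ).prod (vol μ τ)))) :
    ∫ p, splitSum (fun q => f (p.1, q)) p.2 ∂ν.prod (vol μ τ) =
      ∫ q, f q ∂ν.prod ((vol μ τ).prod (vol μ τ)) := by
  by_cases hE : CompleteSpace E
  swap
  · simp [integral, hE]
  have h1 := integrable_splitSum hτ hnt hf
  rw [prod_vol_eq] at h1 ⊢
  rw [prod_vol_vol_eq_sum hτ hnt] at hf ⊢
  have h2 := hasSum_integral_measure hf
  have h3 := hasSum_integral_measure h1
  refine h3.unique (h2.sigma fun n => ?_)
  have hi : ∀ I : Finset (Fin n), Integrable (fun p : Y × Tup τ n => f (p.1, subPair τ ⟨n, I⟩ p.2))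
      (ν.prod (tupVol μ τ n)) := fun I => by
    have := hf.mono_measure (Measure.le_sum _ (⟨n, I⟩ : Σ n, Finset (Fin n)))
    exact this.comp_aemeasurable (aemeasurable_prodMap_subPair _)
  have : ∫ x, splitSum (fun q => f (x.1, q)) x.2
      ∂(ν.prod (tupVol μ τ n)).map (Prod.map id (ofTuple τ n)) = ∑ I : Finset (Fin n),
      ∫ q, f q ∂(ν.prod (tupVol μ τ n)).map (Prod.map id (subPair τ ⟨n, I⟩)) := by
    rw [(measurableEmbedding_prodMap n).integral_map]
    simp only [Prod.map, splitSum_ofTuple]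
    rw [integral_finsetSum, Finset.powerset_univ]
    · refine Finset.sum_congr rfl fun I _ => ?_
      rw [integral_map (aemeasurable_prodMap_subPair ⟨n, I⟩)
        (hf.mono_measure (Measure.le_sum _ (⟨n, I⟩ : Σ n, Finset (Fin n)))).1]
      rfl
    · exact fun I _ => hi I
  rw [this]
  exact hasSum_fintype _

end Param

end Conf

namespace Conf

variable {Z : Type*} [MeasurableSpace Z] {τ : Z → ℝ≥0} {μ : Measure Z} [SigmaFinite μ]

theorem mem_fin_image {n : ℕ} {z : Fin n → Z} {x : Z} :
    x ∈ (image τ z).fin ↔ ∃ i, z i = x := by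
  classical
  refine (Finset.mem_image (s := Finset.univ)).trans ?_
  simp

theorem image_comp_perm {n : ℕ} (z : Fin n → Z) (σ : Equiv.Perm (Fin n)) :
    image τ (z ∘ σ) = image τ z := by
  refine conf_ext fun x => ?_
  simp only [mem_fin_image]
  exact ⟨fun ⟨i, hi⟩ => ⟨σ i, hi⟩, fun ⟨i, hi⟩ => ⟨σ.symm i, by simpa using hi⟩⟩

theorem aemeasurable_image (hτ : Measurable τ) {Y : Type*} [MeasurableSpace Y] {ν : Measure Y}
    {n : ℕ} {u : Y → Fin n → Z} (hu : Measurable u)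
    (hi : ∀ᵐ y ∂ν, Function.Injective fun i => τ (u y i)) :
    AEMeasurable (fun y => image τ (u y)) ν := by
  let A : Equiv.Perm (Fin n) → Set Y := fun σ => {y | StrictMono fun i => τ (u y (σ i))}
  have hus : ∀ σ : Equiv.Perm (Fin n), Measurable fun y i => u y (σ i) := fun σ =>
    measurable_pi_iff.2 fun i => (measurable_pi_apply _).comp hu
  have hA : ∀ σ, MeasurableSet (A σ) := fun σ => measurableSet_strictMono hτ n |>.preimage (hus σ)
  have hc : ν.restrict (⋃ σ, A σ) = ν := by
    refine Measure.restrict_eq_self_of_ae_mem ?_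
    filter_upwards [hi] with y hy
    refine Set.mem_iUnion.2 ⟨Tuple.sort fun i => τ (u y i), ?_⟩
    exact (Tuple.monotone_sort fun i => τ (u y i)).strictMono_of_injective
      (hy.comp (Equiv.injective _))
  rw [← hc, aemeasurable_iUnion_iff]
  intro σ
  refine aemeasurable_restrict_of_measurable_subtype (hA σ) ?_
  have h2 : Measurable fun y : A σ => image τ fun i => u y (σ i) :=
    measurable_image ((hus σ).comp measurable_subtype_coe) fun y => y.2
  convert h2 using 1
  funext y
  exact (image_comp_perm (u y) σ).symm

theorem ae_prod_tupVol_ne (hτ : Measurable τ) (hnt : ∀ c, μ {z | τ z = c} = 0) (n m : ℕ) :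
    ∀ᵐ p ∂(tupVol μ τ n).prod (tupVol μ τ m), ∀ i j, τ (p.1.1 i) ≠ τ (p.2.1 j) := by
  have hm : MeasurableSet {p : Tup τ n × Tup τ m | ∀ i j, τ (p.1.1 i) ≠ τ (p.2.1 j)} := by
    simp only [Set.ofPred_forall]
    refine MeasurableSet.iInter fun i => MeasurableSet.iInter fun j => ?_
    exact (measurableSet_eq_fun
      (hτ.comp ((measurable_pi_apply i).comp (measurable_subtype_coe.comp measurable_fst)))
      (hτ.comp ((measurable_pi_apply j).comp (measurable_subtype_coe.comp measurable_snd)))).compl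
  refine (Measure.ae_prod_iff_ae_ae hm).2 (Filter.Eventually.of_forall fun z => ?_)
  refine ae_all_iff.2 fun i => ae_all_iff.2 fun j => ?_
  have h : ∀ᵐ x ∂μ, τ (z.1 i) ≠ τ x := by
    rw [ae_iff]; simpa [eq_comm] using hnt (τ (z.1 i))
  rw [ae_tupVol_iff hτ (P := fun w => τ (z.1 i) ≠ τ (w j))]
  filter_upwards [(Measure.quasiMeasurePreserving_eval (fun _ : Fin m => μ) j).ae h] with w hw _
    using hw

theorem vol_prod_vol_eq : (vol μ τ).prod (vol μ τ) = Measure.sum fun i : ℕ × ℕ =>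
    ((tupVol μ τ i.1).prod (tupVol μ τ i.2)).map (Prod.map (ofTuple τ i.1) (ofTuple τ i.2)) := by
  rw [vol_eq, Measure.prod_sum]
  congr 1
  funext i
  rw [Measure.map_prod_map _ _ (measurable_ofTuple τ _) (measurable_ofTuple τ _)]

theorem measurableEmbedding_prodMap_ofTuple (n m : ℕ) :
    MeasurableEmbedding (Prod.map (ofTuple τ n) (ofTuple τ m)) :=
  MeasurableEmbedding.prodMap (measurableEmbedding_ofTuple τ n) (measurableEmbedding_ofTuple τ m)

/-- Two independent chains almost surely have no simultaneous points. -/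
theorem ae_prod_vol_ne (hτ : Measurable τ) (hnt : ∀ c, μ {z | τ z = c} = 0) :
    ∀ᵐ p ∂(vol μ τ).prod (vol μ τ), ∀ x ∈ p.1.fin, ∀ y ∈ p.2.fin, τ x ≠ τ y := by
  rw [vol_prod_vol_eq, Measure.ae_sum_iff]
  rintro ⟨n, m⟩
  rw [(measurableEmbedding_prodMap_ofTuple n m).ae_map_iff]
  filter_upwards [ae_prod_tupVol_ne hτ hnt n m] with p hp x hx y hy
  obtain ⟨i, rfl⟩ := (mem_ofTuple p.1 x).1 hx
  obtain ⟨j, rfl⟩ := (mem_ofTuple p.2 y).1 hy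
  exact hp i j

theorem aemeasurable_un (hτ : Measurable τ) (hnt : ∀ c, μ {z | τ z = c} = 0) :
    AEMeasurable (fun p : Conf τ × Conf τ => un p.1 p.2) ((vol μ τ).prod (vol μ τ)) := by
  rw [vol_prod_vol_eq, aemeasurable_sum_measure_iff]
  rintro ⟨n, m⟩
  rw [(measurableEmbedding_prodMap_ofTuple n m).aemeasurable_map_iff]
  have h : ((fun p : Conf τ × Conf τ => un p.1 p.2) ∘ Prod.map (ofTuple τ n) (ofTuple τ m)) =
      fun p : Tup τ n × Tup τ m => image τ (Fin.append p.1.1 p.2.1) := by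
    funext p
    refine conf_ext fun x => ?_
    rw [mem_fin_image]
    change x ∈ (un (ofTuple τ n p.1) (ofTuple τ m p.2)).fin ↔ _
    rw [mem_fin_un, mem_ofTuple, mem_ofTuple]
    constructor
    · rintro (⟨i, rfl⟩ | ⟨i, rfl⟩)
      · exact ⟨Fin.castAdd m i, by simp⟩
      · exact ⟨Fin.natAdd n i, by simp⟩
    · rintro ⟨i, rfl⟩
      induction i using Fin.addCases with
      | left i => exact Or.inl ⟨i, by simp⟩
      | right i => exact Or.inr ⟨i, by simp⟩
  rw [h]
  refine aemeasurable_image hτ ?_ ?_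
  · refine measurable_pi_iff.2 fun i => ?_
    induction i using Fin.addCases with
    | left i =>
      simp only [Fin.append_left]
      exact (measurable_pi_apply i).comp (measurable_subtype_coe.comp measurable_fst)
    | right i =>
      simp only [Fin.append_right]
      exact (measurable_pi_apply i).comp (measurable_subtype_coe.comp measurable_snd)
  · filter_upwards [ae_prod_tupVol_ne hτ hnt n m] with p hp i j hij
    induction i using Fin.addCases with
    | left i =>
      induction j using Fin.addCases with
      | left j =>
        simp only [Fin.append_left] at hij
        rw [p.1.2.injective hij]
      | right j =>
        simp only [Fin.append_left, Fin.append_right] at hij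
        exact absurd hij (hp i j)
    | right i =>
      induction j using Fin.addCases with
      | left j =>
        simp only [Fin.append_left, Fin.append_right] at hij
        exact absurd hij.symm (hp j i)
      | right j =>
        simp only [Fin.append_right] at hij
        rw [p.2.2.injective hij]

theorem un_sdiff {a ϑ : Conf τ} (h : a.fin ⊆ ϑ.fin) : un a (sdiff ϑ a) = ϑ := by
  refine conf_ext fun x => ?_
  rw [mem_fin_un, mem_fin_sdiff]
  constructor
  · rintro (hx | hx)
    · exact h hx
    · exact hx.1
  · intro hx
    by_cases hxa : x ∈ a.fin
    · exact Or.inl hxa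
    · exact Or.inr ⟨hx, hxa⟩

theorem sdiff_subset' {a ϑ : Conf τ} (h : (a : Finset Z) ∈ ϑ.fin.powerset) : a.fin ⊆ ϑ.fin :=
  Finset.mem_powerset.1 h

theorem splitSum_congr {E : Type*} [AddCommMonoid E] {G H : Conf τ × Conf τ → E} {ϑ : Conf τ}
    (h : ∀ a : Conf τ, a.fin ⊆ ϑ.fin → G (a, sdiff ϑ a) = H (a, sdiff ϑ a)) :
    splitSum G ϑ = splitSum H ϑ :=
  Finset.sum_congr rfl fun a ha => h a (Finset.mem_powerset.1 ha)

theorem nonsingular_unit {α : Type*} [MeasurableSpace α] {ρ : Measure α} [SFinite ρ] :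
    NonsingularMap (fun a => ((), a)) ρ ((Measure.dirac ()).prod ρ) := by
  refine ⟨measurable_prodMk_left.aemeasurable, ?_⟩
  rw [Measure.dirac_prod]

theorem ae_splits' (hτ : Measurable τ) (hnt : ∀ c, μ {z | τ z = c} = 0)
    {P : Conf τ × Conf τ → Prop} (h : ∀ᵐ q ∂(vol μ τ).prod (vol μ τ), P q) :
    ∀ᵐ ϑ ∂vol μ τ, ∀ a : Conf τ, a.fin ⊆ ϑ.fin → P (a, sdiff ϑ a) :=
  nonsingular_unit.ae (ae_splits hτ hnt (ν := Measure.dirac ()) (P := fun q => P q.2)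
    (NonsingularMap.snd.ae h))

theorem lintegral_splitSum' (hτ : Measurable τ) (hnt : ∀ c, μ {z | τ z = c} = 0)
    {f : Conf τ × Conf τ → ℝ≥0∞} (hf : AEMeasurable f ((vol μ τ).prod (vol μ τ))) :
    ∫⁻ ϑ, splitSum f ϑ ∂vol μ τ = ∫⁻ q, f q ∂(vol μ τ).prod (vol μ τ) := by
  have h : (fun ϑ : Conf τ => splitSum f ϑ) =ᵐ[vol μ τ] splitSum (hf.mk f) := by
    filter_upwards [ae_splits' hτ hnt hf.ae_eq_mk] with ϑ hϑ using splitSum_congr hϑ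
  rw [lintegral_congr_ae h, lintegral_splitSum hτ hnt hf.measurable_mk,
    lintegral_congr_ae hf.ae_eq_mk]

theorem nonsingular_un (hτ : Measurable τ) (hnt : ∀ c, μ {z | τ z = c} = 0) :
    NonsingularMap (fun p : Conf τ × Conf τ => un p.1 p.2) ((vol μ τ).prod (vol μ τ))
      (vol μ τ) := by
  have hu := aemeasurable_un (μ := μ) hτ hnt
  refine NonsingularMap.of_ae hu fun s hs h0 => ?_
  have hi : AEMeasurable (fun p : Conf τ × Conf τ => s.indicator (1 : Conf τ → ℝ≥0∞)
      (un p.1 p.2)) ((vol μ τ).prod (vol μ τ)) :=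
    (measurable_one.indicator hs).comp_aemeasurable hu
  have h1 := lintegral_splitSum' hτ hnt hi
  have h2 : ∫⁻ ϑ, splitSum (fun p : Conf τ × Conf τ => s.indicator (1 : Conf τ → ℝ≥0∞)
      (un p.1 p.2)) ϑ ∂vol μ τ = 0 := by
    refine lintegral_eq_zero_of_ae_eq_zero ?_
    have : ∀ᵐ ϑ ∂vol μ τ, ϑ ∉ s := by rw [ae_iff]; simpa using h0
    filter_upwards [this] with ϑ hϑ
    refine Finset.sum_eq_zero fun a ha => ?_
    have := un_sdiff (τ := τ) (a := a) (ϑ := ϑ) (Finset.mem_powerset.1 ha)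
    simp only
    rw [this, Set.indicator_of_notMem hϑ]
  rw [h2] at h1
  filter_upwards [(lintegral_eq_zero_iff' hi).1 h1.symm] with p hp hps
  rw [Set.indicator_of_mem hps] at hp
  simp at hp

/-- The configuration with the single point `x`. -/
def single (τ : Z → ℝ≥0) (x : Z) : Conf τ := ({x} : Finset Z)

theorem mem_fin_single {x y : Z} : y ∈ (single τ x).fin ↔ y = x := Finset.mem_singleton

theorem un_single (x : Z) (a : Conf τ) : un (single τ x) a = ins x a :=
  conf_ext fun y => by rw [mem_fin_un, mem_fin_single, mem_fin_ins]

theorem nonsingular_eval (hτ : Measurable τ) :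
    NonsingularMap (fun z : Tup τ 1 => z.1 0) (tupVol μ τ 1) μ := by
  refine NonsingularMap.of_ae
    ((measurable_pi_apply 0).comp measurable_subtype_coe).aemeasurable fun s hs h0 => ?_
  have h2 : ∀ᵐ c ∂μ, c ∉ s := by rw [ae_iff]; simpa using h0
  rw [ae_tupVol_iff hτ (P := fun z => z 0 ∉ s)]
  filter_upwards [(Measure.quasiMeasurePreserving_eval (fun _ : Fin 1 => μ) 0).ae h2] with z hz _
    using hz

theorem nonsingular_single (hτ : Measurable τ) : NonsingularMap (single τ) μ (vol μ τ) := by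
  have hi : single τ = fun x => image τ fun _ : Fin 1 => x := by
    funext x
    refine conf_ext fun y => ?_
    rw [mem_fin_single, mem_fin_image]
    simp [eq_comm]
  refine NonsingularMap.of_ae ?_ fun s hs h0 => ?_
  · rw [hi]
    exact (measurable_image (measurable_pi_iff.2 fun _ => measurable_id)
      fun y => Subsingleton.strictMono _).aemeasurable
  · have h2 : ∀ᵐ c ∂vol μ τ, c ∉ s := by rw [ae_iff]; simpa using h0
    have h3 := ae_vol_iff.1 h2 1
    have h4 := (ae_tupVol_iff hτ (P := fun z => image τ z ∉ s)).1 h3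
    have h5 := (measurePreserving_funUnique μ (Fin 1)).symm.quasiMeasurePreserving.ae h4
    filter_upwards [h5] with x hx
    rw [hi]
    exact hx (Subsingleton.strictMono _)

theorem nonsingular_ins (hτ : Measurable τ) (hnt : ∀ c, μ {z | τ z = c} = 0) :
    NonsingularMap (fun p : Z × Conf τ => ins p.1 p.2) (μ.prod (vol μ τ)) (vol μ τ) := by
  have := (nonsingular_un (μ := μ) hτ hnt).comp
    ((nonsingular_single hτ).prodMap (NonsingularMap.id (μ := vol μ τ)))
  convert this using 1
  funext p
  exact (un_single p.1 p.2).symm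

theorem ae_ins_ne (hτ : Measurable τ) (hnt : ∀ c, μ {z | τ z = c} = 0) :
    ∀ᵐ p ∂μ.prod (vol μ τ), ∀ y ∈ p.2.fin, τ y ≠ τ p.1 := by
  have h := ((nonsingular_single hτ).prodMap (NonsingularMap.id (μ := vol μ τ))).ae
    (ae_prod_vol_ne (μ := μ) hτ hnt)
  filter_upwards [h] with p hp y hy h'
  exact hp p.1 (mem_fin_single.2 rfl) y hy h'.symm

/-- Almost everywhere statements about a point and a chain hold at all points of a chain. -/
theorem ae_points (hτ : Measurable τ) (hnt : ∀ c, μ {z | τ z = c} = 0)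
    {Y : Type*} [MeasurableSpace Y] {ν : Measure Y} [SFinite ν] {P : Y × (Z × Conf τ) → Prop}
    (h : ∀ᵐ q ∂ν.prod (μ.prod (vol μ τ)), P q) :
    ∀ᵐ p ∂ν.prod (vol μ τ), ∀ y ∈ p.2.fin, P (p.1, (y, sdiff p.2 (single τ y))) := by
  have h1 : ∀ᵐ q ∂ν.prod ((vol μ τ).prod (vol μ τ)),
      ∀ y, q.2.1 = single τ y → P (q.1, (y, q.2.2)) := by
    have h2 : ∀ᵐ q ∂(ν.prod (vol μ τ)).prod (vol μ τ),
        ∀ y, q.2 = single τ y → P (q.1.1, (y, q.1.2)) := by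
      refine ae_prod_vol_iff.2 fun n => ?_
      by_cases hn : n = 1
      · subst hn
        have h3 := ((NonsingularMap.id (μ := ν)).prodMap ((nonsingular_eval (μ := μ) hτ).prodMap
          (NonsingularMap.id (μ := vol μ τ)))).ae h
        have h4 := (((NonsingularMap.id (μ := ν)).prodMap (NonsingularMap.swap (μ := vol μ τ)
          (ρ := tupVol μ τ 1))).comp NonsingularMap.assoc).ae h3
        filter_upwards [h4] with q hq y hy
        have : q.2.1 0 = y := by
          have h5 : q.2.1 0 ∈ (ofTuple τ 1 q.2).fin := (mem_ofTuple _ _).2 ⟨0, rfl⟩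
          rw [hy] at h5
          exact mem_fin_single.1 h5
        rw [← this]
        exact hq
      · refine Filter.Eventually.of_forall fun q y hy => absurd ?_ hn
        have h5 := card_ofTuple q.2
        simp only at hy
        rw [hy] at h5
        rw [← h5]
        exact Finset.card_singleton y
    have h3 := (NonsingularMap.assoc_symm.comp ((NonsingularMap.id (μ := ν)).prodMap
      (NonsingularMap.swap (μ := vol μ τ) (ρ := vol μ τ)))).ae h2
    exact h3
  filter_upwards [ae_splits hτ hnt h1] with p hp y hy
  refine hp (single τ y) (fun z hz => ?_) y rfl
  rw [mem_fin_single.1 hz]; exact hy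

/-- The product of the values of `w` over a configuration. -/
def wt (w : Z → ℝ≥0) (a : Conf τ) : ℝ≥0∞ := ((∏ y ∈ a.fin, w y : ℝ≥0) : ℝ≥0∞)

theorem wt_ne_top (w : Z → ℝ≥0) (a : Conf τ) : wt w a ≠ ∞ := ENNReal.coe_ne_top

theorem wt_ne_zero {w : Z → ℝ≥0} (hw : ∀ x, w x ≠ 0) (a : Conf τ) : wt w a ≠ 0 := by
  unfold wt
  rw [ENNReal.coe_ne_zero]
  exact Finset.prod_ne_zero_iff.2 fun x _ => hw x

theorem wt_mul (w w' : Z → ℝ≥0) (a : Conf τ) : wt (w * w') a = wt w a * wt w' a := by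
  simp [wt, Finset.prod_mul_distrib]

theorem splitSum_wt (w w' : Z → ℝ≥0) (ϑ : Conf τ) :
    splitSum (fun q => wt w q.1 * wt w' q.2) ϑ = wt (w + w') ϑ := by
  classical
  unfold splitSum wt
  simp only [Pi.add_apply, Finset.prod_add, ENNReal.ofNNReal_finsetSum, ENNReal.coe_mul]
  refine Finset.sum_congr rfl fun a _ => ?_
  have : ϑ.fin \ a = (sdiff ϑ a).fin := Finset.ext fun x => by
    rw [Finset.mem_sdiff]
    exact (mem_fin_sdiff (a := ϑ) (b := a)).symm
  rw [this]
  rfl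

theorem aemeasurable_wt (hτ : Measurable τ) {w : Z → ℝ≥0} (hw : AEMeasurable w μ) :
    AEMeasurable (wt w) (vol μ τ) := by
  have h : wt (hw.mk w) =ᵐ[vol μ τ] wt (τ := τ) w := by
    filter_upwards [ae_forall_mem hτ hw.ae_eq_mk] with a ha
    unfold wt
    rw [Finset.prod_congr rfl ha]
  refine AEMeasurable.congr (Measurable.aemeasurable ?_) h
  refine measurable_of_comp fun n => ?_
  classical
  have : ∀ z : Tup τ n, wt (hw.mk w) (ofTuple τ n z) = ((∏ i, hw.mk w (z.1 i) : ℝ≥0) : ℝ≥0∞) :=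
    fun z => by
      unfold wt
      rw [fin_ofTuple, Finset.prod_image]
      exact fun i _ j _ h => tup_injective z h
  simp only [this]
  refine measurable_coe_nnreal_ennreal.comp (Finset.measurable_prod _ fun i _ => ?_)
  exact hw.measurable_mk.comp ((measurable_pi_apply i).comp measurable_subtype_coe)

theorem wt_un {w : Z → ℝ≥0} {a b : Conf τ} (h : ∀ x ∈ a.fin, x ∉ b.fin) :
    wt w (un a b) = wt w a * wt w b := by
  classical
  have : (un a b).fin = a.fin ∪ b.fin := Finset.ext fun x => by
    rw [mem_fin_un, Finset.mem_union]
  unfold wt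
  rw [this, Finset.prod_union (Finset.disjoint_left.2 h), ENNReal.coe_mul]

end Conf

namespace Conf

variable {Z : Type*} [MeasurableSpace Z] {τ : Z → ℝ≥0} {μ : Measure Z} [SigmaFinite μ]

theorem measurableSet_snocDomain (hτ : Measurable τ) :
    MeasurableSet {p : Z × Conf τ | p.2 ∈ before τ (τ p.1)} :=
  measurableSet_before_pair hτ (hτ.comp measurable_fst) measurable_snd

theorem vol_eq_add (hτ : Measurable τ) : vol μ τ = Measure.dirac (nil τ) +
    ((μ.prod (vol μ τ)).restrict {p : Z × Conf τ | p.2 ∈ before τ (τ p.1)}).map snoc := by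
  refine Measure.ext fun s hs => ?_
  have hD := measurableSet_snocDomain hτ
  have hm : Measurable (s.indicator (1 : Conf τ → ℝ≥0∞)) := measurable_one.indicator hs
  have hms : Measurable fun p : Z × Conf τ => s.indicator (1 : Conf τ → ℝ≥0∞) (snoc p) :=
    hm.comp (measurable_snoc hτ)
  rw [Measure.add_apply, ← lintegral_indicator_one hs, lintegral_vol hτ hm,
    Measure.dirac_apply' _ hs, ← lintegral_indicator_one (μ := Measure.map _ _) hs,
    lintegral_map hm (measurable_snoc hτ), ← lintegral_indicator hD,
    lintegral_prod _ (hms.indicator hD).aemeasurable]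
  congr 1
  refine lintegral_congr fun x => ?_
  rw [← lintegral_indicator (measurableSet_before hτ _)]
  rfl

theorem lintegral_ins_le (hτ : Measurable τ) {f : Conf τ → ℝ≥0∞} (hf : AEMeasurable f (vol μ τ))
    (t : ℝ≥0) : ∫⁻ x in {x | τ x < t}, ∫⁻ a in before τ (τ x), f (ins x a) ∂vol μ τ ∂μ ≤
      ∫⁻ a in before τ t, f a ∂vol μ τ := by
  have hD := measurableSet_snocDomain hτ
  have hi : AEMeasurable ((before τ t).indicator f) (vol μ τ) :=
    hf.indicator (measurableSet_before hτ t)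
  rw [← lintegral_indicator (measurableSet_before hτ t)]
  have hle : ((μ.prod (vol μ τ)).restrict {p : Z × Conf τ | p.2 ∈ before τ (τ p.1)}).map snoc ≤
      vol μ τ := by
    conv_rhs => rw [vol_eq_add hτ]
    exact Measure.le_add_left le_rfl
  refine le_trans ?_ (lintegral_mono' hle le_rfl)
  rw [lintegral_map' (hi.mono_measure hle) (measurable_snoc hτ).aemeasurable,
    ← lintegral_indicator hD, lintegral_prod]
  · rw [← lintegral_indicator (measurableSet_lt hτ measurable_const)]
    refine lintegral_mono fun x => ?_
    by_cases hx : τ x < t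
    · rw [Set.indicator_of_mem (by exact hx), ← lintegral_indicator (measurableSet_before hτ _)]
      refine lintegral_mono_ae ?_
      filter_upwards [ae_mem_chains (τ := τ) (μ := μ)] with a ha
      by_cases hb : a ∈ before τ (τ x)
      · rw [Set.indicator_of_mem hb, Set.indicator_of_mem (by exact hb), snoc_eq ha hb,
          Set.indicator_of_mem (ins_mem_before.2 ⟨hx, fun z hz => (hb z hz).trans hx⟩)]
      · rw [Set.indicator_of_notMem hb]
        exact zero_le
    · rw [Set.indicator_of_notMem (by exact hx)]
      exact zero_le
  · have : AEMeasurable (fun p => (before τ t).indicator f (snoc p))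
        ((μ.prod (vol μ τ)).restrict {p : Z × Conf τ | p.2 ∈ before τ (τ p.1)}) :=
      (hi.mono_measure hle).comp_aemeasurable (measurable_snoc hτ).aemeasurable
    exact (aemeasurable_indicator_iff hD).2 this

/-- A latest point added to the first chain of a pair. -/
def snocLeft (q : Z × (Conf τ × Conf τ)) : Conf τ × Conf τ := (snoc (q.1, q.2.1), q.2.2)

/-- A latest point added to the second chain of a pair. -/
def snocRight (q : Z × (Conf τ × Conf τ)) : Conf τ × Conf τ := (q.2.1, snoc (q.1, q.2.2))

theorem measurable_snocLeft (hτ : Measurable τ) : Measurable (snocLeft (τ := τ)) :=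
  ((measurable_snoc hτ).comp (measurable_fst.prodMk (measurable_fst.comp measurable_snd))).prodMk
    (measurable_snd.comp measurable_snd)

theorem measurable_snocRight (hτ : Measurable τ) : Measurable (snocRight (τ := τ)) :=
  (measurable_fst.comp measurable_snd).prodMk
    ((measurable_snoc hτ).comp (measurable_fst.prodMk (measurable_snd.comp measurable_snd)))

/-- The domain on which a point is later than a pair of chains. -/
def laterPoint (τ : Z → ℝ≥0) : Set (Z × (Conf τ × Conf τ)) := {q | q.2 ∈ before₂ τ (τ q.1)}

theorem measurableSet_laterPoint (hτ : Measurable τ) : MeasurableSet (laterPoint τ) :=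
  (measurableSet_before_pair hτ (hτ.comp measurable_fst) (measurable_fst.comp measurable_snd)).inter
    (measurableSet_before_pair hτ (hτ.comp measurable_fst) (measurable_snd.comp measurable_snd))

/-- The measure on points and pairs of earlier chains. -/
def laterVol (μ : Measure Z) (τ : Z → ℝ≥0) : Measure (Z × (Conf τ × Conf τ)) :=
  (μ.prod ((vol μ τ).prod (vol μ τ))).restrict (laterPoint τ)

theorem lintegral_laterVol (hτ : Measurable τ) {g : Z × (Conf τ × Conf τ) → ℝ≥0∞}
    (hg : Measurable g) : ∫⁻ q, g q ∂laterVol μ τ = ∫⁻ x, ∫⁻ p in before₂ τ (τ x), g (x, p)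
      ∂(vol μ τ).prod (vol μ τ) ∂μ := by
  have hD := measurableSet_laterPoint hτ
  rw [laterVol, ← lintegral_indicator hD, lintegral_prod _ (hg.indicator hD).aemeasurable]
  refine lintegral_congr fun x => ?_
  rw [← lintegral_indicator ((measurableSet_before hτ _).prod (measurableSet_before hτ _))]
  rfl

theorem vol_prod_vol_eq_add (hτ : Measurable τ) (hnt : ∀ c, μ {z | τ z = c} = 0) :
    (vol μ τ).prod (vol μ τ) = Measure.dirac (nil τ, nil τ) +
      ((laterVol μ τ).map snocLeft + (laterVol μ τ).map snocRight) := by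
  refine Measure.ext fun s hs => ?_
  have hm : Measurable (s.indicator (1 : Conf τ × Conf τ → ℝ≥0∞)) := measurable_one.indicator hs
  have hl := measurable_snocLeft hτ
  have hr := measurable_snocRight hτ
  have hml : Measurable fun q : Z × (Conf τ × Conf τ) =>
    s.indicator (1 : Conf τ × Conf τ → ℝ≥0∞) (snocLeft q) := hm.comp hl
  have hmr : Measurable fun q : Z × (Conf τ × Conf τ) =>
    s.indicator (1 : Conf τ × Conf τ → ℝ≥0∞) (snocRight q) := hm.comp hr
  rw [Measure.add_apply, Measure.add_apply, ← lintegral_indicator_one hs,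
    lintegral_prod_vol hτ hnt hm, Measure.dirac_apply' _ hs,
    ← lintegral_indicator_one (μ := Measure.map _ _) hs,
    ← lintegral_indicator_one (μ := Measure.map snocRight _) hs,
    lintegral_map hm hl, lintegral_map hm hr, ← lintegral_add_left hml]
  have hadd := lintegral_laterVol (μ := μ) hτ (hml.add hmr)
  simp only [Pi.add_apply] at hadd
  rw [hadd]
  rfl

theorem ae_laterVol_snoc (hτ : Measurable τ) : ∀ᵐ q ∂laterVol μ τ,
    snocLeft q = (ins q.1 q.2.1, q.2.2) ∧ snocRight q = (q.2.1, ins q.1 q.2.2) := by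
  refine (ae_restrict_iff' (measurableSet_laterPoint hτ)).2 ?_
  filter_upwards [(NonsingularMap.fst.comp NonsingularMap.snd).ae
      (ae_mem_chains (τ := τ) (μ := μ)), (NonsingularMap.snd.comp NonsingularMap.snd).ae
      (ae_mem_chains (τ := τ) (μ := μ))] with q h1 h2 hq
  unfold snocLeft snocRight
  have e1 : snoc (q.1, q.2.1) = ins q.1 q.2.1 := snoc_eq h1 hq.1
  have e2 : snoc (q.1, q.2.2) = ins q.1 q.2.2 := snoc_eq h2 hq.2
  rw [e1, e2]
  exact ⟨rfl, rfl⟩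

section Bochner

variable {E : Type*} [NormedAddCommGroup E] [NormedSpace ℝ E]

theorem integral_laterVol (hτ : Measurable τ) {g : Z × (Conf τ × Conf τ) → E}
    (hg : Integrable g (laterVol μ τ)) :
    Integrable (fun x => ∫ p in before₂ τ (τ x), g (x, p) ∂(vol μ τ).prod (vol μ τ)) μ ∧
    ∫ q, g q ∂laterVol μ τ = ∫ x, ∫ p in before₂ τ (τ x), g (x, p)
      ∂(vol μ τ).prod (vol μ τ) ∂μ := by
  have hD := measurableSet_laterPoint hτ
  have h1 : ∀ x, ∫ p in before₂ τ (τ x), g (x, p) ∂(vol μ τ).prod (vol μ τ) =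
      ∫ p, (laterPoint τ).indicator g (x, p) ∂(vol μ τ).prod (vol μ τ) := fun x => by
    rw [← integral_indicator ((measurableSet_before hτ _).prod (measurableSet_before hτ _))]
    rfl
  have hgi : Integrable ((laterPoint τ).indicator g) (μ.prod ((vol μ τ).prod (vol μ τ))) :=
    (integrable_indicator_iff hD).2 hg
  simp only [h1]
  refine ⟨hgi.integral_prod_left, ?_⟩
  rw [laterVol, ← integral_indicator hD, integral_prod _ hgi]

/-- Disintegration of integrals over pairs of chains with respect to the latest point. -/
theorem integral_prod_vol [CompleteSpace E] (hτ : Measurable τ) (hnt : ∀ c, μ {z | τ z = c} = 0)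
    {f : Conf τ × Conf τ → E} (hf : Integrable f ((vol μ τ).prod (vol μ τ))) :
    Integrable (fun x => ∫ p in before₂ τ (τ x), f (ins x p.1, p.2)
      ∂(vol μ τ).prod (vol μ τ)) μ ∧
    Integrable (fun x => ∫ p in before₂ τ (τ x), f (p.1, ins x p.2)
      ∂(vol μ τ).prod (vol μ τ)) μ ∧
    ∫ p, f p ∂(vol μ τ).prod (vol μ τ) = f (nil τ, nil τ) +
      (∫ x, ∫ p in before₂ τ (τ x), f (ins x p.1, p.2) ∂(vol μ τ).prod (vol μ τ) ∂μ +
      ∫ x, ∫ p in before₂ τ (τ x), f (p.1, ins x p.2) ∂(vol μ τ).prod (vol μ τ) ∂μ) := by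
  have h0 := vol_prod_vol_eq_add (μ := μ) hτ hnt
  have hf' := hf
  rw [h0] at hf'
  have hfl := (integrable_add_measure.1 (integrable_add_measure.1 hf').2).1
  have hfr := (integrable_add_measure.1 (integrable_add_measure.1 hf').2).2
  have hl := hfl.comp_measurable (measurable_snocLeft hτ)
  have hr := hfr.comp_measurable (measurable_snocRight hτ)
  have el : (fun q => f (snocLeft q)) =ᵐ[laterVol μ τ] fun q => f (ins q.1 q.2.1, q.2.2) := by
    filter_upwards [ae_laterVol_snoc hτ] with q hq
    simp [hq.1]
  have er : (fun q => f (snocRight q)) =ᵐ[laterVol μ τ] fun q => f (q.2.1, ins q.1 q.2.2) := by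
    filter_upwards [ae_laterVol_snoc hτ] with q hq
    simp [hq.2]
  obtain ⟨il, jl⟩ := integral_laterVol hτ (hl.congr el)
  obtain ⟨ir, jr⟩ := integral_laterVol hτ (hr.congr er)
  refine ⟨il, ir, ?_⟩
  rw [← jl, ← jr, h0, integral_add_measure (integrable_add_measure.1 hf').1
    (integrable_add_measure.1 hf').2, integral_add_measure hfl hfr,
    integral_map (measurable_snocLeft hτ).aemeasurable hfl.1,
    integral_map (measurable_snocRight hτ).aemeasurable hfr.1]
  have e0 : ∀ᵐ p ∂Measure.dirac (nil τ, nil τ), f p = f (nil τ, nil τ) := by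
    have : ∀ᵐ p ∂Measure.dirac (nil τ, nil τ), p ∈ ({(nil τ, nil τ)} : Set _) :=
      (ae_dirac_iff measurableSet_nilnil).2 rfl
    filter_upwards [this] with p hp
    rw [Set.mem_singleton_iff.1 hp]
  rw [integral_congr_ae e0, integral_congr_ae el, integral_congr_ae er]
  simp

end Bochner

end Conf

namespace EssOrderedSpace

variable {X : Type*} [MeasurableSpace X] (S : EssOrderedSpace X)

instance : SigmaFinite S.vol := S.sigmaFinite_vol

instance : SigmaFinite S.markedVol := by unfold markedVol; infer_instance

/-- The time of a marked point. -/
abbrev mtime (y : X × ℕ) : ℝ≥0 := S.time y.1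

theorem measurable_mtime : Measurable S.mtime := S.measurable_time.comp measurable_fst

theorem vol_time_eq (c : ℝ≥0) : S.vol {x | S.time x = c} = 0 := by
  have h1 : S.vol.map (fun x => (S.time x : ℝ)) {(c : ℝ)} = 0 := S.time_ac (by simp)
  have hm : Measurable fun x => (S.time x : ℝ) :=
    measurable_coe_nnreal_real.comp S.measurable_time
  rw [Measure.map_apply hm (measurableSet_singleton _)] at h1
  convert h1 using 2
  ext x
  simp

theorem measurableSet_idx : MeasurableSet {y : X × ℕ | y.2 ∈ S.idx y.1} := by
  have : {y : X × ℕ | y.2 ∈ S.idx y.1} = ⋃ j : ℕ, {x | j ∈ S.idx x} ×ˢ {j} := by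
    ext ⟨x, j⟩
    simp
  rw [this]
  exact MeasurableSet.iUnion fun j => (S.measurable_idx j).prod (measurableSet_singleton j)

theorem markedVol_fst {P : X → Prop} (h : ∀ᵐ x ∂S.vol, P x) : ∀ᵐ y ∂S.markedVol, P y.1 :=
  ae_restrict_of_ae (NonsingularMap.fst.ae h)

theorem nonsingular_fst : NonsingularMap Prod.fst S.markedVol S.vol :=
  (NonsingularMap.fst (ρ := Measure.count)).restrict _

theorem markedVol_time_eq (c : ℝ≥0) : S.markedVol {y | S.mtime y = c} = 0 := by
  have h : ∀ᵐ x ∂S.vol, S.time x ≠ c := by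
    rw [ae_iff]; simpa using S.vol_time_eq c
  have h2 := S.markedVol_fst h
  rw [ae_iff] at h2
  simpa using h2

instance : SigmaFinite S.dChain := by unfold dChain; infer_instance

instance : SigmaFinite S.dMChain := Conf.sigmaFinite_vol (τ := S.mtime) S.markedVol

theorem dMChain_eq : S.dMChain = Conf.vol S.markedVol S.mtime := rfl

open Conf

/-- The marked tuple over a tuple. -/
def markTup {n : ℕ} (j : Fin n → ℕ) (z : Tup S.time n) : Tup S.mtime n :=
  ⟨fun i => (z.1 i, j i), z.2⟩

/-- The marked chain over a tuple. -/
def markMap {n : ℕ} (j : Fin n → ℕ) (z : Tup S.time n) : S.MChain :=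
  ofTuple S.mtime n (S.markTup j z)

theorem measurable_markMap {n : ℕ} (j : Fin n → ℕ) : Measurable (S.markMap j) := by
  refine (measurable_ofTuple _ n).comp (Measurable.subtype_mk ?_)
  exact measurable_pi_iff.2 fun i =>
    ((measurable_pi_apply i).comp measurable_subtype_coe).prodMk measurable_const

/-- The tuples admitting the marks `j`. -/
def markDomain {n : ℕ} (j : Fin n → ℕ) : Set (Fin n → X) := {z | ∀ i, j i ∈ S.idx (z i)}

theorem measurableSet_markDomain {n : ℕ} (j : Fin n → ℕ) : MeasurableSet (S.markDomain j) := by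
  have : S.markDomain j = ⋂ i, {z | j i ∈ S.idx (z i)} := by
    ext z; simp [markDomain]
  rw [this]
  exact MeasurableSet.iInter fun i => (S.measurable_idx (j i)).preimage (measurable_pi_apply i)

theorem pi_count (n : ℕ) : (Measure.pi fun _ : Fin n => (Measure.count : Measure ℕ)) =
    Measure.count := by
  refine Measure.ext_of_singleton fun j => ?_
  rw [Measure.pi_singleton]
  simp

theorem lintegral_pi_markedVol {n : ℕ} {g : (Fin n → X × ℕ) → ℝ≥0∞} (hg : Measurable g) :
    ∫⁻ w, g w ∂(Measure.pi fun _ : Fin n => S.markedVol) =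
      ∑' j : Fin n → ℕ, ∫⁻ z in S.markDomain j, g (fun i => (z i, j i))
        ∂(Measure.pi fun _ : Fin n => S.vol) := by
  have hm : ∀ j : Fin n → ℕ, Measurable fun z : Fin n → X => g fun i => (z i, j i) := fun j =>
    hg.comp (measurable_pi_iff.2 fun i => (measurable_pi_apply i).prodMk measurable_const)
  have hA : MeasurableSet (Set.univ.pi fun _ : Fin n => {y : X × ℕ | y.2 ∈ S.idx y.1}) :=
    MeasurableSet.univ_pi fun _ => S.measurableSet_idx
  have h1 : (Measure.pi fun _ : Fin n => S.markedVol) =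
      (Measure.pi fun _ : Fin n => S.vol.prod (Measure.count : Measure ℕ)).restrict
        (Set.univ.pi fun _ => {y | y.2 ∈ S.idx y.1}) :=
    (Measure.restrict_pi_pi (fun _ : Fin n => S.vol.prod (Measure.count : Measure ℕ))
      fun _ => {y : X × ℕ | y.2 ∈ S.idx y.1}).symm
  have h2 := (measurePreserving_arrowProdEquivProdArrow X ℕ (Fin n) (fun _ => S.vol)
    fun _ => Measure.count).symm
  have hgA := hg.indicator hA
  rw [h1, ← lintegral_indicator hA, ← h2.lintegral_comp hgA, pi_count, lintegral_prod_symm,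
    lintegral_count]
  · refine tsum_congr fun j => ?_
    rw [← lintegral_indicator (S.measurableSet_markDomain j)]
    refine lintegral_congr fun z => ?_
    have he : (MeasurableEquiv.arrowProdEquivProdArrow X ℕ (Fin n)).symm (z, j) =
      fun i => (z i, j i) := rfl
    rw [he]
    by_cases hz : z ∈ S.markDomain j
    · rw [Set.indicator_of_mem hz, Set.indicator_of_mem]
      exact fun i _ => hz i
    · rw [Set.indicator_of_notMem hz, Set.indicator_of_notMem]
      exact fun h => hz fun i => h i trivial
  · exact (hgA.comp (MeasurableEquiv.measurable _)).aemeasurable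

/-- The tuples together with admissible marks. -/
def markSet (n : ℕ) : Set (Tup S.time n × (Fin n → ℕ)) := {p | p.1.1 ∈ S.markDomain p.2}

theorem measurableSet_markSet (n : ℕ) : MeasurableSet (S.markSet n) := by
  have : S.markSet n = ⋃ j : Fin n → ℕ, (Subtype.val ⁻¹' S.markDomain j) ×ˢ {j} := by
    ext ⟨z, j⟩
    simp [markSet]
  rw [this]
  exact MeasurableSet.iUnion fun j =>
    ((S.measurableSet_markDomain j).preimage measurable_subtype_coe).prod
      (measurableSet_singleton j)

theorem measurable_markMap_uncurry (n : ℕ) :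
    Measurable fun p : Tup S.time n × (Fin n → ℕ) => S.markMap p.2 p.1 :=
  measurable_from_prod_countable_left fun j => S.measurable_markMap j

/-- The measure on marked chains as the sum over all marks of image measures. -/
theorem dMChain_eq_sum : S.dMChain = Measure.sum fun n =>
    (((tupVol S.vol S.time n).prod Measure.count).restrict (S.markSet n)).map
      fun p => S.markMap p.2 p.1 := by
  refine Measure.ext fun s hs => ?_
  have hm : Measurable (s.indicator (1 : S.MChain → ℝ≥0∞)) := measurable_one.indicator hs
  rw [Measure.sum_apply _ hs, ← lintegral_indicator_one hs, dMChain_eq, lintegral_vol_eq]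
  refine tsum_congr fun n => ?_
  rw [lintegral_tupVol S.measurable_mtime (s.indicator (1 : S.MChain → ℝ≥0∞)),
    S.lintegral_pi_markedVol (measurable_indicator_image S.measurable_mtime hm n),
    ← lintegral_indicator_one hs, lintegral_map hm (S.measurable_markMap_uncurry n),
    ← lintegral_indicator (S.measurableSet_markSet n), lintegral_prod_symm, lintegral_count]
  · refine tsum_congr fun j => ?_
    rw [← lintegral_indicator (S.measurableSet_markDomain j)]
    have hv := (measurableEmbedding_val S.measurable_time n).lintegral_map
      (μ := tupVol S.vol S.time n) fun z => (S.markDomain j).indicator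
        (fun z => s.indicator (1 : S.MChain → ℝ≥0∞) (image S.mtime fun i => (z i, j i))) z
    rw [map_val_tupVol S.measurable_time,
      ← lintegral_indicator (measurableSet_strictMono S.measurable_time n)] at hv
    refine Eq.trans ?_ (hv.trans ?_)
    · refine lintegral_congr fun z => ?_
      have h3 : {w : Fin n → X × ℕ | StrictMono fun i => S.mtime (w i)}.indicator
          (fun w => s.indicator (1 : S.MChain → ℝ≥0∞) (image S.mtime w)) (fun i => (z i, j i)) =
        {z : Fin n → X | StrictMono fun i => S.time (z i)}.indicator
          (fun z => s.indicator (1 : S.MChain → ℝ≥0∞) (image S.mtime fun i => (z i, j i))) z := rfl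
      by_cases h1 : z ∈ S.markDomain j
      · rw [Set.indicator_of_mem h1, h3]
        by_cases h2 : z ∈ {z : Fin n → X | StrictMono fun i => S.time (z i)}
        · rw [Set.indicator_of_mem h2, Set.indicator_of_mem h2, Set.indicator_of_mem h1]
        · rw [Set.indicator_of_notMem h2, Set.indicator_of_notMem h2]
      · rw [Set.indicator_of_notMem h1]
        symm
        by_cases h2 : z ∈ {z : Fin n → X | StrictMono fun i => S.time (z i)}
        · rw [Set.indicator_of_mem h2, Set.indicator_of_notMem h1]
        · rw [Set.indicator_of_notMem h2]
    · rfl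
  · exact ((hm.comp (S.measurable_markMap_uncurry n)).indicator
      (S.measurableSet_markSet n)).aemeasurable

theorem mem_positions {a : Finset (X × ℕ)} {x : X} : x ∈ positions a ↔ ∃ j, (x, j) ∈ a := by
  simp [positions]

theorem mem_markMap {n : ℕ} {j : Fin n → ℕ} {z : Tup S.time n} {y : X × ℕ} :
    y ∈ (S.markMap j z).fin ↔ ∃ i, z.1 i = y.1 ∧ j i = y.2 := by
  unfold markMap
  rw [mem_ofTuple]
  simp [markTup, Prod.ext_iff]

theorem positions_markMap {n : ℕ} (j : Fin n → ℕ) (z : Tup S.time n) :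
    positions (S.markMap j z).fin = (ofTuple S.time n z).fin := by
  ext x
  simp only [mem_positions, mem_markMap, mem_ofTuple]
  exact ⟨fun ⟨_, i, h, _⟩ => ⟨i, h⟩, fun ⟨i, h⟩ => ⟨_, i, h, rfl⟩⟩

/-- The markings of a chain correspond to its admissible marks. -/
def markingEquiv {n : ℕ} (z : Tup S.time n) :
    {j : Fin n → ℕ // z.1 ∈ S.markDomain j} ≃
      {a : Marking X // S.IsMarking (ofTuple S.time n z).fin a} := by
  refine Equiv.ofBijective (fun j => ⟨(S.markMap j.1 z).fin, S.positions_markMap j.1 z, ?_, ?_⟩) ?_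
  · rintro y hy y' hy' h
    obtain ⟨i, h1, h2⟩ := S.mem_markMap.1 hy
    obtain ⟨i', h1', h2'⟩ := S.mem_markMap.1 hy'
    have : i = i' := tup_injective z (h1.trans (h.trans h1'.symm))
    subst this
    exact Prod.ext h (h2.symm.trans h2')
  · intro y hy
    obtain ⟨i, h1, h2⟩ := S.mem_markMap.1 hy
    rw [← h1, ← h2]
    exact j.2 i
  · constructor
    · intro j j' h
      refine Subtype.ext (funext fun i => ?_)
      have h0 : (S.markMap j.1 z).fin = (S.markMap j'.1 z).fin := congrArg Subtype.val h
      have h1 : (z.1 i, j.1 i) ∈ (S.markMap j'.1 z).fin := by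
        rw [← h0]; exact S.mem_markMap.2 ⟨i, rfl, rfl⟩
      obtain ⟨i', h2, h3⟩ := S.mem_markMap.1 h1
      have h4 : j'.1 i' = j.1 i := h3
      have h5 : i' = i := tup_injective z h2
      rw [← h4, h5]
    · rintro ⟨a, ha1, ha2, ha3⟩
      have h1 : ∀ i, ∃ j, (z.1 i, j) ∈ (show Finset (X × ℕ) from a) := fun i => by
        have : z.1 i ∈ positions a := by rw [ha1]; exact (mem_ofTuple z _).2 ⟨i, rfl⟩
        exact mem_positions.1 this
      choose j hj using h1
      refine ⟨⟨j, fun i => ha3 _ (hj i)⟩, Subtype.ext ?_⟩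
      refine Finset.ext fun y => ?_
      change y ∈ (S.markMap j z).fin ↔ _
      rw [S.mem_markMap]
      constructor
      · rintro ⟨i, h2, h3⟩
        have : y = (z.1 i, j i) := Prod.ext h2.symm h3.symm
        rw [this]; exact hj i
      · intro hy
        have h2 : y.1 ∈ positions a := mem_positions.2 ⟨y.2, hy⟩
        rw [ha1] at h2
        obtain ⟨i, hi⟩ := (mem_ofTuple z _).1 h2
        have h3 := ha2 (hj i) hy hi
        exact ⟨i, hi, congrArg Prod.snd h3⟩

instance countable_marking (υ : Finset X) : Countable {a : Marking X // S.IsMarking υ a} := by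
  classical
  have hc : Countable {y : X × ℕ // y.1 ∈ υ} := by
    have : ({y : X × ℕ | y.1 ∈ υ}) = (υ : Set X) ×ˢ Set.univ := by ext y; simp
    have h2 : ({y : X × ℕ | y.1 ∈ υ}).Countable := by
      rw [this]; exact υ.countable_toSet.prod Set.countable_univ
    exact h2.to_subtype
  refine Function.Injective.countable (β := Finset {y : X × ℕ // y.1 ∈ υ})
    (f := fun a => Finset.subtype _ (show Finset (X × ℕ) from a.1)) ?_
  rintro ⟨a, ha⟩ ⟨b, hb⟩ hab
  refine Subtype.ext ?_
  have h1 : ∀ (c : Finset (X × ℕ)), S.IsMarking υ c → ∀ y ∈ c, y.1 ∈ υ := fun c hc y hy => by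
    rw [← hc.1]; exact mem_positions.2 ⟨y.2, hy⟩
  have h2 := congrArg (Finset.map (Function.Embedding.subtype _)) hab
  simp only at h2
  rw [Finset.subtype_map_of_mem (h1 a ha), Finset.subtype_map_of_mem (h1 b hb)] at h2
  exact h2

theorem measurable_marking {β : Type*} [MeasurableSpace β] (f : Marking X → β) : Measurable f :=
  fun _ _ => trivial

theorem markCount_eq_sum (υ : Finset X) : S.markCount υ =
    Measure.sum fun a : {a : Marking X // S.IsMarking υ a} => Measure.dirac a.1 := by
  refine Measure.ext fun s hs => ?_
  have hA : MeasurableSet {a : Marking X | S.IsMarking υ a} := trivial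
  rw [Measure.sum_apply _ hs, ← lintegral_indicator_one hs, markCount, ← lintegral_indicator hA,
    lintegral_count' (measurable_marking _)]
  have h1 := tsum_subtype {a : Marking X | S.IsMarking υ a}
    (s.indicator (1 : Marking X → ℝ≥0∞))
  refine h1.symm.trans (tsum_congr fun a => ?_)
  rw [Measure.dirac_apply' _ hs]

theorem ae_markCount_iff {υ : Finset X} {P : Marking X → Prop} :
    (∀ᵐ a ∂S.markCount υ, P a) ↔ ∀ a, S.IsMarking υ a → P a := by
  have hP : MeasurableSet {a | P a} := trivial
  rw [markCount_eq_sum, Measure.ae_sum_iff]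
  constructor
  · intro h a ha
    exact (ae_dirac_iff hP).1 (h ⟨a, ha⟩)
  · intro h a
    exact (ae_dirac_iff hP).2 (h a.1 a.2)

instance (υ : Finset X) : SigmaFinite (S.markCount υ) := by
  let A : Set (Set (Marking X)) :=
    insert {a : Marking X | ¬ S.IsMarking υ a} ((fun a => {a}) '' {a : Marking X | S.IsMarking υ a})
  have hA : A.Countable := by
    have h1 : {a : Marking X | S.IsMarking υ a}.Countable :=
      Set.countable_coe_iff.1 (S.countable_marking υ)
    exact (h1.image _).insert _
  refine Measure.sigmaFinite_of_countable hA ?_ ?_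
  · rintro s (rfl | ⟨a, -, rfl⟩)
    · have : S.markCount υ {a : Marking X | ¬ S.IsMarking υ a} = 0 := by
        have := S.ae_markCount_iff (υ := υ) (P := fun a => S.IsMarking υ a)
        exact ae_iff.1 (this.2 fun a ha => ha)
      exact this.trans_lt ENNReal.zero_lt_top
    · refine lt_of_le_of_lt (Measure.restrict_apply_le _ _) ?_
      have : MeasurableSet ({a} : Set (Marking X)) := trivial
      rw [Measure.count_apply this]
      simp
  · refine Set.eq_univ_of_forall fun a => ?_
    by_cases ha : S.IsMarking υ a
    · exact ⟨{a}, Or.inr ⟨a, ha, rfl⟩, rfl⟩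
    · exact ⟨_, Or.inl rfl, ha⟩

theorem markMap_injective {n : ℕ} (z : Tup S.time n) :
    Function.Injective fun j : Fin n → ℕ => S.markMap j z := by
  intro j j' h
  funext i
  have h0 : (S.markMap j z).fin = (S.markMap j' z).fin := congrArg fin h
  have h1 : (z.1 i, j i) ∈ (S.markMap j' z).fin := by
    rw [← h0]; exact S.mem_markMap.2 ⟨i, rfl, rfl⟩
  obtain ⟨i', h2, h3⟩ := S.mem_markMap.1 h1
  have h4 : j' i' = j i := h3
  have h5 : i' = i := tup_injective z h2
  rw [← h4, h5]

theorem isMarking_markMap {n : ℕ} {j : Fin n → ℕ} {z : Tup S.time n}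
    (h : z.1 ∈ S.markDomain j) : S.IsMarking (ofTuple S.time n z).fin (S.markMap j z).fin :=
  (S.markingEquiv z ⟨j, h⟩).2

theorem exists_markMap {n : ℕ} {z : Tup S.time n} {a : Marking X}
    (h : S.IsMarking (ofTuple S.time n z).fin a) :
    ∃ j, z.1 ∈ S.markDomain j ∧ (S.markMap j z : Finset (X × ℕ)) = a := by
  obtain ⟨⟨j, hj⟩, h2⟩ := (S.markingEquiv z).surjective ⟨a, h⟩
  exact ⟨j, hj, congrArg Subtype.val h2⟩

/-- The marking of a tuple with given marks. -/
def markMark {n : ℕ} (z : Tup S.time n) (j : Fin n → ℕ) : Marking X := (S.markMap j z).fin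

/-- The marked chain with a given set of points. -/
def toM (a : Marking X) : S.MChain := a

theorem markCount_ofTuple {n : ℕ} (z : Tup S.time n) :
    S.markCount (ofTuple S.time n z).fin =
      (Measure.count.restrict {j | z.1 ∈ S.markDomain j}).map
        (S.markMark z) := by
  refine Measure.ext fun s hs => ?_
  have hf : Measurable (S.markMark z) := measurable_of_countable _
  have hA : MeasurableSet {j : Fin n → ℕ | z.1 ∈ S.markDomain j} := .of_discrete
  rw [markCount_eq_sum, Measure.sum_apply _ hs, Measure.map_apply hf hs,
    ← lintegral_indicator_one (hf hs), ← lintegral_indicator hA, lintegral_count,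
    ← (S.markingEquiv z).tsum_eq]
  refine Eq.trans ?_ (tsum_subtype {j : Fin n → ℕ | z.1 ∈ S.markDomain j} _)
  refine tsum_congr fun j => ?_
  rw [Measure.dirac_apply' _ hs]
  rfl

section Param

variable {Y : Type*} [MeasurableSpace Y] {ν : Measure Y} [SFinite ν]

/-- The map from marked tuples to marked chains, with a parameter. -/
def markMap' (Y : Type*) (n : ℕ) (p : (Y × Tup S.time n) × (Fin n → ℕ)) : Y × S.MChain :=
  (p.1.1, S.markMap p.2 p.1.2)

/-- The admissible marked tuples, with a parameter. -/
def markSet' (Y : Type*) (n : ℕ) : Set ((Y × Tup S.time n) × (Fin n → ℕ)) :=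
  {p | p.1.2.1 ∈ S.markDomain p.2}

theorem measurableSet_markSet' (n : ℕ) : MeasurableSet (S.markSet' Y n) :=
  (S.measurableSet_markSet n).preimage
    ((measurable_snd.comp measurable_fst).prodMk measurable_snd)

theorem measurable_markMap' (n : ℕ) : Measurable (S.markMap' Y n) :=
  (measurable_fst.comp measurable_fst).prodMk ((S.measurable_markMap_uncurry n).comp
    ((measurable_snd.comp measurable_fst).prodMk measurable_snd))

theorem prod_dMChain_eq_sum : ν.prod S.dMChain = Measure.sum fun n =>
    (((ν.prod (tupVol S.vol S.time n)).prod Measure.count).restrict (S.markSet' Y n)).map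
      (S.markMap' Y n) := by
  rw [dMChain_eq_sum, Measure.prod_sum_right]
  congr 1
  funext n
  have h0 := Measure.map_prod_map ν
    (((tupVol S.vol S.time n).prod (Measure.count : Measure (Fin n → ℕ))).restrict (S.markSet n))
    measurable_id (S.measurable_markMap_uncurry n)
  rw [Measure.map_id] at h0
  have h1 : ν.prod (((tupVol S.vol S.time n).prod
      (Measure.count : Measure (Fin n → ℕ))).restrict (S.markSet n)) =
      (ν.prod ((tupVol S.vol S.time n).prod Measure.count)).restrict
        (Set.univ ×ˢ S.markSet n) := by
    rw [← Measure.prod_restrict, Measure.restrict_univ]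
  have hms : MeasurableSet ((Set.univ : Set Y) ×ˢ S.markSet n) :=
    MeasurableSet.univ.prod (S.measurableSet_markSet n)
  rw [h0, h1, ← (measurePreserving_prodAssoc ν (tupVol S.vol S.time n)
    (Measure.count : Measure (Fin n → ℕ))).map_eq,
    Measure.restrict_map (MeasurableEquiv.measurable _) hms, Measure.map_map
    (measurable_id.prodMap (S.measurable_markMap_uncurry n)) (MeasurableEquiv.measurable _)]
  congr 2
  ext p
  simp only [markSet', markSet, Set.mem_preimage, Set.mem_prod, Set.mem_univ, true_and]
  rfl

theorem ae_marks {P : Y × S.MChain → Prop} (h : ∀ᵐ q ∂ν.prod S.dMChain, P q) :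
    ∀ᵐ p ∂ν.prod S.dChain, ∀ a, S.IsMarking p.2.fin a → P (p.1, S.toM a) := by
  rw [dChain, ae_prod_vol_iff]
  intro n
  rw [prod_dMChain_eq_sum, Measure.ae_sum_iff] at h
  have h1 := ae_of_ae_map (S.measurable_markMap' n).aemeasurable (h n)
  rw [ae_restrict_iff' (S.measurableSet_markSet' n)] at h1
  filter_upwards [Measure.ae_ae_of_ae_prod h1] with p hp a ha
  obtain ⟨j, hj, rfl⟩ := S.exists_markMap ha
  have h2 := Measure.ae_count_iff.1 hp j
  exact h2 hj

theorem lintegral_markCount_ofTuple {n : ℕ} (z : Tup S.time n) (f : S.MChain → ℝ≥0∞) :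
    ∫⁻ a, f (S.toM a) ∂S.markCount (ofTuple S.time n z).fin =
      ∫⁻ j in {j | z.1 ∈ S.markDomain j}, f (S.markMap j z) ∂Measure.count := by
  have hf : Measurable (S.markMark z) := measurable_of_countable _
  rw [markCount_ofTuple, lintegral_map (measurable_marking _) hf]
  rfl

theorem aemeasurable_marks {f : Y × S.MChain → ℝ≥0∞} (hf : AEMeasurable f (ν.prod S.dMChain)) :
    AEMeasurable (fun p : Y × S.Chain => ∫⁻ a, f (p.1, S.toM a) ∂S.markCount p.2.fin)
      (ν.prod S.dChain) ∧
    ∫⁻ p, ∫⁻ a, f (p.1, S.toM a) ∂S.markCount p.2.fin ∂ν.prod S.dChain =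
      ∫⁻ q, f q ∂ν.prod S.dMChain := by
  have hf' := hf
  rw [prod_dMChain_eq_sum, aemeasurable_sum_measure_iff] at hf'
  have h1 : ∀ n, AEMeasurable ((S.markSet' Y n).indicator fun p => f (S.markMap' Y n p))
      ((ν.prod (tupVol S.vol S.time n)).prod Measure.count) := fun n =>
    (aemeasurable_indicator_iff (S.measurableSet_markSet' n)).2
      ((hf' n).comp_measurable (S.measurable_markMap' n))
  have h2 : ∀ n (p : Y × Tup S.time n),
      ∫⁻ a, f (p.1, S.toM a) ∂S.markCount (ofTuple S.time n p.2).fin =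
        ∫⁻ j, (S.markSet' Y n).indicator (fun p => f (S.markMap' Y n p)) (p, j)
          ∂Measure.count := by
    intro n p
    rw [S.lintegral_markCount_ofTuple p.2 fun ω => f (p.1, ω),
      ← lintegral_indicator (.of_discrete)]
    rfl
  constructor
  · rw [dChain, aemeasurable_prod_vol_iff]
    intro n
    simp only [h2]
    exact (h1 n).lintegral_prod_right'
  · rw [dChain, prod_vol_eq, lintegral_sum_measure, prod_dMChain_eq_sum, lintegral_sum_measure]
    refine tsum_congr fun n => ?_
    rw [(measurableEmbedding_prodMap n).lintegral_map,
      lintegral_map' (hf' n) (S.measurable_markMap' n).aemeasurable,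
      ← lintegral_indicator (S.measurableSet_markSet' n), lintegral_prod _ (h1 n)]
    exact lintegral_congr fun p => h2 n p

theorem integral_marks {E : Type*} [NormedAddCommGroup E] [NormedSpace ℝ E]
    {f : Y × S.MChain → E} (hf : Integrable f (ν.prod S.dMChain)) :
    Integrable (fun p : Y × S.Chain => ∫ a, f (p.1, S.toM a) ∂S.markCount p.2.fin)
      (ν.prod S.dChain) ∧
    ∫ p, ∫ a, f (p.1, S.toM a) ∂S.markCount p.2.fin ∂ν.prod S.dChain =
      ∫ q, f q ∂ν.prod S.dMChain := by
  have hf' := hf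
  rw [prod_dMChain_eq_sum] at hf'
  have hi : ∀ n, Integrable f ((((ν.prod (tupVol S.vol S.time n)).prod
      Measure.count).restrict (S.markSet' Y n)).map (S.markMap' Y n)) := fun n =>
    hf'.mono_measure (Measure.le_sum _ n)
  have h1 : ∀ n, Integrable ((S.markSet' Y n).indicator fun p => f (S.markMap' Y n p))
      ((ν.prod (tupVol S.vol S.time n)).prod Measure.count) := fun n =>
    (integrable_indicator_iff (S.measurableSet_markSet' n)).2
      ((hi n).comp_measurable (S.measurable_markMap' n))
  have h2 : ∀ n (p : Y × Tup S.time n),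
      ∫ a, f (p.1, S.toM a) ∂S.markCount (ofTuple S.time n p.2).fin =
        ∫ j, (S.markSet' Y n).indicator (fun p => f (S.markMap' Y n p)) (p, j)
          ∂Measure.count := by
    intro n p
    have hem : MeasurableEmbedding (S.markMark p.2) :=
      ⟨S.markMap_injective p.2, measurable_of_countable _, fun _ _ => trivial⟩
    rw [markCount_ofTuple, hem.integral_map, ← integral_indicator (.of_discrete)]
    rfl
  have hae : AEStronglyMeasurable
      (fun p : Y × S.Chain => ∫ a, f (p.1, S.toM a) ∂S.markCount p.2.fin)
      (ν.prod S.dChain) := by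
    rw [dChain, aestronglyMeasurable_prod_vol_iff]
    intro n
    simp only [h2]
    exact (h1 n).aestronglyMeasurable.integral_prod_right'
  have hint : Integrable (fun p : Y × S.Chain => ∫ a, f (p.1, S.toM a) ∂S.markCount p.2.fin)
      (ν.prod S.dChain) := by
    refine ⟨hae, ?_⟩
    refine lt_of_le_of_lt (lintegral_mono fun p => enorm_integral_le_lintegral_enorm _) ?_
    rw [(S.aemeasurable_marks (f := fun q => ‖f q‖ₑ) hf.aestronglyMeasurable.enorm).2]
    exact hf.2
  refine ⟨hint, ?_⟩
  rw [dChain, prod_vol_eq] at hint ⊢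
  rw [integral_sum_measure hint, prod_dMChain_eq_sum, integral_sum_measure hf']
  refine tsum_congr fun n => ?_
  rw [(measurableEmbedding_prodMap n).integral_map,
    integral_map (S.measurable_markMap' n).aemeasurable (hi n).aestronglyMeasurable,
    ← integral_indicator (S.measurableSet_markSet' n), integral_prod _ (h1 n)]
  exact integral_congr_ae (.of_forall fun p => h2 n p)

end Param

/-- The chain of positions of a marked chain. -/
def pos (ω : S.MChain) : S.Chain := positions ω.fin

theorem pos_ofTuple {n : ℕ} (w : Tup S.mtime n) :
    S.pos (ofTuple S.mtime n w) = ofTuple S.time n ⟨fun i => (w.1 i).1, w.2⟩ := by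
  refine conf_ext fun x => ?_
  change x ∈ positions _ ↔ _
  rw [mem_positions, mem_ofTuple]
  simp only [mem_ofTuple]
  constructor
  · rintro ⟨j, i, hi⟩; exact ⟨i, congrArg Prod.fst hi⟩
  · rintro ⟨i, hi⟩; exact ⟨(w.1 i).2, i, Prod.ext hi rfl⟩

theorem measurable_pos : Measurable S.pos := by
  refine measurable_of_comp fun n => ?_
  simp only [pos_ofTuple]
  refine (measurable_ofTuple _ n).comp (Measurable.subtype_mk ?_)
  exact measurable_pi_iff.2 fun i =>
    measurable_fst.comp ((measurable_pi_apply i).comp measurable_subtype_coe)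

theorem nonsingular_pos : NonsingularMap S.pos S.dMChain S.dChain := by
  refine .of_ae S.measurable_pos.aemeasurable fun s hs h0 => ?_
  have h1 : ∀ᵐ υ ∂S.dChain, υ ∉ s := by rw [ae_iff]; simpa using h0
  rw [dChain, ae_vol_iff] at h1
  rw [dMChain_eq_sum, Measure.ae_sum_iff]
  intro n
  have hms : MeasurableSet {ω : S.MChain | S.pos ω ∉ s} := (S.measurable_pos hs).compl
  rw [ae_map_iff (S.measurable_markMap_uncurry n).aemeasurable hms]
  refine ae_restrict_of_ae ?_
  filter_upwards [Measure.quasiMeasurePreserving_fst.ae (h1 n)] with p hp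
  have : S.pos (S.markMap p.2 p.1) = ofTuple S.time n p.1 :=
    S.positions_markMap p.2 p.1
  rwa [this]

theorem ae_isMarking : ∀ᵐ ω ∂S.dMChain, S.IsMarking (S.pos ω).fin ω.fin := by
  rw [dMChain_eq_sum, Measure.ae_sum_iff]
  intro n
  let Q : Set S.MChain := {ω | ∀ y ∈ ω.fin, y.2 ∈ S.idx y.1}
  have hQ : MeasurableSet {ω : S.MChain | S.IsMarking (S.pos ω).fin ω.fin} := by
    refine MeasurableSpace.measurableSet_iInf.2 fun m => ?_
    change MeasurableSet (ofTuple S.mtime m ⁻¹' _)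
    have : ofTuple S.mtime m ⁻¹' {ω : S.MChain | S.IsMarking (S.pos ω).fin ω.fin} =
        ⋂ i, {w | (w.1 i).2 ∈ S.idx (w.1 i).1} := by
      ext w
      simp only [Set.mem_preimage, Set.mem_iInter]
      constructor
      · rintro ⟨-, -, h⟩ i
        exact h _ ((mem_ofTuple w _).2 ⟨i, rfl⟩)
      · intro h
        refine ⟨rfl, ?_, ?_⟩
        · intro y hy y' hy' hyy
          obtain ⟨i, rfl⟩ := (mem_ofTuple w _).1 hy
          obtain ⟨i', rfl⟩ := (mem_ofTuple w _).1 hy'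
          have h5 : i = i' := w.2.injective (congrArg S.time hyy)
          rw [h5]
        · intro y hy
          obtain ⟨i, rfl⟩ := (mem_ofTuple w _).1 hy
          exact h i
    rw [this]
    exact MeasurableSet.iInter fun i =>
      S.measurableSet_idx.preimage ((measurable_pi_apply i).comp measurable_subtype_coe)
  rw [ae_map_iff (S.measurable_markMap_uncurry n).aemeasurable hQ]
  refine (ae_restrict_mem (S.measurableSet_markSet n)).mono fun p hp => ?_
  have : S.pos (S.markMap p.2 p.1) = ofTuple S.time n p.1 :=
    S.positions_markMap p.2 p.1
  rw [this]
  exact S.isMarking_markMap hp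

end EssOrderedSpace

namespace EssOrderedSpace

open Conf

variable {X : Type*} [MeasurableSpace X] (S : EssOrderedSpace X)

section MarkProd

variable {Y : Type*} [MeasurableSpace Y] {ν : Measure Y} [SFinite ν] {υ : Finset X}

theorem measurableEmbedding_mk (a : Marking X) :
    MeasurableEmbedding (Prod.mk a : Y → Marking X × Y) where
  injective := Prod.mk_right_injective a
  measurable := measurable_prodMk_left
  measurableSet_image' := fun s hs => by
    have h1 : MeasurableSet ({a} : Set (Marking X)) := trivial
    have : Prod.mk a '' s = {a} ×ˢ s := by ext ⟨b, y⟩; simp [eq_comm, and_comm]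
    rw [this]
    exact h1.prod hs

theorem markCount_prod_eq_sum : (S.markCount υ).prod ν =
    Measure.sum fun a : {a : Marking X // S.IsMarking υ a} => ν.map (Prod.mk a.1) := by
  rw [markCount_eq_sum, Measure.prod_sum_left]
  congr 1
  funext a
  rw [Measure.dirac_prod]

theorem ae_markProd_iff {P : Marking X × Y → Prop} :
    (∀ᵐ z ∂(S.markCount υ).prod ν, P z) ↔ ∀ a, S.IsMarking υ a → ∀ᵐ y ∂ν, P (a, y) := by
  rw [markCount_prod_eq_sum, Measure.ae_sum_iff]
  simp only [(measurableEmbedding_mk _).ae_map_iff]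
  exact ⟨fun h a ha => h ⟨a, ha⟩, fun h a => h a.1 a.2⟩

theorem aemeasurable_markProd_iff {E : Type*} [MeasurableSpace E] {f : Marking X × Y → E} :
    AEMeasurable f ((S.markCount υ).prod ν) ↔
      ∀ a, S.IsMarking υ a → AEMeasurable (fun y => f (a, y)) ν := by
  rw [markCount_prod_eq_sum, aemeasurable_sum_measure_iff]
  simp only [(measurableEmbedding_mk _).aemeasurable_map_iff]
  exact ⟨fun h a ha => h ⟨a, ha⟩, fun h a => h a.1 a.2⟩

theorem aestronglyMeasurable_markProd_iff {E : Type*} [NormedAddCommGroup E]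
    {f : Marking X × Y → E} :
    AEStronglyMeasurable f ((S.markCount υ).prod ν) ↔
      ∀ a, S.IsMarking υ a → AEStronglyMeasurable (fun y => f (a, y)) ν := by
  rw [markCount_prod_eq_sum, aestronglyMeasurable_sum_measure_iff]
  simp only [(measurableEmbedding_mk _).aestronglyMeasurable_map_iff]
  exact ⟨fun h a ha => h ⟨a, ha⟩, fun h a => h a.1 a.2⟩

theorem lintegral_markCount (f : Marking X → ℝ≥0∞) :
    ∫⁻ a, f a ∂S.markCount υ = ∑' a : {a : Marking X // S.IsMarking υ a}, f a.1 := by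
  rw [markCount_eq_sum, lintegral_sum_measure]
  exact tsum_congr fun a => lintegral_dirac' _ (measurable_marking f)

theorem lintegral_markProd (f : Marking X × Y → ℝ≥0∞) :
    ∫⁻ z, f z ∂(S.markCount υ).prod ν = ∫⁻ a, ∫⁻ y, f (a, y) ∂ν ∂S.markCount υ := by
  rw [markCount_prod_eq_sum, lintegral_sum_measure, lintegral_markCount]
  exact tsum_congr fun a => (measurableEmbedding_mk _).lintegral_map _

end MarkProd

theorem mem_of_isMarking {υ : Finset X} {a : Finset (X × ℕ)} (h : S.IsMarking υ a) {y : X × ℕ}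
    (hy : y ∈ a) : y.1 ∈ υ := by
  rw [← h.1]; exact mem_positions.2 ⟨y.2, hy⟩

open Classical in
/-- The union of two markings. -/
def markUn (a b : Marking X) : Marking X :=
  ((show Finset (X × ℕ) from a) ∪ (show Finset (X × ℕ) from b) : Finset (X × ℕ))

/-- The points of a marking. -/
def mpts (a : Marking X) : Finset (X × ℕ) := a

theorem mem_markUn {a b : Marking X} {y : X × ℕ} :
    y ∈ mpts (markUn a b) ↔ y ∈ mpts a ∨ y ∈ mpts b := by
  classical
  exact Finset.mem_union

theorem marking_ext {a b : Marking X} (h : ∀ y, y ∈ mpts a ↔ y ∈ mpts b) : a = b := Finset.ext h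

theorem isMarking_markUn [DecidableEq X] {υ₁ υ₂ : Finset X} (hd : Disjoint υ₁ υ₂) {a b : Marking X}
    (ha : S.IsMarking υ₁ a) (hb : S.IsMarking υ₂ b) :
    S.IsMarking (υ₁ ∪ υ₂) (markUn a b) := by
  refine ⟨?_, ?_, ?_⟩
  · ext x
    refine mem_positions.trans ?_
    rw [Finset.mem_union, ← ha.1, ← hb.1]
    refine Iff.trans ?_ (or_congr mem_positions mem_positions).symm
    exact (exists_congr fun j => mem_markUn).trans exists_or
  · intro y hy y' hy' h
    rcases mem_markUn.1 hy with h1 | h1 <;> rcases mem_markUn.1 hy' with h2 | h2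
    · exact ha.2.1 h1 h2 h
    · exact absurd (h ▸ S.mem_of_isMarking ha h1 : y'.1 ∈ υ₁)
        (Finset.disjoint_right.1 hd (S.mem_of_isMarking hb h2))
    · exact absurd (h ▸ S.mem_of_isMarking hb h1 : y'.1 ∈ υ₂)
        (Finset.disjoint_left.1 hd (S.mem_of_isMarking ha h2))
    · exact hb.2.1 h1 h2 h
  · intro y hy
    rcases mem_markUn.1 hy with h1 | h1
    · exact ha.2.2 y h1
    · exact hb.2.2 y h1

theorem isMarking_filter {υ υ' : Finset X} {c : Finset (X × ℕ)} (hc : S.IsMarking υ c)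
    (h : υ' ⊆ υ) [DecidablePred fun y : X × ℕ => y.1 ∈ υ'] :
    S.IsMarking υ' (c.filter fun y => y.1 ∈ υ') := by
  refine ⟨?_, fun y hy y' hy' h => ?_, fun y hy => ?_⟩
  · ext x
    rw [mem_positions]
    simp only [Finset.mem_filter]
    refine ⟨fun ⟨j, _, h⟩ => h, fun hx => ?_⟩
    have h1 := h hx
    rw [← hc.1, mem_positions] at h1
    exact h1.imp fun j hj => ⟨hj, hx⟩
  · exact hc.2.1 (Finset.mem_filter.1 hy).1 (Finset.mem_filter.1 hy').1 h
  · exact hc.2.2 y (Finset.mem_filter.1 hy).1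

/-- The markings of a disjoint union are the pairs of markings. -/
theorem bijective_markUn [DecidableEq X] {υ₁ υ₂ : Finset X} (hd : Disjoint υ₁ υ₂) :
    Function.Bijective fun p : {a : Marking X // S.IsMarking υ₁ a} ×
      {a : Marking X // S.IsMarking υ₂ a} =>
      (⟨markUn p.1.1 p.2.1, S.isMarking_markUn hd p.1.2 p.2.2⟩ :
        {a : Marking X // S.IsMarking (υ₁ ∪ υ₂) a}) := by
  classical
  constructor
  · rintro ⟨⟨a, ha⟩, b, hb⟩ ⟨⟨a', ha'⟩, b', hb'⟩ h
    have h0 : ∀ y, y ∈ mpts a ∨ y ∈ mpts b ↔ y ∈ mpts a' ∨ y ∈ mpts b' := fun y => by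
      rw [← mem_markUn, ← mem_markUn]
      rw [show markUn a b = markUn a' b' from congrArg Subtype.val h]
    have k : ∀ {c : Marking X}, S.IsMarking υ₁ c → ∀ {d : Marking X}, S.IsMarking υ₂ d →
        ∀ y, y ∈ mpts c → y ∈ mpts d → False := fun hc d hd' y h1 h2 =>
      Finset.disjoint_left.1 hd (S.mem_of_isMarking hc h1) (S.mem_of_isMarking hd' h2)
    have e1 : a = a' := marking_ext fun y =>
      ⟨fun hy => ((h0 y).1 (Or.inl hy)).resolve_right fun h' => k ha hb' y hy h',
        fun hy => ((h0 y).2 (Or.inl hy)).resolve_right fun h' => k ha' hb y hy h'⟩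
    have e2 : b = b' := marking_ext fun y =>
      ⟨fun hy => ((h0 y).1 (Or.inr hy)).resolve_left fun h' => k ha' hb y h' hy,
        fun hy => ((h0 y).2 (Or.inr hy)).resolve_left fun h' => k ha hb' y h' hy⟩
    subst e1; subst e2; rfl
  · rintro ⟨c, hc⟩
    refine ⟨⟨⟨_, S.isMarking_filter hc Finset.subset_union_left⟩,
      ⟨_, S.isMarking_filter hc Finset.subset_union_right⟩⟩, Subtype.ext ?_⟩
    refine marking_ext fun y => ?_
    rw [mem_markUn]
    have e : ∀ (υ : Finset X), (y ∈ mpts (show Marking X from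
        Finset.filter (fun y : X × ℕ => y.1 ∈ υ) c)) ↔ y ∈ mpts c ∧ y.1 ∈ υ :=
      fun υ => Finset.mem_filter
    refine (or_congr (e υ₁) (e υ₂)).trans ?_
    rw [← and_or_left, ← Finset.mem_union]
    exact ⟨fun h => h.1, fun h => ⟨h, S.mem_of_isMarking hc h⟩⟩

theorem markCount_union [DecidableEq X] {υ₁ υ₂ : Finset X} (hd : Disjoint υ₁ υ₂) :
    S.markCount (υ₁ ∪ υ₂) = Measure.sum fun a : {a : Marking X // S.IsMarking υ₁ a} =>
      (S.markCount υ₂).map (markUn a.1) := by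
  refine Measure.ext fun s hs => ?_
  rw [Measure.sum_apply _ hs, ← lintegral_indicator_one hs, lintegral_markCount,
    ← (Equiv.ofBijective _ (S.bijective_markUn hd)).tsum_eq]
  refine (ENNReal.tsum_prod (f := fun (a : {a : Marking X // S.IsMarking υ₁ a})
    (b : {a : Marking X // S.IsMarking υ₂ a}) => s.indicator (1 : Marking X → ℝ≥0∞)
      (markUn a.1 b.1))).trans ?_
  refine tsum_congr fun a => ?_
  rw [← lintegral_indicator_one hs, lintegral_map (measurable_marking _) (measurable_marking _),
    lintegral_markCount]

theorem lintegral_markCount_union [DecidableEq X] {υ₁ υ₂ : Finset X} (hd : Disjoint υ₁ υ₂)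
    (f : Marking X → ℝ≥0∞) : ∫⁻ c, f c ∂S.markCount (υ₁ ∪ υ₂) =
      ∫⁻ a, ∫⁻ b, f (markUn a b) ∂S.markCount υ₂ ∂S.markCount υ₁ := by
  rw [S.markCount_union hd, lintegral_sum_measure, lintegral_markCount]
  exact tsum_congr fun a => lintegral_map (measurable_marking _) (measurable_marking _)

theorem aestronglyMeasurable_markCount {E : Type*} [NormedAddCommGroup E] {υ : Finset X}
    (f : Marking X → E) : AEStronglyMeasurable f (S.markCount υ) := by
  rw [markCount_eq_sum, aestronglyMeasurable_sum_measure_iff]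
  intro a
  have h3 : MeasurableSet {c | f c = f a.1} := trivial
  have h4 : f =ᵐ[Measure.dirac a.1] fun _ => f a.1 := (ae_dirac_iff h3).2 rfl
  exact aestronglyMeasurable_const.congr h4.symm

theorem integral_markCount {E : Type*} [NormedAddCommGroup E] [NormedSpace ℝ E] [CompleteSpace E]
    {υ : Finset X} {f : Marking X → E} (hf : Integrable f (S.markCount υ)) :
    ∫ a, f a ∂S.markCount υ = ∑' a : {a : Marking X // S.IsMarking υ a}, f a.1 := by
  rw [markCount_eq_sum] at hf ⊢
  rw [integral_sum_measure hf]
  refine tsum_congr fun a => ?_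
  have h1 : MeasurableSet {b | f b = f a.1} := trivial
  have h2 : f =ᵐ[Measure.dirac a.1] fun _ => f a.1 := (ae_dirac_iff h1).2 rfl
  rw [integral_congr_ae h2, integral_const]
  simp

theorem integral_markCount_union {E : Type*} [NormedAddCommGroup E] [NormedSpace ℝ E]
    [CompleteSpace E] [DecidableEq X] {υ₁ υ₂ : Finset X} (hd : Disjoint υ₁ υ₂)
    {f : Marking X → E} (hf : Integrable f (S.markCount (υ₁ ∪ υ₂))) :
    ∫ c, f c ∂S.markCount (υ₁ ∪ υ₂) =
      ∫ a, ∫ b, f (markUn a b) ∂S.markCount υ₂ ∂S.markCount υ₁ := by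
  have hf' := hf
  rw [S.markCount_union hd] at hf'
  have h0 : ∀ a : {a : Marking X // S.IsMarking υ₁ a},
      Integrable f ((S.markCount υ₂).map (markUn a.1)) := fun a =>
    hf'.mono_measure (Measure.le_sum _ a)
  have h1 : ∀ a : {a : Marking X // S.IsMarking υ₁ a},
      ∫ b, f b ∂(S.markCount υ₂).map (markUn a.1) = ∫ b, f (markUn a.1 b) ∂S.markCount υ₂ :=
    fun a => integral_map (measurable_marking _).aemeasurable (h0 a).aestronglyMeasurable
  have h2 : Integrable (fun a => ∫ b, f (markUn a b) ∂S.markCount υ₂) (S.markCount υ₁) := by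
    refine ⟨?_, ?_⟩
    · exact S.aestronglyMeasurable_markCount _
    · refine lt_of_le_of_lt (lintegral_mono fun a => enorm_integral_le_lintegral_enorm _) ?_
      rw [← S.lintegral_markCount_union hd fun c => ‖f c‖ₑ]
      exact hf.2
  rw [S.markCount_union hd, integral_sum_measure hf', S.integral_markCount h2]
  exact tsum_congr h1

/-- The weight of a marked chain. -/
def mwt (q : X → ℝ≥0) (ω : S.MChain) : ℝ≥0∞ := wt (τ := S.mtime) (fun y => q y.1) ω

theorem weighted_eq (q : X → ℝ≥0) : S.weighted q = S.dMChain.withDensity (S.mwt q) := rfl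

theorem aemeasurable_mwt {q : X → ℝ≥0} (hq : AEMeasurable q S.vol) :
    AEMeasurable (S.mwt q) S.dMChain :=
  aemeasurable_wt S.measurable_mtime (S.nonsingular_fst.aemeasurable_comp hq)

theorem mwt_ne_top (q : X → ℝ≥0) (ω : S.MChain) : S.mwt q ω ≠ ∞ := wt_ne_top _ ω

theorem mwt_ne_zero {q : X → ℝ≥0} (hq : ∀ x, q x ≠ 0) (ω : S.MChain) : S.mwt q ω ≠ 0 :=
  wt_ne_zero (w := fun y : X × ℕ => q y.1) (fun y => hq y.1) ω

instance (q : X → ℝ≥0) : SFinite (S.weighted q) := by rw [weighted_eq]; infer_instance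

theorem dMChain_ac {q : X → ℝ≥0} (hq : AEMeasurable q S.vol) (hq0 : ∀ x, q x ≠ 0) :
    S.dMChain ≪ S.weighted q :=
  withDensity_absolutelyContinuous' (S.aemeasurable_mwt hq) (.of_forall (S.mwt_ne_zero hq0))

theorem lintegral_weighted {q : X → ℝ≥0} (hq : AEMeasurable q S.vol) {f : S.MChain → ℝ≥0∞}
    (hf : AEMeasurable f S.dMChain) :
    ∫⁻ ω, f ω ∂S.weighted q = ∫⁻ ω, S.mwt q ω * f ω ∂S.dMChain := by
  rw [weighted_eq, lintegral_withDensity_eq_lintegral_mul₀ (S.aemeasurable_mwt hq) hf]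
  rfl

section Coeff

variable {υ : Finset X} {q : X → ℝ≥0}

theorem ae_coeff_iff (hq : AEMeasurable q S.vol) (hq0 : ∀ x, q x ≠ 0)
    {P : Marking X × S.MChain → Prop} : (∀ᵐ z ∂S.coeffMeasure υ q, P z) ↔
      ∀ a, S.IsMarking υ a → ∀ᵐ ω ∂S.dMChain, P (a, ω) := by
  unfold coeffMeasure
  rw [ae_markProd_iff]
  exact forall₂_congr fun a _ => ⟨fun h => (S.dMChain_ac hq hq0).ae_le h,
    fun h => (S.weighted_ac q).ae_le h⟩

theorem aestronglyMeasurable_coeff_iff (hq : AEMeasurable q S.vol) (hq0 : ∀ x, q x ≠ 0)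
    {E : Type*} [NormedAddCommGroup E] {f : Marking X × S.MChain → E} :
    AEStronglyMeasurable f (S.coeffMeasure υ q) ↔
      ∀ a, S.IsMarking υ a → AEStronglyMeasurable (fun ω => f (a, ω)) S.dMChain := by
  unfold coeffMeasure
  rw [aestronglyMeasurable_markProd_iff]
  exact forall₂_congr fun a _ => ⟨fun h => h.mono_ac (S.dMChain_ac hq hq0),
    fun h => h.mono_ac (S.weighted_ac q)⟩

theorem aemeasurable_coeff_iff (hq : AEMeasurable q S.vol) (hq0 : ∀ x, q x ≠ 0)
    {f : Marking X × S.MChain → ℝ≥0∞} : AEMeasurable f (S.coeffMeasure υ q) ↔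
      ∀ a, S.IsMarking υ a → AEMeasurable (fun ω => f (a, ω)) S.dMChain := by
  unfold coeffMeasure
  rw [aemeasurable_markProd_iff]
  exact forall₂_congr fun a _ => ⟨fun h => h.mono_ac (S.dMChain_ac hq hq0),
    fun h => h.mono_ac (S.weighted_ac q)⟩

theorem lintegral_coeff (hq : AEMeasurable q S.vol) {f : Marking X × S.MChain → ℝ≥0∞}
    (hf : ∀ a, S.IsMarking υ a → AEMeasurable (fun ω => f (a, ω)) S.dMChain) :
    ∫⁻ z, f z ∂S.coeffMeasure υ q =
      ∫⁻ a, ∫⁻ ω, S.mwt q ω * f (a, ω) ∂S.dMChain ∂S.markCount υ := by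
  unfold coeffMeasure
  rw [lintegral_markProd]
  refine lintegral_congr_ae ((S.ae_markCount_iff).2 fun a ha => ?_)
  exact S.lintegral_weighted hq (hf a ha)

end Coeff

/-- The weight of a chain. -/
def cwt (q : X → ℝ≥0) (υ : S.Chain) : ℝ≥0∞ := wt (τ := S.time) q υ

theorem mwt_toM {υ : Finset X} {a : Marking X} (h : S.IsMarking υ a) (q : X → ℝ≥0) :
    S.mwt q (S.toM a) = ((∏ x ∈ υ, q x : ℝ≥0) : ℝ≥0∞) := by
  classical
  have h1 : positions (mpts a) = (mpts a).image Prod.fst := by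
    ext x
    rw [mem_positions]
    simp
  have h2 : υ = (mpts a).image Prod.fst := h.1.symm.trans h1
  unfold mwt wt
  rw [h2]
  congr 1
  exact (Finset.prod_image h.2.1).symm

end EssOrderedSpace

theorem eLpNorm_two_eq {α E : Type*} [MeasurableSpace α] [NormedAddCommGroup E] {μ : Measure α}
    (f : α → E) : eLpNorm f 2 μ = (∫⁻ z, ‖f z‖ₑ ^ 2 ∂μ) ^ (1 / 2 : ℝ) := by
  rw [eLpNorm_eq_lintegral_rpow_enorm_toReal two_ne_zero ENNReal.ofNat_ne_top]
  simp

theorem ENNReal.rpow_half_sq (a : ℝ≥0∞) : (a ^ (1 / 2 : ℝ)) ^ 2 = a := by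
  rw [← ENNReal.rpow_natCast, ← ENNReal.rpow_mul]
  norm_num

theorem ENNReal.rpow_half_mul_self (a : ℝ≥0∞) : a ^ (1 / 2 : ℝ) * a ^ (1 / 2 : ℝ) = a := by
  rw [← sq, ENNReal.rpow_half_sq]

theorem ENNReal.sq_rpow_half (a : ℝ≥0∞) : (a ^ 2) ^ (1 / 2 : ℝ) = a := by
  rw [← ENNReal.rpow_natCast, ← ENNReal.rpow_mul]
  norm_num

/-- Cauchy-Schwarz. -/
theorem lintegral_mul_le_sqrt {α : Type*} [MeasurableSpace α] {μ : Measure α} {f g : α → ℝ≥0∞}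
    (hf : AEMeasurable f μ) (hg : AEMeasurable g μ) :
    ∫⁻ z, f z * g z ∂μ ≤
      (∫⁻ z, f z ^ 2 ∂μ) ^ (1 / 2 : ℝ) * (∫⁻ z, g z ^ 2 ∂μ) ^ (1 / 2 : ℝ) := by
  have := ENNReal.lintegral_mul_le_Lp_mul_Lq μ Real.HolderConjugate.two_two hf hg
  simpa using this

/-- Two measures with reciprocal densities. -/
structure DualWeight {α : Type*} [MeasurableSpace α] (m ν ν' : Measure α) where
  w : α → ℝ≥0
  w' : α → ℝ≥0
  mul_eq : ∀ z, w z * w' z = 1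
  aemeas : AEMeasurable w m
  aemeas' : AEMeasurable w' m
  eq : ν = m.withDensity fun z => w z
  eq' : ν' = m.withDensity fun z => w' z

namespace DualWeight

variable {α : Type*} [MeasurableSpace α] {m ν ν' : Measure α} (D : DualWeight m ν ν')

/-- The reversed pair. -/
def symm : DualWeight m ν' ν :=
  ⟨D.w', D.w, fun z => by rw [mul_comm, D.mul_eq], D.aemeas', D.aemeas, D.eq', D.eq⟩

include D

theorem w_ne_zero (z : α) : D.w z ≠ 0 := left_ne_zero_of_mul_eq_one (D.mul_eq z)

theorem ac : ν ≪ m := by rw [D.eq]; exact withDensity_absolutelyContinuous _ _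

theorem ac' : m ≪ ν := by
  conv_rhs => rw [D.eq]
  exact withDensity_absolutelyContinuous' D.aemeas.coe_nnreal_ennreal
    (.of_forall fun z => by simpa using D.w_ne_zero z)

theorem lintegral_eq {f : α → ℝ≥0∞} (hf : AEMeasurable f m) :
    ∫⁻ z, f z ∂ν = ∫⁻ z, D.w z * f z ∂m := by
  conv_lhs => rw [D.eq]
  rw [lintegral_withDensity_eq_lintegral_mul₀ D.aemeas.coe_nnreal_ennreal hf]
  rfl

theorem sigmaFinite [SigmaFinite m] : SigmaFinite ν := by
  rw [D.eq]; exact SigmaFinite.withDensity D.w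

theorem coe_mul_eq (z : α) : (D.w z : ℝ≥0∞) * D.w' z = 1 := by
  rw [← ENNReal.coe_mul, D.mul_eq, ENNReal.coe_one]

theorem lintegral_mul_le {f g : α → ℝ≥0∞} (hf : AEMeasurable f m) (hg : AEMeasurable g m) :
    ∫⁻ z, f z * g z ∂m ≤
      (∫⁻ z, f z ^ 2 ∂ν) ^ (1 / 2 : ℝ) * (∫⁻ z, g z ^ 2 ∂ν') ^ (1 / 2 : ℝ) := by
  have h1 : ∀ z, f z * g z =
      ((D.w z : ℝ≥0∞) ^ (1 / 2 : ℝ) * f z) * ((D.w' z : ℝ≥0∞) ^ (1 / 2 : ℝ) * g z) := fun z => by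
    rw [mul_mul_mul_comm, ← ENNReal.mul_rpow_of_nonneg _ _ (by norm_num), D.coe_mul_eq,
      ENNReal.one_rpow, one_mul]
  have hw := D.aemeas.coe_nnreal_ennreal.pow_const (1 / 2 : ℝ)
  have hw' := D.aemeas'.coe_nnreal_ennreal.pow_const (1 / 2 : ℝ)
  rw [lintegral_congr h1]
  refine (lintegral_mul_le_sqrt (hw.mul hf) (hw'.mul hg)).trans ?_
  rw [D.lintegral_eq (hf.pow_const 2), D.symm.lintegral_eq (hg.pow_const 2)]
  have h2 : ∀ (u : ℝ≥0) (a : ℝ≥0∞), ((u : ℝ≥0∞) ^ (1 / 2 : ℝ) * a) ^ 2 = u * a ^ 2 := fun u a => by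
    rw [mul_pow, ENNReal.rpow_half_sq]
  exact le_of_eq (congrArg₂ (fun a b : ℝ≥0∞ => a ^ (1 / 2 : ℝ) * b ^ (1 / 2 : ℝ))
    (lintegral_congr fun z => h2 _ _) (lintegral_congr fun z => h2 _ _))

/-- The converse of the Cauchy-Schwarz inequality. -/
theorem le_of_forall_lintegral_mul_le [SigmaFinite m] {K : α → ℝ≥0∞} (hK : AEMeasurable K m)
    {C : ℝ≥0∞} (h : ∀ g : α → ℝ≥0∞, AEMeasurable g m →
      ∫⁻ z, g z * K z ∂m ≤ C * (∫⁻ z, g z ^ 2 ∂ν) ^ (1 / 2 : ℝ)) :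
    (∫⁻ z, K z ^ 2 ∂ν') ^ (1 / 2 : ℝ) ≤ C := by
  have := D.symm.sigmaFinite
  let L : ℕ → α → ℝ≥0∞ := fun n => (spanningSets ν' n).indicator fun z => min (K z) n
  have hL : ∀ n, AEMeasurable (L n) m := fun n =>
    (hK.min aemeasurable_const).indicator (measurableSet_spanningSets ν' n)
  have hLK : ∀ n z, L n z ≤ K z := fun n z =>
    Set.indicator_apply_le' (fun _ => min_le_left _ _) fun _ => zero_le
  have hmono : ∀ z, Monotone fun n => L n z := by
    intro z n k hnk
    refine Set.indicator_apply_le' (fun hz => ?_) fun _ => zero_le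
    have hz' : z ∈ spanningSets ν' k := monotone_spanningSets ν' hnk hz
    simp only [L, Set.indicator_of_mem hz']
    exact min_le_min_left _ (by exact_mod_cast hnk)
  have hsup : ∀ z, ⨆ n, L n z = K z := by
    intro z
    refine le_antisymm (iSup_le fun n => hLK n z) (le_of_forall_lt fun c hc => ?_)
    obtain ⟨n, hn⟩ := Set.mem_iUnion.1 ((iUnion_spanningSets ν').symm ▸ Set.mem_univ z :
      z ∈ ⋃ n, spanningSets ν' n)
    obtain ⟨k, hk⟩ := ENNReal.exists_nat_gt (ne_top_of_lt hc)
    refine lt_iSup_iff.2 ⟨max n k, ?_⟩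
    have hz' : z ∈ spanningSets ν' (max n k) := monotone_spanningSets ν' (le_max_left n k) hn
    simp only [L, Set.indicator_of_mem hz']
    refine lt_min hc (hk.trans_le ?_)
    exact_mod_cast le_max_right n k
  have hI : ∀ n, (∫⁻ z, L n z ^ 2 ∂ν') ^ (1 / 2 : ℝ) ≤ C := by
    intro n
    have hfin : ∫⁻ z, L n z ^ 2 ∂ν' ≠ ∞ := by
      refine ne_top_of_le_ne_top (b := ∫⁻ z in spanningSets ν' n, (n : ℝ≥0∞) ^ 2 ∂ν') ?_ ?_
      · rw [setLIntegral_const]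
        exact ENNReal.mul_ne_top (by finiteness) (measure_spanningSets_lt_top ν' n).ne
      · rw [← lintegral_indicator (measurableSet_spanningSets ν' n)]
        refine lintegral_mono fun z => ?_
        by_cases hz : z ∈ spanningSets ν' n
        · simp only [L, Set.indicator_of_mem hz]
          gcongr
          exact min_le_right _ _
        · simp [L, Set.indicator_of_notMem hz]
    have h1 := h (fun z => D.w' z * L n z) (D.aemeas'.coe_nnreal_ennreal.mul (hL n))
    have h2 : ∫⁻ z, (D.w' z * L n z) ^ 2 ∂ν = ∫⁻ z, L n z ^ 2 ∂ν' := by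
      rw [D.lintegral_eq (f := fun z => (D.w' z * L n z) ^ 2)
        ((D.aemeas'.coe_nnreal_ennreal.mul (hL n)).pow_const 2),
        D.symm.lintegral_eq ((hL n).pow_const 2)]
      refine lintegral_congr fun z => ?_
      change _ = (D.w' z : ℝ≥0∞) * _
      rw [mul_pow, sq (D.w' z : ℝ≥0∞), ← mul_assoc, ← mul_assoc, D.coe_mul_eq, one_mul]
    have h3 : ∫⁻ z, L n z ^ 2 ∂ν' ≤ ∫⁻ z, D.w' z * L n z * K z ∂m := by
      rw [D.symm.lintegral_eq ((hL n).pow_const 2)]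
      refine lintegral_mono fun z => ?_
      change (D.w' z : ℝ≥0∞) * _ ≤ _
      rw [mul_assoc, sq]
      gcongr
      exact hLK n z
    rw [h2] at h1
    have h4 := h3.trans h1
    set I := ∫⁻ z, L n z ^ 2 ∂ν'
    by_cases h0 : I = 0
    · rw [h0]; simp
    have h5 : I ^ (1 / 2 : ℝ) * I ^ (1 / 2 : ℝ) ≤ C * I ^ (1 / 2 : ℝ) := by
      rwa [ENNReal.rpow_half_mul_self]
    refine (ENNReal.mul_le_mul_iff_left ?_ ?_).1 h5
    · simpa [ENNReal.rpow_eq_zero_iff] using h0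
    · exact ENNReal.rpow_ne_top_of_nonneg (by norm_num) hfin
  have hlim : ∫⁻ z, K z ^ 2 ∂ν' = ⨆ n, ∫⁻ z, L n z ^ 2 ∂ν' := by
    rw [← lintegral_iSup' (fun n => ((hL n).mono_ac D.symm.ac).pow_const 2)
      (.of_forall fun z n k hnk => by simp only; gcongr; exact hmono z hnk)]
    refine lintegral_congr fun z => ?_
    rw [← hsup z, ENNReal.iSup_pow_of_ne_zero two_ne_zero]
  have h6 : ∫⁻ z, K z ^ 2 ∂ν' ≤ C ^ 2 := by
    rw [hlim]
    refine iSup_le fun n => ?_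
    have := pow_le_pow_left' (hI n) 2
    rwa [ENNReal.rpow_half_sq] at this
  calc (∫⁻ z, K z ^ 2 ∂ν') ^ (1 / 2 : ℝ) ≤ (C ^ 2) ^ (1 / 2 : ℝ) := by gcongr
    _ = C := ENNReal.sq_rpow_half C

section Hilbert

variable {h : Type*} [NormedAddCommGroup h] [InnerProductSpace ℂ h]

theorem eLpNorm_smul {f : α → h} (hf : AEStronglyMeasurable f m) :
    eLpNorm (fun z => (D.w z : ℂ) • f z) 2 ν' = eLpNorm f 2 ν := by
  have hwc : AEStronglyMeasurable (fun z => (D.w z : ℂ)) m :=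
    (Complex.continuous_ofReal.measurable.comp_aemeasurable
      D.aemeas.coe_nnreal_real).aestronglyMeasurable
  rw [eLpNorm_two_eq, eLpNorm_two_eq, D.lintegral_eq (hf.enorm.pow_const 2),
    D.symm.lintegral_eq (f := fun z => ‖(D.w z : ℂ) • f z‖ₑ ^ 2)
      ((hwc.smul hf).enorm.pow_const 2)]
  congr 1
  refine lintegral_congr fun z => ?_
  have h1 : ‖(D.w z : ℂ)‖ₑ = D.w z := by
    rw [enorm_eq_nnnorm]
    congr 1
    ext
    simp
  change (D.w' z : ℝ≥0∞) * _ = _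
  rw [enorm_smul, h1, mul_pow, sq (D.w z : ℝ≥0∞), ← mul_assoc, ← mul_assoc,
    mul_comm (D.w' z : ℝ≥0∞), D.coe_mul_eq, one_mul]

theorem memLp_smul {f : α → h} (hf : MemLp f 2 ν) : MemLp (fun z => (D.w z : ℂ) • f z) 2 ν' := by
  have hfm := hf.1.mono_ac D.ac'
  have hwc : AEStronglyMeasurable (fun z => (D.w z : ℂ)) m :=
    (Complex.continuous_ofReal.measurable.comp_aemeasurable
      D.aemeas.coe_nnreal_real).aestronglyMeasurable
  exact ⟨(hwc.smul hfm).mono_ac D.symm.ac, by rw [D.eLpNorm_smul hfm]; exact hf.2⟩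

/-- The isometry of the dual `L²`-spaces given by the density. -/
def toDual : Lp h 2 ν →ₗᵢ[ℂ] Lp h 2 ν' where
  toFun f := (D.memLp_smul (Lp.memLp f)).toLp
  map_add' f g := by
    refine Lp.ext ?_
    filter_upwards [(D.memLp_smul (Lp.memLp (f + g))).coeFn_toLp,
      Lp.coeFn_add (D.memLp_smul (Lp.memLp f)).toLp (D.memLp_smul (Lp.memLp g)).toLp,
      (D.memLp_smul (Lp.memLp f)).coeFn_toLp, (D.memLp_smul (Lp.memLp g)).coeFn_toLp,
      D.symm.ac.ae_le (D.ac'.ae_le (Lp.coeFn_add f g))] with z h1 h2 h3 h4 h5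
    rw [h1, h2, Pi.add_apply, h3, h4, h5, Pi.add_apply, smul_add]
  map_smul' c f := by
    refine Lp.ext ?_
    filter_upwards [(D.memLp_smul (Lp.memLp (c • f))).coeFn_toLp,
      Lp.coeFn_smul c (D.memLp_smul (Lp.memLp f)).toLp,
      (D.memLp_smul (Lp.memLp f)).coeFn_toLp,
      D.symm.ac.ae_le (D.ac'.ae_le (Lp.coeFn_smul c f))] with z h1 h2 h3 h5
    rw [h1, RingHom.id_apply, h2, Pi.smul_apply, h3, h5, Pi.smul_apply, smul_comm]
  norm_map' f := by
    change ‖(D.memLp_smul (Lp.memLp f)).toLp‖ = _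
    rw [Lp.norm_toLp, D.eLpNorm_smul ((Lp.memLp f).1.mono_ac D.ac'), Lp.norm_def]

theorem coeFn_toDual (f : Lp h 2 ν) : D.toDual f =ᵐ[m] fun z => (D.w z : ℂ) • f z :=
  D.symm.ac'.ae_le (D.memLp_smul (Lp.memLp f)).coeFn_toLp

theorem toDual_toDual (f : Lp h 2 ν') : D.toDual (D.symm.toDual f) = f := by
  refine Lp.ext (D.symm.ac.ae_le ?_)
  filter_upwards [D.coeFn_toDual (D.symm.toDual f), D.symm.coeFn_toDual f] with z h1 h2
  rw [h1, h2, smul_smul, ← Complex.ofReal_mul, ← NNReal.coe_mul]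
  change (((D.w z * D.w' z : ℝ≥0) : ℝ) : ℂ) • _ = _
  rw [D.mul_eq]
  simp

theorem inner_toDual (η : Lp h 2 ν) (χ : Lp h 2 ν') :
    inner ℂ (D.toDual η) χ = ∫ z, inner ℂ (η z) (χ z) ∂m := by
  have h0 : ∀ F : α → ℂ, ∫ z, F z ∂ν' = ∫ z, D.w' z • F z ∂m := fun F => by
    conv_lhs => rw [D.eq']
    exact integral_withDensity_eq_integral_smul₀ D.aemeas' F
  rw [L2.inner_def, h0]
  refine integral_congr_ae ?_
  filter_upwards [D.coeFn_toDual η] with z hz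
  rw [hz, inner_smul_left, Complex.conj_ofReal, NNReal.smul_def, Complex.real_smul, ← mul_assoc,
    ← Complex.ofReal_mul, ← NNReal.coe_mul, mul_comm (D.w' z), D.mul_eq]
  simp

variable {β : Type*} [MeasurableSpace β] {m₁ ν₁ ν₁' : Measure β} (D₁ : DualWeight m₁ ν₁ ν₁')

include D₁

theorem exists_adjoint [CompleteSpace h] (A : Lp h 2 ν₁ →L[ℂ] Lp h 2 ν') :
    ∃ A' : Lp h 2 ν →L[ℂ] Lp h 2 ν₁', ∀ η ξ,
      ∫ z, inner ℂ (η z) (A ξ z) ∂m = ∫ z, inner ℂ (A' η z) (ξ z) ∂m₁ := by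
  refine ⟨D₁.toDual.toContinuousLinearMap ∘L (ContinuousLinearMap.adjoint A) ∘L
    D.toDual.toContinuousLinearMap, fun η ξ => ?_⟩
  have h1 := D.inner_toDual η (A ξ)
  have h2 := D₁.symm.inner_toDual ((D₁.toDual.toContinuousLinearMap ∘L
    (ContinuousLinearMap.adjoint A) ∘L D.toDual.toContinuousLinearMap) η) ξ
  rw [← h1, ← h2, ← ContinuousLinearMap.adjoint_inner_left]
  congr 1
  exact (D₁.symm.toDual_toDual _).symm

theorem norm_adjoint_le {A : Lp h 2 ν₁ →L[ℂ] Lp h 2 ν'} {A' : Lp h 2 ν →L[ℂ] Lp h 2 ν₁'}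
    (hA : ∀ η ξ, ∫ z, inner ℂ (η z) (A ξ z) ∂m = ∫ z, inner ℂ (A' η z) (ξ z) ∂m₁) :
    ‖A'‖ ≤ ‖A‖ := by
  refine ContinuousLinearMap.opNorm_le_bound _ (ContinuousLinearMap.opNorm_nonneg A) fun η => ?_
  have h1 := hA η (D₁.symm.toDual (A' η))
  rw [← D.inner_toDual, ← D₁.symm.inner_toDual] at h1
  have h2 : ‖A' η‖ * ‖A' η‖ ≤ ‖A‖ * ‖η‖ * ‖A' η‖ := by
    have h3 := norm_inner_le_norm (𝕜 := ℂ) (D.toDual η) (A (D₁.symm.toDual (A' η)))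
    rw [h1, inner_self_eq_norm_sq_to_K, LinearIsometry.norm_map, LinearIsometry.norm_map] at h3
    have h4 : ‖((‖A' η‖ : ℂ)) ^ 2‖ = ‖A' η‖ * ‖A' η‖ := by
      rw [norm_pow, Complex.norm_real, norm_norm, sq]
    have h5 := A.le_opNorm (D₁.symm.toDual (A' η))
    rw [LinearIsometry.norm_map] at h5
    calc ‖A' η‖ * ‖A' η‖ = ‖((‖A' η‖ : ℂ)) ^ 2‖ := h4.symm
      _ ≤ ‖η‖ * ‖A (D₁.symm.toDual (A' η))‖ := h3
      _ ≤ ‖η‖ * (‖A‖ * ‖A' η‖) := by gcongr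
      _ = ‖A‖ * ‖η‖ * ‖A' η‖ := by ring
  by_cases h0 : ‖A' η‖ = 0
  · rw [h0]; positivity
  · exact le_of_mul_le_mul_right h2 (lt_of_le_of_ne (norm_nonneg _) (Ne.symm h0))

theorem norm_adjoint_eq {A : Lp h 2 ν₁ →L[ℂ] Lp h 2 ν'} {A' : Lp h 2 ν →L[ℂ] Lp h 2 ν₁'}
    (hA : ∀ η ξ, ∫ z, inner ℂ (η z) (A ξ z) ∂m = ∫ z, inner ℂ (A' η z) (ξ z) ∂m₁) :
    ‖A'‖ = ‖A‖ := by
  refine le_antisymm (D.norm_adjoint_le D₁ hA) (D₁.norm_adjoint_le D fun ξ η => ?_)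
  have := congrArg (starRingEnd ℂ) (hA η ξ)
  rw [← integral_conj, ← integral_conj] at this
  simp only [inner_conj_symm] at this
  exact this.symm

end Hilbert

end DualWeight

namespace EssOrderedSpace

variable {X : Type*} [MeasurableSpace X] (S : EssOrderedSpace X) {q : X → ℝ≥0}

/-- The duality of the weights `q` and `q⁻¹`. -/
def dualWeight (hq : AEMeasurable q S.vol) (hq0 : ∀ x, q x ≠ 0) :
    DualWeight S.dMChain (S.weighted q) (S.weighted q⁻¹) where
  w ω := ∏ y ∈ ω.fin, q y.1
  w' ω := ∏ y ∈ ω.fin, q⁻¹ y.1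
  mul_eq ω := by
    rw [← Finset.prod_mul_distrib]
    exact Finset.prod_eq_one fun y _ => mul_inv_cancel₀ (hq0 y.1)
  aemeas := (S.aemeasurable_mwt hq).ennreal_toNNReal
  aemeas' := (S.aemeasurable_mwt hq.inv).ennreal_toNNReal
  eq := rfl
  eq' := rfl

/-- The duality of the weights `q` and `q⁻¹`, for functions of a marking and a chain. -/
def dualWeightT (υ : Finset X) (hq : AEMeasurable q S.vol) (hq0 : ∀ x, q x ≠ 0) :
    DualWeight ((S.markCount υ).prod S.dMChain) (S.coeffMeasure υ q) (S.coeffMeasure υ q⁻¹) where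
  w z := ∏ y ∈ z.2.fin, q y.1
  w' z := ∏ y ∈ z.2.fin, q⁻¹ y.1
  mul_eq z := (S.dualWeight hq hq0).mul_eq z.2
  aemeas := NonsingularMap.snd.aemeasurable_comp (S.dualWeight hq hq0).aemeas
  aemeas' := NonsingularMap.snd.aemeasurable_comp (S.dualWeight hq hq0).aemeas'
  eq := by
    unfold coeffMeasure
    rw [weighted_eq, prod_withDensity_right₀ (S.aemeasurable_mwt hq)]
    rfl
  eq' := by
    unfold coeffMeasure
    rw [weighted_eq, prod_withDensity_right₀ (S.aemeasurable_mwt hq.inv)]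
    rfl

variable {h : Type*} [NormedAddCommGroup h] [InnerProductSpace ℂ h]

theorem isAdjoint_adjoint [CompleteSpace h] (hq : AEMeasurable q S.vol) (hq0 : ∀ x, q x ≠ 0)
    {υ υ' : Finset X} (A : S.GT h υ q →L[ℂ] S.GT h υ' q⁻¹) : S.IsAdjoint A (S.adjoint A) := by
  have H : ∃ A', S.IsAdjoint A A' :=
    (S.dualWeightT υ' hq hq0).exists_adjoint (S.dualWeightT υ hq hq0) A
  unfold adjoint
  rw [dif_pos H]
  exact H.choose_spec

theorem IsAdjoint.norm_eq (hq : AEMeasurable q S.vol) (hq0 : ∀ x, q x ≠ 0)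
    {υ υ' : Finset X} {A : S.GT h υ q →L[ℂ] S.GT h υ' q⁻¹} {A' : S.GT h υ' q →L[ℂ] S.GT h υ q⁻¹}
    (hA : S.IsAdjoint A A') : ‖A'‖ = ‖A‖ :=
  (S.dualWeightT υ' hq hq0).norm_adjoint_eq (S.dualWeightT υ hq hq0) hA

theorem norm_eq_of_pairing (hq : AEMeasurable q S.vol) (hq0 : ∀ x, q x ≠ 0)
    {A A' : S.G h q →L[ℂ] S.G h q⁻¹} (hA : ∀ η χ : S.G h q, S.pairing η (A χ) = S.pairing (A' η) χ) :
    ‖A'‖ = ‖A‖ :=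
  (S.dualWeight hq hq0).norm_adjoint_eq (S.dualWeight hq hq0) hA

end EssOrderedSpace

namespace EssOrderedSpace

open Conf

variable {X : Type*} [MeasurableSpace X] (S : EssOrderedSpace X)

theorem ae_notMem (α : Finset X) : ∀ᵐ x ∂S.vol, x ∉ α := by
  have h : ∀ᵐ x ∂S.vol, ∀ y : α, S.time x ≠ S.time y := by
    refine ae_all_iff.2 fun y => ?_
    rw [ae_iff]
    simpa using S.vol_time_eq (S.time y)
  exact h.mono fun x hx hxα => hx ⟨x, hxα⟩ rfl

theorem ae_chain_disjoint (α : Finset X) : ∀ᵐ υ ∂S.dChain, Disjoint α υ.fin :=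
  (ae_forall_mem S.measurable_time (S.ae_notMem α)).mono fun _ h =>
    Finset.disjoint_right.2 fun x hx => h x hx

theorem ae_mchain_notMem (α : Finset X) : ∀ᵐ ω ∂S.dMChain, ∀ y ∈ ω.fin, y.1 ∉ α :=
  ae_forall_mem S.measurable_mtime (S.markedVol_fst (S.ae_notMem α))

theorem ae_marks' {P : S.MChain → Prop} (h : ∀ᵐ q ∂S.dMChain, P q) :
    ∀ᵐ υ ∂S.dChain, ∀ a, S.IsMarking υ.fin a → P (S.toM a) :=
  nonsingular_unit.ae (S.ae_marks (ν := Measure.dirac ()) (P := fun q => P q.2)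
    (NonsingularMap.snd.ae h))

theorem lintegral_marks {f : S.MChain → ℝ≥0∞} (hf : AEMeasurable f S.dMChain) :
    AEMeasurable (fun υ : S.Chain => ∫⁻ a, f (S.toM a) ∂S.markCount υ.fin) S.dChain ∧
    ∫⁻ υ, ∫⁻ a, f (S.toM a) ∂S.markCount υ.fin ∂S.dChain = ∫⁻ ω, f ω ∂S.dMChain := by
  have h := S.aemeasurable_marks (ν := Measure.dirac ()) (f := fun q => f q.2)
    (NonsingularMap.snd.aemeasurable_comp hf)
  refine ⟨nonsingular_unit.aemeasurable_comp h.1, ?_⟩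
  have h2 := h.2
  rw [lintegral_prod _ h.1, lintegral_prod _ (NonsingularMap.snd.aemeasurable_comp hf)] at h2
  simpa using h2

open Classical in
/-- The argument of the multiple point split. -/
def splitPt (α : Finset X) (z : Marking X × S.MChain) : Marking X × S.MChain :=
  ((mpts z.1).filter (fun y => y.1 ∈ α),
    ((mpts z.1).filter (fun y => y.1 ∉ α) ∪ z.2.fin : Finset (X × ℕ)))

theorem split_apply {h : Type*} [NormedAddCommGroup h] [InnerProductSpace ℂ h] (α : Finset X)
    (ξ : Marking X × S.MChain → h) (z : Marking X × S.MChain) :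
    S.split α ξ z = ξ (S.splitPt α z) := rfl

theorem splitPt_markUn {α : Finset X} {e a : Marking X} (he : ∀ y ∈ mpts e, y.1 ∈ α)
    (ha : ∀ y ∈ mpts a, y.1 ∉ α) (ω : S.MChain) :
    S.splitPt α (markUn e a, ω) = (e, un (S.toM a) ω) := by
  classical
  refine Prod.ext (marking_ext fun y => ?_) (conf_ext fun y => ?_)
  · refine Finset.mem_filter.trans ?_
    refine ⟨fun h => (mem_markUn.1 h.1).resolve_right fun h' => ha y h' h.2,
      fun h => ⟨mem_markUn.2 (Or.inl h), he y h⟩⟩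
  · refine Finset.mem_union.trans ?_
    rw [mem_fin_un, Finset.mem_filter]
    refine or_congr ⟨fun h => (mem_markUn.1 h.1).resolve_left fun h' => h.2 (he y h'),
      fun h => ⟨mem_markUn.2 (Or.inr h), ha y h⟩⟩ Iff.rfl

theorem splitPt_markUn' {α υ : Finset X} (hd : Disjoint α υ) {e a : Marking X}
    (he : S.IsMarking α e) (ha : S.IsMarking υ a) (ω : S.MChain) :
    S.splitPt α (markUn e a, ω) = (e, un (S.toM a) ω) :=
  S.splitPt_markUn (fun _ hy => S.mem_of_isMarking he hy)
    (fun _ hy => Finset.disjoint_right.1 hd (S.mem_of_isMarking ha hy)) ω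

theorem nonsingular_unM : NonsingularMap (fun p : S.MChain × S.MChain => un p.1 p.2)
    (S.dMChain.prod S.dMChain) S.dMChain :=
  nonsingular_un S.measurable_mtime S.markedVol_time_eq

theorem nonsingular_unC : NonsingularMap (fun p : S.Chain × S.Chain => un p.1 p.2)
    (S.dChain.prod S.dChain) S.dChain :=
  nonsingular_un S.measurable_time S.vol_time_eq

section Split

open Classical

variable {α : Finset X}

/-- A general principle for almost every split. -/
theorem ae_split_of {Q : Marking X → (S.MChain → Marking X × S.MChain) → Prop}
    (h : ∀ e, S.IsMarking α e → ∀ᵐ a ∂S.dMChain, Q e fun ω => (e, un a ω)) :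
    ∀ᵐ υ ∂S.dChain, ∀ c, S.IsMarking (α ∪ υ.fin) c →
      ∃ e, S.IsMarking α e ∧ Q e fun ω => S.splitPt α (c, ω) := by
  have h1 : ∀ᵐ υ ∂S.dChain, ∀ e : {e : Marking X // S.IsMarking α e},
      ∀ a, S.IsMarking υ.fin a → Q e.1 fun ω => (e.1, un (S.toM a) ω) :=
    ae_all_iff.2 fun e => S.ae_marks' (h e.1 e.2)
  filter_upwards [h1, S.ae_chain_disjoint α] with υ hυ hd c hc
  obtain ⟨⟨e, a⟩, h2⟩ := (S.bijective_markUn hd).2 ⟨c, hc⟩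
  have h3 : markUn e.1 a.1 = c := congrArg Subtype.val h2
  refine ⟨e.1, e.2, ?_⟩
  rw [← h3]
  have h4 := hυ e a.1 a.2
  have h5 : (fun ω => S.splitPt α (markUn e.1 a.1, ω)) = fun ω => (e.1, un (S.toM a.1) ω) :=
    funext fun ω => S.splitPt_markUn' hd e.2 a.2 ω
  rw [h5]
  exact h4

theorem ae_splitPt {P : Marking X × S.MChain → Prop}
    (h : ∀ e, S.IsMarking α e → ∀ᵐ ϑ ∂S.dMChain, P (e, ϑ)) :
    ∀ᵐ υ ∂S.dChain, ∀ c, S.IsMarking (α ∪ υ.fin) c → ∀ᵐ ω ∂S.dMChain, P (S.splitPt α (c, ω)) := by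
  have := S.ae_split_of (α := α) (Q := fun _ u => ∀ᵐ ω ∂S.dMChain, P (u ω)) fun e he =>
    Measure.ae_ae_of_ae_prod (S.nonsingular_unM.ae (h e he))
  exact this.mono fun υ hυ c hc => (hυ c hc).choose_spec.2

theorem aestronglyMeasurable_splitPt {E : Type*} [NormedAddCommGroup E]
    {f : Marking X × S.MChain → E}
    (h : ∀ e, S.IsMarking α e → AEStronglyMeasurable (fun ϑ => f (e, ϑ)) S.dMChain) :
    ∀ᵐ υ ∂S.dChain, ∀ c, S.IsMarking (α ∪ υ.fin) c →
      AEStronglyMeasurable (fun ω => f (S.splitPt α (c, ω))) S.dMChain := by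
  have := S.ae_split_of (α := α)
    (Q := fun _ u => AEStronglyMeasurable (fun ω => f (u ω)) S.dMChain) fun e he =>
    (S.nonsingular_unM.aestronglyMeasurable_comp (h e he)).prodMk_left
  exact this.mono fun υ hυ c hc => (hυ c hc).choose_spec.2

theorem aemeasurable_splitPt {f : Marking X × S.MChain → ℝ≥0∞}
    (h : ∀ e, S.IsMarking α e → AEMeasurable (fun ϑ => f (e, ϑ)) S.dMChain) :
    ∀ᵐ υ ∂S.dChain, ∀ c, S.IsMarking (α ∪ υ.fin) c →
      AEMeasurable (fun ω => f (S.splitPt α (c, ω))) S.dMChain := by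
  have := S.ae_split_of (α := α)
    (Q := fun _ u => AEMeasurable (fun ω => f (u ω)) S.dMChain) fun e he => by
      have := (S.nonsingular_unM.aemeasurable_comp (h e he)).aestronglyMeasurable.prodMk_left
      exact this.mono fun a ha => ha.aemeasurable
  exact this.mono fun υ hυ c hc => (hυ c hc).choose_spec.2

/-- The squared norm of the split of a nonnegative function. -/
def splitSq (α : Finset X) (g : Marking X × S.MChain → ℝ≥0∞) (q : X → ℝ≥0) (υ : Finset X) :
    ℝ≥0∞ :=
  ∫⁻ z, g (S.splitPt α z) ^ 2 ∂S.coeffMeasure (α ∪ υ) q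

theorem splitSq_eq {g : Marking X × S.MChain → ℝ≥0∞} {q : X → ℝ≥0} (hq : AEMeasurable q S.vol)
    (hg : ∀ e, S.IsMarking α e → AEMeasurable (fun ϑ => g (e, ϑ)) S.dMChain) :
    ∀ᵐ υ ∂S.dChain, S.splitSq α g q υ.fin =
      ∑' e : {e : Marking X // S.IsMarking α e}, ∫⁻ a,
        ∫⁻ ω, S.mwt q ω * g (e.1, un (S.toM a) ω) ^ 2 ∂S.dMChain ∂S.markCount υ.fin := by
  filter_upwards [S.aemeasurable_splitPt hg, S.ae_chain_disjoint α] with υ hυ hd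
  have h1 := S.lintegral_coeff (υ := α ∪ υ.fin) (f := fun z => g (S.splitPt α z) ^ 2) hq
    fun c hc => (hυ c hc).pow_const 2
  refine h1.trans ?_
  rw [S.lintegral_markCount_union hd, lintegral_markCount]
  refine tsum_congr fun e => ?_
  refine lintegral_congr_ae (S.ae_markCount_iff.2 fun a ha => ?_)
  refine lintegral_congr fun ω => ?_
  exact congrArg (fun z => S.mwt q ω * g z ^ 2) (S.splitPt_markUn' hd e.2 ha ω)

theorem lintegral_unM_weight {q w : X → ℝ≥0} (hq : AEMeasurable q S.vol)
    (hw : AEMeasurable w S.vol) {f : S.MChain → ℝ≥0∞} (hf : AEMeasurable f S.dMChain) :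
    ∫⁻ a, S.mwt w a * ∫⁻ ω, S.mwt q ω * f (un a ω) ∂S.dMChain ∂S.dMChain =
      ∫⁻ ϑ, S.mwt (w + q) ϑ * f ϑ ∂S.dMChain := by
  have hF : AEMeasurable (fun p : S.MChain × S.MChain =>
      S.mwt w p.1 * (S.mwt q p.2 * f (un p.1 p.2))) (S.dMChain.prod S.dMChain) :=
    (NonsingularMap.fst.aemeasurable_comp (S.aemeasurable_mwt hw)).mul
      ((NonsingularMap.snd.aemeasurable_comp (S.aemeasurable_mwt hq)).mul
        (S.nonsingular_unM.aemeasurable_comp hf))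
  have h1 := lintegral_splitSum' S.measurable_mtime S.markedVol_time_eq hF
  have h2 : ∀ ϑ : S.MChain, splitSum (fun p : S.MChain × S.MChain =>
      S.mwt w p.1 * (S.mwt q p.2 * f (un p.1 p.2))) ϑ = S.mwt (w + q) ϑ * f ϑ := by
    intro ϑ
    have h3 : S.mwt (w + q) ϑ = splitSum (fun p => S.mwt w p.1 * S.mwt q p.2) ϑ :=
      (splitSum_wt (τ := S.mtime) (fun y => w y.1) (fun y => q y.1) ϑ).symm
    rw [h3]
    unfold splitSum
    rw [Finset.sum_mul]
    refine Finset.sum_congr rfl fun a ha => ?_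
    have h4 : f (un a (sdiff ϑ a)) = f ϑ := congrArg f (un_sdiff (sdiff_subset' ha))
    rw [mul_assoc]
    exact congrArg (fun c => S.mwt w a * (S.mwt q (sdiff ϑ a) * c)) h4
  rw [← lintegral_congr h2]
  refine Eq.trans ?_ h1.symm
  rw [← dMChain_eq, lintegral_prod _ hF]
  refine lintegral_congr fun a => ?_
  rw [lintegral_const_mul' _ _ (S.mwt_ne_top w a)]

theorem aemeasurable_split_inner {q : X → ℝ≥0} (hq : AEMeasurable q S.vol)
    {f : S.MChain → ℝ≥0∞} (hf : AEMeasurable f S.dMChain) :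
    AEMeasurable (fun a => ∫⁻ ω, S.mwt q ω * f (un a ω) ∂S.dMChain) S.dMChain := by
  have hF : AEMeasurable (fun p : S.MChain × S.MChain => S.mwt q p.2 * f (un p.1 p.2))
      (S.dMChain.prod S.dMChain) :=
    (NonsingularMap.snd.aemeasurable_comp (S.aemeasurable_mwt hq)).mul
        (S.nonsingular_unM.aemeasurable_comp hf)
  exact hF.lintegral_prod_right'

theorem aemeasurable_splitSq {g : Marking X × S.MChain → ℝ≥0∞} {q : X → ℝ≥0}
    (hq : AEMeasurable q S.vol)
    (hg : ∀ e, S.IsMarking α e → AEMeasurable (fun ϑ => g (e, ϑ)) S.dMChain) :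
    AEMeasurable (fun υ : S.Chain => S.splitSq α g q υ.fin) S.dChain := by
  refine AEMeasurable.congr ?_ (Filter.EventuallyEq.symm (S.splitSq_eq hq hg))
  exact AEMeasurable.tsum fun e => (S.lintegral_marks (S.aemeasurable_split_inner hq
    ((hg e.1 e.2).pow_const 2))).1

theorem aemeasurable_cwt {w : X → ℝ≥0} (hw : AEMeasurable w S.vol) :
    AEMeasurable (S.cwt w) S.dChain := aemeasurable_wt S.measurable_time hw

/-- The weighted integral of the squared norms of the splits. -/
theorem lintegral_splitSq {g : Marking X × S.MChain → ℝ≥0∞} {q w : X → ℝ≥0}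
    (hq : AEMeasurable q S.vol) (hw : AEMeasurable w S.vol)
    (hg : ∀ e, S.IsMarking α e → AEMeasurable (fun ϑ => g (e, ϑ)) S.dMChain) :
    ∫⁻ υ : S.Chain, S.cwt w υ * S.splitSq α g q υ.fin ∂S.dChain =
      ∫⁻ z, g z ^ 2 ∂S.coeffMeasure α (w + q) := by
  have h0 := S.lintegral_coeff (υ := α) (f := fun z => g z ^ 2) (hw.add hq)
    fun e he => (hg e he).pow_const 2
  refine Eq.trans ?_ h0.symm
  rw [lintegral_markCount]
  have hin : ∀ e : {e : Marking X // S.IsMarking α e}, AEMeasurable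
      (fun a => S.mwt w a * ∫⁻ ω, S.mwt q ω * g (e.1, un a ω) ^ 2 ∂S.dMChain) S.dMChain := fun e =>
    (S.aemeasurable_mwt hw).mul (S.aemeasurable_split_inner hq
      (f := fun ϑ => g (e.1, ϑ) ^ 2) ((hg e.1 e.2).pow_const 2))
  have h1 : ∀ᵐ υ : S.Chain ∂S.dChain, S.cwt w υ * S.splitSq α g q υ.fin =
      ∑' e : {e : Marking X // S.IsMarking α e}, ∫⁻ a, S.mwt w (S.toM a) *
        ∫⁻ ω, S.mwt q ω * g (e.1, un (S.toM a) ω) ^ 2 ∂S.dMChain ∂S.markCount υ.fin := by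
    filter_upwards [S.splitSq_eq hq hg] with υ hυ
    rw [hυ, ← ENNReal.tsum_mul_left]
    refine tsum_congr fun e => ?_
    refine (lintegral_const_mul' _ _ (wt_ne_top _ _)).symm.trans ?_
    refine lintegral_congr_ae (S.ae_markCount_iff.2 fun a ha => ?_)
    simp only
    rw [S.mwt_toM ha]
    rfl
  rw [lintegral_congr_ae h1, lintegral_tsum fun e => (S.lintegral_marks (hin e)).1]
  refine tsum_congr fun e => ?_
  rw [(S.lintegral_marks (hin e)).2]
  exact S.lintegral_unM_weight hq hw (f := fun ϑ => g (e.1, ϑ) ^ 2) ((hg e.1 e.2).pow_const 2)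

section Vector

variable {h : Type*} [NormedAddCommGroup h] [InnerProductSpace ℂ h] {ξ : Marking X × S.MChain → h}
  {p q w : X → ℝ≥0}

theorem memLp_two_iff {β : Type*} [MeasurableSpace β] {μ : Measure β} {f : β → h} :
    MemLp f 2 μ ↔ AEStronglyMeasurable f μ ∧ ∫⁻ z, ‖f z‖ₑ ^ 2 ∂μ < ∞ := by
  unfold MemLp
  rw [eLpNorm_two_eq, ENNReal.rpow_lt_top_iff_of_pos (by norm_num)]

theorem memLp_split (hq : AEMeasurable q S.vol) (hq0 : ∀ x, q x ≠ 0)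
    (hw : AEMeasurable w S.vol) (hw0 : ∀ x, w x ≠ 0)
    (hξ : MemLp ξ 2 (S.coeffMeasure α (w + q))) :
    ∀ᵐ υ ∂S.dChain, MemLp (S.split α ξ) 2 (S.coeffMeasure (α ∪ υ.fin) q) := by
  have hwq : ∀ x, (w + q) x ≠ 0 := fun x => by simp [hq0 x]
  rw [memLp_two_iff, S.aestronglyMeasurable_coeff_iff (hw.add hq) hwq] at hξ
  have h1 := S.lintegral_splitSq hq hw (g := fun z => ‖ξ z‖ₑ) fun e he => (hξ.1 e he).enorm
  have h2 := ae_lt_top' ((S.aemeasurable_cwt hw).mul (S.aemeasurable_splitSq hq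
    (g := fun z => ‖ξ z‖ₑ) fun e he => (hξ.1 e he).enorm)) (h1 ▸ hξ.2.ne)
  filter_upwards [h2, S.aestronglyMeasurable_splitPt hξ.1] with υ h3 h4
  refine memLp_two_iff.2 ⟨(S.aestronglyMeasurable_coeff_iff hq hq0).2 h4, ?_⟩
  exact ENNReal.lt_top_of_mul_ne_top_right h3.ne (wt_ne_zero hw0 υ)

theorem split_congr_ae {ξ' : Marking X × S.MChain → h}
    (hξ : ∀ e, S.IsMarking α e → ∀ᵐ ϑ ∂S.dMChain, ξ (e, ϑ) = ξ' (e, ϑ)) :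
    ∀ᵐ υ ∂S.dChain, ∀ c, S.IsMarking (α ∪ υ.fin) c → ∀ᵐ ω ∂S.dMChain,
      S.split α ξ (c, ω) = S.split α ξ' (c, ω) := S.ae_splitPt (P := fun z => ξ z = ξ' z) hξ

end Vector

end Split

end EssOrderedSpace

namespace Conf

variable {Z : Type*} [MeasurableSpace Z] {τ : Z → ℝ≥0} {μ : Measure Z} [SigmaFinite μ]

/-- The sum over the decompositions of a configuration into three parts. -/
def splitSum₂ {E : Type*} [AddCommMonoid E] (W : Conf τ × (Conf τ × Conf τ) → E) (ϑ : Conf τ) : E :=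
  splitSum (fun p => splitSum (fun p' => W (p.1, p')) p.2) ϑ

theorem ae_splits₂ (hτ : Measurable τ) (hnt : ∀ c, μ {z | τ z = c} = 0)
    {P : Conf τ × (Conf τ × Conf τ) → Prop}
    (h : ∀ᵐ q ∂(vol μ τ).prod ((vol μ τ).prod (vol μ τ)), P q) :
    ∀ᵐ ϑ ∂vol μ τ, ∀ b : Conf τ, b.fin ⊆ ϑ.fin → ∀ c : Conf τ, c.fin ⊆ (sdiff ϑ b).fin →
      P (b, (c, sdiff (sdiff ϑ b) c)) :=
  ae_splits' hτ hnt (ae_splits hτ hnt h)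

theorem splitSum₂_congr {E : Type*} [AddCommMonoid E] {W W' : Conf τ × (Conf τ × Conf τ) → E}
    {ϑ : Conf τ} (h : ∀ b : Conf τ, b.fin ⊆ ϑ.fin → ∀ c : Conf τ, c.fin ⊆ (sdiff ϑ b).fin →
      W (b, (c, sdiff (sdiff ϑ b) c)) = W' (b, (c, sdiff (sdiff ϑ b) c))) :
    splitSum₂ W ϑ = splitSum₂ W' ϑ :=
  splitSum_congr fun b hb => splitSum_congr fun c hc => h b hb c hc

theorem aemeasurable_splitSum' (hτ : Measurable τ) (hnt : ∀ c, μ {z | τ z = c} = 0)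
    {f : Conf τ × Conf τ → ℝ≥0∞} (hf : AEMeasurable f ((vol μ τ).prod (vol μ τ))) :
    AEMeasurable (splitSum f) (vol μ τ) :=
  nonsingular_unit.aemeasurable_comp (aemeasurable_splitSum hτ hnt (ν := Measure.dirac ())
    (f := fun q => f q.2) (NonsingularMap.snd.aemeasurable_comp hf))

theorem aestronglyMeasurable_splitSum' (hτ : Measurable τ) (hnt : ∀ c, μ {z | τ z = c} = 0)
    {E : Type*} [NormedAddCommGroup E]
    {f : Conf τ × Conf τ → E} (hf : AEStronglyMeasurable f ((vol μ τ).prod (vol μ τ))) :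
    AEStronglyMeasurable (splitSum f) (vol μ τ) :=
  nonsingular_unit.aestronglyMeasurable_comp (aestronglyMeasurable_splitSum hτ hnt
    (ν := Measure.dirac ()) (f := fun q => f q.2) (NonsingularMap.snd.aestronglyMeasurable_comp hf))

theorem integral_splitSum' (hτ : Measurable τ) (hnt : ∀ c, μ {z | τ z = c} = 0)
    {E : Type*} [NormedAddCommGroup E] [NormedSpace ℝ E]
    {f : Conf τ × Conf τ → E} (hf : Integrable f ((vol μ τ).prod (vol μ τ))) :
    Integrable (splitSum f) (vol μ τ) ∧
    ∫ ϑ, splitSum f ϑ ∂vol μ τ = ∫ q, f q ∂(vol μ τ).prod (vol μ τ) := by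
  have h1 : Integrable (fun q : Unit × (Conf τ × Conf τ) => f q.2)
      ((Measure.dirac ()).prod ((vol μ τ).prod (vol μ τ))) := hf.comp_snd _
  refine ⟨⟨aestronglyMeasurable_splitSum' hτ hnt hf.1, ?_⟩, ?_⟩
  · refine lt_of_le_of_lt (lintegral_mono fun ϑ => enorm_splitSum_le f ϑ) ?_
    rw [lintegral_splitSum' hτ hnt hf.1.enorm]
    exact hf.2
  · have h2 := integral_prod_splitSum hτ hnt h1
    rw [Measure.dirac_prod, Measure.dirac_prod] at h2
    have e1 : MeasurableEmbedding (Prod.mk () : Conf τ → Unit × Conf τ) :=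
      measurableEmbedding_prodMk_left ()
    have e2 : MeasurableEmbedding (Prod.mk () : Conf τ × Conf τ → Unit × (Conf τ × Conf τ)) :=
      measurableEmbedding_prodMk_left ()
    rw [e1.integral_map, e2.integral_map] at h2
    exact h2

theorem aemeasurable_splitSum₂ (hτ : Measurable τ) (hnt : ∀ c, μ {z | τ z = c} = 0)
    {W : Conf τ × (Conf τ × Conf τ) → ℝ≥0∞}
    (hW : AEMeasurable W ((vol μ τ).prod ((vol μ τ).prod (vol μ τ)))) :
    AEMeasurable (splitSum₂ W) (vol μ τ) :=
  aemeasurable_splitSum' hτ hnt (aemeasurable_splitSum hτ hnt hW)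

theorem aestronglyMeasurable_splitSum₂ (hτ : Measurable τ) (hnt : ∀ c, μ {z | τ z = c} = 0)
    {E : Type*} [NormedAddCommGroup E] {W : Conf τ × (Conf τ × Conf τ) → E}
    (hW : AEStronglyMeasurable W ((vol μ τ).prod ((vol μ τ).prod (vol μ τ)))) :
    AEStronglyMeasurable (splitSum₂ W) (vol μ τ) :=
  aestronglyMeasurable_splitSum' hτ hnt (aestronglyMeasurable_splitSum hτ hnt hW)

theorem lintegral_splitSum₂ (hτ : Measurable τ) (hnt : ∀ c, μ {z | τ z = c} = 0)
    {W : Conf τ × (Conf τ × Conf τ) → ℝ≥0∞}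
    (hW : AEMeasurable W ((vol μ τ).prod ((vol μ τ).prod (vol μ τ)))) :
    ∫⁻ ϑ, splitSum₂ W ϑ ∂vol μ τ = ∫⁻ q, W q ∂(vol μ τ).prod ((vol μ τ).prod (vol μ τ)) := by
  rw [← lintegral_prod_splitSum hτ hnt hW]
  exact lintegral_splitSum' hτ hnt (aemeasurable_splitSum hτ hnt hW)

theorem integral_splitSum₂ (hτ : Measurable τ) (hnt : ∀ c, μ {z | τ z = c} = 0)
    {E : Type*} [NormedAddCommGroup E] [NormedSpace ℝ E] {W : Conf τ × (Conf τ × Conf τ) → E}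
    (hW : Integrable W ((vol μ τ).prod ((vol μ τ).prod (vol μ τ)))) :
    Integrable (splitSum₂ W) (vol μ τ) ∧
    ∫ ϑ, splitSum₂ W ϑ ∂vol μ τ = ∫ q, W q ∂(vol μ τ).prod ((vol μ τ).prod (vol μ τ)) := by
  rw [← integral_prod_splitSum hτ hnt hW]
  exact integral_splitSum' hτ hnt (integrable_splitSum hτ hnt hW)

/-- The union of three configurations. -/
def un₃ (q : Conf τ × (Conf τ × Conf τ)) : Conf τ := un q.1 (un q.2.1 q.2.2)

theorem nonsingular_un₃ (hτ : Measurable τ) (hnt : ∀ c, μ {z | τ z = c} = 0) :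
    NonsingularMap un₃ ((vol μ τ).prod ((vol μ τ).prod (vol μ τ))) (vol μ τ) :=
  (nonsingular_un hτ hnt).comp (NonsingularMap.id.prodMap (nonsingular_un hτ hnt))

theorem un₃_sdiff {ϑ b c : Conf τ} (hb : b.fin ⊆ ϑ.fin) (hc : c.fin ⊆ (sdiff ϑ b).fin) :
    un₃ (b, (c, sdiff (sdiff ϑ b) c)) = ϑ := by
  unfold un₃
  rw [un_sdiff hc, un_sdiff hb]

theorem splitSum₂_mul {W : Conf τ × (Conf τ × Conf τ) → ℝ≥0∞} (g : Conf τ → ℝ≥0∞) (ϑ : Conf τ) :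
    g ϑ * splitSum₂ W ϑ = splitSum₂ (fun q => g (un₃ q) * W q) ϑ := by
  unfold splitSum₂ splitSum
  rw [Finset.mul_sum]
  refine Finset.sum_congr rfl fun b hb => ?_
  rw [Finset.mul_sum]
  refine Finset.sum_congr rfl fun c hc => ?_
  have h4 : g (un₃ (b, (c, sdiff (sdiff ϑ b) c))) = g ϑ :=
    congrArg g (un₃_sdiff (sdiff_subset' hb) (sdiff_subset' hc))
  exact congrArg (fun y => y * W (b, (c, sdiff (sdiff ϑ b) c))) h4.symm

theorem enorm_splitSum₂_le {E : Type*} [NormedAddCommGroup E]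
    (W : Conf τ × (Conf τ × Conf τ) → E) (ϑ : Conf τ) :
    ‖splitSum₂ W ϑ‖ₑ ≤ splitSum₂ (fun q => ‖W q‖ₑ) ϑ :=
  (enorm_splitSum_le _ _).trans (Finset.sum_le_sum fun _ _ => enorm_splitSum_le _ _)

theorem splitSum₂_mono {W W' : Conf τ × (Conf τ × Conf τ) → ℝ≥0∞} (h : ∀ q, W q ≤ W' q)
    (ϑ : Conf τ) : splitSum₂ W ϑ ≤ splitSum₂ W' ϑ :=
  Finset.sum_le_sum fun _ _ => Finset.sum_le_sum fun _ _ => h _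

theorem le_splitSum₂ (W : Conf τ × (Conf τ × Conf τ) → ℝ≥0∞) {ϑ b c : Conf τ}
    (hb : b.fin ⊆ ϑ.fin) (hc : c.fin ⊆ (sdiff ϑ b).fin) :
    W (b, (c, sdiff (sdiff ϑ b) c)) ≤ splitSum₂ W ϑ := by
  have h1 : W (b, (c, sdiff (sdiff ϑ b) c)) ≤ splitSum (fun p' => W (b, p')) (sdiff ϑ b) :=
    Finset.single_le_sum (f := fun a => W (b, (a, sdiff (sdiff ϑ b) a)))
      (fun _ _ => zero_le) (Finset.mem_powerset.2 hc)
  exact h1.trans (Finset.single_le_sum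
    (f := fun a => splitSum (fun p' => W (a, p')) (sdiff ϑ a))
      (fun _ _ => zero_le) (Finset.mem_powerset.2 hb))

end Conf

section Shuffle

variable {A B C D E : Type*} [MeasurableSpace A] [MeasurableSpace B] [MeasurableSpace C]
  [MeasurableSpace D] [MeasurableSpace E] {a : Measure A} {b : Measure B} {c : Measure C}
  {d : Measure D} {e : Measure E} [SFinite a] [SFinite b] [SFinite c] [SFinite d] [SFinite e]

theorem measurePreserving_shuffle : MeasurePreserving
    (fun p : (C × (D × E)) × (A × B) => ((p.2.1, (p.2.2, (p.1.1, p.1.2.1))), p.1.2.2))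
    ((c.prod (d.prod e)).prod (a.prod b)) ((a.prod (b.prod (c.prod d))).prod e) :=
  ((measurePreserving_prodAssoc a b (c.prod d)).prod (MeasurePreserving.id e)).comp
    (((measurePreserving_prodAssoc (a.prod b) (c.prod d) e).symm).comp
      (Measure.measurePreserving_swap.comp
        (((measurePreserving_prodAssoc c d e).symm).prod (MeasurePreserving.id (a.prod b)))))

theorem MeasurePreserving.lintegral_comp_ae {f : A → B} (hf : MeasurePreserving f a b)
    {g : B → ℝ≥0∞} (hg : AEMeasurable g b) : ∫⁻ x, g (f x) ∂a = ∫⁻ y, g y ∂b := by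
  rw [← hf.map_eq] at hg ⊢
  exact (lintegral_map' hg hf.measurable.aemeasurable).symm

theorem MeasurePreserving.integral_comp_ae {F : Type*} [NormedAddCommGroup F] [NormedSpace ℝ F]
    {f : A → B} (hf : MeasurePreserving f a b)
    {g : B → F} (hg : AEStronglyMeasurable g b) : ∫ x, g (f x) ∂a = ∫ y, g y ∂b := by
  rw [← hf.map_eq] at hg ⊢
  exact (integral_map hf.measurable.aemeasurable hg).symm

end Shuffle

section Schur

variable {C : Type*} [MeasurableSpace C] {κ : Measure C} [SFinite κ]

theorem lintegral_mul_mul_le_essSup {N A B : C → ℝ≥0∞} {σ σ' : C → ℝ≥0∞}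
    (hσ' : AEMeasurable σ' κ) (hA : AEMeasurable A κ) (hB : AEMeasurable B κ)
    (hσσ : ∀ c, σ' c * σ c = 1) :
    ∫⁻ c, N c * A c * B c ∂κ ≤ essSup (fun c => σ c * N c) κ *
      ((∫⁻ c, σ' c * A c ^ 2 ∂κ) ^ (1 / 2 : ℝ) * (∫⁻ c, σ' c * B c ^ 2 ∂κ) ^ (1 / 2 : ℝ)) := by
  have h1 : ∀ᵐ c ∂κ, N c * A c * B c ≤ essSup (fun c => σ c * N c) κ *
      ((σ' c ^ (1 / 2 : ℝ) * A c) * (σ' c ^ (1 / 2 : ℝ) * B c)) := by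
    filter_upwards [ENNReal.ae_le_essSup fun c => σ c * N c] with c hc
    calc N c * A c * B c = (σ' c * σ c) * (N c * A c * B c) := by rw [hσσ, one_mul]
      _ = (σ c * N c) * (σ' c * (A c * B c)) := by ring
      _ ≤ essSup (fun c => σ c * N c) κ * (σ' c * (A c * B c)) := by gcongr
      _ = _ := by
        rw [mul_mul_mul_comm (σ' c ^ (1 / 2 : ℝ)), ENNReal.rpow_half_mul_self]
  have hs := hσ'.pow_const (1 / 2 : ℝ)
  refine (lintegral_mono_ae h1).trans ?_
  have h5 : AEMeasurable (fun c => (σ' c ^ (1 / 2 : ℝ) * A c) * (σ' c ^ (1 / 2 : ℝ) * B c)) κ :=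
    (hs.mul hA).mul (hs.mul hB)
  rw [lintegral_const_mul'' _ h5]
  gcongr
  refine (lintegral_mul_le_sqrt (hs.mul hA) (hs.mul hB)).trans (le_of_eq ?_)
  have h2 : ∀ a b : ℝ≥0∞, (a ^ (1 / 2 : ℝ) * b) ^ 2 = a * b ^ 2 := fun a b => by
    rw [mul_pow, ENNReal.rpow_half_sq]
  exact congrArg₂ (fun a b : ℝ≥0∞ => a ^ (1 / 2 : ℝ) * b ^ (1 / 2 : ℝ))
    (lintegral_congr fun c => h2 _ _) (lintegral_congr fun c => h2 _ _)

theorem aemeasurable_essSup {Y : Type*} [MeasurableSpace Y] {ν : Measure Y} [SFinite ν]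
    {f : Y × C → ℝ≥0∞} (hf : AEMeasurable f (ν.prod κ)) :
    AEMeasurable (fun y => essSup (fun c => f (y, c)) κ) ν := by
  have h1 : (fun y => essSup (fun c => f (y, c)) κ) =ᵐ[ν]
      fun y => essSup (fun c => hf.mk f (y, c)) κ := by
    filter_upwards [Measure.ae_ae_of_ae_prod hf.ae_eq_mk] with y hy using essSup_congr_ae hy
  refine AEMeasurable.congr (Measurable.aemeasurable ?_) h1.symm
  refine measurable_of_Ioi fun a => ?_
  have h2 : (fun y => essSup (fun c => hf.mk f (y, c)) κ) ⁻¹' Set.Ioi a =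
      {y | κ (Prod.mk y ⁻¹' {p | a < hf.mk f p}) ≠ 0} := by
    ext y
    simp only [Set.mem_preimage, Set.mem_Ioi, Set.mem_ofPred_eq]
    rw [← not_le, not_iff_not]
    constructor
    · intro h
      have h3 : ∀ᵐ c ∂κ, hf.mk f (y, c) ≤ a :=
        (ENNReal.ae_le_essSup fun c => hf.mk f (y, c)).mono fun c hc => hc.trans h
      rw [ae_iff] at h3
      simpa using h3
    · intro h
      refine essSup_le_of_ae_le a ?_
      rw [Filter.EventuallyLE, ae_iff]
      simpa using h
  rw [h2]
  have h3 : MeasurableSet {p | a < hf.mk f p} :=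
    measurableSet_lt measurable_const hf.measurable_mk
  exact (measurable_measure_prodMk_left h3 (measurableSet_singleton 0)).compl

/-- The Schur test for kernels on tables. -/
theorem lintegral_table_le {N : C × (C × (C × C)) → ℝ≥0∞} {A B : C × C → ℝ≥0∞}
    {σ σ' ρ ρ' : C → ℝ≥0∞}
    (hN : AEMeasurable N (κ.prod (κ.prod (κ.prod κ))))
    (hA : AEMeasurable A (κ.prod κ)) (hB : AEMeasurable B (κ.prod κ))
    (hσ : AEMeasurable σ κ) (hσ' : AEMeasurable σ' κ) (hσσ : ∀ c, σ' c * σ c = 1)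
    (hρ : AEMeasurable ρ κ) (hρ' : AEMeasurable ρ' κ) (hρρ : ∀ c, ρ' c * ρ c = 1) :
    ∫⁻ z, N z * B (z.2.1, z.2.2.2) * A (z.2.2.1, z.2.2.2) ∂κ.prod (κ.prod (κ.prod κ)) ≤
      (∫⁻ mp, (∫⁻ cp, ∫⁻ mc, essSup (fun cc => σ cc * N (mp, mc, cp, cc)) κ ^ 2 *
        (ρ cp * ρ mc) ∂κ ∂κ) ^ (1 / 2 : ℝ) ∂κ) *
      ((∫⁻ z, ρ' z.1 * (σ' z.2 * B z ^ 2) ∂κ.prod κ) ^ (1 / 2 : ℝ) *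
        (∫⁻ z, ρ' z.1 * (σ' z.2 * A z ^ 2) ∂κ.prod κ) ^ (1 / 2 : ℝ)) := by
  have hBz : AEMeasurable (fun z : C × (C × (C × C)) => B (z.2.1, z.2.2.2))
      (κ.prod (κ.prod (κ.prod κ))) :=
    ((NonsingularMap.id.prodMap NonsingularMap.snd).comp NonsingularMap.snd).aemeasurable_comp hB
  have hAz : AEMeasurable (fun z : C × (C × (C × C)) => A (z.2.2.1, z.2.2.2))
      (κ.prod (κ.prod (κ.prod κ))) :=
    (NonsingularMap.snd.comp NonsingularMap.snd).aemeasurable_comp hA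
  have hint : AEMeasurable (fun z : C × (C × (C × C)) =>
      N z * B (z.2.1, z.2.2.2) * A (z.2.2.1, z.2.2.2)) (κ.prod (κ.prod (κ.prod κ))) :=
    (hN.mul hBz).mul hAz
  let b : C → ℝ≥0∞ := fun mc => ∫⁻ cc, σ' cc * B (mc, cc) ^ 2 ∂κ
  let a : C → ℝ≥0∞ := fun cp => ∫⁻ cc, σ' cc * A (cp, cc) ^ 2 ∂κ
  have hb : AEMeasurable b κ := AEMeasurable.lintegral_prod_right'
    (f := fun z : C × C => σ' z.2 * B z ^ 2)
    ((NonsingularMap.snd.aemeasurable_comp hσ').mul (hB.pow_const 2))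
  have ha : AEMeasurable a κ := AEMeasurable.lintegral_prod_right'
    (f := fun z : C × C => σ' z.2 * A z ^ 2)
    ((NonsingularMap.snd.aemeasurable_comp hσ').mul (hA.pow_const 2))
  let J : C × (C × C) → ℝ≥0∞ := fun y => essSup (fun cc => σ cc * N (y.1, y.2.1, y.2.2, cc)) κ
  have hJ : AEMeasurable J (κ.prod (κ.prod κ)) := by
    refine aemeasurable_essSup (f := fun z : (C × (C × C)) × C =>
      σ z.2 * N (z.1.1, z.1.2.1, z.1.2.2, z.2)) ?_
    refine (NonsingularMap.snd.aemeasurable_comp hσ).mul ?_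
    exact ((NonsingularMap.id.prodMap NonsingularMap.assoc).comp
      NonsingularMap.assoc).aemeasurable_comp hN
  rw [lintegral_prod _ hint, ← lintegral_mul_const'']
  swap
  · have h1 : AEMeasurable (fun y : C × (C × C) => J (y.1, y.2.2, y.2.1) ^ 2 *
        (ρ y.2.1 * ρ y.2.2)) (κ.prod (κ.prod κ)) :=
      (((NonsingularMap.id.prodMap NonsingularMap.swap).aemeasurable_comp hJ).pow_const 2).mul
        (((NonsingularMap.fst.comp NonsingularMap.snd).aemeasurable_comp hρ).mul
          ((NonsingularMap.snd.comp NonsingularMap.snd).aemeasurable_comp hρ))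
    have h2 : AEMeasurable (fun mp => ∫⁻ y, J (mp, y.2, y.1) ^ 2 * (ρ y.1 * ρ y.2) ∂κ.prod κ) κ :=
      h1.lintegral_prod_right'
    have h3 : (fun mp => ∫⁻ y, J (mp, y.2, y.1) ^ 2 * (ρ y.1 * ρ y.2) ∂κ.prod κ) =ᵐ[κ]
        fun mp => ∫⁻ cp, ∫⁻ mc, essSup (fun cc => σ cc * N (mp, mc, cp, cc)) κ ^ 2 *
          (ρ cp * ρ mc) ∂κ ∂κ := by
      have h4 := h1.aestronglyMeasurable.prodMk_left
      filter_upwards [h4] with mp h5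
      rw [lintegral_prod _ h5.aemeasurable]
    exact (h2.congr h3).pow_const _
  refine lintegral_mono_ae ?_
  filter_upwards [hint.aestronglyMeasurable.prodMk_left, hN.aestronglyMeasurable.prodMk_left,
    hJ.aestronglyMeasurable.prodMk_left] with mp h1 h2 h3
  have h2' : AEMeasurable (fun y : C × (C × C) => N (mp, y)) (κ.prod (κ.prod κ)) := h2.aemeasurable
  have h3' : AEMeasurable (fun y : C × C => J (mp, y)) (κ.prod κ) := h3.aemeasurable
  have e1 : ∫⁻ y, N (mp, y) * B (y.1, y.2.2) * A (y.2.1, y.2.2) ∂κ.prod (κ.prod κ) =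
      ∫⁻ y : C × C, ∫⁻ cc, N (mp, y.1, y.2, cc) * B (y.1, cc) * A (y.2, cc) ∂κ ∂κ.prod κ := by
    have h5 := MeasurePreserving.lintegral_comp_ae (measurePreserving_prodAssoc κ κ κ)
      h1.aemeasurable
    rw [← h5, lintegral_prod]
    · rfl
    · exact NonsingularMap.assoc.aemeasurable_comp h1.aemeasurable
  refine e1.le.trans ?_
  have e2 : ∀ᵐ y : C × C ∂κ.prod κ,
      ∫⁻ cc, N (mp, y.1, y.2, cc) * B (y.1, cc) * A (y.2, cc) ∂κ ≤
        J (mp, y) * (b y.1 ^ (1 / 2 : ℝ) * a y.2 ^ (1 / 2 : ℝ)) := by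
    filter_upwards [NonsingularMap.fst.ae (f := Prod.fst) hB.aestronglyMeasurable.prodMk_left,
      NonsingularMap.snd.ae (f := Prod.snd) hA.aestronglyMeasurable.prodMk_left] with y h6 h7
    exact lintegral_mul_mul_le_essSup hσ' h6.aemeasurable h7.aemeasurable hσσ
  refine (lintegral_mono_ae e2).trans ?_
  have hmr : AEMeasurable (fun y : C × C => ρ y.1 * ρ y.2) (κ.prod κ) :=
    (NonsingularMap.fst.aemeasurable_comp hρ).mul (NonsingularMap.snd.aemeasurable_comp hρ)
  have hmr' : AEMeasurable (fun y : C × C => ρ' y.1 * ρ' y.2) (κ.prod κ) :=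
    (NonsingularMap.fst.aemeasurable_comp hρ').mul (NonsingularMap.snd.aemeasurable_comp hρ')
  have hbs : AEMeasurable (fun y : C × C => b y.1 ^ (1 / 2 : ℝ) * a y.2 ^ (1 / 2 : ℝ))
      (κ.prod κ) :=
    (NonsingularMap.fst.aemeasurable_comp (hb.pow_const _)).mul
      (NonsingularMap.snd.aemeasurable_comp (ha.pow_const _))
  have e3 : ∀ y : C × C, J (mp, y) * (b y.1 ^ (1 / 2 : ℝ) * a y.2 ^ (1 / 2 : ℝ)) =
      ((ρ y.1 * ρ y.2) ^ (1 / 2 : ℝ) * J (mp, y)) *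
        ((ρ' y.1 * ρ' y.2) ^ (1 / 2 : ℝ) * (b y.1 ^ (1 / 2 : ℝ) * a y.2 ^ (1 / 2 : ℝ))) := by
    intro y
    rw [mul_mul_mul_comm ((ρ y.1 * ρ y.2) ^ (1 / 2 : ℝ)), ← ENNReal.mul_rpow_of_nonneg
      (ρ y.1 * ρ y.2) _ (by norm_num : (0 : ℝ) ≤ 1 / 2)]
    have : ρ y.1 * ρ y.2 * (ρ' y.1 * ρ' y.2) = (ρ' y.1 * ρ y.1) * (ρ' y.2 * ρ y.2) := by ring
    rw [this, hρρ, hρρ]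
    simp
  rw [lintegral_congr e3]
  refine (lintegral_mul_le_sqrt ((hmr.pow_const _).mul h3')
    ((hmr'.pow_const _).mul hbs)).trans (le_of_eq ?_)
  have e4 : ∫⁻ y : C × C, ((ρ y.1 * ρ y.2) ^ (1 / 2 : ℝ) * J (mp, y)) ^ 2 ∂κ.prod κ =
      ∫⁻ cp, ∫⁻ mc, essSup (fun cc => σ cc * N (mp, mc, cp, cc)) κ ^ 2 *
        (ρ cp * ρ mc) ∂κ ∂κ := by
    have h9 : AEMeasurable (fun y : C × C => ((ρ y.1 * ρ y.2) ^ (1 / 2 : ℝ) * J (mp, y)) ^ 2)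
        (κ.prod κ) := ((hmr.pow_const _).mul h3').pow_const 2
    rw [lintegral_prod_symm _ h9]
    refine lintegral_congr fun cp => lintegral_congr fun mc => ?_
    rw [mul_pow, ENNReal.rpow_half_sq, mul_comm, mul_comm (ρ cp)]
  have e5 : ∫⁻ y : C × C, ((ρ' y.1 * ρ' y.2) ^ (1 / 2 : ℝ) *
      (b y.1 ^ (1 / 2 : ℝ) * a y.2 ^ (1 / 2 : ℝ))) ^ 2 ∂κ.prod κ =
      (∫⁻ mc, ρ' mc * b mc ∂κ) * ∫⁻ cp, ρ' cp * a cp ∂κ := by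
    rw [← lintegral_prod_mul (f := fun x => ρ' x * b x) (g := fun x => ρ' x * a x)
      (hρ'.mul hb) (hρ'.mul ha)]
    refine lintegral_congr fun y => ?_
    rw [mul_pow, mul_pow, ENNReal.rpow_half_sq, ENNReal.rpow_half_sq, ENNReal.rpow_half_sq,
      mul_mul_mul_comm]
  have e6 : ∀ {G : C × C → ℝ≥0∞}, AEMeasurable G (κ.prod κ) →
      ∫⁻ z, ρ' z.1 * (σ' z.2 * G z ^ 2) ∂κ.prod κ =
        ∫⁻ x, ρ' x * ∫⁻ cc, σ' cc * G (x, cc) ^ 2 ∂κ ∂κ := by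
    intro G hG
    have h8 : AEMeasurable (fun z : C × C => σ' z.2 * G z ^ 2) (κ.prod κ) :=
      (NonsingularMap.snd.aemeasurable_comp hσ').mul (hG.pow_const 2)
    have h9 : AEMeasurable (fun z : C × C => ρ' z.1 * (σ' z.2 * G z ^ 2)) (κ.prod κ) :=
      (NonsingularMap.fst.aemeasurable_comp hρ').mul h8
    rw [lintegral_prod _ h9]
    refine lintegral_congr_ae ?_
    filter_upwards [h8.aestronglyMeasurable.prodMk_left] with x hx
    exact lintegral_const_mul'' _ hx.aemeasurable
  rw [e6 hA, e6 hB]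
  have e7 : ∀ u v : ℝ≥0∞, (u * v) ^ (1 / 2 : ℝ) = u ^ (1 / 2 : ℝ) * v ^ (1 / 2 : ℝ) :=
    fun u v => ENNReal.mul_rpow_of_nonneg _ _ (by norm_num)
  refine congrArg₂ (fun u v : ℝ≥0∞ => u * v) (congrArg (fun u : ℝ≥0∞ => u ^ (1 / 2 : ℝ)) e4) ?_
  exact (congrArg (fun u : ℝ≥0∞ => u ^ (1 / 2 : ℝ)) e5).trans (e7 _ _)

end Schur

section Rot

variable {A B C D : Type*} [MeasurableSpace A] [MeasurableSpace B] [MeasurableSpace C]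
  [MeasurableSpace D] {a : Measure A} {b : Measure B} {c : Measure C}
  {d : Measure D} [SFinite a] [SFinite b] [SFinite c] [SFinite d]

theorem measurePreserving_assoc₃ : MeasurePreserving
    (fun p : (A × (B × C)) × D => (p.1.1, (p.1.2.1, (p.1.2.2, p.2))))
    ((a.prod (b.prod c)).prod d) (a.prod (b.prod (c.prod d))) :=
  ((MeasurePreserving.id a).prod (measurePreserving_prodAssoc b c d)).comp
    (measurePreserving_prodAssoc a (b.prod c) d)

theorem measurePreserving_assoc₃_symm : MeasurePreserving
    (fun p : A × (B × (C × D)) => ((p.1, (p.2.1, p.2.2.1)), p.2.2.2))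
    (a.prod (b.prod (c.prod d))) ((a.prod (b.prod c)).prod d) :=
  ((measurePreserving_prodAssoc a (b.prod c) d).symm).comp
    ((MeasurePreserving.id a).prod ((measurePreserving_prodAssoc b c d).symm))

theorem measurePreserving_swap_last : MeasurePreserving
    (fun p : (A × (B × D)) × C => ((p.1.1, (p.1.2.1, p.2)), p.1.2.2))
    ((a.prod (b.prod d)).prod c) ((a.prod (b.prod c)).prod d) :=
  measurePreserving_assoc₃_symm.comp (((MeasurePreserving.id a).prod
    ((MeasurePreserving.id b).prod Measure.measurePreserving_swap)).comp
      measurePreserving_assoc₃)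

theorem MeasureTheory.MeasurePreserving.nonsingular {f : A → B} (hf : MeasurePreserving f a b) :
    NonsingularMap f a b := .of_quasi hf.quasiMeasurePreserving

theorem MeasurePreserving.integrable_comp_ae {F : Type*} [NormedAddCommGroup F]
    {f : A → B} (hf : MeasurePreserving f a b) {g : B → F} (hg : Integrable g b) :
    Integrable (fun x => g (f x)) a := by
  rw [← hf.map_eq] at hg
  exact hg.comp_measurable hf.measurable

end Rot

theorem ae_eq_of_ae_ae_eq {A B E : Type*} [MeasurableSpace A] [MeasurableSpace B]
    {a : Measure A} {b : Measure B} [SFinite b] [NormedAddCommGroup E] {f g : A × B → E}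
    (hf : AEStronglyMeasurable f (a.prod b)) (hg : AEStronglyMeasurable g (a.prod b))
    (h : ∀ᵐ x ∂a, ∀ᵐ y ∂b, f (x, y) = g (x, y)) : f =ᵐ[a.prod b] g := by
  have h1 : ∀ᵐ p ∂a.prod b, hf.mk f p = hg.mk g p := by
    rw [Measure.ae_prod_iff_ae_ae
      (hf.stronglyMeasurable_mk.measurableSet_eq_fun hg.stronglyMeasurable_mk)]
    filter_upwards [h, Measure.ae_ae_of_ae_prod hf.ae_eq_mk,
      Measure.ae_ae_of_ae_prod hg.ae_eq_mk] with x h2 h3 h4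
    filter_upwards [h2, h3, h4] with y h5 h6 h7
    rw [← h6, ← h7, h5]
  filter_upwards [h1, hf.ae_eq_mk, hg.ae_eq_mk] with p h2 h3 h4
  rw [h3, h4, h2]

namespace MultiIntegrand

open Conf EssOrderedSpace

variable {X : Type*} [MeasurableSpace X] (S : EssOrderedSpace X)

/-- The base of tables with marked out-parts. -/
abbrev Base : Type _ := S.Chain × S.Chain × S.MChain × S.MChain

/-- Tables of chains. -/
abbrev Tables : Type _ := S.Chain × S.Chain × S.Chain × S.Chain

instance : SFinite (baseMeasure S) := by unfold baseMeasure; infer_instance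

instance : SFinite (tableMeasure S) := by unfold tableMeasure; infer_instance

/-- The underlying table of chains. -/
def outT (z : Base S) : Tables S := (z.1, z.2.1, S.pos z.2.2.2, S.pos z.2.2.1)

theorem toTable_outT (z : Base S) : toTable (outT S z) = outTable z := rfl

theorem nonsingular_outT : NonsingularMap (outT S) (baseMeasure S) (tableMeasure S) :=
  NonsingularMap.id.prodMap (NonsingularMap.id.prodMap
    ((S.nonsingular_pos.prodMap S.nonsingular_pos).comp NonsingularMap.swap))

section Marks

theorem ae_base_marks {P : Base S → Prop} (h : ∀ᵐ z ∂baseMeasure S, P z) :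
    ∀ᵐ u ∂tableMeasure S, ∀ b, S.IsMarking u.2.2.2.fin b → ∀ c, S.IsMarking u.2.2.1.fin c →
      P (u.1, u.2.1, S.toM b, S.toM c) := by
  have h1 := S.ae_marks (measurePreserving_assoc₃.nonsingular.ae h)
  have h2 := S.ae_marks (measurePreserving_swap_last.nonsingular.ae h1)
  exact (measurePreserving_assoc₃_symm.nonsingular.ae h2).mono fun u hu b hb c hc => hu b hb c hc

theorem lintegral_base_marks {H : Base S → ℝ≥0∞} (hH : AEMeasurable H (baseMeasure S)) :
    AEMeasurable (fun u : Tables S => ∫⁻ b, ∫⁻ c, H (u.1, u.2.1, S.toM b, S.toM c)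
      ∂S.markCount u.2.2.1.fin ∂S.markCount u.2.2.2.fin) (tableMeasure S) ∧
    ∫⁻ u : Tables S, ∫⁻ b, ∫⁻ c, H (u.1, u.2.1, S.toM b, S.toM c)
      ∂S.markCount u.2.2.1.fin ∂S.markCount u.2.2.2.fin ∂tableMeasure S =
      ∫⁻ z, H z ∂baseMeasure S := by
  have e1 : MeasurePreserving _ _ (baseMeasure S) := measurePreserving_assoc₃ (a := S.dChain)
    (b := S.dChain) (c := S.dMChain) (d := S.dMChain)
  have h1 := S.aemeasurable_marks (e1.nonsingular.aemeasurable_comp hH)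
  have e2 := measurePreserving_swap_last (a := S.dChain) (b := S.dChain) (c := S.dMChain)
    (d := S.dChain)
  have h2 := S.aemeasurable_marks (e2.nonsingular.aemeasurable_comp h1.1)
  have e3 : MeasurePreserving _ (tableMeasure S) _ := measurePreserving_assoc₃_symm
    (a := S.dChain) (b := S.dChain) (c := S.dChain) (d := S.dChain)
  refine ⟨e3.nonsingular.aemeasurable_comp h2.1, ?_⟩
  refine (MeasurePreserving.lintegral_comp_ae e3 h2.1).trans (h2.2.trans ?_)
  refine (MeasurePreserving.lintegral_comp_ae e2 h1.1).trans (h1.2.trans ?_)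
  exact MeasurePreserving.lintegral_comp_ae e1 hH

theorem integral_base_marks {E : Type*} [NormedAddCommGroup E] [NormedSpace ℝ E] {H : Base S → E}
    (hH : Integrable H (baseMeasure S)) :
    ∫ u : Tables S, ∫ b, ∫ c, H (u.1, u.2.1, S.toM b, S.toM c)
      ∂S.markCount u.2.2.1.fin ∂S.markCount u.2.2.2.fin ∂tableMeasure S =
      ∫ z, H z ∂baseMeasure S := by
  have e1 : MeasurePreserving _ _ (baseMeasure S) := measurePreserving_assoc₃ (a := S.dChain)
    (b := S.dChain) (c := S.dMChain) (d := S.dMChain)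
  have h1 := S.integral_marks (MeasurePreserving.integrable_comp_ae e1 hH)
  have e2 := measurePreserving_swap_last (a := S.dChain) (b := S.dChain) (c := S.dMChain)
    (d := S.dChain)
  have h2 := S.integral_marks (MeasurePreserving.integrable_comp_ae e2 h1.1)
  have e3 : MeasurePreserving _ (tableMeasure S) _ := measurePreserving_assoc₃_symm
    (a := S.dChain) (b := S.dChain) (c := S.dChain) (d := S.dChain)
  refine (MeasurePreserving.integral_comp_ae e3 h2.1.1).trans (h2.2.trans ?_)
  refine (MeasurePreserving.integral_comp_ae e2 h1.1.1).trans (h1.2.trans ?_)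
  exact MeasurePreserving.integral_comp_ae e1 hH.1

end Marks

/-- The in-part of a table of chains. -/
def inC (u : Tables S) : S.Chain := un u.2.1 u.2.2.2

/-- The out-part of a table of chains. -/
def outC (u : Tables S) : S.Chain := un u.2.2.1 u.2.2.2

theorem nonsingular_inC : NonsingularMap (inC S) (tableMeasure S) S.dChain :=
  S.nonsingular_unC.comp ((NonsingularMap.id.prodMap NonsingularMap.snd).comp NonsingularMap.snd)

theorem nonsingular_outC : NonsingularMap (outC S) (tableMeasure S) S.dChain :=
  S.nonsingular_unC.comp (NonsingularMap.snd.comp NonsingularMap.snd)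

open Classical in
theorem union_inp (u : Tables S) (B : Table X) :
    ((toTable u).union B).inp = B.inp ∪ (inC S u).fin := by
  ext x
  simp only [Table.inp, Table.union, Finset.mem_union, inC, mem_fin_un]
  change ((x ∈ u.2.1.fin ∨ _) ∨ (x ∈ u.2.2.2.fin ∨ _)) ↔ _
  tauto

open Classical in
theorem union_out (u : Tables S) (B : Table X) :
    ((toTable u).union B).out = B.out ∪ (outC S u).fin := by
  ext x
  simp only [Table.out, Table.union, Finset.mem_union, outC, mem_fin_un]
  change ((x ∈ u.2.2.1.fin ∨ _) ∨ (x ∈ u.2.2.2.fin ∨ _)) ↔ _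
  tauto

theorem join_eq (d b c : Marking X) : join (mpts d) (mpts b) (mpts c) = markUn d (markUn b c) := by
  classical
  refine marking_ext fun y => ?_
  rw [mem_markUn, mem_markUn, ← or_assoc]
  exact Finset.mem_union.trans (or_congr Finset.mem_union Iff.rfl)

theorem ae_tables_disjoint (α : Finset X) : ∀ᵐ u ∂tableMeasure S,
    Disjoint u.2.2.2.fin u.2.2.1.fin ∧ Disjoint α (outC S u).fin := by
  have h1 : ∀ᵐ u ∂tableMeasure S, ∀ x ∈ u.2.2.1.fin, ∀ y ∈ u.2.2.2.fin, S.time x ≠ S.time y :=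
    (NonsingularMap.snd.comp NonsingularMap.snd).ae
      (ae_prod_vol_ne S.measurable_time S.vol_time_eq)
  filter_upwards [h1, (nonsingular_outC S).ae (S.ae_chain_disjoint α)] with u h2 h3
  refine ⟨Finset.disjoint_left.2 fun x hx hx' => h2 x hx' x hx rfl, h3⟩

theorem outC_fin [DecidableEq X] (u : Tables S) :
    (outC S u).fin = u.2.2.2.fin ∪ u.2.2.1.fin := by
  ext x
  rw [Finset.mem_union, or_comm]
  exact mem_fin_un

open Classical in
/-- The integral of a kernel against a nonnegative function, estimated through the tables. -/
theorem lintegral_marked_le {α : Finset X} {q : X → ℝ≥0} (hq : AEMeasurable q S.vol)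
    (hq0 : ∀ x, q x ≠ 0) {Φ : Marking X → Base S × S.MChain → ℝ≥0∞}
    (hΦ : ∀ d, S.IsMarking α d → AEMeasurable (Φ d) ((baseMeasure S).prod S.dMChain))
    {g : Marking X × S.MChain → ℝ≥0∞}
    (hg : ∀ d, S.IsMarking α d → AEMeasurable (fun ϑ => g (d, ϑ)) S.dMChain)
    {E : Tables S → ℝ≥0∞}
    (hR : ∀ᵐ u ∂tableMeasure S, ∃ R : Marking X × S.MChain → ℝ≥0∞,
      (∀ k, S.IsMarking (α ∪ (outC S u).fin) k → AEMeasurable (fun ω => R (k, ω)) S.dMChain) ∧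
      (∀ d, S.IsMarking α d → ∀ b, S.IsMarking u.2.2.2.fin b → ∀ c, S.IsMarking u.2.2.1.fin c →
        ∀ᵐ ω ∂S.dMChain, Φ d ((u.1, u.2.1, S.toM b, S.toM c), ω) = R (join d b c, ω)) ∧
      (∫⁻ z, R z ^ 2 ∂S.coeffMeasure (α ∪ (outC S u).fin) q⁻¹) ^ (1 / 2 : ℝ) ≤ E u) :
    ∫⁻ d, ∫⁻ p, g (d, un₃ (p.1.2.2.1, (p.1.2.2.2, p.2))) * Φ d p
        ∂(baseMeasure S).prod S.dMChain ∂S.markCount α ≤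
      ∫⁻ u, E u * (S.splitSq α g q (outC S u).fin) ^ (1 / 2 : ℝ) ∂tableMeasure S := by
  have hun : NonsingularMap (fun p : Base S × S.MChain => un₃ (p.1.2.2.1, (p.1.2.2.2, p.2)))
      ((baseMeasure S).prod S.dMChain) S.dMChain :=
    (nonsingular_un₃ S.measurable_mtime S.markedVol_time_eq).comp (NonsingularMap.assoc.comp
      ((NonsingularMap.snd.comp NonsingularMap.snd).prodMap NonsingularMap.id))
  have hint : ∀ d, S.IsMarking α d → AEMeasurable (fun p : Base S × S.MChain =>
      g (d, un₃ (p.1.2.2.1, (p.1.2.2.2, p.2))) * Φ d p) ((baseMeasure S).prod S.dMChain) :=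
    fun d hd => (hun.aemeasurable_comp (hg d hd)).mul (hΦ d hd)
  let H : Marking X → Base S → ℝ≥0∞ := fun d z =>
    ∫⁻ ω, g (d, un₃ (z.2.2.1, (z.2.2.2, ω))) * Φ d (z, ω) ∂S.dMChain
  have hH : ∀ d, S.IsMarking α d → AEMeasurable (H d) (baseMeasure S) := fun d hd =>
    (hint d hd).lintegral_prod_right'
  rw [lintegral_markCount]
  have h1 : ∀ d : {a : Marking X // S.IsMarking α a},
      ∫⁻ p, g (d.1, un₃ (p.1.2.2.1, (p.1.2.2.2, p.2))) * Φ d.1 p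
        ∂(baseMeasure S).prod S.dMChain =
      ∫⁻ u : Tables S, ∫⁻ b, ∫⁻ c, H d.1 (u.1, u.2.1, S.toM b, S.toM c)
        ∂S.markCount u.2.2.1.fin ∂S.markCount u.2.2.2.fin ∂tableMeasure S := fun d => by
    rw [lintegral_prod _ (hint d.1 d.2), (lintegral_base_marks S (hH d.1 d.2)).2]
  refine (tsum_congr h1).trans_le ?_
  refine (lintegral_tsum fun d : {a : Marking X // S.IsMarking α a} =>
    (lintegral_base_marks S (hH d.1 d.2)).1).symm.trans_le ?_
  refine lintegral_mono_ae ?_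
  filter_upwards [hR, ae_tables_disjoint S α,
    (nonsingular_outC S).ae (S.aemeasurable_splitPt hg)] with u ⟨R, hR1, hR2, hR3⟩ hd hgs
  have h2 : ∑' d : {a : Marking X // S.IsMarking α a}, ∫⁻ b, ∫⁻ c,
      H d.1 (u.1, u.2.1, S.toM b, S.toM c) ∂S.markCount u.2.2.1.fin ∂S.markCount u.2.2.2.fin =
      ∫⁻ z, g (S.splitPt α z) * R z ∂(S.markCount (α ∪ (outC S u).fin)).prod S.dMChain := by
    rw [lintegral_markProd, S.lintegral_markCount_union hd.2, lintegral_markCount]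
    refine tsum_congr fun d => ?_
    rw [outC_fin, S.lintegral_markCount_union hd.1]
    refine lintegral_congr_ae (S.ae_markCount_iff.2 fun b hb => ?_)
    refine lintegral_congr_ae (S.ae_markCount_iff.2 fun c hc => ?_)
    refine lintegral_congr_ae ((hR2 d.1 d.2 b hb c hc).mono fun ω hω => ?_)
    have h3 : S.IsMarking (outC S u).fin (markUn b c) := by
      rw [outC_fin]; exact S.isMarking_markUn hd.1 hb hc
    have h4 := S.splitPt_markUn' hd.2 d.2 h3 ω
    have h5 : un (S.toM (markUn b c)) ω = un₃ (S.toM b, (S.toM c, ω)) := by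
      refine conf_ext fun y => ?_
      unfold un₃
      rw [mem_fin_un, mem_fin_un, mem_fin_un, ← or_assoc]
      exact or_congr mem_markUn Iff.rfl
    have h6 : (join d.1 b c : Marking X) = markUn d.1 (markUn b c) := join_eq d.1 b c
    rw [h5] at h4
    refine congrArg₂ (fun x y : ℝ≥0∞ => x * y) (congrArg g h4.symm) ?_
    rw [h6] at hω
    exact hω
  rw [h2]
  have hD := (S.dualWeightT (α ∪ (outC S u).fin) hq hq0).lintegral_mul_le
    (f := fun z => g (S.splitPt α z)) (g := R) (S.aemeasurable_markProd_iff.2 hgs)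
    (S.aemeasurable_markProd_iff.2 hR1)
  refine hD.trans ?_
  rw [mul_comm]
  gcongr
  exact le_rfl

end MultiIntegrand

namespace EssOrderedSpace

open Conf

variable {X : Type*} [MeasurableSpace X] (S : EssOrderedSpace X)
  {h : Type*} [NormedAddCommGroup h] [InnerProductSpace ℂ h]

theorem coeffMeasure_mono {q q' : X → ℝ≥0} (hqq : q ≤ q') (υ : Finset X) :
    S.coeffMeasure υ q ≤ S.coeffMeasure υ q' := by
  unfold coeffMeasure
  rw [markCount_prod_eq_sum, markCount_prod_eq_sum]
  refine Measure.le_iff.2 fun s hs => ?_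
  rw [Measure.sum_apply _ hs, Measure.sum_apply _ hs]
  exact ENNReal.tsum_le_tsum fun a =>
    Measure.map_mono (S.weighted_mono hqq) measurable_prodMk_left s

theorem lintegral_unC_weight {v w : X → ℝ≥0} (hv : AEMeasurable v S.vol)
    (hw : AEMeasurable w S.vol) {f : S.Chain → ℝ≥0∞} (hf : AEMeasurable f S.dChain) :
    ∫⁻ p, S.cwt v p.1 * (S.cwt w p.2 * f (un p.1 p.2)) ∂S.dChain.prod S.dChain =
      ∫⁻ υ, S.cwt (v + w) υ * f υ ∂S.dChain := by
  have hF : AEMeasurable (fun p : S.Chain × S.Chain =>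
      S.cwt v p.1 * (S.cwt w p.2 * f (un p.1 p.2))) (S.dChain.prod S.dChain) :=
    (NonsingularMap.fst.aemeasurable_comp (S.aemeasurable_cwt hv)).mul
      ((NonsingularMap.snd.aemeasurable_comp (S.aemeasurable_cwt hw)).mul
        (S.nonsingular_unC.aemeasurable_comp hf))
  have h1 := lintegral_splitSum' S.measurable_time S.vol_time_eq hF
  have h2 : ∀ ϑ : S.Chain, splitSum (fun p : S.Chain × S.Chain =>
      S.cwt v p.1 * (S.cwt w p.2 * f (un p.1 p.2))) ϑ = S.cwt (v + w) ϑ * f ϑ := by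
    intro ϑ
    have h3 : S.cwt (v + w) ϑ = splitSum (fun p => S.cwt v p.1 * S.cwt w p.2) ϑ :=
      (splitSum_wt (τ := S.time) v w ϑ).symm
    rw [h3]
    unfold splitSum
    rw [Finset.sum_mul]
    refine Finset.sum_congr rfl fun a ha => ?_
    have h4 : f (un a (sdiff ϑ a)) = f ϑ := congrArg f (un_sdiff (sdiff_subset' ha))
    rw [mul_assoc]
    exact congrArg (fun c => S.cwt v a * (S.cwt w (sdiff ϑ a) * c)) h4
  rw [← lintegral_congr h2]
  exact h1.symm

theorem cwt_inv_mul {r : X → ℝ≥0} (hr : ∀ x, r x ≠ 0) (υ : S.Chain) :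
    S.cwt r⁻¹ υ * S.cwt r υ = 1 := by
  unfold cwt
  rw [← wt_mul]
  have : r⁻¹ * r = 1 := funext fun x => inv_mul_cancel₀ (hr x)
  rw [this]
  simp [wt]

section App

variable {υ υ' : Finset X} {q q' : X → ℝ≥0} (A : S.GT h υ q →L[ℂ] S.GT h υ' q')
  {f g : Marking X × S.MChain → h}

theorem app_of_memLp (hf : MemLp f 2 (S.coeffMeasure υ q)) : S.app A f = A hf.toLp :=
  dif_pos hf

theorem app_congr (hfg : f =ᵐ[S.coeffMeasure υ q] g) : S.app A f = S.app A g := by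
  by_cases hf : MemLp f 2 (S.coeffMeasure υ q)
  · have hg := (memLp_congr_ae hfg).1 hf
    rw [app_of_memLp S A hf, app_of_memLp S A hg,
      (MemLp.toLp_eq_toLp_iff hf hg).2 hfg]
  · have hg : ¬ MemLp g 2 (S.coeffMeasure υ q) := fun hg => hf ((memLp_congr_ae hfg).2 hg)
    unfold app
    rw [dif_neg hf, dif_neg hg]

theorem eLpNorm_app_le : eLpNorm (S.app A f) 2 (S.coeffMeasure υ' q') ≤
    ‖A‖ₑ * eLpNorm f 2 (S.coeffMeasure υ q) := by
  by_cases hf : MemLp f 2 (S.coeffMeasure υ q)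
  · rw [app_of_memLp S A hf, ← Lp.enorm_def]
    refine (ContinuousLinearMap.le_opENorm A _).trans (le_of_eq ?_)
    rw [Lp.enorm_toLp]
  · unfold app
    rw [dif_neg hf]
    simp

theorem app_add (hf : MemLp f 2 (S.coeffMeasure υ q)) (hg : MemLp g 2 (S.coeffMeasure υ q)) :
    S.app A (f + g) =ᵐ[S.coeffMeasure υ' q'] S.app A f + S.app A g := by
  rw [app_of_memLp S A hf, app_of_memLp S A hg, app_of_memLp S A (hf.add hg), MemLp.toLp_add,
    map_add]
  exact Lp.coeFn_add _ _

theorem app_smul (c : ℂ) (hf : MemLp f 2 (S.coeffMeasure υ q)) :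
    S.app A (c • f) =ᵐ[S.coeffMeasure υ' q'] c • S.app A f := by
  rw [app_of_memLp S A hf, app_of_memLp S A (hf.const_smul c), MemLp.toLp_const_smul, map_smul]
  exact Lp.coeFn_smul _ _

theorem aestronglyMeasurable_app :
    AEStronglyMeasurable (S.app A f) (S.coeffMeasure υ' q') := by
  by_cases hf : MemLp f 2 (S.coeffMeasure υ q)
  · rw [app_of_memLp S A hf]
    exact Lp.aestronglyMeasurable _
  · unfold app
    rw [dif_neg hf]
    exact aestronglyMeasurable_zero

end App

end EssOrderedSpace

namespace MultiIntegrand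

open Conf EssOrderedSpace

variable {X : Type*} [MeasurableSpace X] {S : EssOrderedSpace X}
  {h : Type*} [NormedAddCommGroup h] [InnerProductSpace ℂ h] {q : X → ℝ≥0}

/-- The integrand norm of a nonnegative function of tables. -/
def polyFun (S : EssOrderedSpace X) (N : Table X → ℝ≥0∞) (r s : X → ℝ≥0) (t : ℝ≥0) : ℝ≥0∞ :=
  ∫⁻ mp in S.chainsBefore t,
    (∫⁻ cp in S.chainsBefore t, ∫⁻ mc in S.chainsBefore t,
      (essSup (fun cc : S.Chain =>
          ((∏ x ∈ (show Finset X from cc), s x : ℝ≥0) : ℝ≥0∞) * N ⟨mp, mc, cp, cc⟩)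
        (S.dChain.restrict (S.chainsBefore t))) ^ 2
      * (((∏ x ∈ (show Finset X from cp), r x) * ∏ x ∈ (show Finset X from mc), r x : ℝ≥0) : ℝ≥0∞)
      ∂S.dChain ∂S.dChain) ^ (1 / 2 : ℝ) ∂S.dChain

theorem polyNorm_eq (M : MultiIntegrand S h q) (r s : X → ℝ≥0) (t : ℝ≥0) :
    M.polyNorm r s t = polyFun S (fun u => ‖M u‖ₑ) r s t := rfl

/-- The tables before time `t`. -/
def tabBefore (S : EssOrderedSpace X) (t : ℝ≥0) : Set (Tables S) :=
  S.chainsBefore t ×ˢ (S.chainsBefore t ×ˢ (S.chainsBefore t ×ˢ S.chainsBefore t))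

theorem measurableSet_chainsBefore (t : ℝ≥0) : MeasurableSet (S.chainsBefore t) :=
  measurableSet_before S.measurable_time t

theorem measurableSet_tabBefore (t : ℝ≥0) : MeasurableSet (tabBefore S t) :=
  (measurableSet_chainsBefore t).prod ((measurableSet_chainsBefore t).prod
    ((measurableSet_chainsBefore t).prod (measurableSet_chainsBefore t)))

theorem tableMeasure_restrict (t : ℝ≥0) : (tableMeasure S).restrict (tabBefore S t) =
    (S.dChain.restrict (S.chainsBefore t)).prod ((S.dChain.restrict (S.chainsBefore t)).prod
      ((S.dChain.restrict (S.chainsBefore t)).prod (S.dChain.restrict (S.chainsBefore t)))) := by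
  unfold tableMeasure tabBefore
  rw [← Measure.prod_restrict, ← Measure.prod_restrict, ← Measure.prod_restrict]

open Classical in
/-- The Schur test on the Fock scale. -/
theorem lintegral_table_split_le {r s : X → ℝ≥0} {t : ℝ≥0} (hq : AEMeasurable q S.vol)
    (hr : AEMeasurable r S.vol) (hr0 : ∀ x, r x ≠ 0) (hs : AEMeasurable s S.vol)
    (hs0 : ∀ x, s x ≠ 0) {N : Table X → ℝ≥0∞}
    (hN : AEMeasurable (fun u => N (toTable u)) (tableMeasure S)) {α β : Finset X}
    {f g : Marking X × S.MChain → ℝ≥0∞}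
    (hf : ∀ e, S.IsMarking α e → AEMeasurable (fun ϑ => f (e, ϑ)) S.dMChain)
    (hg : ∀ e, S.IsMarking β e → AEMeasurable (fun ϑ => g (e, ϑ)) S.dMChain) :
    ∫⁻ u in tabBefore S t, N (toTable u) * S.splitSq α f q (inC S u).fin ^ (1 / 2 : ℝ) *
      S.splitSq β g q (outC S u).fin ^ (1 / 2 : ℝ) ∂tableMeasure S ≤
    polyFun S N r s t * ((∫⁻ z, f z ^ 2 ∂S.coeffMeasure α (r⁻¹ + s⁻¹ + q)) ^ (1 / 2 : ℝ) *
      (∫⁻ z, g z ^ 2 ∂S.coeffMeasure β (r⁻¹ + s⁻¹ + q)) ^ (1 / 2 : ℝ)) := by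
  set κ := S.dChain.restrict (S.chainsBefore t) with hκ
  have hNκ : AEMeasurable (fun u => N (toTable u)) (κ.prod (κ.prod (κ.prod κ))) := by
    rw [← tableMeasure_restrict]; exact hN.restrict
  have hκκ : κ.prod κ = (S.dChain.prod S.dChain).restrict
      (S.chainsBefore t ×ˢ S.chainsBefore t) := Measure.prod_restrict _ _
  have hA : ∀ {γ : Finset X} {G : Marking X × S.MChain → ℝ≥0∞},
      (∀ e, S.IsMarking γ e → AEMeasurable (fun ϑ => G (e, ϑ)) S.dMChain) →
      AEMeasurable (fun z : S.Chain × S.Chain =>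
        S.splitSq γ G q (un z.1 z.2).fin ^ (1 / 2 : ℝ)) (κ.prod κ) := fun hG => by
    rw [hκκ]
    exact ((S.nonsingular_unC.aemeasurable_comp (S.aemeasurable_splitSq hq hG)).pow_const
      _).restrict
  have h1 := lintegral_table_le (κ := κ) (σ := S.cwt s) (σ' := S.cwt s⁻¹) (ρ := S.cwt r)
    (ρ' := S.cwt r⁻¹) hNκ (hA hg) (hA hf) (S.aemeasurable_cwt hs).restrict
    (S.aemeasurable_cwt hs.inv).restrict (S.cwt_inv_mul hs0) (S.aemeasurable_cwt hr).restrict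
    (S.aemeasurable_cwt hr.inv).restrict (S.cwt_inv_mul hr0)
  have h2 : ∀ {γ : Finset X} {G : Marking X × S.MChain → ℝ≥0∞},
      (∀ e, S.IsMarking γ e → AEMeasurable (fun ϑ => G (e, ϑ)) S.dMChain) →
      ∫⁻ z : S.Chain × S.Chain, S.cwt r⁻¹ z.1 * (S.cwt s⁻¹ z.2 *
        (S.splitSq γ G q (un z.1 z.2).fin ^ (1 / 2 : ℝ)) ^ 2) ∂κ.prod κ ≤
      ∫⁻ z, G z ^ 2 ∂S.coeffMeasure γ (r⁻¹ + s⁻¹ + q) := fun {γ G} hG => by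
    rw [← S.lintegral_splitSq hq (hr.inv.add hs.inv) hG,
      ← S.lintegral_unC_weight hr.inv hs.inv (S.aemeasurable_splitSq hq hG), hκκ]
    refine (setLIntegral_le_lintegral _ _).trans (lintegral_mono fun z => ?_)
    rw [ENNReal.rpow_half_sq]
  rw [tableMeasure_restrict]
  refine h1.trans ?_
  have h3 : ∫⁻ mp, (∫⁻ cp, ∫⁻ mc, essSup (fun cc => S.cwt s cc * N (toTable (mp, mc, cp, cc))) κ ^ 2
      * (S.cwt r cp * S.cwt r mc) ∂κ ∂κ) ^ (1 / 2 : ℝ) ∂κ = polyFun S N r s t := by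
    unfold polyFun
    simp only [ENNReal.coe_mul]
    rfl
  refine (mul_le_mul' h3.le (mul_le_mul' (ENNReal.rpow_le_rpow (h2 hf) (by norm_num))
    (ENNReal.rpow_le_rpow (h2 hg) (by norm_num))))

/-- The marked tables before time `t`. -/
def baseBefore (S : EssOrderedSpace X) (t : ℝ≥0) : Set (Base S × S.MChain) :=
  (S.chainsBefore t ×ˢ (S.chainsBefore t ×ˢ
    (before S.mtime t ×ˢ before S.mtime t))) ×ˢ Set.univ

theorem measurableSet_baseBefore (t : ℝ≥0) : MeasurableSet (baseBefore S t) :=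
  ((measurableSet_chainsBefore t).prod ((measurableSet_chainsBefore t).prod
    ((measurableSet_before S.measurable_mtime t).prod
      (measurableSet_before S.measurable_mtime t)))).prod MeasurableSet.univ

/-- The truncation of a field of vectors. -/
def trunc (t : ℝ≥0) (F : Base S × S.MChain → h) : Base S × S.MChain → h :=
  (baseBefore S t).indicator F

/-- The kernel obtained by integrating over the parts `υ⁻₊, υ⁻∘`. -/
def kerInt (t : ℝ≥0) (F : Base S × S.MChain → h) (y : S.MChain × (S.MChain × S.MChain)) : h :=
  ∫ m : S.Chain × S.Chain, trunc t F ((m.1, m.2, y.1, y.2.1), y.2.2) ∂S.dChain.prod S.dChain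

/-- The absolute kernel. -/
def kerAbs (t : ℝ≥0) (F : Base S × S.MChain → h) (y : S.MChain × (S.MChain × S.MChain)) : ℝ≥0∞ :=
  ∫⁻ m : S.Chain × S.Chain, ‖trunc t F ((m.1, m.2, y.1, y.2.1), y.2.2)‖ₑ ∂S.dChain.prod S.dChain

theorem shuffle_base : MeasurePreserving
    (fun p : (S.MChain × (S.MChain × S.MChain)) × (S.Chain × S.Chain) =>
      (((p.2.1, (p.2.2, (p.1.1, p.1.2.1))) : Base S), p.1.2.2))
    ((S.dMChain.prod (S.dMChain.prod S.dMChain)).prod (S.dChain.prod S.dChain))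
    ((baseMeasure S).prod S.dMChain) := measurePreserving_shuffle

section Kernel

variable {t : ℝ≥0} {F F' : Base S × S.MChain → h}

theorem aestronglyMeasurable_trunc (hF : AEStronglyMeasurable F ((baseMeasure S).prod S.dMChain)) :
    AEStronglyMeasurable (trunc t F) ((baseMeasure S).prod S.dMChain) :=
  hF.indicator (measurableSet_baseBefore t)

theorem aestronglyMeasurable_kerInt
    (hF : AEStronglyMeasurable F ((baseMeasure S).prod S.dMChain)) :
    AEStronglyMeasurable (kerInt t F) (S.dMChain.prod (S.dMChain.prod S.dMChain)) :=
  (shuffle_base.nonsingular.aestronglyMeasurable_comp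
    (aestronglyMeasurable_trunc (t := t) hF)).integral_prod_right'

theorem aemeasurable_kerAbs (hF : AEStronglyMeasurable F ((baseMeasure S).prod S.dMChain)) :
    AEMeasurable (kerAbs t F) (S.dMChain.prod (S.dMChain.prod S.dMChain)) :=
  (shuffle_base.nonsingular.aemeasurable_comp
    (aestronglyMeasurable_trunc (t := t) hF).enorm).lintegral_prod_right'

theorem enorm_kerInt_le (y : S.MChain × (S.MChain × S.MChain)) :
    ‖kerInt t F y‖ₑ ≤ kerAbs t F y := enorm_integral_le_lintegral_enorm _

theorem lintegral_mul_splitSum₂_kerAbs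
    (hF : AEStronglyMeasurable F ((baseMeasure S).prod S.dMChain))
    {g : S.MChain → ℝ≥0∞} (hg : AEMeasurable g S.dMChain) :
    ∫⁻ ϑ, g ϑ * splitSum₂ (kerAbs t F) ϑ ∂S.dMChain =
      ∫⁻ p, g (un₃ (p.1.2.2.1, (p.1.2.2.2, p.2))) * ‖trunc t F p‖ₑ
        ∂(baseMeasure S).prod S.dMChain := by
  have hun := nonsingular_un₃ S.measurable_mtime S.markedVol_time_eq
  have h0 : AEMeasurable (fun y : S.MChain × (S.MChain × S.MChain) =>
      g (un₃ y) * kerAbs t F y) (S.dMChain.prod (S.dMChain.prod S.dMChain)) :=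
    (hun.aemeasurable_comp hg).mul (aemeasurable_kerAbs hF)
  have h1 : AEMeasurable (fun p : Base S × S.MChain =>
      g (un₃ (p.1.2.2.1, (p.1.2.2.2, p.2))) * ‖trunc t F p‖ₑ)
      ((baseMeasure S).prod S.dMChain) :=
    ((hun.comp (NonsingularMap.assoc.comp
      ((NonsingularMap.snd.comp NonsingularMap.snd).prodMap
        NonsingularMap.id))).aemeasurable_comp hg).mul (aestronglyMeasurable_trunc hF).enorm
  have h2 : ∀ ϑ : S.MChain, g ϑ * splitSum₂ (kerAbs t F) ϑ =
      splitSum₂ (fun y => g (un₃ y) * kerAbs t F y) ϑ := fun ϑ => splitSum₂_mul g ϑ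
  rw [lintegral_congr h2]
  refine (lintegral_splitSum₂ S.measurable_mtime S.markedVol_time_eq h0).trans ?_
  refine Eq.trans ?_ (MeasurePreserving.lintegral_comp_ae shuffle_base h1)
  have h3 := shuffle_base.nonsingular.aemeasurable_comp h1
  rw [lintegral_prod _ h3]
  refine lintegral_congr_ae ?_
  have h4 := (shuffle_base.nonsingular.aemeasurable_comp
    (aestronglyMeasurable_trunc (t := t) hF).enorm).aestronglyMeasurable.prodMk_left
  filter_upwards [h4] with y hy
  exact (lintegral_const_mul'' _ hy.aemeasurable).symm

theorem splitSum₂_kerInt_congr (hFF : F =ᵐ[(baseMeasure S).prod S.dMChain] F') :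
    splitSum₂ (kerInt t F) =ᵐ[S.dMChain] splitSum₂ (kerInt t F') := by
  have h1 : ∀ᵐ y ∂S.dMChain.prod (S.dMChain.prod S.dMChain), kerInt t F y = kerInt t F' y := by
    filter_upwards [Measure.ae_ae_of_ae_prod (shuffle_base.nonsingular.ae hFF)] with y hy
    refine integral_congr_ae (hy.mono fun m hm => ?_)
    unfold trunc
    simp only [Set.indicator]
    split_ifs
    · exact hm
    · rfl
  filter_upwards [ae_splits₂ S.measurable_mtime S.markedVol_time_eq h1] with ϑ hϑ
  exact splitSum₂_congr hϑ

theorem ae_integrable_trunc (hF : AEStronglyMeasurable F ((baseMeasure S).prod S.dMChain))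
    (hK : ∀ᵐ ϑ ∂S.dMChain, splitSum₂ (kerAbs t F) ϑ < ∞) :
    ∀ᵐ ϑ ∂S.dMChain, ∀ b : S.MChain, b.fin ⊆ ϑ.fin → ∀ c : S.MChain,
      c.fin ⊆ (sdiff ϑ b).fin → Integrable (fun m : S.Chain × S.Chain =>
        trunc t F ((m.1, m.2, b, c), sdiff (sdiff ϑ b) c)) (S.dChain.prod S.dChain) := by
  have h1 := (shuffle_base.nonsingular.aestronglyMeasurable_comp
    (aestronglyMeasurable_trunc (t := t) hF)).prodMk_left
  filter_upwards [ae_splits₂ S.measurable_mtime S.markedVol_time_eq h1, hK] with ϑ h2 h3 b hb c hc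
  exact ⟨h2 b hb c hc, (le_splitSum₂ (kerAbs t F) hb hc).trans_lt h3⟩

theorem splitSum₂_kerInt_add (hF : AEStronglyMeasurable F ((baseMeasure S).prod S.dMChain))
    (hF' : AEStronglyMeasurable F' ((baseMeasure S).prod S.dMChain))
    (hK : ∀ᵐ ϑ ∂S.dMChain, splitSum₂ (kerAbs t F) ϑ < ∞)
    (hK' : ∀ᵐ ϑ ∂S.dMChain, splitSum₂ (kerAbs t F') ϑ < ∞) :
    ∀ᵐ ϑ ∂S.dMChain, splitSum₂ (kerInt t (F + F')) ϑ =
      splitSum₂ (kerInt t F) ϑ + splitSum₂ (kerInt t F') ϑ := by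
  filter_upwards [ae_integrable_trunc hF hK, ae_integrable_trunc hF' hK'] with ϑ h1 h2
  have h3 : splitSum₂ (kerInt t (F + F')) ϑ =
      splitSum₂ (fun y => kerInt t F y + kerInt t F' y) ϑ := by
    refine splitSum₂_congr fun b hb c hc => ?_
    refine Eq.trans ?_ (integral_add (h1 b hb c hc) (h2 b hb c hc))
    refine integral_congr_ae (.of_forall fun m => ?_)
    unfold trunc
    simp only [Set.indicator]
    split_ifs
    · rfl
    · exact (add_zero _).symm
  rw [h3]
  simp only [splitSum₂, splitSum, Finset.sum_add_distrib]

theorem splitSum₂_kerInt_smul (a : ℂ) (ϑ : S.MChain) :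
    splitSum₂ (kerInt t (a • F)) ϑ = a • splitSum₂ (kerInt t F) ϑ := by
  have h1 : ∀ y, kerInt t (a • F) y = a • kerInt t F y := fun y => by
    unfold kerInt
    rw [← integral_smul]
    refine integral_congr_ae (.of_forall fun m => ?_)
    unfold trunc
    simp only [Set.indicator]
    split_ifs
    · rfl
    · exact (smul_zero _).symm
  have h2 : kerInt t (a • F) = fun y => a • kerInt t F y := funext h1
  rw [h2]
  simp only [splitSum₂, splitSum, Finset.smul_sum]

theorem mem_pastPart {ω : Finset (X × ℕ)} {y : X × ℕ} :
    y ∈ S.pastPart t ω ↔ y ∈ ω ∧ S.time y.1 < t := by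
  unfold pastPart
  rw [Finset.mem_filter]

theorem subset_pastPart_iff {ω b : Finset (X × ℕ)} :
    b ⊆ S.pastPart t ω ↔ b ⊆ ω ∧ ((show S.MChain from b) ∈ before S.mtime t) := by
  constructor
  · intro hb
    exact ⟨fun y hy => (mem_pastPart.1 (hb hy)).1, fun y hy => (mem_pastPart.1 (hb hy)).2⟩
  · rintro ⟨h1, h2⟩ y hy
    exact mem_pastPart.2 ⟨h1 hy, h2 y hy⟩

theorem trunc_of_mem {b c ω : S.MChain} (hb : b ∈ before S.mtime t) (hc : c ∈ before S.mtime t)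
    (m : S.Chain × S.Chain) : trunc t F ((m.1, m.2, b, c), ω) =
      (S.chainsBefore t ×ˢ S.chainsBefore t).indicator
        (fun m : S.Chain × S.Chain => F ((m.1, m.2, b, c), ω)) m := by
  unfold trunc
  by_cases hm : m ∈ S.chainsBefore t ×ˢ S.chainsBefore t
  · rw [Set.indicator_of_mem hm, Set.indicator_of_mem]
    exact ⟨⟨hm.1, hm.2, hb, hc⟩, trivial⟩
  · rw [Set.indicator_of_notMem hm, Set.indicator_of_notMem]
    exact fun h' => hm ⟨h'.1.1, h'.1.2.1⟩

theorem kerInt_of_notMem {b c ω : S.MChain}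
    (hbc : ¬ (b ∈ before S.mtime t ∧ c ∈ before S.mtime t)) : kerInt t F (b, (c, ω)) = 0 := by
  unfold kerInt
  have : ∀ m : S.Chain × S.Chain, trunc t F ((m.1, m.2, b, c), ω) = 0 := fun m => by
    unfold trunc
    rw [Set.indicator_of_notMem]
    exact fun h' => hbc h'.1.2.2
  simp [this]

theorem kerInt_of_mem {b c ω : S.MChain} (hb : b ∈ before S.mtime t)
    (hc : c ∈ before S.mtime t) : kerInt t F (b, (c, ω)) =
      ∫ m in S.chainsBefore t ×ˢ S.chainsBefore t, F ((m.1, m.2, b, c), ω)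
        ∂S.dChain.prod S.dChain := by
  unfold kerInt
  rw [← integral_indicator ((measurableSet_chainsBefore t).prod (measurableSet_chainsBefore t))]
  exact integral_congr_ae (.of_forall fun m => trunc_of_mem hb hc m)

theorem sdiff_sdiff_eq [DecidableEq (X × ℕ)] (ϑ b c : S.MChain) :
    (sdiff (sdiff ϑ b) c).fin = ϑ.fin \ (b.fin ∪ c.fin) := by
  ext y
  rw [mem_fin_sdiff, mem_fin_sdiff, Finset.mem_sdiff, Finset.mem_union, not_or, and_assoc]

theorem summand_eq (F : Base S × S.MChain → h) (ϑ b c : S.MChain) (m : S.Chain × S.Chain) :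
    summand F ϑ.fin b.fin c.fin m = F ((m.1, m.2, b, c), sdiff (sdiff ϑ b) c) := by
  classical
  unfold summand
  have : (sdiff (sdiff ϑ b) c) = (show S.MChain from (ϑ.fin \ (b.fin ∪ c.fin) : Finset (X × ℕ))) :=
    sdiff_sdiff_eq ϑ b c
  rw [this]
  congr

open Classical in
/-- The sum over the parts before `t`. -/
theorem splitSum₂_kerInt_eq (ϑ : S.MChain) : splitSum₂ (kerInt t F) ϑ =
    ∑ b ∈ (S.pastPart t ϑ).powerset, ∑ c ∈ (S.pastPart t ϑ \ b).powerset,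
      ∫ z in S.chainsBefore t ×ˢ S.chainsBefore t, summand F ϑ b c z
        ∂(S.dChain.prod S.dChain) := by
  unfold splitSum₂ splitSum
  symm
  refine Eq.trans ?_ (Finset.sum_subset (s₁ := (S.pastPart t ϑ).powerset) ?_ ?_)
  · refine Finset.sum_congr rfl fun b hb => ?_
    have hb' := subset_pastPart_iff.1 (Finset.mem_powerset.1 hb)
    refine Eq.trans ?_ (Finset.sum_subset (s₁ := (S.pastPart t ϑ \ b).powerset) ?_ ?_)
    · refine Finset.sum_congr rfl fun c hc => ?_
      have hc' := subset_pastPart_iff.1 ((Finset.mem_powerset.1 hc).trans Finset.sdiff_subset)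
      have h1 := kerInt_of_mem (F := F) (ω := sdiff (sdiff ϑ b) c) hb'.2 hc'.2
      refine Eq.trans ?_ h1.symm
      exact integral_congr_ae (.of_forall fun m => summand_eq F ϑ b c m)
    · intro c hc
      refine Finset.mem_powerset.2 fun y hy => mem_fin_sdiff.2 ?_
      have := Finset.mem_sdiff.1 (Finset.mem_powerset.1 hc hy)
      exact ⟨(mem_pastPart.1 this.1).1, this.2⟩
    · intro c hc hc'
      refine kerInt_of_notMem fun hh => hc' (Finset.mem_powerset.2 fun y hy => ?_)
      have h2 := mem_fin_sdiff.1 (Finset.mem_powerset.1 hc hy)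
      exact Finset.mem_sdiff.2 ⟨mem_pastPart.2 ⟨h2.1, hh.2 y hy⟩, h2.2⟩
  · intro b hb
    exact Finset.mem_powerset.2 (subset_pastPart_iff.1 (Finset.mem_powerset.1 hb)).1
  · intro b hb hb'
    refine Finset.sum_eq_zero fun c hc => kerInt_of_notMem fun hh => hb' ?_
    exact Finset.mem_powerset.2 (subset_pastPart_iff.2 ⟨Finset.mem_powerset.1 hb, hh.1⟩)

theorem ae_integrableOn_summand
    (hF : AEStronglyMeasurable F ((baseMeasure S).prod S.dMChain))
    (hK : ∀ᵐ ϑ ∂S.dMChain, splitSum₂ (kerAbs t F) ϑ < ∞) :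
    ∀ᵐ ϑ ∂S.dMChain, ∀ b c : Finset (X × ℕ), b ⊆ S.pastPart t ϑ → c ⊆ S.pastPart t ϑ →
      Disjoint b c → IntegrableOn (summand F ϑ b c) (S.chainsBefore t ×ˢ S.chainsBefore t)
        (S.dChain.prod S.dChain) := by
  filter_upwards [ae_integrable_trunc hF hK] with ϑ h1 b c hb hc hbc
  have hb' := subset_pastPart_iff.1 hb
  have hc' := subset_pastPart_iff.1 hc
  have h2 := h1 b hb'.1 c fun y hy =>
    mem_fin_sdiff.2 ⟨hc'.1 hy, Finset.disjoint_right.1 hbc hy⟩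
  rw [← integrable_indicator_iff
    ((measurableSet_chainsBefore t).prod (measurableSet_chainsBefore t))]
  refine h2.congr (.of_forall fun m => ?_)
  have h3 := trunc_of_mem (F := F) (ω := sdiff (sdiff ϑ b) c) hb'.2 hc'.2 m
  refine h3.trans ?_
  have h4 : summand F ϑ b c = fun m : S.Chain × S.Chain =>
      F ((m.1, m.2, b, c), sdiff (sdiff ϑ b) c) := funext fun m => summand_eq F ϑ b c m
  rw [h4]

end Kernel

end MultiIntegrand

/-- A bounded operator between `L²`-spaces from its graph on representatives. -/
theorem exists_clm_of_relation {α β E : Type*} [MeasurableSpace α] [MeasurableSpace β]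
    [NormedAddCommGroup E] [InnerProductSpace ℂ E] {μ : Measure α} {ν : Measure β}
    (R : (α → E) → (β → E) → Prop) {C : ℝ≥0∞} (hC : C ≠ ∞)
    (hex : ∀ ξ, MemLp ξ 2 μ → ∃ ψ, R ξ ψ ∧ MemLp ψ 2 ν ∧ eLpNorm ψ 2 ν ≤ C * eLpNorm ξ 2 μ)
    (hcongr : ∀ ξ ξ' φ φ', MemLp ξ 2 μ → ξ =ᵐ[μ] ξ' → φ =ᵐ[ν] φ' → R ξ φ → R ξ' φ')
    (huniq : ∀ ξ φ φ', MemLp ξ 2 μ → R ξ φ → R ξ φ' → φ =ᵐ[ν] φ')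
    (hadd : ∀ ξ ξ' φ φ', MemLp ξ 2 μ → MemLp ξ' 2 μ → R ξ φ → R ξ' φ' → R (ξ + ξ') (φ + φ'))
    (hsmul : ∀ (a : ℂ) ξ φ, MemLp ξ 2 μ → R ξ φ → R (a • ξ) (a • φ)) :
    ∃ A : Lp E 2 μ →L[ℂ] Lp E 2 ν, (∀ ξ : Lp E 2 μ, R ξ (A ξ)) ∧ ‖A‖ₑ ≤ C := by
  choose ψ hψ1 hψ2 hψ3 using fun ξ : Lp E 2 μ => hex ξ (Lp.memLp ξ)
  let L : Lp E 2 μ →ₗ[ℂ] Lp E 2 ν :=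
    { toFun := fun ξ => (hψ2 ξ).toLp
      map_add' := fun ξ ξ' => by
        rw [← MemLp.toLp_add]
        refine (MemLp.toLp_eq_toLp_iff _ _).2 (huniq _ _ _ (Lp.memLp (ξ + ξ')) (hψ1 _) ?_)
        exact hcongr _ _ _ _ ((Lp.memLp ξ).add (Lp.memLp ξ')) (Lp.coeFn_add ξ ξ').symm .rfl
          (hadd _ _ _ _ (Lp.memLp ξ) (Lp.memLp ξ') (hψ1 ξ) (hψ1 ξ'))
      map_smul' := fun a ξ => by
        rw [RingHom.id_apply, ← MemLp.toLp_const_smul]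
        refine (MemLp.toLp_eq_toLp_iff _ _).2 (huniq _ _ _ (Lp.memLp (a • ξ)) (hψ1 _) ?_)
        exact hcongr _ _ _ _ ((Lp.memLp ξ).const_smul a) (Lp.coeFn_smul a ξ).symm .rfl
          (hsmul a _ _ (Lp.memLp ξ) (hψ1 ξ)) }
  have hbound : ∀ ξ : Lp E 2 μ, ‖L ξ‖ ≤ C.toReal * ‖ξ‖ := fun ξ => by
    rw [Lp.norm_def ξ, ← ENNReal.toReal_mul]
    change ‖(hψ2 ξ).toLp‖ ≤ _
    rw [Lp.norm_toLp]
    exact ENNReal.toReal_mono (ENNReal.mul_lt_top hC.lt_top (Lp.memLp ξ).2).ne (hψ3 ξ)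
  refine ⟨L.mkContinuous _ hbound, fun ξ => ?_, ?_⟩
  · exact hcongr _ _ _ _ (Lp.memLp ξ) .rfl (hψ2 ξ).coeFn_toLp.symm (hψ1 ξ)
  · have h1 := L.mkContinuous_norm_le ENNReal.toReal_nonneg hbound
    rw [← ofReal_norm (L.mkContinuous _ hbound)]
    exact (ENNReal.ofReal_le_ofReal h1).trans (ENNReal.ofReal_toReal hC).le

namespace MultiIntegrand

open Conf EssOrderedSpace

variable {X : Type*} [MeasurableSpace X] {S : EssOrderedSpace X}
  {h : Type*} [NormedAddCommGroup h] [InnerProductSpace ℂ h] {q : X → ℝ≥0}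

/-- The integrand norm of `M(· ⊔ B)`. -/
def polyNormAt (M : MultiIntegrand S h q) (B : Table X) (r s : X → ℝ≥0) (t : ℝ≥0) : ℝ≥0∞ :=
  polyFun S (fun u => ‖M (u.union B)‖ₑ) r s t

/-- The weights are positive and measurable and `M(· ⊔ B)` is a measurable field of operators with
a measurable norm. -/
structure IsRegular (M : MultiIntegrand S h q) (B : Table X) (r s : X → ℝ≥0) : Prop where
  hq : AEMeasurable q S.vol
  hq0 : ∀ x, q x ≠ 0
  hr : AEMeasurable r S.vol
  hr0 : ∀ x, r x ≠ 0
  hs : AEMeasurable s S.vol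
  hs0 : ∀ x, s x ≠ 0
  field : M.IsMeasurableField B
  norm : AEMeasurable (fun u => ‖M ((toTable u).union B)‖ₑ) (tableMeasure S)

/-- Measurability of all the coefficients of a section. -/
def SliceMeas (S : EssOrderedSpace X) (α : Finset X) (ξ : Marking X × S.MChain → h) : Prop :=
  ∀ e, S.IsMarking α e → AEStronglyMeasurable (fun ϑ => ξ (e, ϑ)) S.dMChain

theorem isMeasurableInput_split {B : Table X} {ξ : Marking X × S.MChain → h}
    (hξ : SliceMeas S B.inp ξ) : IsMeasurableInput S B (fun _ => S.split B.inp ξ) := by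
  intro e he
  have h1 : NonsingularMap (fun z : S.Chain × S.MChain × S.MChain × S.Chain × S.MChain =>
      un (un z.2.1 z.2.2.1) z.2.2.2.2)
      (S.dChain.prod (S.dMChain.prod (S.dMChain.prod (S.dChain.prod S.dMChain)))) S.dMChain :=
    S.nonsingular_unM.comp ((S.nonsingular_unM.prodMap NonsingularMap.id).comp
      (NonsingularMap.assoc_symm.comp ((NonsingularMap.id.prodMap
        (NonsingularMap.id.prodMap NonsingularMap.snd)).comp NonsingularMap.snd)))
  refine (h1.aestronglyMeasurable_comp (hξ e he)).congr ?_
  have h2 := (NonsingularMap.fst.comp NonsingularMap.snd).ae (μ := S.dChain.prod (S.dMChain.prod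
    (S.dMChain.prod (S.dChain.prod S.dMChain)))) (S.ae_mchain_notMem B.inp)
  have h3 := (NonsingularMap.fst.comp (NonsingularMap.snd.comp NonsingularMap.snd)).ae
    (μ := S.dChain.prod (S.dMChain.prod (S.dMChain.prod (S.dChain.prod S.dMChain))))
    (S.ae_mchain_notMem B.inp)
  filter_upwards [h2, h3] with z hz1 hz2
  have h4 := S.splitPt_markUn (α := B.inp) (e := e) (a := markUn z.2.1 z.2.2.1)
    (fun _ hy => S.mem_of_isMarking he hy)
    (fun y hy => (mem_markUn.1 hy).elim (hz1 y) (hz2 y)) z.2.2.2.2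
  have h5 : join e z.2.1 z.2.2.1 = markUn e (markUn z.2.1 z.2.2.1) :=
    join_eq e z.2.1 z.2.2.1
  have h6 : un (S.toM (markUn z.2.1 z.2.2.1)) z.2.2.2.2 = un (un z.2.1 z.2.2.1) z.2.2.2.2 := by
    refine conf_ext fun y => ?_
    rw [mem_fin_un, mem_fin_un, mem_fin_un]
    exact or_congr_left mem_markUn
  rw [S.split_apply, h5]
  rw [h6] at h4
  exact (congrArg ξ h4).symm

theorem isMarking_join {u : Tables S} {α : Finset X} [DecidableEq X]
    (hu : Disjoint u.2.2.2.fin u.2.2.1.fin ∧ Disjoint α (outC S u).fin)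
    {d b c : Marking X} (hd : S.IsMarking α d) (hb : S.IsMarking u.2.2.2.fin b)
    (hc : S.IsMarking u.2.2.1.fin c) : S.IsMarking (α ∪ (outC S u).fin) (join d b c) := by
  have h1 : S.IsMarking (outC S u).fin (markUn b c) := by
    rw [outC_fin]; exact S.isMarking_markUn hu.1 hb hc
  have h2 := S.isMarking_markUn hu.2 hd h1
  have h3 : join d b c = markUn d (markUn b c) := join_eq d b c
  rw [h3]
  exact h2

theorem ae_isMarking_join {B : Table X} {d : Marking X} (hd : S.IsMarking B.out d) :
    ∀ᵐ z ∂baseMeasure S, S.IsMarking ((outTable z).union B).out (join d z.2.2.1 z.2.2.2) := by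
  classical
  have h1 : NonsingularMap (fun z : Base S => z.2.2.1) (baseMeasure S) S.dMChain :=
    NonsingularMap.fst.comp (NonsingularMap.snd.comp NonsingularMap.snd)
  have h2 : NonsingularMap (fun z : Base S => z.2.2.2) (baseMeasure S) S.dMChain :=
    NonsingularMap.snd.comp (NonsingularMap.snd.comp NonsingularMap.snd)
  filter_upwards [h1.ae S.ae_isMarking, h2.ae S.ae_isMarking,
    (nonsingular_outT S).ae (ae_tables_disjoint S B.out)] with z hb hc hdis
  have h3 := isMarking_join (u := outT S z) hdis hd hb hc
  have h4 := union_out S (outT S z) B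
  have h5 : ((outTable z).union B).out = B.out ∪ (outC S (outT S z)).fin := by
    rw [← toTable_outT, h4]
  rw [h5]
  exact h3

theorem outTable_marks {u : Tables S} {b c : Marking X} (hb : S.IsMarking u.2.2.2.fin b)
    (hc : S.IsMarking u.2.2.1.fin c) :
    outTable (S := S) (u.1, u.2.1, S.toM b, S.toM c) = toTable u := by
  unfold outTable toTable
  have h1 : positions (S.toM c).fin = u.2.2.1.fin := hc.1
  have h2 : positions (S.toM b).fin = u.2.2.2.fin := hb.1
  exact congrArg₂ (fun x y => Table.mk u.1.fin u.2.1.fin x y) h1 h2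

theorem mem_before_marks {υ : S.Chain} {b : Marking X} (hb : S.IsMarking υ.fin b) {t : ℝ≥0} :
    S.toM b ∈ before S.mtime t ↔ υ ∈ S.chainsBefore t := by
  constructor
  · intro h1 x hx
    have h2 : x ∈ positions (mpts b) := by
      have := hb.1
      exact this ▸ hx
    obtain ⟨j, hj⟩ := mem_positions.1 h2
    exact h1 (x, j) hj
  · intro h1 y hy
    exact h1 y.1 (S.mem_of_isMarking hb hy)

section Versions

variable {M : MultiIntegrand S h q} {B : Table X} {r s : X → ℝ≥0} {t : ℝ≥0}
  {ξ ξ' : Marking X × S.MChain → h}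
  {F F' : Marking X → (S.Chain × S.Chain × S.MChain × S.MChain) × S.MChain → h}

theorem IsRegular.weight (H : M.IsRegular B r s) : AEMeasurable (r⁻¹ + s⁻¹ + q) S.vol :=
  (H.hr.inv.add H.hs.inv).add H.hq

theorem IsRegular.weight_ne_zero (H : M.IsRegular B r s) (x : X) : (r⁻¹ + s⁻¹ + q) x ≠ 0 := by
  have := H.hq0 x
  simp [this]

theorem sliceMeas_of_memLp {α : Finset X} {p : X → ℝ≥0} (hp : AEMeasurable p S.vol)
    (hp0 : ∀ x, p x ≠ 0) (hξ : MemLp ξ 2 (S.coeffMeasure α p)) : SliceMeas S α ξ :=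
  (S.aestronglyMeasurable_coeff_iff hp hp0).1 hξ.1

theorem IsRegular.ae_memLp_split (H : M.IsRegular B r s)
    (hξ : MemLp ξ 2 (S.coeffMeasure B.inp (r⁻¹ + s⁻¹ + q))) :
    ∀ᵐ u ∂tableMeasure S,
      MemLp (S.split B.inp ξ) 2 (S.coeffMeasure ((toTable u).union B).inp q) := by
  have h1 := S.memLp_split H.hq H.hq0 (w := r⁻¹ + s⁻¹) (H.hr.inv.add H.hs.inv)
    (fun x => by simp [H.hr0 x]) hξ
  filter_upwards [(nonsingular_inC S).ae h1] with u hu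
  rw [union_inp]
  exact hu

theorem IsRegular.exists_version (H : M.IsRegular B r s)
    (hξ : MemLp ξ 2 (S.coeffMeasure B.inp (r⁻¹ + s⁻¹ + q))) :
    ∃ F, M.IsVersion B (fun _ => S.split B.inp ξ) F :=
  H.field _ (isMeasurableInput_split (sliceMeas_of_memLp H.weight H.weight_ne_zero hξ))
    (H.ae_memLp_split hξ)

theorem IsVersion.ae_eq {f : Table X → Marking X × S.MChain → h} (hF : M.IsVersion B f F)
    (hF' : M.IsVersion B f F') {d : Marking X} (hd : S.IsMarking B.out d) :
    F d =ᵐ[(baseMeasure S).prod S.dMChain] F' d := by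
  refine ae_eq_of_ae_ae_eq (hF d hd).1 (hF' d hd).1 ?_
  filter_upwards [(hF d hd).2, (hF' d hd).2] with z h1 h2
  filter_upwards [h1, h2] with ω h3 h4
  rw [h3, h4]

/-- A relation between fields of vectors that holds on almost every table passes to versions. -/
theorem IsRegular.ae_base_of_tables (H : M.IsRegular B r s)
    {f f' : Table X → Marking X × S.MChain → h}
    (hff : ∀ᵐ u ∂tableMeasure S, f (toTable u) =ᵐ[S.coeffMeasure ((toTable u).union B).out q⁻¹]
      f' (toTable u)) {d : Marking X} (hd : S.IsMarking B.out d) :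
    ∀ᵐ z ∂baseMeasure S, ∀ᵐ ω ∂S.dMChain,
      f (outTable z) (join d z.2.2.1 z.2.2.2, ω) = f' (outTable z) (join d z.2.2.1 z.2.2.2, ω) := by
  filter_upwards [(nonsingular_outT S).ae hff, ae_isMarking_join hd] with z h1 h2
  rw [toTable_outT, Filter.EventuallyEq, S.ae_coeff_iff H.hq.inv fun x => inv_ne_zero (H.hq0 x)]
    at h1
  exact h1 _ h2

theorem IsRegular.ae_split_congr (H : M.IsRegular B r s)
    (hξξ : ∀ e, S.IsMarking B.inp e → ∀ᵐ ϑ ∂S.dMChain, ξ (e, ϑ) = ξ' (e, ϑ)) :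
    ∀ᵐ u ∂tableMeasure S,
      S.split B.inp ξ =ᵐ[S.coeffMeasure ((toTable u).union B).inp q] S.split B.inp ξ' := by
  classical
  filter_upwards [(nonsingular_inC S).ae (S.split_congr_ae hξξ)] with u hu
  rw [union_inp, Filter.EventuallyEq, S.ae_coeff_iff H.hq H.hq0]
  exact hu

theorem IsRegular.version_congr (H : M.IsRegular B r s)
    (hξξ : ∀ e, S.IsMarking B.inp e → ∀ᵐ ϑ ∂S.dMChain, ξ (e, ϑ) = ξ' (e, ϑ))
    (hF : M.IsVersion B (fun _ => S.split B.inp ξ) F) :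
    M.IsVersion B (fun _ => S.split B.inp ξ') F := fun d hd => by
  have h1 := H.ae_base_of_tables (f := fun u => S.app (M (u.union B)) (S.split B.inp ξ))
    (f' := fun u => S.app (M (u.union B)) (S.split B.inp ξ'))
    ((H.ae_split_congr hξξ).mono fun u hu =>
      Filter.EventuallyEq.of_eq (S.app_congr (M ((toTable u).union B)) hu)) hd
  refine ⟨(hF d hd).1, ?_⟩
  filter_upwards [(hF d hd).2, h1] with z h2 h3
  filter_upwards [h2, h3] with ω h4 h5
  rw [h4, h5]

theorem IsRegular.version_add (H : M.IsRegular B r s)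
    (hξ : MemLp ξ 2 (S.coeffMeasure B.inp (r⁻¹ + s⁻¹ + q)))
    (hξ' : MemLp ξ' 2 (S.coeffMeasure B.inp (r⁻¹ + s⁻¹ + q)))
    (hF : M.IsVersion B (fun _ => S.split B.inp ξ) F)
    (hF' : M.IsVersion B (fun _ => S.split B.inp ξ') F') :
    M.IsVersion B (fun _ => S.split B.inp (ξ + ξ')) (F + F') := fun d hd => by
  have h1 := H.ae_base_of_tables (f := fun u => S.app (M (u.union B)) (S.split B.inp (ξ + ξ')))
    (f' := fun u => S.app (M (u.union B)) (S.split B.inp ξ) +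
      S.app (M (u.union B)) (S.split B.inp ξ'))
    (by
      filter_upwards [H.ae_memLp_split hξ, H.ae_memLp_split hξ'] with u h1 h2
      exact S.app_add (M ((toTable u).union B)) h1 h2) hd
  refine ⟨(hF d hd).1.add (hF' d hd).1, ?_⟩
  filter_upwards [(hF d hd).2, (hF' d hd).2, h1] with z h2 h2' h3
  filter_upwards [h2, h2', h3] with ω h4 h4' h5
  refine Eq.trans ?_ h5.symm
  exact congrArg₂ (· + ·) h4 h4'

theorem IsRegular.version_smul (H : M.IsRegular B r s) (a : ℂ)
    (hξ : MemLp ξ 2 (S.coeffMeasure B.inp (r⁻¹ + s⁻¹ + q)))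
    (hF : M.IsVersion B (fun _ => S.split B.inp ξ) F) :
    M.IsVersion B (fun _ => S.split B.inp (a • ξ)) (fun d => a • F d) := fun d hd => by
  have h1 := H.ae_base_of_tables (f := fun u => S.app (M (u.union B)) (S.split B.inp (a • ξ)))
    (f' := fun u => a • S.app (M (u.union B)) (S.split B.inp ξ))
    (by
      filter_upwards [H.ae_memLp_split hξ] with u h1
      exact S.app_smul (M ((toTable u).union B)) a h1) hd
  refine ⟨(hF d hd).1.const_smul a, ?_⟩
  filter_upwards [(hF d hd).2, h1] with z h2 h3
  filter_upwards [h2, h3] with ω h4 h5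
  refine Eq.trans ?_ h5.symm
  exact congrArg (a • ·) h4

end Versions

section Estimate

variable {M : MultiIntegrand S h q} {B : Table X} {r s : X → ℝ≥0} {t : ℝ≥0}
  {ξ ξ' : Marking X × S.MChain → h}
  {F F' : Marking X → (S.Chain × S.Chain × S.MChain × S.MChain) × S.MChain → h}

/-- The absolute integrals of a version. -/
def absVal (t : ℝ≥0) (F : Marking X → (S.Chain × S.Chain × S.MChain × S.MChain) × S.MChain → h)
    (z : Marking X × S.MChain) : ℝ≥0∞ := splitSum₂ (kerAbs t (F z.1)) z.2

/-- The integrals of a version. -/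
def intVal (t : ℝ≥0) (F : Marking X → (S.Chain × S.Chain × S.MChain × S.MChain) × S.MChain → h)
    (z : Marking X × S.MChain) : h := splitSum₂ (kerInt t (F z.1)) z.2

theorem mem_baseBefore_marks {u : Tables S} {b c : Marking X} (hb : S.IsMarking u.2.2.2.fin b)
    (hc : S.IsMarking u.2.2.1.fin c) (ω : S.MChain) :
    (((u.1, u.2.1, S.toM b, S.toM c) : Base S), ω) ∈ baseBefore S t ↔ u ∈ tabBefore S t := by
  have h1 := mem_before_marks hb (t := t)
  have h2 := mem_before_marks hc (t := t)
  constructor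
  · rintro ⟨⟨h3, h4, h5, h6⟩, -⟩
    exact ⟨h3, h4, h2.1 h6, h1.1 h5⟩
  · rintro ⟨h3, h4, h5, h6⟩
    exact ⟨⟨h3, h4, h1.2 h6, h2.2 h5⟩, trivial⟩

theorem IsRegular.lintegral_mul_absVal_le (H : M.IsRegular B r s)
    (hξ : MemLp ξ 2 (S.coeffMeasure B.inp (r⁻¹ + s⁻¹ + q)))
    (hF : M.IsVersion B (fun _ => S.split B.inp ξ) F)
    {g : Marking X × S.MChain → ℝ≥0∞}
    (hg : ∀ d, S.IsMarking B.out d → AEMeasurable (fun ϑ => g (d, ϑ)) S.dMChain) :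
    ∫⁻ z, g z * absVal t F z ∂(S.markCount B.out).prod S.dMChain ≤
      M.polyNormAt B r s t * ((∫⁻ z, ‖ξ z‖ₑ ^ 2 ∂S.coeffMeasure B.inp (r⁻¹ + s⁻¹ + q)) ^ (1 / 2 : ℝ) *
      (∫⁻ z, g z ^ 2 ∂S.coeffMeasure B.out (r⁻¹ + s⁻¹ + q)) ^ (1 / 2 : ℝ)) := by
  classical
  have hsl := sliceMeas_of_memLp H.weight H.weight_ne_zero hξ
  refine Eq.trans_le ?_ (LE.le.trans (lintegral_marked_le S (α := B.out) H.hq H.hq0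
    (Φ := fun d p => ‖trunc t (F d) p‖ₑ)
    (fun d hd => (aestronglyMeasurable_trunc (hF d hd).1).enorm) hg
    (E := (tabBefore S t).indicator fun u => ‖M ((toTable u).union B)‖ₑ *
      S.splitSq B.inp (fun z => ‖ξ z‖ₑ) q (inC S u).fin ^ (1 / 2 : ℝ)) ?_) ?_)
  · rw [S.lintegral_markProd]
    refine lintegral_congr_ae (S.ae_markCount_iff.2 fun d hd => ?_)
    exact lintegral_mul_splitSum₂_kerAbs (hF d hd).1 (hg d hd)
  · have h1 : ∀ᵐ u ∂tableMeasure S, ∀ d : {d : Marking X // S.IsMarking B.out d},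
        ∀ b, S.IsMarking u.2.2.2.fin b → ∀ c, S.IsMarking u.2.2.1.fin c → ∀ᵐ ω ∂S.dMChain,
        F d.1 ((u.1, u.2.1, S.toM b, S.toM c), ω) =
          S.app (M ((outTable (S := S) (u.1, u.2.1, S.toM b, S.toM c)).union B))
            (S.split B.inp ξ) (join d.1 (S.toM b) (S.toM c), ω) :=
      ae_all_iff.2 fun d => ae_base_marks S (hF d.1 d.2).2
    filter_upwards [h1] with u hu
    refine ⟨fun z => if u ∈ tabBefore S t then
      ‖S.app (M ((toTable u).union B)) (S.split B.inp ξ) z‖ₑ else 0, ?_, ?_, ?_⟩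
    · intro k hk
      split_ifs
      · have h2 := S.aestronglyMeasurable_app (M ((toTable u).union B)) (f := S.split B.inp ξ)
        rw [S.aestronglyMeasurable_coeff_iff H.hq.inv fun x => inv_ne_zero (H.hq0 x)] at h2
        refine (h2 k ?_).enorm
        rw [union_out]
        exact hk
      · exact aemeasurable_const
    · intro d hd b hb c hc
      filter_upwards [hu ⟨d, hd⟩ b hb c hc] with ω hω
      have h2 := mem_baseBefore_marks (t := t) hb hc ω
      unfold trunc
      by_cases h3 : u ∈ tabBefore S t
      · rw [Set.indicator_of_mem (h2.2 h3), if_pos h3]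
        refine congrArg (fun x : h => ‖x‖ₑ) (hω.trans ?_)
        exact congrArg (fun T : Table X => S.app (M (T.union B)) (S.split B.inp ξ)
          (join d (S.toM b) (S.toM c), ω)) (outTable_marks hb hc)
      · rw [Set.indicator_of_notMem (fun h4 => h3 (h2.1 h4)), if_neg h3]
        exact enorm_zero
    · by_cases h3 : u ∈ tabBefore S t
      · simp only [h3, if_true, Set.indicator_of_mem]
        have h4 := S.eLpNorm_app_le (M ((toTable u).union B)) (f := S.split B.inp ξ)
        rw [eLpNorm_two_eq, eLpNorm_two_eq] at h4
        have h5 : ∀ ρ : Marking X × S.MChain → ℝ≥0∞,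
            ∫⁻ z, ρ z ∂S.coeffMeasure (B.out ∪ (outC S u).fin) q⁻¹ =
            ∫⁻ z, ρ z ∂S.coeffMeasure ((toTable u).union B).out q⁻¹ := fun ρ => by
          rw [union_out]
        have h6 : S.splitSq B.inp (fun z => ‖ξ z‖ₑ) q (inC S u).fin =
            ∫⁻ z, ‖S.split B.inp ξ z‖ₑ ^ 2 ∂S.coeffMeasure ((toTable u).union B).inp q := by
          rw [union_inp]; rfl
        rw [h6]
        exact (congrArg (fun x : ℝ≥0∞ => x ^ (1 / 2 : ℝ)) (h5 _)).trans_le h4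
      · simp [h3]
  · have h2 : ∀ u, (tabBefore S t).indicator (fun u => ‖M ((toTable u).union B)‖ₑ *
        S.splitSq B.inp (fun z => ‖ξ z‖ₑ) q (inC S u).fin ^ (1 / 2 : ℝ)) u *
        S.splitSq B.out g q (outC S u).fin ^ (1 / 2 : ℝ) =
      (tabBefore S t).indicator (fun u => ‖M ((toTable u).union B)‖ₑ *
        S.splitSq B.inp (fun z => ‖ξ z‖ₑ) q (inC S u).fin ^ (1 / 2 : ℝ) *
        S.splitSq B.out g q (outC S u).fin ^ (1 / 2 : ℝ)) u := fun u => by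
      simp only [Set.indicator]
      split_ifs
      · rfl
      · exact zero_mul _
    rw [lintegral_congr h2, lintegral_indicator (measurableSet_tabBefore t)]
    exact lintegral_table_split_le H.hq H.hr H.hr0 H.hs H.hs0
      (N := fun u => ‖M (u.union B)‖ₑ) H.norm (fun e he => (hsl e he).enorm) hg

theorem IsVersion.aemeasurable_absVal {f : Table X → Marking X × S.MChain → h}
    (hF : M.IsVersion B f F) {d : Marking X} (hd : S.IsMarking B.out d) :
    AEMeasurable (fun ϑ => absVal t F (d, ϑ)) S.dMChain := by
  have h1 : AEMeasurable (splitSum₂ (kerAbs t (F d))) S.dMChain :=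
    aemeasurable_splitSum₂ (W := kerAbs t (F d)) S.measurable_mtime S.markedVol_time_eq
      (aemeasurable_kerAbs (hF d hd).1)
  exact h1

theorem IsVersion.aestronglyMeasurable_intVal {f : Table X → Marking X × S.MChain → h}
    (hF : M.IsVersion B f F) {d : Marking X} (hd : S.IsMarking B.out d) :
    AEStronglyMeasurable (fun ϑ => intVal t F (d, ϑ)) S.dMChain := by
  have h1 : AEStronglyMeasurable (splitSum₂ (kerInt t (F d))) S.dMChain :=
    aestronglyMeasurable_splitSum₂ (W := kerInt t (F d)) S.measurable_mtime S.markedVol_time_eq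
      (aestronglyMeasurable_kerInt (hF d hd).1)
  exact h1

theorem enorm_intVal_le (z : Marking X × S.MChain) : ‖intVal t F z‖ₑ ≤ absVal t F z :=
  (enorm_splitSum₂_le _ _).trans (splitSum₂_mono (fun _ => enorm_kerInt_le _) _)

theorem IsRegular.absVal_norm_le (H : M.IsRegular B r s) {p : X → ℝ≥0}
    (hp : AEMeasurable p S.vol) (hpq : r⁻¹ + s⁻¹ + q ≤ p)
    (hξ : MemLp ξ 2 (S.coeffMeasure B.inp p))
    (hF : M.IsVersion B (fun _ => S.split B.inp ξ) F) :
    (∫⁻ z, absVal t F z ^ 2 ∂S.coeffMeasure B.out p⁻¹) ^ (1 / 2 : ℝ) ≤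
      M.polyNormAt B r s t * eLpNorm ξ 2 (S.coeffMeasure B.inp p) := by
  have hp0 : ∀ x, p x ≠ 0 := fun x =>
    ((pos_iff_ne_zero.2 (H.weight_ne_zero x)).trans_le (hpq x)).ne'
  have hm := S.coeffMeasure_mono hpq
  refine (S.dualWeightT B.out hp hp0).le_of_forall_lintegral_mul_le
    (S.aemeasurable_markProd_iff.2 fun d hd => hF.aemeasurable_absVal hd) fun g hg => ?_
  refine (H.lintegral_mul_absVal_le (hξ.mono_measure (hm _)) hF
    (S.aemeasurable_markProd_iff.1 hg)).trans ?_
  rw [mul_assoc, eLpNorm_two_eq]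
  gcongr
  · exact hm _
  · exact hm _

theorem IsRegular.ae_absVal_lt_top (H : M.IsRegular B r s) (hfin : M.polyNormAt B r s t < ∞)
    (hξ : MemLp ξ 2 (S.coeffMeasure B.inp (r⁻¹ + s⁻¹ + q)))
    (hF : M.IsVersion B (fun _ => S.split B.inp ξ) F) {d : Marking X}
    (hd : S.IsMarking B.out d) : ∀ᵐ ϑ ∂S.dMChain, absVal t F (d, ϑ) < ∞ := by
  have h1 := (H.absVal_norm_le (t := t) H.weight le_rfl hξ hF).trans_lt
    (ENNReal.mul_lt_top hfin hξ.2)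
  rw [ENNReal.rpow_lt_top_iff_of_pos (by norm_num)] at h1
  have hi := H.weight.inv
  have hi0 : ∀ x, (r⁻¹ + s⁻¹ + q)⁻¹ x ≠ 0 := fun x => inv_ne_zero (H.weight_ne_zero x)
  have h2 := ae_lt_top' ((S.aemeasurable_coeff_iff (υ := B.out) hi hi0
    (f := fun z => absVal t F z ^ 2)).2 fun d hd => (hF.aemeasurable_absVal hd).pow_const 2) h1.ne
  rw [S.ae_coeff_iff hi hi0] at h2
  exact (h2 d hd).mono fun ϑ h3 => by
    by_contra h4
    simp only [not_lt, top_le_iff] at h4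
    simp [h4] at h3

theorem IsRegular.isIntegral_iff (H : M.IsRegular B r s) (hfin : M.polyNormAt B r s t < ∞)
    (hξ : MemLp ξ 2 (S.coeffMeasure B.inp (r⁻¹ + s⁻¹ + q)))
    (hF : M.IsVersion B (fun _ => S.split B.inp ξ) F) {ψ : Marking X × S.MChain → h} :
    M.IsIntegral B t ξ ψ ↔ ∀ d, S.IsMarking B.out d → ∀ᵐ ϑ ∂S.dMChain,
      ψ (d, ϑ) = intVal t F (d, ϑ) := by
  constructor
  · intro h1 d hd
    filter_upwards [h1.2 F hF d hd] with ϑ h2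
    exact h2.2.trans (splitSum₂_kerInt_eq ϑ).symm
  · intro h1
    refine ⟨⟨F, hF⟩, fun F' hF' d hd => ?_⟩
    have h3 := H.ae_absVal_lt_top hfin hξ hF' hd
    filter_upwards [h1 d hd, ae_integrableOn_summand (hF' d hd).1 h3,
      splitSum₂_kerInt_congr (t := t) (hF.ae_eq hF' hd)] with ϑ h4 h5 h6
    exact ⟨h5, (h4.trans h6).trans (splitSum₂_kerInt_eq ϑ)⟩

theorem IsRegular.isIntegral_congr (H : M.IsRegular B r s) (hfin : M.polyNormAt B r s t < ∞)
    (hξ : MemLp ξ 2 (S.coeffMeasure B.inp (r⁻¹ + s⁻¹ + q)))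
    (hξξ : ∀ e, S.IsMarking B.inp e → ∀ᵐ ϑ ∂S.dMChain, ξ (e, ϑ) = ξ' (e, ϑ))
    {ψ ψ' : Marking X × S.MChain → h}
    (hψ : ∀ d, S.IsMarking B.out d → ∀ᵐ ϑ ∂S.dMChain, ψ (d, ϑ) = ψ' (d, ϑ))
    (hI : M.IsIntegral B t ξ ψ) : M.IsIntegral B t ξ' ψ' := by
  have hξ' : MemLp ξ' 2 (S.coeffMeasure B.inp (r⁻¹ + s⁻¹ + q)) :=
    (memLp_congr_ae ((S.ae_coeff_iff H.weight H.weight_ne_zero).2 hξξ)).1 hξ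
  obtain ⟨F, hF⟩ := hI.1
  have h1 := (H.isIntegral_iff hfin hξ hF).1 hI
  refine (H.isIntegral_iff hfin hξ' (H.version_congr hξξ hF)).2 fun d hd => ?_
  filter_upwards [h1 d hd, hψ d hd] with ϑ h2 h3
  rw [← h3, h2]

theorem IsRegular.isIntegral_unique (H : M.IsRegular B r s) (hfin : M.polyNormAt B r s t < ∞)
    (hξ : MemLp ξ 2 (S.coeffMeasure B.inp (r⁻¹ + s⁻¹ + q)))
    {ψ ψ' : Marking X × S.MChain → h} (hI : M.IsIntegral B t ξ ψ) (hI' : M.IsIntegral B t ξ ψ')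
    {d : Marking X} (hd : S.IsMarking B.out d) : ∀ᵐ ϑ ∂S.dMChain, ψ (d, ϑ) = ψ' (d, ϑ) := by
  obtain ⟨F, hF⟩ := hI.1
  filter_upwards [(H.isIntegral_iff hfin hξ hF).1 hI d hd,
    (H.isIntegral_iff hfin hξ hF).1 hI' d hd] with ϑ h1 h2
  rw [h1, h2]

theorem IsRegular.isIntegral_add (H : M.IsRegular B r s) (hfin : M.polyNormAt B r s t < ∞)
    (hξ : MemLp ξ 2 (S.coeffMeasure B.inp (r⁻¹ + s⁻¹ + q)))
    (hξ' : MemLp ξ' 2 (S.coeffMeasure B.inp (r⁻¹ + s⁻¹ + q)))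
    {ψ ψ' : Marking X × S.MChain → h} (hI : M.IsIntegral B t ξ ψ)
    (hI' : M.IsIntegral B t ξ' ψ') : M.IsIntegral B t (ξ + ξ') (ψ + ψ') := by
  obtain ⟨F, hF⟩ := hI.1
  obtain ⟨F', hF'⟩ := hI'.1
  refine (H.isIntegral_iff hfin (hξ.add hξ') (H.version_add hξ hξ' hF hF')).2 fun d hd => ?_
  filter_upwards [(H.isIntegral_iff hfin hξ hF).1 hI d hd,
    (H.isIntegral_iff hfin hξ' hF').1 hI' d hd,
    splitSum₂_kerInt_add (hF d hd).1 (hF' d hd).1 (H.ae_absVal_lt_top hfin hξ hF hd)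
      (H.ae_absVal_lt_top hfin hξ' hF' hd)] with ϑ h1 h2 h3
  exact (congrArg₂ (· + ·) h1 h2).trans h3.symm

theorem IsRegular.isIntegral_smul (H : M.IsRegular B r s) (hfin : M.polyNormAt B r s t < ∞)
    (a : ℂ) (hξ : MemLp ξ 2 (S.coeffMeasure B.inp (r⁻¹ + s⁻¹ + q)))
    {ψ : Marking X × S.MChain → h} (hI : M.IsIntegral B t ξ ψ) :
    M.IsIntegral B t (a • ξ) (a • ψ) := by
  obtain ⟨F, hF⟩ := hI.1
  refine (H.isIntegral_iff hfin (hξ.const_smul a) (H.version_smul a hξ hF)).2 fun d hd => ?_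
  filter_upwards [(H.isIntegral_iff hfin hξ hF).1 hI d hd] with ϑ h1
  exact (congrArg (a • ·) h1).trans (splitSum₂_kerInt_smul a ϑ).symm

/-- The multiple integral of a square-integrable section. -/
theorem IsRegular.exists_integral (H : M.IsRegular B r s) (hfin : M.polyNormAt B r s t < ∞)
    {p : X → ℝ≥0} (hp : AEMeasurable p S.vol) (hpq : r⁻¹ + s⁻¹ + q ≤ p)
    (hξ : MemLp ξ 2 (S.coeffMeasure B.inp p)) :
    ∃ ψ, M.IsIntegral B t ξ ψ ∧ MemLp ψ 2 (S.coeffMeasure B.out p⁻¹) ∧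
      eLpNorm ψ 2 (S.coeffMeasure B.out p⁻¹) ≤
        M.polyNormAt B r s t * eLpNorm ξ 2 (S.coeffMeasure B.inp p) := by
  have hp0 : ∀ x, p x ≠ 0 := fun x =>
    ((pos_iff_ne_zero.2 (H.weight_ne_zero x)).trans_le (hpq x)).ne'
  have hξ0 := hξ.mono_measure (S.coeffMeasure_mono hpq _)
  obtain ⟨F, hF⟩ := H.exists_version hξ0
  have h1 : eLpNorm (intVal t F) 2 (S.coeffMeasure B.out p⁻¹) ≤
        M.polyNormAt B r s t * eLpNorm ξ 2 (S.coeffMeasure B.inp p) := by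
    refine le_trans ?_ (H.absVal_norm_le hp hpq hξ hF)
    rw [eLpNorm_two_eq]
    gcongr with z
    exact enorm_intVal_le z
  refine ⟨intVal t F, (H.isIntegral_iff hfin hξ0 hF).2 fun d hd => .of_forall fun _ => rfl,
    ⟨?_, h1.trans_lt (ENNReal.mul_lt_top hfin hξ.2)⟩, h1⟩
  exact (S.aestronglyMeasurable_coeff_iff hp.inv fun x => inv_ne_zero (hp0 x)).2
    fun d hd => hF.aestronglyMeasurable_intVal hd

/-- The multiple integral as a bounded operator. -/
theorem IsRegular.exists_operator (H : M.IsRegular B r s) (hfin : M.polyNormAt B r s t < ∞)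
    {p : X → ℝ≥0} (hp : AEMeasurable p S.vol) (hpq : r⁻¹ + s⁻¹ + q ≤ p) :
    ∃ A : S.GT h B.inp p →L[ℂ] S.GT h B.out p⁻¹,
      (∀ ξ : S.GT h B.inp p, M.IsIntegral B t ξ (A ξ)) ∧ ‖A‖ₑ ≤ M.polyNormAt B r s t := by
  have hp0 : ∀ x, p x ≠ 0 := fun x =>
    ((pos_iff_ne_zero.2 (H.weight_ne_zero x)).trans_le (hpq x)).ne'
  have hpi0 : ∀ x, p⁻¹ x ≠ 0 := fun x => inv_ne_zero (hp0 x)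
  have hL : ∀ {ξ : Marking X × S.MChain → h}, MemLp ξ 2 (S.coeffMeasure B.inp p) →
      MemLp ξ 2 (S.coeffMeasure B.inp (r⁻¹ + s⁻¹ + q)) := fun hξ =>
    hξ.mono_measure (S.coeffMeasure_mono hpq _)
  refine exists_clm_of_relation (M.IsIntegral B t) hfin.ne
    (fun ξ hξ => H.exists_integral hfin hp hpq hξ) ?_ ?_ ?_ ?_
  · exact fun ξ ξ' φ φ' hξ h1 h2 hI => H.isIntegral_congr hfin (hL hξ)
      ((S.ae_coeff_iff hp hp0 (P := fun z => ξ z = ξ' z)).1 h1)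
      ((S.ae_coeff_iff hp.inv hpi0 (P := fun z => φ z = φ' z)).1 h2) hI
  · exact fun ξ φ φ' hξ h1 h2 =>
      (S.ae_coeff_iff hp.inv hpi0 (P := fun z => φ z = φ' z)).2 fun d hd =>
      H.isIntegral_unique hfin (hL hξ) h1 h2 hd
  · exact fun ξ ξ' φ φ' hξ hξ' h1 h2 => H.isIntegral_add hfin (hL hξ) (hL hξ') h1 h2
  · exact fun a ξ φ hξ h1 => H.isIntegral_smul hfin a (hL hξ) h1

end Estimate

end MultiIntegrand

theorem DualWeight.integrable_inner {α : Type*} [MeasurableSpace α] {m ν ν' : Measure α}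
    (D : DualWeight m ν ν') {h : Type*} [NormedAddCommGroup h] [InnerProductSpace ℂ h]
    {f g : α → h} (hf : MemLp f 2 ν) (hg : MemLp g 2 ν') :
    Integrable (fun z => inner ℂ (f z) (g z)) m := by
  have hfm : AEStronglyMeasurable f m := hf.1.mono_ac D.ac'
  have hgm : AEStronglyMeasurable g m := hg.1.mono_ac D.symm.ac'
  refine ⟨hfm.inner hgm, ?_⟩
  refine lt_of_le_of_lt (lintegral_mono fun z => ?_)
    ((D.lintegral_mul_le hfm.enorm hgm.enorm).trans_lt ?_)
  · rw [← enorm_norm (f z), ← enorm_norm (g z), ← enorm_mul, enorm_le_iff_norm_le]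
    simpa using norm_inner_le_norm (𝕜 := ℂ) (f z) (g z)
  · rw [← eLpNorm_two_eq, ← eLpNorm_two_eq]
    exact ENNReal.mul_lt_top hf.2 hg.2

namespace EssOrderedSpace

open Conf

variable {X : Type*} [MeasurableSpace X] (S : EssOrderedSpace X)
  {h : Type*} [NormedAddCommGroup h] [InnerProductSpace ℂ h]

/-- The empty marking. -/
def noMarks (X : Type*) : Marking X := (∅ : Finset (X × ℕ))

theorem isMarking_empty_iff {a : Marking X} : S.IsMarking ∅ a ↔ a = noMarks X := by
  constructor
  · intro ha
    refine marking_ext fun y => ?_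
    simp only [noMarks, mpts, Finset.notMem_empty, iff_false]
    exact fun hy => Finset.notMem_empty _ (S.mem_of_isMarking ha hy)
  · rintro rfl
    refine ⟨?_, ?_, ?_⟩
    · ext x; simp [positions, noMarks]
    · intro x hx; simp [noMarks] at hx
    · intro x hx; simp [noMarks] at hx

theorem coeffMeasure_empty (q : X → ℝ≥0) :
    S.coeffMeasure ∅ q = (S.weighted q).map (Prod.mk (noMarks X)) := by
  unfold coeffMeasure
  rw [markCount_prod_eq_sum]
  let d : {a : Marking X // S.IsMarking ∅ a} := ⟨noMarks X, S.isMarking_empty_iff.2 rfl⟩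
  have hd : ∀ a : {a : Marking X // S.IsMarking ∅ a}, a = d := fun a =>
    Subtype.ext (S.isMarking_empty_iff.1 a.2)
  refine Measure.ext fun s hs => ?_
  rw [Measure.sum_apply _ hs]
  exact tsum_eq_single d fun a ha => absurd (hd a) ha

theorem eLpNorm_coeff_empty (q : X → ℝ≥0) (f : Marking X × S.MChain → h) :
    eLpNorm f 2 (S.coeffMeasure ∅ q) = eLpNorm (fun ω => f (noMarks X, ω)) 2 (S.weighted q) := by
  rw [coeffMeasure_empty]
  exact (measurableEmbedding_mk (noMarks X)).eLpNorm_map_measure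

theorem memLp_coeff_empty {q : X → ℝ≥0} {f : Marking X × S.MChain → h} :
    MemLp f 2 (S.coeffMeasure ∅ q) ↔ MemLp (fun ω => f (noMarks X, ω)) 2 (S.weighted q) := by
  rw [coeffMeasure_empty]
  exact (measurableEmbedding_mk (noMarks X)).memLp_map_measure_iff

theorem isAdjoint_app {q : X → ℝ≥0} (hq : AEMeasurable q S.vol) (hq0 : ∀ x, q x ≠ 0)
    {υ υ' : Finset X} {A : S.GT h υ q →L[ℂ] S.GT h υ' q⁻¹} {A' : S.GT h υ' q →L[ℂ] S.GT h υ q⁻¹}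
    (hA : S.IsAdjoint A A') {η ξ : Marking X × S.MChain → h}
    (hη : MemLp η 2 (S.coeffMeasure υ' q)) (hξ : MemLp ξ 2 (S.coeffMeasure υ q)) :
    S.pairingT υ' η (S.app A ξ) = S.pairingT υ (S.app A' η) ξ := by
  rw [app_of_memLp S A hξ, app_of_memLp S A' hη]
  refine Eq.trans ?_ ((hA hη.toLp hξ.toLp).trans ?_)
  · refine integral_congr_ae ?_
    filter_upwards [(S.dualWeightT υ' hq hq0).ac' hη.coeFn_toLp] with z hz
    rw [hz]
  · refine integral_congr_ae ?_
    filter_upwards [(S.dualWeightT υ hq hq0).ac' hξ.coeFn_toLp] with z hz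
    rw [hz]

end EssOrderedSpace

theorem Table.union_empty {X : Type*} (u : Table X) : u.union Table.empty = u := by
  classical
  simp [Table.union, Table.empty]

theorem Table.inp_empty {X : Type*} : (Table.empty : Table X).inp = ∅ := by
  classical
  simp [Table.inp, Table.empty]

theorem Table.out_empty {X : Type*} : (Table.empty : Table X).out = ∅ := by
  classical
  simp [Table.out, Table.empty]

namespace MultiIntegrand

open Conf EssOrderedSpace

variable {X : Type*} [MeasurableSpace X] {S : EssOrderedSpace X}
  {h : Type*} [NormedAddCommGroup h] [InnerProductSpace ℂ h] {q : X → ℝ≥0}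
  {M : MultiIntegrand S h q} {r s : X → ℝ≥0} {t : ℝ≥0}

theorem enorm_union_empty (M : MultiIntegrand S h q) (u : Table X) :
    ‖M (u.union Table.empty)‖ₑ = ‖M u‖ₑ :=
  congrArg (fun T => ‖M T‖ₑ) u.union_empty

theorem polyNormAt_empty (M : MultiIntegrand S h q) (r s : X → ℝ≥0) (t : ℝ≥0) :
    M.polyNormAt Table.empty r s t = M.polyNorm r s t := by
  unfold polyNormAt
  rw [polyNorm_eq]
  exact congrArg (fun N => polyFun S N r s t) (funext fun u => M.enorm_union_empty u)

/-- `ψ` represents the multiple integral of `χ`. -/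
def Represents (M : MultiIntegrand S h q) (t : ℝ≥0) (χ ψ : S.MChain → h) : Prop :=
  M.IsIntegral Table.empty t (S.lift χ) (S.lift ψ)

theorem memLp_lift {p : X → ℝ≥0} {χ : S.MChain → h} :
    MemLp (S.lift χ) 2 (S.coeffMeasure (Table.empty : Table X).inp p) ↔ MemLp χ 2 (S.weighted p) := by
  rw [Table.inp_empty]
  exact S.memLp_coeff_empty

section Scalar

theorem IsRegular.represents_congr (H : M.IsRegular Table.empty r s) (hfin : M.polyNorm r s t < ∞)
    {χ χ' ψ ψ' : S.MChain → h} (hχ : MemLp χ 2 (S.weighted (r⁻¹ + s⁻¹ + q)))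
    (h1 : χ =ᵐ[S.dMChain] χ') (h2 : ψ =ᵐ[S.dMChain] ψ') (hI : M.Represents t χ ψ) :
    M.Represents t χ' ψ' :=
  H.isIntegral_congr (ξ := S.lift χ) (ξ' := S.lift χ') (ψ := S.lift ψ) (ψ' := S.lift ψ')
    (M.polyNormAt_empty r s t ▸ hfin) (memLp_lift.2 hχ) (fun _ _ => h1) (fun _ _ => h2) hI

theorem IsRegular.represents_unique (H : M.IsRegular Table.empty r s)
    (hfin : M.polyNorm r s t < ∞) {χ ψ ψ' : S.MChain → h}
    (hχ : MemLp χ 2 (S.weighted (r⁻¹ + s⁻¹ + q)))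
    (hI : M.Represents t χ ψ) (hI' : M.Represents t χ ψ') : ψ =ᵐ[S.dMChain] ψ' :=
  H.isIntegral_unique (d := noMarks X) (M.polyNormAt_empty r s t ▸ hfin) (memLp_lift.2 hχ) hI hI'
    (Table.out_empty (X := X) ▸ S.isMarking_empty_iff.2 rfl)

/-- The multiple integral as a bounded operator of the Fock scale. -/
theorem IsRegular.exists_scalar_operator (H : M.IsRegular Table.empty r s)
    (hfin : M.polyNorm r s t < ∞) {p : X → ℝ≥0} (hp : AEMeasurable p S.vol)
    (hpq : r⁻¹ + s⁻¹ + q ≤ p) : ∃ A : S.G h p →L[ℂ] S.G h p⁻¹,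
      (∀ χ : S.G h p, M.Represents t χ (A χ)) ∧ ‖A‖ₑ ≤ M.polyNorm r s t := by
  have hfin' : M.polyNormAt Table.empty r s t < ∞ := M.polyNormAt_empty r s t ▸ hfin
  have hp0 : ∀ x, p x ≠ 0 := fun x =>
    ((pos_iff_ne_zero.2 (H.weight_ne_zero x)).trans_le (hpq x)).ne'
  have hpi0 : ∀ x, p⁻¹ x ≠ 0 := fun x => inv_ne_zero (hp0 x)
  have hL : ∀ {χ : S.MChain → h}, MemLp χ 2 (S.weighted p) →
      MemLp χ 2 (S.weighted (r⁻¹ + s⁻¹ + q)) := fun hχ => hχ.mono_measure (S.weighted_mono hpq)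
  have hac := S.dMChain_ac hp hp0
  have hac' := S.dMChain_ac hp.inv hpi0
  refine exists_clm_of_relation (M.Represents t) hfin.ne ?_ ?_ ?_ ?_ ?_
  · intro χ hχ
    obtain ⟨ψ, h1, h2, h3⟩ := H.exists_integral hfin' hp hpq (memLp_lift.2 hχ)
    rw [Table.out_empty] at h2 h3
    rw [M.polyNormAt_empty, Table.inp_empty, S.eLpNorm_coeff_empty, S.eLpNorm_coeff_empty] at h3
    refine ⟨fun ω => ψ (noMarks X, ω), ?_, S.memLp_coeff_empty.1 h2, h3⟩
    refine H.isIntegral_congr hfin' (memLp_lift.2 (hL hχ)) (fun _ _ => .of_forall fun _ => rfl)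
      (fun d hd => .of_forall fun ϑ => ?_) h1
    rw [Table.out_empty] at hd
    have hd' : d = noMarks X := S.isMarking_empty_iff.1 hd
    rw [hd']
    rfl
  · exact fun χ χ' φ φ' hχ h1 h2 hI => H.represents_congr hfin (hL hχ) (hac.ae_le h1)
      (hac'.ae_le h2) hI
  · exact fun χ φ φ' hχ h1 h2 => (S.weighted_ac _).ae_le (H.represents_unique hfin (hL hχ) h1 h2)
  · exact fun χ χ' φ φ' hχ hχ' h1 h2 => H.isIntegral_add hfin' (memLp_lift.2 (hL hχ))
      (memLp_lift.2 (hL hχ')) h1 h2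
  · exact fun a χ φ hχ h1 => H.isIntegral_smul hfin' a (memLp_lift.2 (hL hχ)) h1

end Scalar

end MultiIntegrand

namespace EssOrderedSpace

variable {X : Type*} [MeasurableSpace X] (S : EssOrderedSpace X)
  {h : Type*} [NormedAddCommGroup h] [InnerProductSpace ℂ h]

/-- A bounded operator `G_⋆(p) → G_⋆(p⁻¹)`, `p ∈ 𝔭₁`, as a continuous operator `G_+ → G_-`. -/
theorem exists_continuousOp {P₀ : AddSubmonoid (X → ℝ≥0)} {p₀ : X → ℝ≥0} (hp₀ : p₀ ∈ P₀)
    (hp : AEMeasurable (1 + p₀) S.vol) (A : S.G h (1 + p₀) →L[ℂ] S.G h (1 + p₀)⁻¹) :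
    ∃ T : S.Gplus h P₀ →ₗ[ℂ] S.Gminus h P₀, S.IsExtension T A ∧ S.IsContinuousOp T := by
  have hp0 : ∀ x, (1 + p₀) x ≠ 0 := fun x => by simp
  have hac := S.dMChain_ac hp hp0
  have hac' := S.dMChain_ac hp.inv fun x => inv_ne_zero (hp0 x)
  let J : S.Gplus h P₀ → S.G h (1 + p₀) := fun χ => (χ.2 p₀ hp₀).toLp
  have hJ : ∀ χ, (J χ : S.MChain → h) =ᵐ[S.dMChain] χ.1 := fun χ =>
    hac.ae_le (χ.2 p₀ hp₀).coeFn_toLp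
  have hm : ∀ f : S.G h (1 + p₀)⁻¹, AEStronglyMeasurable f S.dMChain := fun f =>
    (Lp.aestronglyMeasurable f).mono_ac hac'
  have hmk : ∀ f : S.G h (1 + p₀)⁻¹, AEEqFun.mk f (hm f) =ᵐ[S.dMChain] f := fun f =>
    AEEqFun.coeFn_mk _ _
  let T : S.Gplus h P₀ →ₗ[ℂ] S.Gminus h P₀ :=
    { toFun := fun χ => ⟨AEEqFun.mk (A (J χ)) (hm _), p₀, hp₀,
        (memLp_congr_ae ((S.weighted_ac _).ae_le (hmk _))).2 (Lp.memLp _)⟩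
      map_add' := fun χ χ' => by
        have h1 : J (χ + χ') = J χ + J χ' := by
          refine Lp.ext ((S.weighted_ac _).ae_le ?_)
          filter_upwards [hJ (χ + χ'), hJ χ, hJ χ', AEEqFun.coeFn_add χ.1 χ'.1,
            hac.ae_le (Lp.coeFn_add (J χ) (J χ'))] with ω h1 h2 h3 h4 h5
          rw [h1, h5, Pi.add_apply, h2, h3]
          exact h4
        refine Subtype.ext (AEEqFun.ext ?_)
        filter_upwards [hmk (A (J (χ + χ'))), hmk (A (J χ)), hmk (A (J χ')),
          AEEqFun.coeFn_add (AEEqFun.mk (A (J χ)) (hm _)) (AEEqFun.mk (A (J χ')) (hm _)),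
          hac'.ae_le (Lp.coeFn_add (A (J χ)) (A (J χ')))] with ω h2 h3 h4 h5 h6
        refine h2.trans (Eq.trans ?_ h5.symm)
        rw [h1, map_add, h6, Pi.add_apply, Pi.add_apply, h3, h4]
      map_smul' := fun a χ => by
        have h1 : J (a • χ) = a • J χ := by
          refine Lp.ext ((S.weighted_ac _).ae_le ?_)
          filter_upwards [hJ (a • χ), hJ χ, AEEqFun.coeFn_smul a χ.1,
            hac.ae_le (Lp.coeFn_smul a (J χ))] with ω h1 h2 h4 h5
          rw [h1, h5, Pi.smul_apply, h2]
          exact h4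
        refine Subtype.ext (AEEqFun.ext ?_)
        filter_upwards [hmk (A (J (a • χ))), hmk (A (J χ)),
          AEEqFun.coeFn_smul a (AEEqFun.mk (A (J χ)) (hm _)),
          hac'.ae_le (Lp.coeFn_smul a (A (J χ)))] with ω h2 h3 h5 h6
        refine h2.trans (Eq.trans ?_ h5.symm)
        rw [h1, map_smul, h6, Pi.smul_apply, Pi.smul_apply, h3] }
  refine ⟨T, fun χ hχ => (hmk _).symm, p₀, hp₀, ‖A‖.toNNReal, fun χ => ?_⟩
  have h1 : eLpNorm (T χ).1 2 (S.weighted (1 + p₀)⁻¹) = ‖A (J χ)‖ₑ := by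
    rw [Lp.enorm_def]
    exact eLpNorm_congr_ae ((S.weighted_ac _).ae_le (hmk _))
  have h2 : eLpNorm χ.1 2 (S.weighted (1 + p₀)) = ‖J χ‖ₑ := (Lp.enorm_toLp (χ.2 p₀ hp₀)).symm
  rw [h1, h2]
  have h3 := A.le_opENorm (J χ)
  rwa [← ofReal_norm A] at h3

end EssOrderedSpace

namespace MultiIntegrand

open Conf EssOrderedSpace

variable {X : Type*} [MeasurableSpace X] {S : EssOrderedSpace X}
  {h : Type*} [NormedAddCommGroup h] [InnerProductSpace ℂ h] {q : X → ℝ≥0}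
  {M : MultiIntegrand S h q} {r s : X → ℝ≥0} {t : ℝ≥0}

theorem measurePreserving_reflect : MeasurePreserving
    (fun u : Tables S => ((u.1, (u.2.2.1, (u.2.1, u.2.2.2))) : Tables S))
    (tableMeasure S) (tableMeasure S) :=
  (MeasurePreserving.id S.dChain).prod
    ((measurePreserving_prodAssoc S.dChain S.dChain S.dChain).comp
      ((Measure.measurePreserving_swap.prod (MeasurePreserving.id S.dChain)).comp
        (measurePreserving_prodAssoc S.dChain S.dChain S.dChain).symm))

/-- The reflection of tables. -/
def reflectEquiv (S : EssOrderedSpace X) : Tables S ≃ᵐ Tables S where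
  toFun u := (u.1, (u.2.2.1, (u.2.1, u.2.2.2)))
  invFun u := (u.1, (u.2.2.1, (u.2.1, u.2.2.2)))
  left_inv _ := rfl
  right_inv _ := rfl
  measurable_toFun := measurePreserving_reflect.measurable
  measurable_invFun := measurePreserving_reflect.measurable

theorem polyFun_reflect {N : Table X → ℝ≥0∞} (hs : AEMeasurable s S.vol)
    (hr : AEMeasurable r S.vol)
    (hN : AEMeasurable (fun u => N (toTable u)) (tableMeasure S)) :
    polyFun S (fun u => N u.reflect) r s t = polyFun S N r s t := by
  set κ := S.dChain.restrict (S.chainsBefore t) with hκ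
  have hNκ : AEMeasurable (fun u : Tables S => N (toTable u)) (κ.prod (κ.prod (κ.prod κ))) := by
    rw [← tableMeasure_restrict]; exact hN.restrict
  unfold polyFun
  rw [← hκ]
  refine lintegral_congr_ae ?_
  filter_upwards [hNκ.aestronglyMeasurable.prodMk_left] with mp hmp
  have h1 : NonsingularMap (fun p : (S.Chain × S.Chain) × S.Chain => (p.1.1, (p.1.2, p.2)))
      ((κ.prod κ).prod κ) (κ.prod (κ.prod κ)) := NonsingularMap.assoc
  have h2 : AEMeasurable (fun p : (S.Chain × S.Chain) × S.Chain =>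
      S.cwt s p.2 * N (toTable (S := S) (mp, (p.1.1, (p.1.2, p.2))))) ((κ.prod κ).prod κ) :=
    (NonsingularMap.snd.aemeasurable_comp (S.aemeasurable_cwt hs).restrict).mul
      (h1.aemeasurable_comp hmp.aemeasurable)
  let J : S.Chain → S.Chain → ℝ≥0∞ := fun x y =>
    essSup (fun cc => S.cwt s cc * N (toTable (S := S) (mp, (x, (y, cc))))) κ
  have h3 : AEMeasurable (fun p : S.Chain × S.Chain => J p.1 p.2) (κ.prod κ) :=
    aemeasurable_essSup (f := fun p : (S.Chain × S.Chain) × S.Chain =>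
      S.cwt s p.2 * N (toTable (S := S) (mp, (p.1.1, (p.1.2, p.2))))) h2
  have h4 : AEMeasurable (fun p : S.Chain × S.Chain =>
      J p.1 p.2 ^ 2 * (S.cwt r p.2 * S.cwt r p.1)) (κ.prod κ) :=
    (h3.pow_const 2).mul ((NonsingularMap.snd.aemeasurable_comp
      (S.aemeasurable_cwt hr).restrict).mul (NonsingularMap.fst.aemeasurable_comp
      (S.aemeasurable_cwt hr).restrict))
  have h5 : ∫⁻ x, ∫⁻ y, J x y ^ 2 * (S.cwt r y * S.cwt r x) ∂κ ∂κ =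
      ∫⁻ y, ∫⁻ x, J x y ^ 2 * (S.cwt r y * S.cwt r x) ∂κ ∂κ :=
    lintegral_lintegral_swap (f := fun x y => J x y ^ 2 * (S.cwt r y * S.cwt r x)) h4
  have h6 : ∫⁻ x, ∫⁻ y, J x y ^ 2 * (S.cwt r x * S.cwt r y) ∂κ ∂κ =
      ∫⁻ y, ∫⁻ x, J x y ^ 2 * (S.cwt r y * S.cwt r x) ∂κ ∂κ := by
    rw [← h5]
    refine lintegral_congr fun x => lintegral_congr fun y => ?_
    rw [mul_comm (S.cwt r x)]
  refine congrArg (fun x : ℝ≥0∞ => x ^ (1 / 2 : ℝ)) ?_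
  simp only [ENNReal.coe_mul]
  exact h6

theorem integral_markProd_union {υ υ₁ υ₂ : Finset X} [DecidableEq X]
    (hυ : υ = υ₁ ∪ υ₂) (hd : Disjoint υ₁ υ₂) {G : Marking X × S.MChain → ℂ}
    (hG : Integrable G ((S.markCount υ).prod S.dMChain)) :
    ∫ z, G z ∂(S.markCount υ).prod S.dMChain =
      ∫ b, ∫ c, ∫ ω, G (markUn b c, ω) ∂S.dMChain ∂S.markCount υ₂ ∂S.markCount υ₁ := by
  subst hυ
  rw [integral_prod _ hG, S.integral_markCount_union hd hG.integral_prod_left]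

theorem _root_.EssOrderedSpace.memLp_app {υ υ' : Finset X} {q q' : X → ℝ≥0}
    (A : S.GT h υ q →L[ℂ] S.GT h υ' q') {f : Marking X × S.MChain → h}
    (hf : MemLp f 2 (S.coeffMeasure υ q)) : MemLp (S.app A f) 2 (S.coeffMeasure υ' q') :=
  ⟨S.aestronglyMeasurable_app A, (S.eLpNorm_app_le A).trans_lt
    (ENNReal.mul_lt_top enorm_lt_top hf.2)⟩

theorem markUn_noMarks (a : Marking X) : markUn (noMarks X) a = a :=
  marking_ext fun y => by rw [mem_markUn]; simp [noMarks, mpts]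

theorem split_empty (η : S.MChain → h) (a : Marking X) (ω : S.MChain) :
    S.split ∅ (S.lift η) (a, ω) = η (un (S.toM a) ω) := by
  have h1 := S.splitPt_markUn (α := ∅) (e := noMarks X) (a := a)
    (fun y hy => by simp [noMarks, mpts] at hy) (fun y _ => by simp) ω
  rw [markUn_noMarks] at h1
  exact congrArg (S.lift η) h1

section Star

variable [CompleteSpace h]

theorem IsRegular.isAdjoint_star (H : M.IsRegular Table.empty r s) (u : Table X) :
    S.IsAdjoint (M u.reflect) (M.star u) :=
  S.isAdjoint_adjoint H.hq H.hq0 (M u.reflect)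

theorem IsRegular.enorm_star (H : M.IsRegular Table.empty r s) (u : Table X) :
    ‖M.star u‖ₑ = ‖M u.reflect‖ₑ := by
  have h1 := IsAdjoint.norm_eq S H.hq H.hq0 (H.isAdjoint_star u)
  rw [← ofReal_norm, ← ofReal_norm]
  exact congrArg ENNReal.ofReal h1

theorem IsRegular.aemeasurable_norm (H : M.IsRegular Table.empty r s) :
    AEMeasurable (fun u => ‖M (toTable u)‖ₑ) (tableMeasure S) :=
  H.norm.congr (.of_forall fun u => M.enorm_union_empty (toTable u))

theorem IsRegular.star (H : M.IsRegular Table.empty r s)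
    (hf : M.star.IsMeasurableField Table.empty) : M.star.IsRegular Table.empty r s where
  hq := H.hq
  hq0 := H.hq0
  hr := H.hr
  hr0 := H.hr0
  hs := H.hs
  hs0 := H.hs0
  field := hf
  norm := by
    refine (measurePreserving_reflect.nonsingular.aemeasurable_comp H.aemeasurable_norm).congr
      (.of_forall fun u => ?_)
    exact ((M.star.enorm_union_empty _).trans (H.enorm_star (toTable u))).symm

theorem IsRegular.polyNorm_star (H : M.IsRegular Table.empty r s) :
    M.star.polyNorm r s t = M.polyNorm r s t := by
  rw [polyNorm_eq, polyNorm_eq]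
  exact (congrArg (fun N => polyFun S N r s t) (funext H.enorm_star)).trans
    (polyFun_reflect (N := fun u => ‖M u‖ₑ) H.hs H.hr H.aemeasurable_norm)

theorem reflect_mem_tabBefore {u : Tables S} :
    ((u.1, (u.2.2.1, (u.2.1, u.2.2.2))) : Tables S) ∈ tabBefore S t ↔ u ∈ tabBefore S t := by
  unfold tabBefore
  simp only [Set.mem_prod]
  tauto

theorem IsRegular.ae_memLp_split_lift (H : M.IsRegular Table.empty r s) {χ : S.MChain → h}
    (hχ : MemLp χ 2 (S.weighted (r⁻¹ + s⁻¹ + q))) : ∀ᵐ u ∂tableMeasure S,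
      MemLp (S.split ∅ (S.lift χ)) 2 (S.coeffMeasure (toTable u).inp q) := by
  have h1 := H.ae_memLp_split (memLp_lift.2 hχ)
  simp only [Table.union_empty, Table.inp_empty] at h1
  exact h1

/-- The pairing with the multiple integral, as an integral over the tables. -/
theorem IsRegular.pairing_eq (H : M.IsRegular Table.empty r s) (hfin : M.polyNorm r s t < ∞)
    {χ η ψ : S.MChain → h} (hχ : MemLp χ 2 (S.weighted (r⁻¹ + s⁻¹ + q)))
    (hη : MemLp η 2 (S.weighted (r⁻¹ + s⁻¹ + q))) (hI : M.Represents t χ ψ) :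
    S.pairing η ψ = ∫ u in tabBefore S t, S.pairingT (toTable u).out (S.split ∅ (S.lift η))
      (S.app (M (toTable u)) (S.split ∅ (S.lift χ))) ∂tableMeasure S := by
  classical
  have hfin' : M.polyNormAt Table.empty r s t < ∞ := M.polyNormAt_empty r s t ▸ hfin
  have hac := S.dMChain_ac H.weight H.weight_ne_zero
  have hηm : AEStronglyMeasurable η S.dMChain := hη.1.mono_ac hac
  have hd : S.IsMarking (Table.empty : Table X).out (noMarks X) :=
    Table.out_empty (X := X) ▸ S.isMarking_empty_iff.2 rfl
  obtain ⟨F, hF⟩ := hI.1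
  have hFm := (hF _ hd).1
  have hψ := (H.isIntegral_iff hfin' (memLp_lift.2 hχ) hF).1 hI _ hd
  set F₀ := F (noMarks X) with hF₀
  have hun : NonsingularMap (fun p : Base S × S.MChain => un₃ (p.1.2.2.1, (p.1.2.2.2, p.2)))
      ((baseMeasure S).prod S.dMChain) S.dMChain :=
    (nonsingular_un₃ S.measurable_mtime S.markedVol_time_eq).comp (NonsingularMap.assoc.comp
      ((NonsingularMap.snd.comp NonsingularMap.snd).prodMap NonsingularMap.id))
  let G : Base S × S.MChain → ℂ := fun p =>
    inner ℂ (η (un₃ (p.1.2.2.1, (p.1.2.2.2, p.2)))) (trunc t F₀ p)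
  have hGi : Integrable G ((baseMeasure S).prod S.dMChain) := by
    refine ⟨(hun.aestronglyMeasurable_comp hηm).inner (aestronglyMeasurable_trunc hFm), ?_⟩
    have h1 : ∫⁻ p, ‖G p‖ₑ ∂(baseMeasure S).prod S.dMChain ≤
        ∫⁻ p, ‖η (un₃ (p.1.2.2.1, (p.1.2.2.2, p.2)))‖ₑ * ‖trunc t F₀ p‖ₑ
          ∂(baseMeasure S).prod S.dMChain := lintegral_mono fun p => by
      rw [← enorm_norm (η _), ← enorm_norm (trunc t F₀ p), ← enorm_mul, enorm_le_iff_norm_le]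
      simpa using norm_inner_le_norm (𝕜 := ℂ) (η _) (trunc t F₀ p)
    refine lt_of_le_of_lt h1 ?_
    have h2 := lintegral_mul_splitSum₂_kerAbs (t := t) hFm hηm.enorm
    have h3 := H.lintegral_mul_absVal_le (t := t) (memLp_lift.2 hχ) hF
      (g := fun z => ‖S.lift η z‖ₑ) fun d _ => hηm.enorm
    rw [S.lintegral_markProd, Table.out_empty, Table.inp_empty, ← eLpNorm_two_eq, ← eLpNorm_two_eq,
      S.eLpNorm_coeff_empty, S.eLpNorm_coeff_empty] at h3
    rw [← h2]
    refine lt_of_le_of_lt ?_ (h3.trans_lt (ENNReal.mul_lt_top hfin'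
      (ENNReal.mul_lt_top hχ.2 hη.2)))
    rw [lintegral_markCount]
    exact ENNReal.le_tsum (f := fun a : {a : Marking X // S.IsMarking ∅ a} =>
      ∫⁻ y, ‖S.lift η (a.1, y)‖ₑ * absVal t F (a.1, y) ∂S.dMChain)
      ⟨noMarks X, S.isMarking_empty_iff.2 rfl⟩
  have hsh := MeasurePreserving.integrable_comp_ae shuffle_base hGi
  have e1 : S.pairing η ψ = ∫ ϑ, splitSum₂ (fun y : S.MChain × (S.MChain × S.MChain) =>
      ∫ m : S.Chain × S.Chain, G ((m.1, m.2, y.1, y.2.1), y.2.2) ∂S.dChain.prod S.dChain) ϑ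
        ∂S.dMChain := by
    refine integral_congr_ae ?_
    filter_upwards [hψ, ae_integrable_trunc (t := t) hFm
      (H.ae_absVal_lt_top hfin' (memLp_lift.2 hχ) hF hd)] with ϑ h1 h2
    have h3 : ψ ϑ = splitSum₂ (kerInt t F₀) ϑ := h1
    rw [h3]
    have h4 : inner ℂ (η ϑ) (splitSum₂ (kerInt t F₀) ϑ) =
        splitSum₂ (fun y => inner ℂ (η ϑ) (kerInt t F₀ y)) ϑ := by
      simp only [splitSum₂, splitSum, inner_sum]
    refine h4.trans (splitSum₂_congr fun b hb c hc => ?_)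
    refine (integral_inner (h2 b hb c hc) (η ϑ)).symm.trans ?_
    refine integral_congr_ae (.of_forall fun m => ?_)
    have h5 : un₃ (b, (c, sdiff (sdiff ϑ b) c)) = ϑ := un₃_sdiff hb hc
    exact congrArg (fun x => inner ℂ (η x) (trunc t F₀ ((m.1, m.2, b, c), sdiff (sdiff ϑ b) c)))
      h5.symm
  have e2 := (integral_splitSum₂ S.measurable_mtime S.markedVol_time_eq
    hsh.integral_prod_left).2
  have e3 := integral_prod _ hsh
  have e4 := MeasurePreserving.integral_comp_ae shuffle_base hGi.1
  have e5 := integral_prod _ hGi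
  have e6 := integral_base_marks S hGi.integral_prod_left
  refine e1.trans (e2.trans (e3.symm.trans (e4.trans (e5.trans (e6.symm.trans ?_)))))
  rw [← integral_indicator (measurableSet_tabBefore t)]
  refine integral_congr_ae ?_
  filter_upwards [ae_base_marks S (hF _ hd).2, ae_tables_disjoint S ∅,
    H.ae_memLp_split_lift hχ, measurePreserving_reflect.nonsingular.ae (H.ae_memLp_split_lift hη)]
    with u hu hdis hχu hηu
  by_cases hut : u ∈ tabBefore S t
  · rw [Set.indicator_of_mem hut]
    have hout : (toTable u).out = u.2.2.2.fin ∪ u.2.2.1.fin := by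
      rw [← outC_fin, ← Table.union_empty (toTable u), union_out, Table.out_empty,
        Finset.empty_union]
    have hηu' : MemLp (S.split ∅ (S.lift η)) 2 (S.coeffMeasure (toTable u).out q) := hηu
    have hint := (S.dualWeightT _ H.hq H.hq0).integrable_inner hηu' (memLp_app (M (toTable u)) hχu)
    refine Eq.trans ?_ (integral_markProd_union hout hdis.1 hint).symm
    refine integral_congr_ae (S.ae_markCount_iff.2 fun b hb => ?_)
    refine integral_congr_ae (S.ae_markCount_iff.2 fun c hc => ?_)
    refine integral_congr_ae ((hu b hb c hc).mono fun ω hω => ?_)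
    have h1 : join (noMarks X) b c = markUn b c :=
      (join_eq (noMarks X) b c).trans (markUn_noMarks _)
    have h2 : un (S.toM (markUn b c)) ω = un₃ (S.toM b, (S.toM c, ω)) := by
      refine conf_ext fun y => ?_
      unfold un₃
      rw [mem_fin_un, mem_fin_un, mem_fin_un, ← or_assoc]
      exact or_congr mem_markUn Iff.rfl
    have h3 := split_empty η (markUn b c) ω
    rw [h2] at h3
    have h4 : trunc t F₀ ((u.1, u.2.1, S.toM b, S.toM c), ω) =
        F₀ ((u.1, u.2.1, S.toM b, S.toM c), ω) :=
      Set.indicator_of_mem ((mem_baseBefore_marks hb hc ω).2 hut) _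
    have h5 : S.app (M ((outTable (S := S) (u.1, u.2.1, S.toM b, S.toM c)).union Table.empty))
        (S.split (Table.empty : Table X).inp (S.lift χ)) (join (noMarks X) b c, ω) =
        S.app (M (toTable u)) (S.split ∅ (S.lift χ)) (markUn b c, ω) := by
      rw [h1, Table.inp_empty]
      exact congrArg (fun T : Table X => S.app (M T) (S.split ∅ (S.lift χ)) (markUn b c, ω))
        ((Table.union_empty _).trans (outTable_marks hb hc))
    exact congrArg₂ (fun x y => inner ℂ x y) h3.symm (h4.trans (hω.trans h5))
  · rw [Set.indicator_of_notMem hut]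
    refine integral_eq_zero_of_ae (S.ae_markCount_iff.2 fun b hb => ?_)
    refine integral_eq_zero_of_ae (S.ae_markCount_iff.2 fun c hc => ?_)
    refine integral_eq_zero_of_ae (.of_forall fun ω => ?_)
    have h4 : trunc t F₀ ((u.1, u.2.1, S.toM b, S.toM c), ω) = 0 :=
      Set.indicator_of_notMem (fun h' => hut ((mem_baseBefore_marks hb hc ω).1 h')) _
    exact (congrArg (inner ℂ _) h4).trans (inner_zero_right _)

theorem pairing_conj (η χ : S.MChain → h) :
    S.pairing η χ = (starRingEnd ℂ) (S.pairing χ η) := by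
  unfold pairing
  rw [← integral_conj]
  exact integral_congr_ae (.of_forall fun ω => (inner_conj_symm _ _).symm)

theorem pairingT_conj (υ : Finset X) (η χ : Marking X × S.MChain → h) :
    S.pairingT υ η χ = (starRingEnd ℂ) (S.pairingT υ χ η) := by
  unfold pairingT
  rw [← integral_conj]
  exact integral_congr_ae (.of_forall fun ω => (inner_conj_symm _ _).symm)

/-- The multiple integrals of `M` and `M⋆` are adjoint to each other. -/
theorem IsRegular.pairing_star (H : M.IsRegular Table.empty r s)
    (hf : M.star.IsMeasurableField Table.empty) (hfin : M.polyNorm r s t < ∞)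
    {χ η ψ φ : S.MChain → h} (hχ : MemLp χ 2 (S.weighted (r⁻¹ + s⁻¹ + q)))
    (hη : MemLp η 2 (S.weighted (r⁻¹ + s⁻¹ + q))) (hI : M.Represents t χ ψ)
    (hI' : M.star.Represents t η φ) : S.pairing η ψ = S.pairing φ χ := by
  rw [pairing_conj φ χ, H.pairing_eq hfin hχ hη hI,
    (H.star hf).pairing_eq (H.polyNorm_star.trans_lt hfin) hη hχ hI', ← integral_conj,
    ← integral_indicator (measurableSet_tabBefore t),
    ← integral_indicator (measurableSet_tabBefore t)]
  let g : Tables S → ℂ := fun u => S.pairingT (toTable u).out (S.split ∅ (S.lift η))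
    (S.app (M (toTable u)) (S.split ∅ (S.lift χ)))
  refine (MeasurePreserving.integral_comp' (f := reflectEquiv S) measurePreserving_reflect
    ((tabBefore S t).indicator g)).symm.trans (integral_congr_ae ?_)
  filter_upwards [H.ae_memLp_split_lift hη,
    measurePreserving_reflect.nonsingular.ae (H.ae_memLp_split_lift hχ)] with u h1 h2
  have h3 := reflect_mem_tabBefore (t := t) (u := u)
  by_cases hu : u ∈ tabBefore S t
  · rw [Set.indicator_of_mem hu]
    refine (Set.indicator_of_mem (h3.2 hu) g).trans ?_
    refine (S.isAdjoint_app H.hq H.hq0 (H.isAdjoint_star (toTable u)) h1 h2).trans ?_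
    exact pairingT_conj _ _ _
  · rw [Set.indicator_of_notMem hu]
    exact Set.indicator_of_notMem (fun h4 => hu (h3.1 h4)) g

end Star

end MultiIntegrand

theorem ae_le_of_ae_ae_le {A B : Type*} [MeasurableSpace A] [MeasurableSpace B]
    {a : Measure A} {b : Measure B} [SFinite b] {f g : A × B → ℝ≥0∞}
    (hf : AEMeasurable f (a.prod b)) (hg : AEMeasurable g (a.prod b))
    (h : ∀ᵐ x ∂a, ∀ᵐ y ∂b, f (x, y) ≤ g (x, y)) : f ≤ᵐ[a.prod b] g := by
  have h1 : ∀ᵐ p ∂a.prod b, hf.mk f p ≤ hg.mk g p := by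
    rw [Measure.ae_prod_iff_ae_ae (measurableSet_le hf.measurable_mk hg.measurable_mk)]
    filter_upwards [h, Measure.ae_ae_of_ae_prod hf.ae_eq_mk,
      Measure.ae_ae_of_ae_prod hg.ae_eq_mk] with x h2 h3 h4
    filter_upwards [h2, h3, h4] with y h5 h6 h7
    rwa [← h6, ← h7]
  filter_upwards [h1, hf.ae_eq_mk, hg.ae_eq_mk] with p h2 h3 h4
  rwa [h3, h4]

/-- Minkowski's integral inequality for the square norm. -/
theorem lintegral_minkowski {A B : Type*} [MeasurableSpace A] [MeasurableSpace B]
    {a : Measure A} {b : Measure B} [SigmaFinite a] [SFinite b] {f : A × B → ℝ≥0∞}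
    (hf : AEMeasurable f (a.prod b)) :
    (∫⁻ x, (∫⁻ y, f (x, y) ∂b) ^ 2 ∂a) ^ (1 / 2 : ℝ) ≤
      ∫⁻ y, (∫⁻ x, f (x, y) ^ 2 ∂a) ^ (1 / 2 : ℝ) ∂b := by
  let D : DualWeight a a a :=
    { w := 1, w' := 1, mul_eq := fun _ => one_mul _, aemeas := aemeasurable_const,
      aemeas' := aemeasurable_const, eq := by simp, eq' := by simp }
  refine D.le_of_forall_lintegral_mul_le hf.lintegral_prod_right' fun g hg => ?_
  have h0 : AEMeasurable (fun p : A × B => g p.1 * f p) (a.prod b) :=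
    (NonsingularMap.fst.aemeasurable_comp hg).mul hf
  have h1 : ∫⁻ x, g x * ∫⁻ y, f (x, y) ∂b ∂a = ∫⁻ y, ∫⁻ x, g x * f (x, y) ∂a ∂b := by
    rw [← lintegral_lintegral_swap (f := fun x y => g x * f (x, y)) h0]
    refine lintegral_congr_ae ?_
    filter_upwards [hf.aestronglyMeasurable.prodMk_left] with x hx
    exact (lintegral_const_mul'' _ hx.aemeasurable).symm
  have h2 : AEMeasurable (fun p : B × A => f (p.2, p.1)) (b.prod a) :=
    NonsingularMap.swap.aemeasurable_comp hf
  have h3 : AEMeasurable (fun y => (∫⁻ x, f (x, y) ^ 2 ∂a) ^ (1 / 2 : ℝ)) b :=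
    (AEMeasurable.lintegral_prod_right' (f := fun p : B × A => f (p.2, p.1) ^ 2)
      (h2.pow_const 2)).pow_const _
  rw [h1, ← lintegral_mul_const'' _ h3]
  refine lintegral_mono_ae ?_
  filter_upwards [h2.aestronglyMeasurable.prodMk_left] with y hy
  exact (lintegral_mul_le_sqrt hg hy.aemeasurable).trans_eq (mul_comm _ _)

theorem upperLIntegral_le {X : Type*} [MeasurableSpace X] {μ : Measure X} {f g : X → ℝ≥0∞}
    (hg : AEMeasurable g μ) (hfg : f ≤ᵐ[μ] g) : upperLIntegral μ f ≤ ∫⁻ x, g x ∂μ := by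
  rw [lintegral_congr_ae hg.ae_eq_mk]
  exact iInf₂_le_of_le (hg.mk g) hg.measurable_mk
    (iInf_le _ (hfg.trans hg.ae_eq_mk.le))

theorem upperLIntegral_mono {X : Type*} [MeasurableSpace X] {μ : Measure X} {f g : X → ℝ≥0∞}
    (hfg : f ≤ᵐ[μ] g) : upperLIntegral μ f ≤ upperLIntegral μ g :=
  le_iInf₂ fun k hk => le_iInf fun hgk => iInf₂_le_of_le k hk (iInf_le _ (hfg.trans hgk))

namespace MultiIntegrand

open Conf EssOrderedSpace

variable {X : Type*} [MeasurableSpace X] {S : EssOrderedSpace X} {N : Table X → ℝ≥0∞}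
  {r s : X → ℝ≥0} {t : ℝ≥0}

/-- The insertion of a point in a table. -/
def insT (k : QSIndex) (p : X × Tables S) : Tables S :=
  match k with
  | .minusPlus => (ins p.1 p.2.1, (p.2.2.1, (p.2.2.2.1, p.2.2.2.2)))
  | .minusCirc => (p.2.1, (ins p.1 p.2.2.1, (p.2.2.2.1, p.2.2.2.2)))
  | .circPlus => (p.2.1, (p.2.2.1, (ins p.1 p.2.2.2.1, p.2.2.2.2)))
  | .circCirc => (p.2.1, (p.2.2.1, (p.2.2.2.1, ins p.1 p.2.2.2.2)))

theorem toTable_insT (k : QSIndex) (p : X × Tables S) :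
    toTable (insT k p) = (toTable p.2).union (Table.atom k p.1) := by
  classical
  have h1 : ∀ (x : X) (a : S.Chain), (ins x a).fin = a.fin ∪ {x} := fun x a => by
    ext y; rw [mem_fin_ins, Finset.mem_union, Finset.mem_singleton, or_comm]
  have h2 : ∀ (x : X) (a : S.Chain), (ins x a : Finset X) = (a.fin : Finset X) ∪ {x} := h1
  cases k <;> simp only [insT, toTable, Table.union, Table.atom, h2] <;>
    congr <;> exact (Finset.union_empty _).symm

theorem nonsingular_insC : NonsingularMap (fun p : X × S.Chain => ins p.1 p.2)
    (S.vol.prod S.dChain) S.dChain := nonsingular_ins S.measurable_time S.vol_time_eq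

theorem nonsingular_insT (k : QSIndex) :
    NonsingularMap (insT (S := S) k) (S.vol.prod (tableMeasure S)) (tableMeasure S) := by
  have h1 : NonsingularMap (fun p : X × (S.Chain × S.Chain) => (p.2.1, ins p.1 p.2.2))
      (S.vol.prod (S.dChain.prod S.dChain)) (S.dChain.prod S.dChain) :=
    (NonsingularMap.id.prodMap nonsingular_insC).comp (NonsingularMap.assoc.comp
      ((NonsingularMap.swap.prodMap NonsingularMap.id).comp NonsingularMap.assoc_symm))
  have h2 : ∀ {B : Type _} [MeasurableSpace B] {b : Measure B} [SFinite b],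
      NonsingularMap (fun p : X × (S.Chain × B) => (ins p.1 p.2.1, p.2.2))
        (S.vol.prod (S.dChain.prod b)) (S.dChain.prod b) := fun {B} _ {b} _ =>
    (nonsingular_insC.prodMap NonsingularMap.id).comp NonsingularMap.assoc_symm
  have h3 : ∀ {B : Type _} [MeasurableSpace B] {b : Measure B} [SFinite b] {f : X × B → B},
      NonsingularMap f (S.vol.prod b) b →
      NonsingularMap (fun p : X × (S.Chain × B) => (p.2.1, f (p.1, p.2.2)))
        (S.vol.prod (S.dChain.prod b)) (S.dChain.prod b) := fun {B} _ {b} _ {f} hf =>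
    (NonsingularMap.id.prodMap hf).comp (NonsingularMap.assoc.comp
      ((NonsingularMap.swap.prodMap NonsingularMap.id).comp NonsingularMap.assoc_symm))
  cases k
  · exact h2
  · exact h3 h2
  · exact h3 (h3 h2)
  · exact h3 (h3 h1)

/-- The essential supremum over the last entry of a table. -/
def supE (S : EssOrderedSpace X) (N : Table X → ℝ≥0∞) (s : X → ℝ≥0) (t : ℝ≥0)
    (z : S.Chain × (S.Chain × S.Chain)) : ℝ≥0∞ :=
  essSup (fun cc : S.Chain => S.cwt s cc * N ⟨z.1, z.2.2, z.2.1, cc⟩)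
    (S.dChain.restrict (S.chainsBefore t))

/-- The integrand norm in terms of the essential suprema. -/
def supNorm (S : EssOrderedSpace X) (E : S.Chain × (S.Chain × S.Chain) → ℝ≥0∞) (r : X → ℝ≥0)
    (t : ℝ≥0) : ℝ≥0∞ :=
  ∫⁻ mp in S.chainsBefore t, (∫⁻ cp in S.chainsBefore t, ∫⁻ mc in S.chainsBefore t,
    E (mp, (cp, mc)) ^ 2 * (S.cwt r cp * S.cwt r mc) ∂S.dChain ∂S.dChain) ^ (1 / 2 : ℝ) ∂S.dChain

theorem polyFun_eq_supNorm : polyFun S N r s t = supNorm S (supE S N s t) r t := by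
  unfold polyFun
  simp only [ENNReal.coe_mul]
  rfl

theorem nonsingular_reorder {c : Measure S.Chain} [SFinite c] : NonsingularMap
    (fun p : (S.Chain × (S.Chain × S.Chain)) × S.Chain =>
      ((p.1.1, (p.1.2.2, (p.1.2.1, p.2))) : Tables S))
    ((S.dChain.prod (S.dChain.prod S.dChain)).prod c) (S.dChain.prod (S.dChain.prod
      (S.dChain.prod c))) :=
  measurePreserving_assoc₃.nonsingular.comp
    ((NonsingularMap.id.prodMap NonsingularMap.swap).prodMap NonsingularMap.id)

theorem aemeasurable_supE (hs : AEMeasurable s S.vol)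
    (hN : AEMeasurable (fun u => N (toTable u)) (tableMeasure S)) :
    AEMeasurable (supE S N s t) (S.dChain.prod (S.dChain.prod S.dChain)) := by
  have h1 : AEMeasurable (fun p : (S.Chain × (S.Chain × S.Chain)) × S.Chain =>
      S.cwt s p.2 * N (toTable (S := S) (p.1.1, (p.1.2.2, (p.1.2.1, p.2)))))
      ((S.dChain.prod (S.dChain.prod S.dChain)).prod S.dChain) :=
    (NonsingularMap.snd.aemeasurable_comp (S.aemeasurable_cwt hs)).mul
      (nonsingular_reorder.aemeasurable_comp hN)
  have h2 := h1.mono_ac (Measure.AbsolutelyContinuous.rfl.prod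
    (Measure.restrict_le_self (s := S.chainsBefore t)).absolutelyContinuous)
  exact aemeasurable_essSup (f := fun p : (S.Chain × (S.Chain × S.Chain)) × S.Chain =>
      S.cwt s p.2 * N (toTable (S := S) (p.1.1, (p.1.2.2, (p.1.2.1, p.2))))) h2

theorem ae_le_supE (hs : AEMeasurable s S.vol)
    (hN : AEMeasurable (fun u => N (toTable u)) (tableMeasure S)) :
    ∀ᵐ u ∂tableMeasure S, u.2.2.2 ∈ S.chainsBefore t →
      S.cwt s u.2.2.2 * N (toTable u) ≤ supE S N s t (u.1, (u.2.2.1, u.2.1)) := by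
  have h0 : AEMeasurable (fun p : (S.Chain × (S.Chain × S.Chain)) × S.Chain =>
      (S.chainsBefore t).indicator 1 p.2 * (S.cwt s p.2 *
        N (toTable (S := S) (p.1.1, (p.1.2.2, (p.1.2.1, p.2))))))
      ((S.dChain.prod (S.dChain.prod S.dChain)).prod S.dChain) :=
    (NonsingularMap.snd.aemeasurable_comp
      ((measurable_one.indicator (measurableSet_chainsBefore t)).aemeasurable)).mul
    ((NonsingularMap.snd.aemeasurable_comp (S.aemeasurable_cwt hs)).mul
      (nonsingular_reorder.aemeasurable_comp hN))
  have h1 := ae_le_of_ae_ae_le h0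
    (NonsingularMap.fst.aemeasurable_comp (aemeasurable_supE (t := t) hs hN))
    (.of_forall fun z => by
      have h2 := (ae_restrict_iff' (measurableSet_chainsBefore t)).1
        (ENNReal.ae_le_essSup (μ := S.dChain.restrict (S.chainsBefore t))
          (fun cc : S.Chain => S.cwt s cc * N ⟨z.1, z.2.2, z.2.1, cc⟩))
      filter_upwards [h2] with cc hcc
      by_cases hc : cc ∈ S.chainsBefore t
      · simp only [Set.indicator_of_mem hc, Pi.one_apply, one_mul]
        exact hcc hc
      · simp [Set.indicator_of_notMem hc])
  have h3 : NonsingularMap (fun u : Tables S => ((u.1, (u.2.2.1, u.2.1)), u.2.2.2))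
      (tableMeasure S) ((S.dChain.prod (S.dChain.prod S.dChain)).prod S.dChain) :=
    measurePreserving_assoc₃_symm.nonsingular.comp
      measurePreserving_reflect.nonsingular
  filter_upwards [h3.ae h1] with u hu hc
  simp only [Set.indicator_of_mem hc, Pi.one_apply, one_mul] at hu
  exact hu

theorem polyFun_le_supNorm {E : S.Chain × (S.Chain × S.Chain) → ℝ≥0∞}
    (h : ∀ᵐ u ∂tableMeasure S, u ∈ tabBefore S t →
      S.cwt s u.2.2.2 * N (toTable u) ≤ E (u.1, (u.2.2.1, u.2.1))) :
    polyFun S N r s t ≤ supNorm S E r t := by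
  rw [polyFun_eq_supNorm]
  have h1 := measurePreserving_reflect.nonsingular.ae h
  have h2 : ∀ᵐ u ∂(tableMeasure S).restrict (tabBefore S t),
      S.cwt s u.2.2.2 * N ⟨u.1, u.2.2.1, u.2.1, u.2.2.2⟩ ≤ E (u.1, (u.2.1, u.2.2.1)) := by
    rw [ae_restrict_iff' (measurableSet_tabBefore t)]
    filter_upwards [h1] with u hu hut
    exact hu (reflect_mem_tabBefore.2 hut)
  rw [tableMeasure_restrict] at h2
  refine lintegral_mono_ae ?_
  filter_upwards [Measure.ae_ae_of_ae_prod h2] with mp h3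
  refine ENNReal.rpow_le_rpow (lintegral_mono_ae ?_) (by norm_num)
  filter_upwards [Measure.ae_ae_of_ae_prod h3] with cp h4
  refine lintegral_mono_ae ?_
  filter_upwards [Measure.ae_ae_of_ae_prod h4] with mc h5
  gcongr
  exact essSup_le_of_ae_le _ h5

theorem chainsBefore_mono {t' : ℝ≥0} (ht : t' ≤ t) : S.chainsBefore t' ⊆ S.chainsBefore t :=
  fun _ h x hx => (h x hx).trans_le ht

theorem ins_mem_chainsBefore {x : X} {υ : S.Chain} (hx : S.time x < t)
    (hυ : υ ∈ S.chainsBefore (S.time x)) : ins x υ ∈ S.chainsBefore t := fun y hy =>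
  (mem_fin_ins.1 hy).elim (fun h => h ▸ hx) fun h => (hυ y h).trans hx

theorem insT_cc_mem (k : QSIndex) {x : X} (hx : S.time x < t) {u : Tables S}
    (hu : u ∈ tabBefore S (S.time x)) : (insT k (x, u)).2.2.2 ∈ S.chainsBefore t := by
  cases k
  · exact chainsBefore_mono hx.le hu.2.2.2
  · exact chainsBefore_mono hx.le hu.2.2.2
  · exact chainsBefore_mono hx.le hu.2.2.2
  · exact ins_mem_chainsBefore hx hu.2.2.2

/-- The estimate of the point derivatives by the essential suprema. -/
theorem ae_insT_le (hs : AEMeasurable s S.vol)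
    (hN : AEMeasurable (fun u => N (toTable u)) (tableMeasure S)) (k : QSIndex) :
    ∀ᵐ x ∂S.vol, S.time x < t → ∀ᵐ u ∂tableMeasure S, u ∈ tabBefore S (S.time x) →
      S.cwt s (insT k (x, u)).2.2.2 * N ((toTable u).union (Table.atom k x)) ≤
        supE S N s t ((insT k (x, u)).1, ((insT k (x, u)).2.2.1, (insT k (x, u)).2.1)) := by
  filter_upwards [Measure.ae_ae_of_ae_prod ((nonsingular_insT k).ae (ae_le_supE (t := t) hs hN))]
    with x hx hxt
  filter_upwards [hx] with u hu hut
  rw [← toTable_insT k (x, u)]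
  exact hu (insT_cc_mem k hxt hut)

theorem cwt_ins {w : X → ℝ≥0} {x : X} {υ : S.Chain} (h : x ∉ υ.fin) :
    S.cwt w (ins x υ) = w x * S.cwt w υ := by
  have h1 := wt_un (τ := S.time) (w := w) (a := single S.time x) (b := υ)
    fun y hy => by rw [mem_fin_single.1 hy]; exact h
  rw [un_single] at h1
  refine h1.trans ?_
  congr 1
  unfold wt
  have h2 : (single S.time x).fin = {x} := Finset.ext fun y => by
    rw [mem_fin_single, Finset.mem_singleton]
  rw [h2, Finset.prod_singleton]

end MultiIntegrand

namespace MultiIntegrand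

open Conf EssOrderedSpace

variable {X : Type*} [MeasurableSpace X] {S : EssOrderedSpace X} {N : Table X → ℝ≥0∞}
  {r s : X → ℝ≥0} {t : ℝ≥0}

/-- The weighted square in the integrand norm. -/
def supSq (S : EssOrderedSpace X) (E : S.Chain × (S.Chain × S.Chain) → ℝ≥0∞) (r : X → ℝ≥0)
    (z : S.Chain × (S.Chain × S.Chain)) : ℝ≥0∞ :=
  E z ^ 2 * (S.cwt r z.2.1 * S.cwt r z.2.2)

theorem aemeasurable_supSq {E : S.Chain × (S.Chain × S.Chain) → ℝ≥0∞}
    (hE : AEMeasurable E (S.dChain.prod (S.dChain.prod S.dChain))) (hr : AEMeasurable r S.vol) :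
    AEMeasurable (supSq S E r) (S.dChain.prod (S.dChain.prod S.dChain)) :=
  (hE.pow_const 2).mul
    (((NonsingularMap.fst.comp NonsingularMap.snd).aemeasurable_comp (S.aemeasurable_cwt hr)).mul
      ((NonsingularMap.snd.comp NonsingularMap.snd).aemeasurable_comp (S.aemeasurable_cwt hr)))

theorem supNorm_mono_time {E : S.Chain × (S.Chain × S.Chain) → ℝ≥0∞} {t' : ℝ≥0} (ht : t' ≤ t) :
    supNorm S E r t' ≤ supNorm S E r t := by
  have h1 : S.dChain.restrict (S.chainsBefore t') ≤ S.dChain.restrict (S.chainsBefore t) :=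
    Measure.restrict_mono (chainsBefore_mono ht) le_rfl
  refine lintegral_mono' h1 fun mp => ENNReal.rpow_le_rpow ?_ (by norm_num)
  exact lintegral_mono' h1 fun cp => lintegral_mono' h1 fun mc => le_rfl

theorem supNorm_const_mul {E : S.Chain × (S.Chain × S.Chain) → ℝ≥0∞} {c : ℝ≥0∞} (hc : c ≠ ∞) :
    supNorm S (fun z => c * E z) r t = c * supNorm S E r t := by
  unfold supNorm
  rw [← lintegral_const_mul' _ _ hc]
  refine lintegral_congr fun mp => ?_
  simp only [mul_pow, mul_assoc]
  simp only [lintegral_const_mul' _ _ (ENNReal.pow_ne_top (n := 2) hc)]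
  rw [ENNReal.mul_rpow_of_nonneg _ _ (by norm_num), ENNReal.sq_rpow_half]

theorem ae_notMem_chain : ∀ᵐ x ∂S.vol, ∀ᵐ υ ∂S.dChain, x ∉ υ.fin :=
  (Measure.ae_ae_of_ae_prod (ae_ins_ne S.measurable_time S.vol_time_eq)).mono fun _ hx =>
    hx.mono fun _ h hm => h _ hm rfl

theorem measurableSet_past (t : ℝ≥0) : MeasurableSet (S.past t) :=
  S.measurable_time measurableSet_Iio

theorem measurableSet_later : MeasurableSet {p : X × S.Chain | p.2 ∈ S.chainsBefore (S.time p.1)} :=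
  measurableSet_snocDomain S.measurable_time

theorem polyFun_circCirc_le (hs : AEMeasurable s S.vol) (hs0 : ∀ x, s x ≠ 0)
    (hN : AEMeasurable (fun u => N (toTable u)) (tableMeasure S)) :
    essSup (fun x => s x * polyFun S (fun u => N (u.union (Table.atom .circCirc x))) r s
      (S.time x)) (S.vol.restrict (S.past t)) ≤ polyFun S N r s t := by
  refine essSup_le_of_ae_le _ ((ae_restrict_iff' (measurableSet_past t)).2 ?_)
  filter_upwards [ae_insT_le (t := t) hs hN .circCirc, ae_notMem_chain (S := S)] with x h1 h2 hx
  have hsx : (s x : ℝ≥0∞) ≠ 0 := ENNReal.coe_ne_zero.2 (hs0 x)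
  have h3 : polyFun S (fun u => N (u.union (Table.atom .circCirc x))) r s (S.time x) ≤
      supNorm S (fun z => (s x : ℝ≥0∞)⁻¹ * supE S N s t z) r (S.time x) := by
    refine polyFun_le_supNorm ?_
    have h4 : NonsingularMap (fun u : Tables S => u.2.2.2) (tableMeasure S) S.dChain :=
      NonsingularMap.snd.comp (NonsingularMap.snd.comp NonsingularMap.snd)
    filter_upwards [h1 hx, h4.ae h2] with u h5 h6 hu
    have h7 := h5 hu
    have h8 : S.cwt s (insT .circCirc (x, u)).2.2.2 = s x * S.cwt s u.2.2.2 := cwt_ins h6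
    rw [h8, mul_assoc] at h7
    rw [← ENNReal.mul_le_iff_le_inv hsx ENNReal.coe_ne_top]
    exact h7
  calc _ ≤ s x * supNorm S (fun z => (s x : ℝ≥0∞)⁻¹ * supE S N s t z) r (S.time x) := by gcongr
    _ = supNorm S (supE S N s t) r (S.time x) := by
      rw [supNorm_const_mul (ENNReal.inv_ne_top.2 hsx), ← mul_assoc,
        ENNReal.mul_inv_cancel hsx ENNReal.coe_ne_top, one_mul]
    _ ≤ _ := (supNorm_mono_time (le_of_lt hx)).trans polyFun_eq_supNorm.ge

theorem upperLIntegral_polyFun_minusPlus_le (hs : AEMeasurable s S.vol)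
    (hr : AEMeasurable r S.vol)
    (hN : AEMeasurable (fun u => N (toTable u)) (tableMeasure S)) :
    upperLIntegral (S.vol.restrict (S.past t)) (fun x =>
      polyFun S (fun u => N (u.union (Table.atom .minusPlus x))) r s (S.time x)) ≤
      polyFun S N r s t := by
  set κ := S.dChain.restrict (S.chainsBefore t) with hκ
  have hκa : κ ≪ S.dChain := Measure.restrict_le_self.absolutelyContinuous
  have hG := aemeasurable_supSq (aemeasurable_supE (t := t) hs hN) hr
  let J : S.Chain → ℝ≥0∞ := fun mp =>
    (∫⁻ cp, ∫⁻ mc, supSq S (supE S N s t) r (mp, (cp, mc)) ∂κ ∂κ) ^ (1 / 2 : ℝ)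
  have hJ : AEMeasurable J S.dChain := by
    have h1 := hG.mono_ac (Measure.AbsolutelyContinuous.rfl.prod (hκa.prod hκa))
    have h2 : AEMeasurable (fun p : (S.Chain × S.Chain) × S.Chain =>
        supSq S (supE S N s t) r (p.1.1, (p.1.2, p.2))) ((S.dChain.prod κ).prod κ) :=
      NonsingularMap.assoc.aemeasurable_comp h1
    exact h2.lintegral_prod_right'.lintegral_prod_right'.pow_const _
  have h0 : AEMeasurable (fun x => ∫⁻ a in S.chainsBefore (S.time x), J (ins x a) ∂S.dChain)
      S.vol := by
    have h1 := ((nonsingular_insC.aemeasurable_comp hJ).indicator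
      measurableSet_later).lintegral_prod_right'
    refine h1.congr (.of_forall fun x => ?_)
    exact lintegral_indicator (measurableSet_chainsBefore (S.time x)) fun a => J (ins x a)
  refine (upperLIntegral_le h0.restrict ((ae_restrict_iff' (measurableSet_past t)).2 ?_)).trans
    ((lintegral_ins_le S.measurable_time hJ t).trans_eq polyFun_eq_supNorm.symm)
  filter_upwards [ae_insT_le (t := t) hs hN .minusPlus] with x h1 hx
  refine (polyFun_le_supNorm (E := fun z => supE S N s t (ins x z.1, z.2)) (h1 hx)).trans ?_
  refine lintegral_mono fun mp => ENNReal.rpow_le_rpow ?_ (by norm_num)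
  have h2 : S.dChain.restrict (S.chainsBefore (S.time x)) ≤ κ :=
    Measure.restrict_mono (chainsBefore_mono (le_of_lt hx)) le_rfl
  exact lintegral_mono' h2 fun cp => lintegral_mono' h2 fun mc => le_rfl

theorem upperLIntegral_polyFun_minusCirc_le (hs : AEMeasurable s S.vol)
    (hr : AEMeasurable r S.vol)
    (hN : AEMeasurable (fun u => N (toTable u)) (tableMeasure S)) :
    (upperLIntegral (S.vol.restrict (S.past t)) fun x =>
      polyFun S (fun u => N (u.union (Table.atom .minusCirc x))) r s (S.time x) ^ 2 * r x) ^
        (1 / 2 : ℝ) ≤ polyFun S N r s t := by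
  set κ := S.dChain.restrict (S.chainsBefore t) with hκ
  have hκa : κ ≪ S.dChain := Measure.restrict_le_self.absolutelyContinuous
  set π := S.vol.restrict (S.past t) with hπ
  have hπa : π ≪ S.vol := Measure.restrict_le_self.absolutelyContinuous
  let G := supSq S (supE S N s t) r
  have hG : AEMeasurable G (S.dChain.prod (S.dChain.prod S.dChain)) :=
    aemeasurable_supSq (aemeasurable_supE (t := t) hs hN) hr
  -- the truncated integrand, as a function of `(υ⁻₊, (υ^∘₊, (x, υ⁻∘)))`
  let K : S.Chain × (S.Chain × (X × S.Chain)) → ℝ≥0∞ := fun z =>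
    {p : X × S.Chain | p.2 ∈ S.chainsBefore (S.time p.1)}.indicator
      (fun p => G (z.1, (z.2.1, ins p.1 p.2))) z.2.2
  have hK : AEMeasurable K (κ.prod (κ.prod (π.prod S.dChain))) := by
    have h1 : NonsingularMap (fun z : S.Chain × (S.Chain × (X × S.Chain)) =>
        (z.1, (z.2.1, ins z.2.2.1 z.2.2.2))) (S.dChain.prod (S.dChain.prod
          (S.vol.prod S.dChain))) (S.dChain.prod (S.dChain.prod S.dChain)) :=
      NonsingularMap.id.prodMap (NonsingularMap.id.prodMap nonsingular_insC)
    have h2 := (h1.aemeasurable_comp hG).mono_ac (hκa.prod (hκa.prod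
      (hπa.prod Measure.AbsolutelyContinuous.rfl)))
    exact h2.indicator (measurableSet_later.preimage (measurable_snd.comp measurable_snd))
  have hKi : ∀ mp cp x, ∫⁻ mc, K (mp, (cp, (x, mc))) ∂S.dChain =
      ∫⁻ mc in S.chainsBefore (S.time x), G (mp, (cp, ins x mc)) ∂S.dChain := fun mp cp x => by
    rw [← lintegral_indicator (measurableSet_chainsBefore _)]
    rfl
  let f : X × S.Chain → ℝ≥0∞ := fun p =>
    (∫⁻ cp, ∫⁻ mc, K (p.2, (cp, (p.1, mc))) ∂S.dChain ∂κ) ^ (1 / 2 : ℝ)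
  have hf : AEMeasurable f (π.prod κ) := by
    have h1 : NonsingularMap (fun p : ((X × S.Chain) × S.Chain) × S.Chain =>
        (p.1.1.2, (p.1.2, (p.1.1.1, p.2)))) (((π.prod κ).prod κ).prod S.dChain)
        (κ.prod (κ.prod (π.prod S.dChain))) := by
      have h2 : NonsingularMap (fun p : (X × S.Chain) × S.Chain => ((p.1.2, p.2), p.1.1))
          ((π.prod κ).prod κ) ((κ.prod κ).prod π) :=
        NonsingularMap.swap.comp NonsingularMap.assoc
      exact NonsingularMap.assoc.comp (NonsingularMap.assoc.comp (h2.prodMap NonsingularMap.id))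
    exact (h1.aemeasurable_comp hK).lintegral_prod_right'.lintegral_prod_right'.pow_const _
  have h1 : upperLIntegral π (fun x =>
      polyFun S (fun u => N (u.union (Table.atom .minusCirc x))) r s (S.time x) ^ 2 * r x) ≤
      ∫⁻ x, (∫⁻ mp, f (x, mp) ∂κ) ^ 2 ∂π := by
    refine upperLIntegral_le (hf.lintegral_prod_right'.pow_const 2)
      ((ae_restrict_iff' (measurableSet_past t)).2 ?_)
    filter_upwards [ae_insT_le (t := t) hs hN .minusCirc, ae_notMem_chain (S := S)] with x h1 h2 hx
    have h3 := polyFun_le_supNorm (r := r) (s := s) (t := S.time x)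
      (N := fun u => N (u.union (Table.atom .minusCirc x)))
      (E := fun z => supE S N s t (z.1, (z.2.1, ins x z.2.2))) (h1 hx)
    have h4 : S.dChain.restrict (S.chainsBefore (S.time x)) ≤ κ :=
      Measure.restrict_mono (chainsBefore_mono (le_of_lt hx)) le_rfl
    have hrt : (r x : ℝ≥0∞) ^ (1 / 2 : ℝ) ≠ ∞ :=
      ENNReal.rpow_ne_top_of_nonneg (by norm_num) ENNReal.coe_ne_top
    have h5 : (r x : ℝ≥0∞) ^ (1 / 2 : ℝ) * polyFun S (fun u =>
        N (u.union (Table.atom .minusCirc x))) r s (S.time x) ≤ ∫⁻ mp, f (x, mp) ∂κ := by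
      refine (mul_le_mul' le_rfl h3).trans ?_
      unfold supNorm
      rw [← lintegral_const_mul' _ _ hrt]
      refine lintegral_mono' h4 fun mp => ?_
      simp only
      rw [← ENNReal.mul_rpow_of_nonneg _ _ (by norm_num : (0 : ℝ) ≤ 1 / 2),
        ← lintegral_const_mul' _ _ ENNReal.coe_ne_top]
      refine ENNReal.rpow_le_rpow (lintegral_mono' h4 fun cp => ?_) (by norm_num)
      simp only
      rw [← lintegral_const_mul' _ _ ENNReal.coe_ne_top, hKi]
      refine lintegral_mono_ae (ae_restrict_of_ae (h2.mono fun mc hmc => ?_))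
      simp only [G, supSq]
      rw [cwt_ins hmc]
      refine le_of_eq ?_
      ring
    calc _ = ((r x : ℝ≥0∞) ^ (1 / 2 : ℝ) * polyFun S (fun u =>
        N (u.union (Table.atom .minusCirc x))) r s (S.time x)) ^ 2 := by
          rw [mul_pow, ENNReal.rpow_half_sq, mul_comm]
      _ ≤ _ := by gcongr
  refine (ENNReal.rpow_le_rpow h1 (by norm_num)).trans ((lintegral_minkowski hf).trans ?_)
  rw [polyFun_eq_supNorm]
  have hGs : ∀ᵐ mp ∂κ, ∀ᵐ cp ∂κ, AEMeasurable (fun mc => G (mp, (cp, mc))) S.dChain := by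
    filter_upwards [hκa.ae_le hG.aestronglyMeasurable.prodMk_left] with mp h2
    filter_upwards [hκa.ae_le h2.prodMk_left] with cp h3 using h3.aemeasurable
  refine lintegral_mono_ae ?_
  filter_upwards [hK.aestronglyMeasurable.prodMk_left, hGs] with mp h2 h3
  refine ENNReal.rpow_le_rpow ?_ (by norm_num)
  have h4 : AEMeasurable (fun p : X × S.Chain => ∫⁻ mc, K (mp, (p.2, (p.1, mc))) ∂S.dChain)
      (π.prod κ) := by
    have h5 : NonsingularMap (fun p : (X × S.Chain) × S.Chain => (p.1.2, (p.1.1, p.2)))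
        ((π.prod κ).prod S.dChain) (κ.prod (π.prod S.dChain)) :=
      NonsingularMap.assoc.comp (NonsingularMap.swap.prodMap NonsingularMap.id)
    exact (h5.aemeasurable_comp h2.aemeasurable).lintegral_prod_right'
  have h6 : ∫⁻ x, f (x, mp) ^ 2 ∂π =
      ∫⁻ cp, ∫⁻ x, ∫⁻ mc, K (mp, (cp, (x, mc))) ∂S.dChain ∂π ∂κ := by
    simp only [f, ENNReal.rpow_half_sq]
    exact lintegral_lintegral_swap
      (f := fun x cp => ∫⁻ mc, K (mp, (cp, (x, mc))) ∂S.dChain) h4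
  rw [h6]
  refine lintegral_mono_ae ?_
  filter_upwards [h3] with cp h7
  simp only [hKi]
  exact lintegral_ins_le (μ := S.vol) S.measurable_time h7 t

end MultiIntegrand

theorem ae_lt_top_of_upperLIntegral {X : Type*} [MeasurableSpace X] {μ : Measure X}
    {f : X → ℝ≥0∞} (hf : upperLIntegral μ f < ∞) : ∀ᵐ x ∂μ, f x < ∞ := by
  unfold upperLIntegral at hf
  simp only [iInf_lt_iff] at hf
  obtain ⟨g, hg, hfg, h1⟩ := hf
  filter_upwards [hfg, ae_lt_top hg h1.ne] with x h2 h3 using h2.trans_lt h3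

namespace MultiIntegrand

open Conf EssOrderedSpace

variable {X : Type*} [MeasurableSpace X] {S : EssOrderedSpace X}
  {h : Type*} [NormedAddCommGroup h] [InnerProductSpace ℂ h] {q : X → ℝ≥0}
  {M : MultiIntegrand S h q} {r s : X → ℝ≥0} {t : ℝ≥0}

theorem ae_of_ae_past {P : X → Prop} (hP : ∀ t : ℝ≥0, ∀ᵐ x ∂S.vol.restrict (S.past t), P x) :
    ∀ᵐ x ∂S.vol, P x := by
  have h1 : ∀ᵐ x ∂S.vol, ∀ n : ℕ, x ∈ S.past n → P x := ae_all_iff.2 fun n =>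
    (ae_restrict_iff' (measurableSet_past (n : ℝ≥0))).1 (hP n)
  filter_upwards [h1] with x hx
  obtain ⟨n, hn⟩ := exists_nat_gt (S.time x)
  exact hx n hn

theorem IsRegular.upperLIntegral_minusPlus_le [CompleteSpace h]
    (H : M.IsRegular Table.empty r s) (t : ℝ≥0) :
    upperLIntegral (S.vol.restrict (S.past t)) (fun x =>
      M.polyNormAt (Table.atom .minusPlus x) r s (S.time x)) ≤ M.polyNorm r s t :=
  upperLIntegral_polyFun_minusPlus_le (N := fun u => ‖M u‖ₑ) H.hs H.hr H.aemeasurable_norm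

theorem IsRegular.upperLIntegral_minusCirc_le [CompleteSpace h]
    (H : M.IsRegular Table.empty r s) (t : ℝ≥0) :
    (upperLIntegral (S.vol.restrict (S.past t)) fun x =>
      M.polyNormAt (Table.atom .minusCirc x) r s (S.time x) ^ 2 * r x) ^ (1 / 2 : ℝ) ≤
      M.polyNorm r s t :=
  upperLIntegral_polyFun_minusCirc_le (N := fun u => ‖M u‖ₑ) H.hs H.hr H.aemeasurable_norm

theorem IsRegular.upperLIntegral_circPlus_le [CompleteSpace h]
    (H : M.IsRegular Table.empty r s) (t : ℝ≥0) :
    (upperLIntegral (S.vol.restrict (S.past t)) fun x =>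
      M.polyNormAt (Table.atom .circPlus x) r s (S.time x) ^ 2 * r x) ^ (1 / 2 : ℝ) ≤
      M.polyNorm r s t := by
  have hN : AEMeasurable (fun u => ‖M (toTable u).reflect‖ₑ) (tableMeasure S) :=
    measurePreserving_reflect.nonsingular.aemeasurable_comp H.aemeasurable_norm
  have h1 := upperLIntegral_polyFun_minusCirc_le (N := fun u => ‖M u.reflect‖ₑ) (t := t)
    H.hs H.hr hN
  rw [polyFun_reflect (N := fun u => ‖M u‖ₑ) H.hs H.hr H.aemeasurable_norm] at h1
  refine le_trans (ENNReal.rpow_le_rpow (upperLIntegral_mono ?_) (by norm_num)) h1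
  have h2 := ((nonsingular_insT (S := S) .minusCirc).aemeasurable_comp
    hN).aestronglyMeasurable.prodMk_left
  refine ae_restrict_of_ae ?_
  filter_upwards [h2] with x hx
  have h3 := polyFun_reflect (N := fun u => ‖M (u.union (Table.atom .minusCirc x)).reflect‖ₑ)
    (r := r) (s := s) (t := S.time x) H.hs H.hr (hx.aemeasurable.congr (.of_forall fun u =>
      congrArg (fun T : Table X => ‖M T.reflect‖ₑ) (toTable_insT .minusCirc (x, u))))
  refine le_of_eq ?_
  exact congrArg (fun y : ℝ≥0∞ => y ^ 2 * r x) h3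

theorem IsRegular.essSup_circCirc_le [CompleteSpace h]
    (H : M.IsRegular Table.empty r s) (t : ℝ≥0) :
    essSup (fun x => s x * M.polyNormAt (Table.atom .circCirc x) r s (S.time x))
      (S.vol.restrict (S.past t)) ≤ M.polyNorm r s t :=
  polyFun_circCirc_le (N := fun u => ‖M u‖ₑ) H.hs H.hs0 H.aemeasurable_norm

theorem IsRegular.ae_polyNormAt_atom_lt_top [CompleteSpace h] (H : M.IsRegular Table.empty r s)
    (hfin : ∀ t, M.polyNorm r s t < ∞) (k : QSIndex) :
    ∀ᵐ x ∂S.vol, M.polyNormAt (Table.atom k x) r s (S.time x) < ∞ := by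
  refine ae_of_ae_past fun t => ?_
  have hsq : ∀ {f : X → ℝ≥0∞}, (upperLIntegral (S.vol.restrict (S.past t)) fun x =>
      f x ^ 2 * r x) ^ (1 / 2 : ℝ) ≤ M.polyNorm r s t →
      ∀ᵐ x ∂S.vol.restrict (S.past t), f x < ∞ := fun {f} hf => by
    have h1 := hf.trans_lt (hfin t)
    rw [ENNReal.rpow_lt_top_iff_of_pos (by norm_num)] at h1
    filter_upwards [ae_lt_top_of_upperLIntegral h1] with x hx
    by_contra h2
    simp only [not_lt, top_le_iff] at h2
    have h3 : (r x : ℝ≥0∞) ≠ 0 := ENNReal.coe_ne_zero.2 (H.hr0 x)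
    simp [h2, ENNReal.top_mul h3] at hx
  cases k
  · exact ae_lt_top_of_upperLIntegral ((H.upperLIntegral_minusPlus_le t).trans_lt (hfin t))
  · exact hsq (H.upperLIntegral_minusCirc_le t)
  · exact hsq (H.upperLIntegral_circPlus_le t)
  · filter_upwards [ENNReal.ae_le_essSup (μ := S.vol.restrict (S.past t)) fun x =>
      s x * M.polyNormAt (Table.atom .circCirc x) r s (S.time x)] with x hx
    by_contra h2
    simp only [not_lt, top_le_iff] at h2
    have h3 : (s x : ℝ≥0∞) ≠ 0 := ENNReal.coe_ne_zero.2 (H.hs0 x)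
    rw [h2, ENNReal.mul_top h3] at hx
    exact absurd (hx.trans (H.essSup_circCirc_le t)) (not_le.2 (hfin t))

theorem IsRegular.ae_atom [CompleteSpace h] (H : M.IsRegular Table.empty r s) {k : QSIndex}
    (hk : ∀ᵐ x ∂S.vol, M.IsMeasurableField (Table.atom k x)) :
    ∀ᵐ x ∂S.vol, M.IsRegular (Table.atom k x) r s := by
  have h2 := ((nonsingular_insT (S := S) k).aemeasurable_comp
    H.aemeasurable_norm).aestronglyMeasurable.prodMk_left
  filter_upwards [hk, h2] with x h3 h4
  exact { hq := H.hq, hq0 := H.hq0, hr := H.hr, hr0 := H.hr0, hs := H.hs, hs0 := H.hs0,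
          field := h3,
          norm := h4.aemeasurable.congr (.of_forall fun u =>
            congrArg (fun T : Table X => ‖M T‖ₑ) (toTable_insT k (x, u))) }

/-- The point derivatives of the multiple integral. -/
theorem IsRegular.exists_derivative [CompleteSpace h] (H : M.IsRegular Table.empty r s)
    (hM : ∀ k, ∀ᵐ x ∂S.vol, M.IsMeasurableField (Table.atom k x))
    (hfin : ∀ t, M.polyNorm r s t < ∞) {p : X → ℝ≥0} (hp : AEMeasurable p S.vol)
    (hpq : r⁻¹ + s⁻¹ + q ≤ p) : ∃ D : QSIntegrand S h p,
      (∀ k : QSIndex, ∀ᵐ x ∂S.vol, ∀ ξ : S.GT h (Table.atom k x).inp p,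
        M.IsIntegral (Table.atom k x) (S.time x) ξ (D k x ξ)) ∧
      (∀ t : ℝ≥0,
        D.normOne .minusPlus t ≤ M.polyNorm r s t ∧
        D.normTwo .minusCirc r t ≤ M.polyNorm r s t ∧
        D.normTwo .circPlus r t ≤ M.polyNorm r s t ∧
        D.normTop .circCirc s t ≤ M.polyNorm r s t) := by
  classical
  let P : ∀ (k : QSIndex) (x : X),
      (S.GT h (Table.atom k x).inp p →L[ℂ] S.GT h (Table.atom k x).out p⁻¹) → Prop :=
    fun k x A => (∀ ξ : S.GT h (Table.atom k x).inp p,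
      M.IsIntegral (Table.atom k x) (S.time x) ξ (A ξ)) ∧
      ‖A‖ₑ ≤ M.polyNormAt (Table.atom k x) r s (S.time x)
  let D : QSIntegrand S h p := fun k x => if hD : ∃ A, P k x A then hD.choose else 0
  have hD : ∀ k, ∀ᵐ x ∂S.vol, P k x (D k x) := fun k => by
    filter_upwards [H.ae_atom (hM k), H.ae_polyNormAt_atom_lt_top hfin k] with x h1 h2
    have h3 : ∃ A, P k x A := h1.exists_operator h2 hp hpq
    have h4 : D k x = h3.choose := dif_pos h3
    rw [h4]
    exact h3.choose_spec
  refine ⟨D, fun k => (hD k).mono fun x hx => hx.1, fun t => ⟨?_, ?_, ?_, ?_⟩⟩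
  · refine (upperLIntegral_mono (ae_restrict_of_ae ?_)).trans (H.upperLIntegral_minusPlus_le t)
    exact (hD .minusPlus).mono fun x hx => hx.2
  · refine (ENNReal.rpow_le_rpow (upperLIntegral_mono (ae_restrict_of_ae ?_))
      (by norm_num)).trans (H.upperLIntegral_minusCirc_le t)
    exact (hD .minusCirc).mono fun x hx => mul_le_mul' (pow_le_pow_left' hx.2 2) le_rfl
  · refine (ENNReal.rpow_le_rpow (upperLIntegral_mono (ae_restrict_of_ae ?_))
      (by norm_num)).trans (H.upperLIntegral_circPlus_le t)
    exact (hD .circPlus).mono fun x hx => mul_le_mul' (pow_le_pow_left' hx.2 2) le_rfl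
  · refine (essSup_mono_ae (ae_restrict_of_ae ?_)).trans (H.essSup_circCirc_le t)
    exact (hD .circCirc).mono fun x hx => mul_le_mul' le_rfl hx.2

end MultiIntegrand

namespace Conf

variable {Z : Type*} [MeasurableSpace Z] {τ : Z → ℝ≥0} {μ : Measure Z} [SigmaFinite μ]

theorem ae_vol_nil (hτ : Measurable τ) {P : Conf τ → Prop} (h : ∀ᵐ a ∂vol μ τ, P a) :
    P (nil τ) := by
  rw [vol_eq_add hτ, ae_add_measure_iff] at h
  by_contra hP
  have h1 := Measure.le_dirac_apply (s := {a : Conf τ | ¬ P a}) (a := nil τ)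
  rw [Set.indicator_of_mem (by exact hP), show Measure.dirac (nil τ) {a : Conf τ | ¬ P a} = 0
    from h.1] at h1
  exact absurd h1 (by simp)

theorem measurableSet_before₂ (hτ : Measurable τ) (t : ℝ≥0) : MeasurableSet (before₂ τ t) :=
  (measurableSet_before hτ t).prod (measurableSet_before hτ t)

/-- The decomposition of an integral over pairs of chains by the last point, if that is later than
a given time. -/
theorem integral_prod_vol_later {E : Type*} [NormedAddCommGroup E] [NormedSpace ℝ E]
    [CompleteSpace E] (hτ : Measurable τ) (hnt : ∀ c, μ {z | τ z = c} = 0) (l : ℝ≥0)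
    {f : Conf τ × Conf τ → E} (hf : Integrable f ((vol μ τ).prod (vol μ τ))) :
    IntegrableOn (fun x => ∫ p in before₂ τ (τ x), f (ins x p.1, p.2)
      ∂(vol μ τ).prod (vol μ τ)) {x | l < τ x} μ ∧
    IntegrableOn (fun x => ∫ p in before₂ τ (τ x), f (p.1, ins x p.2)
      ∂(vol μ τ).prod (vol μ τ)) {x | l < τ x} μ ∧
    ∫ p, f p ∂(vol μ τ).prod (vol μ τ) = ∫ p in before₂ τ l, f p ∂(vol μ τ).prod (vol μ τ) +
      (∫ x in {x | l < τ x}, ∫ p in before₂ τ (τ x), f (ins x p.1, p.2)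
        ∂(vol μ τ).prod (vol μ τ) ∂μ +
      ∫ x in {x | l < τ x}, ∫ p in before₂ τ (τ x), f (p.1, ins x p.2)
        ∂(vol μ τ).prod (vol μ τ) ∂μ) := by
  have hB := measurableSet_before₂ hτ l
  have hS : MeasurableSet {x | l < τ x} := measurableSet_lt measurable_const hτ
  obtain ⟨h1, h2, h3⟩ := integral_prod_vol hτ hnt (hf.indicator hB.compl)
  have hne : ∀ᵐ x ∂μ, τ x ≠ l := by
    rw [ae_iff]
    simpa using hnt l
  have key : ∀ g : Z → Conf τ × Conf τ → Conf τ × Conf τ,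
      (∀ x, ∀ p ∈ before₂ τ (τ x), g x p ∈ before₂ τ l ↔ τ x < l) →
      (fun x => ∫ p in before₂ τ (τ x), (before₂ τ l)ᶜ.indicator f (g x p)
        ∂(vol μ τ).prod (vol μ τ)) =ᵐ[μ] {x | l < τ x}.indicator fun x =>
          ∫ p in before₂ τ (τ x), f (g x p) ∂(vol μ τ).prod (vol μ τ) := fun g hg => by
    filter_upwards [hne] with x hx
    by_cases hl : l < τ x
    · rw [Set.indicator_of_mem (by exact hl)]
      refine setIntegral_congr_fun (measurableSet_before₂ hτ _) fun p hp => ?_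
      exact Set.indicator_of_mem (s := (before₂ τ l)ᶜ)
        (Set.mem_compl fun h => lt_asymm hl ((hg x p hp).1 h)) _
    · rw [Set.indicator_of_notMem (by exact hl)]
      refine setIntegral_eq_zero_of_forall_eq_zero fun p hp => ?_
      exact Set.indicator_of_notMem (s := (before₂ τ l)ᶜ) (Set.notMem_compl_iff.2 ((hg x p hp).2
        (lt_of_le_of_ne (not_lt.1 hl) hx))) _
  have hb : ∀ {x : Z} {a : Conf τ}, a ∈ before τ (τ x) → τ x < l → a ∈ before τ l :=
    fun ha hx z hz => (ha z hz).trans hx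
  have k1 := key (fun x p => (ins x p.1, p.2)) fun x p hp =>
    ⟨fun h => (ins_mem_before.1 h.1).1, fun h => ⟨ins_mem_before.2 ⟨h, hb hp.1 h⟩, hb hp.2 h⟩⟩
  have k2 := key (fun x p => (p.1, ins x p.2)) fun x p hp =>
    ⟨fun h => (ins_mem_before.1 h.2).1, fun h => ⟨hb hp.1 h, ins_mem_before.2 ⟨h, hb hp.2 h⟩⟩⟩
  have hnil : (nil τ, nil τ) ∈ before₂ τ l := ⟨nil_mem_before l, nil_mem_before l⟩
  refine ⟨(integrable_indicator_iff hS).1 (h1.congr k1),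
    (integrable_indicator_iff hS).1 (h2.congr k2), ?_⟩
  rw [← integral_add_compl hB hf, ← integral_indicator hB.compl, h3, integral_congr_ae k1,
    integral_congr_ae k2, integral_indicator hS, integral_indicator hS,
    Set.indicator_of_notMem (Set.notMem_compl_iff.2 hnil), zero_add]

theorem setIntegral_before₂_zero {E : Type*} [NormedAddCommGroup E] [NormedSpace ℝ E]
    [CompleteSpace E] (hτ : Measurable τ) (hnt : ∀ c, μ {z | τ z = c} = 0)
    {f : Conf τ × Conf τ → E} (hf : Integrable f ((vol μ τ).prod (vol μ τ))) :
    ∫ p in before₂ τ 0, f p ∂(vol μ τ).prod (vol μ τ) = f (nil τ, nil τ) := by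
  have h1 := (integral_prod_vol_later hτ hnt 0 (hf.indicator (measurableSet_before₂ hτ 0))).2.2
  have h2 := (integral_prod_vol hτ hnt (hf.indicator (measurableSet_before₂ hτ 0))).2.2
  have hnil : (nil τ, nil τ) ∈ before₂ τ 0 := ⟨nil_mem_before 0, nil_mem_before 0⟩
  have h3 : ∀ x (p : Conf τ × Conf τ), (before₂ τ 0).indicator f (ins x p.1, p.2) = 0 :=
    fun x p => Set.indicator_of_notMem (fun h => not_lt_zero (ins_mem_before.1 h.1).1) _
  have h4 : ∀ x (p : Conf τ × Conf τ), (before₂ τ 0).indicator f (p.1, ins x p.2) = 0 :=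
    fun x p => Set.indicator_of_notMem (fun h => not_lt_zero (ins_mem_before.1 h.2).1) _
  simp only [h3, h4, integral_zero, add_zero, Set.indicator_of_mem hnil] at h2
  rw [← h2, integral_indicator (measurableSet_before₂ hτ 0)]

section SplitSum

variable {E : Type*} [AddCommMonoid E]

theorem splitSum_add (G G' : Conf τ × Conf τ → E) (ϑ : Conf τ) :
    splitSum (fun p => G p + G' p) ϑ = splitSum G ϑ + splitSum G' ϑ := Finset.sum_add_distrib

theorem splitSum₂_add (W W' : Conf τ × (Conf τ × Conf τ) → E) (ϑ : Conf τ) :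
    splitSum₂ (fun y => W y + W' y) ϑ = splitSum₂ W ϑ + splitSum₂ W' ϑ := by
  simp only [splitSum₂, splitSum, Finset.sum_add_distrib]

theorem splitSum₂_zero (ϑ : Conf τ) :
    splitSum₂ (fun _ : Conf τ × (Conf τ × Conf τ) => (0 : E)) ϑ = 0 := by
  simp [splitSum₂, splitSum]

theorem splitSum₂_ins (W : Conf τ × (Conf τ × Conf τ) → E) {x : Z} {ϑ : Conf τ}
    (hx : x ∉ ϑ.fin) : splitSum₂ W (ins x ϑ) =
      splitSum₂ (fun y => W (ins x y.1, y.2)) ϑ +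
        (splitSum₂ (fun y => W (y.1, (ins x y.2.1, y.2.2))) ϑ +
          splitSum₂ (fun y => W (y.1, (y.2.1, ins x y.2.2))) ϑ) := by
  unfold splitSum₂
  rw [splitSum_ins _ hx, splitSum_add]
  congr 1
  rw [← splitSum_add]
  refine splitSum_congr fun a _ => ?_
  rw [← splitSum_add]
  exact splitSum_ins _ fun h => hx (mem_fin_sdiff.1 h).1

open Classical in
/-- The terms of a sum over two disjoint parts, the last point of which is `y`. -/
def lastTerm (W : Conf τ × (Conf τ × Conf τ) → E) (y : Z) (p : Conf τ × (Conf τ × Conf τ)) : E :=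
  if p.1 ∈ before τ (τ y) ∧ p.2.1 ∈ before τ (τ y) then
    W (p.1, (ins y p.2.1, p.2.2)) + W (ins y p.1, p.2) else 0

/-- A sum over two disjoint parts, arranged by the last point of their union. -/
theorem splitSum₂_eq_last {ϑ : Conf τ} (hϑ : Set.InjOn τ (ϑ.fin : Set Z)) :
    ∀ W : Conf τ × (Conf τ × Conf τ) → E, splitSum₂ W ϑ = W (nil τ, (nil τ, ϑ)) +
      ∑ y ∈ ϑ.fin, splitSum₂ (lastTerm W y) (sdiff ϑ (single τ y)) := by
  classical
  suffices H : ∀ Θ : Finset Z, Set.InjOn τ (Θ : Set Z) → ∀ ϑ : Conf τ, ϑ.fin = Θ →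
      ∀ W : Conf τ × (Conf τ × Conf τ) → E, splitSum₂ W ϑ = W (nil τ, (nil τ, ϑ)) +
      ∑ y ∈ Θ, splitSum₂ (lastTerm W y) (sdiff ϑ (single τ y)) from H _ hϑ ϑ rfl
  clear hϑ ϑ
  intro Θ
  induction Θ using Finset.induction_on_max_value τ with
  | empty =>
    intro _ ϑ hϑ W
    have h1 : ∀ a : Conf τ, a.fin ⊆ (∅ : Finset Z) → a = nil τ := fun a ha =>
      Finset.subset_empty.1 ha
    have h2 : ϑ = nil τ := h1 ϑ hϑ.subset
    have h3 : sdiff (nil τ) (nil τ) = nil τ := h1 _ sdiff_subset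
    have h4 : ∀ G : Conf τ × Conf τ → E, splitSum G (nil τ) = G (nil τ, nil τ) := fun G => by
      refine (Finset.sum_singleton (fun a : Conf τ => G (a, sdiff (nil τ) a)) (nil τ)).trans ?_
      rw [h3]
    subst h2
    rw [Finset.sum_empty, add_zero]
    unfold splitSum₂
    rw [h4, h4]
  | insert m Θ hm hmax ih =>
    intro hinj ϑ' hϑ' W
    have hlt : ∀ x ∈ Θ, τ x < τ m := fun x hx => lt_of_le_of_ne (hmax x hx) fun he => by
      have := hinj (Finset.mem_insert_of_mem hx) (Finset.mem_insert_self m Θ) he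
      exact hm (this ▸ hx)
    let ϑ : Conf τ := Θ
    have hϑm : m ∉ ϑ.fin := hm
    have h0 : ϑ' = ins m ϑ := conf_ext fun x => by
      rw [hϑ', mem_fin_ins, Finset.mem_insert]; rfl
    have ih' := ih (hinj.mono (Finset.coe_subset.2 (Finset.subset_insert m Θ))) ϑ rfl
    have h1 : sdiff (ins m ϑ) (single τ m) = ϑ := conf_ext fun x => by
      rw [mem_fin_sdiff, mem_fin_ins, mem_fin_single]
      refine ⟨fun h => h.1.resolve_left h.2, fun h => ⟨Or.inr h, fun he => hϑm (he ▸ h)⟩⟩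
    have h2 : splitSum₂ (lastTerm W m) ϑ = splitSum₂ (fun y => W (y.1, (ins m y.2.1, y.2.2))) ϑ +
        splitSum₂ (fun y => W (ins m y.1, y.2)) ϑ := by
      rw [← splitSum₂_add]
      refine splitSum₂_congr fun b hb c hc => if_pos ⟨fun x hx => hlt x (hb hx), fun x hx =>
        hlt x (sdiff_subset (hc hx))⟩
    have h3 : ∀ y ∈ Θ, splitSum₂ (lastTerm W y) (sdiff (ins m ϑ) (single τ y)) =
        splitSum₂ (lastTerm (fun p => W (p.1, (p.2.1, ins m p.2.2))) y)
          (sdiff ϑ (single τ y)) := fun y hy => by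
      have hmy : m ∉ (single τ y).fin := fun h => hm (mem_fin_single.1 h ▸ hy)
      rw [sdiff_ins hmy, splitSum₂_ins _ fun h => hϑm (mem_fin_sdiff.1 h).1]
      have h4 : ∀ p : Conf τ × (Conf τ × Conf τ), lastTerm W y (ins m p.1, p.2) = 0 :=
        fun p => if_neg fun h => lt_asymm (hlt y hy) (ins_mem_before.1 h.1).1
      have h5 : ∀ p : Conf τ × (Conf τ × Conf τ),
          lastTerm W y (p.1, (ins m p.2.1, p.2.2)) = 0 :=
        fun p => if_neg fun h => lt_asymm (hlt y hy) (ins_mem_before.1 h.2).1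
      simp only [h4, h5, splitSum₂_zero, zero_add]
      rfl
    rw [h0, splitSum₂_ins _ hϑm, ih' fun p => W (p.1, (p.2.1, ins m p.2.2)),
      Finset.sum_insert hm, h1, h2, Finset.sum_congr rfl h3]
    abel

theorem integral_splitSum₂_param {Y E : Type*} [MeasurableSpace Y] [NormedAddCommGroup E]
    [NormedSpace ℝ E] {ν : Measure Y} {G : Y → Conf τ × (Conf τ × Conf τ) → E} {ϑ : Conf τ}
    (hG : ∀ b : Conf τ, b.fin ⊆ ϑ.fin → ∀ c : Conf τ, c.fin ⊆ (sdiff ϑ b).fin →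
      Integrable (fun x => G x (b, (c, sdiff (sdiff ϑ b) c))) ν) :
    Integrable (fun x => splitSum₂ (G x) ϑ) ν ∧
      ∫ x, splitSum₂ (G x) ϑ ∂ν = splitSum₂ (fun y => ∫ x, G x y ∂ν) ϑ := by
  have h1 : ∀ b ∈ ϑ.fin.powerset, Integrable (fun x =>
      splitSum (fun p => G x (b, p)) (sdiff ϑ b)) ν := fun b hb =>
    integrable_finsetSum _ fun c hc => hG b (sdiff_subset' hb) c (sdiff_subset' hc)
  refine ⟨integrable_finsetSum _ h1, (integral_finsetSum _ h1).trans ?_⟩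
  refine Finset.sum_congr rfl fun b hb => integral_finsetSum _ fun c hc =>
    hG b (sdiff_subset' hb) c (sdiff_subset' hc)

end SplitSum

end Conf

section Coordinates

variable {A B C : Type*} [MeasurableSpace A] [MeasurableSpace B] [MeasurableSpace C]
  {a : Measure A} {b : Measure B} {c : Measure C} [SFinite a] [SFinite b] [SFinite c]

theorem NonsingularMap.mapFst {f : A × B → B} (hf : NonsingularMap f (a.prod b) b) :
    NonsingularMap (fun p : A × (B × C) => (f (p.1, p.2.1), p.2.2)) (a.prod (b.prod c))
      (b.prod c) := (hf.prodMap NonsingularMap.id).comp NonsingularMap.assoc_symm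

theorem NonsingularMap.mapSnd {f : A × C → C} (hf : NonsingularMap f (a.prod c) c) :
    NonsingularMap (fun p : A × (B × C) => (p.2.1, f (p.1, p.2.2))) (a.prod (b.prod c))
      (b.prod c) :=
  (NonsingularMap.id.prodMap hf).comp (NonsingularMap.assoc.comp
    ((NonsingularMap.swap.prodMap NonsingularMap.id).comp NonsingularMap.assoc_symm))

end Coordinates

namespace EssOrderedSpace

variable {X : Type*} [MeasurableSpace X] (S : EssOrderedSpace X)

theorem ae_of_ae_markedVol {P : X × ℕ → Prop} (h : ∀ᵐ y ∂S.markedVol, P y) :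
    ∀ᵐ x ∂S.vol, ∀ j ∈ S.idx x, P (x, j) := by
  have h1 := Measure.ae_ae_of_ae_prod ((ae_restrict_iff' S.measurableSet_idx).1 h)
  filter_upwards [h1] with x hx j hj
  exact Measure.ae_count_iff.1 hx j hj

theorem ae_markedVol_mem : ∀ᵐ y ∂S.markedVol, y.2 ∈ S.idx y.1 :=
  ae_restrict_mem S.measurableSet_idx

/-- The measure on the points at the place `k` of a table, which are marked if `k` is in the
out-part. -/
def pointVol : QSIndex → Measure (X × ℕ)
  | .minusPlus | .minusCirc => S.vol.prod (Measure.dirac 0)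
  | .circPlus | .circCirc => S.markedVol

instance (k : QSIndex) : SFinite (S.pointVol k) := by
  cases k <;> unfold pointVol <;> infer_instance

theorem nonsingular_zeroMark :
    NonsingularMap (fun x : X => (x, 0)) S.vol (S.vol.prod (Measure.dirac (0 : ℕ))) := by
  refine ⟨measurable_prodMk_right.aemeasurable, ?_⟩
  rw [Measure.prod_dirac]

/-- The mark of the point in a basis index. -/
def markOf (d : Marking X) : ℕ := (mpts d).sup Prod.snd

theorem mpts_of_isMarking_singleton {x : X} {d : Marking X} (hd : S.IsMarking {x} d) :
    mpts d = {(x, markOf d)} ∧ markOf d ∈ S.idx x := by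
  obtain ⟨j, hj⟩ := mem_positions.1 (hd.1 ▸ Finset.mem_singleton_self x : x ∈ positions (mpts d))
  have h2 : mpts d = {(x, j)} := by
    refine Finset.eq_singleton_iff_unique_mem.2 ⟨hj, fun y hy => ?_⟩
    exact hd.2.1 hy hj (Finset.mem_singleton.1 (S.mem_of_isMarking hd hy))
  have h3 : markOf d = j := by unfold markOf; rw [h2]; exact Finset.sup_singleton
  rw [h3]
  exact ⟨h2, hd.2.2 _ hj⟩

theorem ae_point_of_marking {k : QSIndex} {P : X × ℕ → Prop} (h : ∀ᵐ y ∂S.pointVol k, P y) :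
    ∀ᵐ x ∂S.vol, ∀ d : Marking X, S.IsMarking (Table.atom k x).out d → P (x, markOf d) := by
  classical
  have h1 : ∀ x : X, (∀ d, S.IsMarking ∅ d → P (x, markOf d)) ↔ P (x, 0) := fun x => by
    refine ⟨fun H => H (noMarks X) (S.isMarking_empty_iff.2 rfl), fun H d hd => ?_⟩
    rw [S.isMarking_empty_iff.1 hd]
    exact H
  cases k
  case minusPlus | minusCirc =>
    filter_upwards [S.nonsingular_zeroMark.ae h] with x hx d hd
    exact (h1 x).2 hx d hd
  all_goals
    filter_upwards [S.ae_of_ae_markedVol h] with x hx d hd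
    exact hx _ (S.mpts_of_isMarking_singleton hd).2

end EssOrderedSpace

namespace MultiIntegrand

open Conf EssOrderedSpace

variable {X : Type*} [MeasurableSpace X] {S : EssOrderedSpace X}

/-- The insertion of a point in a table with marked out-parts. -/
def insB (k : QSIndex) (y : X × ℕ) (z : Base S) : Base S :=
  match k with
  | .minusPlus => (ins y.1 z.1, z.2.1, z.2.2.1, z.2.2.2)
  | .minusCirc => (z.1, ins y.1 z.2.1, z.2.2.1, z.2.2.2)
  | .circPlus => (z.1, z.2.1, z.2.2.1, ins y z.2.2.2)
  | .circCirc => (z.1, z.2.1, ins y z.2.2.1, z.2.2.2)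

theorem nonsingular_insB (k : QSIndex) :
    NonsingularMap (fun p : (X × ℕ) × Base S => insB k p.1 p.2)
      ((S.pointVol k).prod (baseMeasure S)) (baseMeasure S) := by
  have h1 : NonsingularMap (fun p : (X × ℕ) × S.Chain => ins p.1.1 p.2)
      ((S.vol.prod (Measure.dirac 0)).prod S.dChain) S.dChain :=
    nonsingular_insC.comp (NonsingularMap.fst.prodMap NonsingularMap.id)
  have h2 : NonsingularMap (fun p : (X × ℕ) × S.MChain => ins p.1 p.2)
      (S.markedVol.prod S.dMChain) S.dMChain :=
    nonsingular_ins S.measurable_mtime S.markedVol_time_eq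
  cases k
  · exact h1.mapFst
  · exact h1.mapFst.mapSnd
  · exact h2.mapSnd.mapSnd.mapSnd
  · exact h2.mapFst.mapSnd.mapSnd

open Classical in
theorem outTable_insB (k : QSIndex) (y : X × ℕ) (z : Base S) :
    outTable (insB k y z) = (outTable z).union (Table.atom k y.1) := by
  have h1 : ∀ (x : X) (a : S.Chain), (ins x a).fin = a.fin ∪ {x} := fun x a => by
    ext y; rw [mem_fin_ins, Finset.mem_union, Finset.mem_singleton, or_comm]
  have h1' : ∀ (x : X) (a : S.Chain), (ins x a : Finset X) = (a.fin : Finset X) ∪ {x} := h1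
  have h2 : ∀ (y : X × ℕ) (a : S.MChain), positions (ins y a) = positions a.fin ∪ {y.1} :=
    fun y a => by
      refine Finset.ext fun x => ?_
      have h3 : ∀ w, w ∈ (ins y a).fin ↔ w = y ∨ w ∈ a.fin := fun w => mem_fin_ins
      refine mem_positions.trans (Iff.trans ?_
        (Finset.mem_union.trans (or_congr mem_positions Finset.mem_singleton)).symm)
      refine (exists_congr fun j => h3 (x, j)).trans ?_
      constructor
      · rintro ⟨j, rfl | hj⟩
        exacts [Or.inr rfl, Or.inl ⟨j, hj⟩]
      · rintro (⟨j, hj⟩ | rfl)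
        exacts [⟨j, Or.inr hj⟩, ⟨y.2, Or.inl rfl⟩]
  cases k <;> simp only [insB, outTable, Table.union, Table.atom, h1', h2] <;>
    congr <;> exact (Finset.union_empty _).symm

theorem join_insB {k : QSIndex} {x : X} {d : Marking X}
    (hd : S.IsMarking (Table.atom k x).out d) (z : Base S) :
    join (mpts (noMarks X)) (insB k (x, markOf d) z).2.2.1.fin (insB k (x, markOf d) z).2.2.2.fin =
      join (mpts d) z.2.2.1.fin z.2.2.2.fin := by
  classical
  have hm : ∀ (a : Marking X) (b c : Finset (X × ℕ)) (w : X × ℕ),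
      w ∈ mpts (join (mpts a) b c) ↔ (w ∈ mpts a ∨ w ∈ b) ∨ w ∈ c := fun a b c w =>
    Finset.mem_union.trans (or_congr Finset.mem_union Iff.rfl)
  have h0 : ∀ w, w ∉ mpts (noMarks X) := fun w => Finset.notMem_empty w
  have h1 : S.IsMarking ∅ d → ∀ w, w ∉ mpts d := fun h w => by
    rw [S.isMarking_empty_iff.1 h]; exact h0 w
  have h2 : S.IsMarking {x} d → ∀ w, w ∈ mpts d ↔ w = (x, markOf d) := fun h w => by
    rw [(S.mpts_of_isMarking_singleton h).1, Finset.mem_singleton]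
  refine marking_ext fun w => (hm _ _ _ w).trans (Iff.trans ?_ (hm _ _ _ w).symm)
  cases k
  case minusPlus | minusCirc =>
    exact or_congr (or_congr (iff_of_false (h0 w) (h1 hd w)) Iff.rfl) Iff.rfl
  case circPlus =>
    have h3 : w ∈ (ins (x, markOf d) z.2.2.2).fin ↔ _ := mem_fin_ins
    have h4 := h2 hd w
    have h5 := h0 w
    change (_ ∨ w ∈ z.2.2.1.fin) ∨ w ∈ (ins (x, markOf d) z.2.2.2).fin ↔ _
    tauto
  case circCirc =>
    have h3 : w ∈ (ins (x, markOf d) z.2.2.1).fin ↔ _ := mem_fin_ins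
    have h4 := h2 hd w
    have h5 := h0 w
    change (_ ∨ w ∈ (ins (x, markOf d) z.2.2.1).fin) ∨ w ∈ z.2.2.2.fin ↔ _
    tauto

section Slices

variable {h : Type*} [NormedAddCommGroup h] [InnerProductSpace ℂ h]

/-- The field of vectors with an inserted point. -/
def insF (k : QSIndex) (F : Base S × S.MChain → h) (y : X × ℕ) (z : Base S × S.MChain) : h :=
  F (insB k y z.1, z.2)

/-- The integral of the point derivative up to the time of the point. -/
def pointVal (k : QSIndex) (F : Base S × S.MChain → h) (p : (X × ℕ) × S.MChain) : h :=
  splitSum₂ (kerInt (S.mtime p.1) (insF k F p.1)) p.2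

theorem measurableSet_baseBefore_point :
    MeasurableSet {p : (X × ℕ) × (Base S × S.MChain) | p.2 ∈ baseBefore S (S.mtime p.1)} := by
  have hf : Measurable fun p : (X × ℕ) × (Base S × S.MChain) => S.mtime p.1 :=
    S.measurable_mtime.comp measurable_fst
  have hz : Measurable fun p : (X × ℕ) × (Base S × S.MChain) => p.2.1 :=
    measurable_fst.comp measurable_snd
  have h1 := measurableSet_before_pair S.measurable_time hf (measurable_fst.comp hz)
  have h2 := measurableSet_before_pair S.measurable_time hf
    (measurable_fst.comp (measurable_snd.comp hz))
  have h3 := measurableSet_before_pair S.measurable_mtime hf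
    (measurable_fst.comp (measurable_snd.comp (measurable_snd.comp hz)))
  have h4 := measurableSet_before_pair S.measurable_mtime hf
    (measurable_snd.comp (measurable_snd.comp (measurable_snd.comp hz)))
  refine (h1.inter (h2.inter (h3.inter h4))).congr (Set.ext fun p => ?_)
  exact ⟨fun h => ⟨⟨h.1, h.2.1, h.2.2.1, h.2.2.2⟩, trivial⟩,
    fun h => ⟨h.1.1, h.1.2.1, h.1.2.2.1, h.1.2.2.2⟩⟩

variable {F : Base S × S.MChain → h}

theorem aestronglyMeasurable_insF (hF : AEStronglyMeasurable F ((baseMeasure S).prod S.dMChain))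
    (k : QSIndex) : AEStronglyMeasurable (fun p : (X × ℕ) × (Base S × S.MChain) => insF k F p.1 p.2)
      ((S.pointVol k).prod ((baseMeasure S).prod S.dMChain)) :=
  (nonsingular_insB k).mapFst.aestronglyMeasurable_comp hF

theorem aestronglyMeasurable_pointVal
    (hF : AEStronglyMeasurable F ((baseMeasure S).prod S.dMChain)) (k : QSIndex) :
    AEStronglyMeasurable (pointVal k F) ((S.pointVol k).prod S.dMChain) := by
  have h1 := (aestronglyMeasurable_insF hF k).indicator (measurableSet_baseBefore_point (S := S))
  have h2 : AEStronglyMeasurable (fun p : (X × ℕ) × (S.MChain × (S.MChain × S.MChain)) =>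
      kerInt (S.mtime p.1) (insF k F p.1) p.2)
      ((S.pointVol k).prod (S.dMChain.prod (S.dMChain.prod S.dMChain))) :=
    (((NonsingularMap.id.prodMap shuffle_base.nonsingular).comp
      NonsingularMap.assoc).aestronglyMeasurable_comp h1).integral_prod_right'
  have h3 := aestronglyMeasurable_splitSum S.measurable_mtime S.markedVol_time_eq
    (NonsingularMap.assoc.aestronglyMeasurable_comp h2)
  exact aestronglyMeasurable_splitSum S.measurable_mtime S.markedVol_time_eq
    (NonsingularMap.assoc_symm.aestronglyMeasurable_comp h3)

variable {q : X → ℝ≥0} {M : MultiIntegrand S h q} {χ : S.MChain → h}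
  {F : Marking X → Base S × S.MChain → h}

theorem split_split_empty (α : Finset X) (χ : S.MChain → h) :
    S.split α (S.split ∅ (S.lift χ)) = S.split ∅ (S.lift χ) := by
  classical
  funext z
  refine (S.split_apply α _ z).trans ((split_empty χ _ _).trans
    (Eq.trans (congrArg χ (conf_ext fun w => ?_)) (split_empty χ z.1 z.2).symm))
  refine mem_fin_un.trans (Iff.trans ?_ mem_fin_un.symm)
  change (w ∈ (mpts z.1).filter _) ∨ (w ∈ (mpts z.1).filter _ ∪ z.2.fin) ↔ w ∈ mpts z.1 ∨ _
  rw [Finset.mem_union, Finset.mem_filter, Finset.mem_filter]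
  tauto

theorem IsVersion.ae_insF (hF : M.IsVersion Table.empty (fun _ => S.split ∅ (S.lift χ)) F)
    (k : QSIndex) : ∀ᵐ x ∂S.vol, M.IsVersion (Table.atom k x) (fun _ => S.split ∅ (S.lift χ))
      fun d => insF k (F (noMarks X)) (x, markOf d) := by
  have h0 : S.IsMarking (Table.empty : Table X).out (noMarks X) :=
    S.isMarking_empty_iff.2 rfl
  obtain ⟨h1, h2⟩ := hF _ h0
  have h3 := (aestronglyMeasurable_insF h1 k).prodMk_left
  have h4 := Measure.ae_ae_of_ae_prod ((nonsingular_insB (S := S) k).ae h2)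
  filter_upwards [S.ae_point_of_marking (h3.and h4)] with x hx d hd
  refine ⟨(hx d hd).1, ?_⟩
  filter_upwards [(hx d hd).2] with z hz
  filter_upwards [hz] with ω hω
  refine hω.trans ?_
  rw [Table.union_empty]
  have h5 := outTable_insB k (x, markOf d) z
  have h6 := join_insB hd z
  exact congrArg₂ (fun (T : Table X) m => S.app (M T) (S.split ∅ (S.lift χ)) (m, ω)) h5 h6

end Slices

end MultiIntegrand

namespace MultiIntegrand

open Conf EssOrderedSpace

variable {X : Type*} [MeasurableSpace X] {S : EssOrderedSpace X}
  {h : Type*} [NormedAddCommGroup h] [InnerProductSpace ℂ h] {q : X → ℝ≥0}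
  {M : MultiIntegrand S h q} {r s : X → ℝ≥0} {t : ℝ≥0} {χ : S.MChain → h} {p : X → ℝ≥0}
  {F : Marking X → Base S × S.MChain → h}

/-- The argument of the point derivative at the place `k`. -/
def pointInp (S : EssOrderedSpace X) (k : QSIndex) (χ : S.MChain → h) : Marking X × S.MChain → h :=
  match k with
  | .minusPlus | .circPlus => S.lift χ
  | .minusCirc | .circCirc => S.split ∅ (S.lift χ)

theorem split_pointInp (k : QSIndex) (x : X) (χ : S.MChain → h) :
    S.split (Table.atom k x).inp (pointInp S k χ) = S.split ∅ (S.lift χ) := by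
  cases k
  exacts [rfl, split_split_empty _ χ, rfl, split_split_empty _ χ]

theorem ae_memLp_pointInp (hp : AEMeasurable p S.vol) (hp0 : ∀ x, p x ≠ 0) {v : X → ℝ≥0}
    (hv : AEMeasurable v S.vol) (hv0 : ∀ x, v x ≠ 0) (hχ : MemLp χ 2 (S.weighted (v + p)))
    (k : QSIndex) :
    ∀ᵐ x ∂S.vol, MemLp (pointInp S k χ) 2 (S.coeffMeasure (Table.atom k x).inp p) := by
  classical
  have h1 : MemLp (S.lift χ) 2 (S.coeffMeasure ∅ (v + p)) := S.memLp_coeff_empty.2 hχ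
  have h2 : MemLp (S.lift χ) 2 (S.coeffMeasure ∅ p) :=
    h1.mono_measure (S.coeffMeasure_mono (fun x => le_add_self) ∅)
  have h3 : ∀ᵐ x ∂S.vol, MemLp (S.split ∅ (S.lift χ)) 2 (S.coeffMeasure {x} p) := by
    filter_upwards [(nonsingular_single S.measurable_time).ae
      (S.memLp_split hp hp0 hv hv0 h1)] with x hx
    rw [Finset.empty_union] at hx
    exact hx
  cases k
  exacts [.of_forall fun x => h2, h3, .of_forall fun x => h2, h3]

variable [CompleteSpace h]

theorem IsRegular.ae_app_eq_pointVal (H : M.IsRegular Table.empty r s)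
    (hfin : ∀ t, M.polyNorm r s t < ∞) {k : QSIndex}
    (hk : ∀ᵐ x ∂S.vol, M.IsMeasurableField (Table.atom k x)) (hp : AEMeasurable p S.vol)
    (hpq : r⁻¹ + s⁻¹ + q ≤ p) {v : X → ℝ≥0} (hv : AEMeasurable v S.vol) (hv0 : ∀ x, v x ≠ 0)
    (hχ : MemLp χ 2 (S.weighted (v + p))) {D : QSIntegrand S h p}
    (hD : ∀ᵐ x ∂S.vol, ∀ ξ : S.GT h (Table.atom k x).inp p,
      M.IsIntegral (Table.atom k x) (S.time x) ξ (D k x ξ))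
    (hF : M.IsVersion Table.empty (fun _ => S.split ∅ (S.lift χ)) F) :
    ∀ᵐ x ∂S.vol, ∀ d : Marking X, S.IsMarking (Table.atom k x).out d → ∀ᵐ ϑ ∂S.dMChain,
      S.app (D k x) (pointInp S k χ) (d, ϑ) =
        pointVal k (F (noMarks X)) ((x, markOf d), ϑ) := by
  have hp0 : ∀ x, p x ≠ 0 := fun x hx => H.weight_ne_zero x (le_zero_iff.1 (hx ▸ hpq x))
  filter_upwards [H.ae_atom hk, H.ae_polyNormAt_atom_lt_top hfin k, hD, hF.ae_insF k,
    ae_memLp_pointInp hp hp0 hv hv0 hχ k] with x h1 h2 h3 h4 h5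
  have hle := S.coeffMeasure_mono hpq (Table.atom k x).inp
  have h6 := h1.isIntegral_congr h2 ((Lp.memLp h5.toLp).mono_measure hle)
    ((S.ae_coeff_iff hp hp0).1 h5.coeFn_toLp) (fun _ _ => .of_forall fun _ => rfl) (h3 h5.toLp)
  rw [← split_pointInp k x χ] at h4
  intro d hd
  have h7 := (h1.isIntegral_iff h2 (h5.mono_measure hle) h4).1 h6 d hd
  rw [S.app_of_memLp _ h5]
  exact h7

section Versions

variable {D : QSIntegrand S h p} {k : QSIndex} {f : Marking X × S.MChain → h}
  {Φ : Base S × S.MChain → h}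

theorem isScalarVersion_pointVal (hΦ : AEStronglyMeasurable Φ ((baseMeasure S).prod S.dMChain))
    (hk : S.pointVol k = S.vol.prod (Measure.dirac 0))
    (hD : ∀ᵐ x ∂S.vol, ∀ᵐ ϑ ∂S.dMChain, S.app (D k x) f (noMarks X, ϑ) = pointVal k Φ ((x, 0), ϑ)) :
    D.IsScalarVersion k f (fun z => pointVal k Φ ((z.1, 0), z.2)) ∧
    ∀ E, D.IsScalarVersion k f E →
      ∀ᵐ ϑ ∂S.dMChain, ∀ᵐ x ∂S.vol, E (x, ϑ) = pointVal k Φ ((x, 0), ϑ) := by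
  have h1 := aestronglyMeasurable_pointVal hΦ k
  rw [hk] at h1
  have h2 : AEStronglyMeasurable (fun z : X × S.MChain => pointVal k Φ ((z.1, 0), z.2))
      (S.vol.prod S.dMChain) :=
    (S.nonsingular_zeroMark.prodMap NonsingularMap.id).aestronglyMeasurable_comp h1
  refine ⟨⟨h2, hD.mono fun x hx => hx.mono fun ϑ hϑ => hϑ.symm⟩, fun E hE => ?_⟩
  refine Measure.ae_ae_of_ae_prod (NonsingularMap.swap.ae (ae_eq_of_ae_ae_eq hE.1 h2 ?_))
  filter_upwards [hD, hE.2] with x h3 h4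
  filter_upwards [h3, h4] with ϑ h5 h6 using h6.trans h5

theorem isVectorVersion_pointVal (hΦ : AEStronglyMeasurable Φ ((baseMeasure S).prod S.dMChain))
    (hk : S.pointVol k = S.markedVol)
    (hD : ∀ᵐ y ∂S.markedVol, ∀ᵐ ϑ ∂S.dMChain,
      S.app (D k y.1) f (({y} : Finset (X × ℕ)), ϑ) = pointVal k Φ (y, ϑ)) :
    D.IsVectorVersion k f (pointVal k Φ) ∧
    ∀ E, D.IsVectorVersion k f E → ∀ᵐ ϑ ∂S.dMChain, ∀ y ∈ ϑ.fin,
      E (y, sdiff ϑ (single S.mtime y)) = pointVal k Φ (y, sdiff ϑ (single S.mtime y)) := by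
  have h1 := aestronglyMeasurable_pointVal hΦ k
  rw [hk] at h1
  refine ⟨⟨h1, hD.mono fun x hx => hx.mono fun ϑ hϑ => hϑ.symm⟩, fun E hE => ?_⟩
  have h2 : E =ᵐ[S.markedVol.prod S.dMChain] pointVal k Φ := by
    refine ae_eq_of_ae_ae_eq hE.1 h1 ?_
    filter_upwards [hD, hE.2] with y h3 h4
    filter_upwards [h3, h4] with ϑ h5 h6 using h6.trans h5
  have h3 := ae_points (ν := Measure.dirac ()) S.measurable_mtime S.markedVol_time_eq
    (NonsingularMap.snd.ae h2)
  exact nonsingular_unit.ae h3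

end Versions

end MultiIntegrand

namespace MultiIntegrand

open Conf EssOrderedSpace

variable {X : Type*} [MeasurableSpace X] {S : EssOrderedSpace X}
  {h : Type*} [NormedAddCommGroup h] [InnerProductSpace ℂ h]
  {t : ℝ≥0} {F : Base S × S.MChain → h}

theorem last_lt_iff {Z : Type*} {τ : Z → ℝ≥0} {a : Conf τ} {u : ℝ≥0} (hu : 0 < u) :
    a.last < u ↔ a ∈ before τ u := Finset.sup_lt_iff hu

theorem indicator_later_ae_eq (k : QSIndex) (g : X → S.Chain × S.Chain → S.Chain × S.Chain)
    {b c ω : S.MChain}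
    (hg : ∀ x m, insB k (x, 0) (m.1, m.2, b, c) = ((g x m).1, (g x m).2, b, c))
    (hg' : ∀ x, ∀ m ∈ before₂ S.time (S.time x), g x m ∈ before₂ S.time t ↔ S.time x < t) :
    {x | max b.last c.last < S.time x}.indicator (fun x => ∫ m in before₂ S.time (S.time x),
        trunc t F (((g x m).1, (g x m).2, b, c), ω) ∂S.dChain.prod S.dChain) =ᵐ[S.vol]
      (S.past t).indicator fun x => kerInt (S.time x) (insF k F (x, 0)) (b, (c, ω)) := by
  have h0 : ∀ᵐ x ∂S.vol, S.time x ≠ 0 := by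
    rw [ae_iff]
    simpa using S.vol_time_eq 0
  filter_upwards [h0] with x hx
  have hpos : 0 < S.time x := pos_of_ne_zero hx
  have hl : max b.last c.last < S.time x ↔
      b ∈ before S.mtime (S.time x) ∧ c ∈ before S.mtime (S.time x) := by
    rw [max_lt_iff]
    exact and_congr (last_lt_iff hpos) (last_lt_iff hpos)
  by_cases hbc : b ∈ before S.mtime (S.time x) ∧ c ∈ before S.mtime (S.time x)
  · rw [Set.indicator_of_mem (by exact hl.2 hbc)]
    by_cases hxt : S.time x < t
    · rw [Set.indicator_of_mem (by exact hxt), kerInt_of_mem hbc.1 hbc.2]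
      refine setIntegral_congr_fun (measurableSet_before₂ S.measurable_time _) fun m hm => ?_
      refine (Set.indicator_of_mem ?_ F).trans
        (congrArg (fun z : Base S => F (z, ω)) (hg x m).symm)
      have h1 := (hg' x m hm).2 hxt
      exact ⟨⟨h1.1, h1.2, fun y hy => (hbc.1 y hy).trans hxt,
        fun y hy => (hbc.2 y hy).trans hxt⟩, trivial⟩
    · rw [Set.indicator_of_notMem (by exact hxt)]
      refine setIntegral_eq_zero_of_forall_eq_zero fun m hm => Set.indicator_of_notMem ?_ F
      exact fun h1 => hxt ((hg' x m hm).1 ⟨h1.1.1, h1.1.2.1⟩)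
  · rw [Set.indicator_of_notMem (by exact fun h1 => hbc (hl.1 h1))]
    symm
    by_cases hxt : S.time x < t
    · rw [Set.indicator_of_mem (by exact hxt), kerInt_of_notMem hbc]
    · rw [Set.indicator_of_notMem (by exact hxt)]

variable [CompleteSpace h]

/-- The part of the kernel in which the last point is in the out-part. -/
def kerOut (t : ℝ≥0) (F : Base S × S.MChain → h) (y : S.MChain × (S.MChain × S.MChain)) : h :=
  ∫ m in before₂ S.time (max y.1.last y.2.1.last), trunc t F ((m.1, m.2, y.1, y.2.1), y.2.2)
    ∂S.dChain.prod S.dChain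

theorem kerInt_eq_kerOut_add {b c ω : S.MChain}
    (hf : Integrable (fun m : S.Chain × S.Chain => trunc t F ((m.1, m.2, b, c), ω))
      (S.dChain.prod S.dChain)) :
    IntegrableOn (fun x => kerInt (S.time x) (insF .minusPlus F (x, 0)) (b, (c, ω)))
      (S.past t) S.vol ∧
    IntegrableOn (fun x => kerInt (S.time x) (insF .minusCirc F (x, 0)) (b, (c, ω)))
      (S.past t) S.vol ∧
    kerInt t F (b, (c, ω)) = kerOut t F (b, (c, ω)) +
      (∫ x in S.past t, kerInt (S.time x) (insF .minusPlus F (x, 0)) (b, (c, ω)) ∂S.vol +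
      ∫ x in S.past t, kerInt (S.time x) (insF .minusCirc F (x, 0)) (b, (c, ω)) ∂S.vol) := by
  have hb : ∀ {x : X} {a : S.Chain}, a ∈ before S.time (S.time x) → S.time x < t →
      a ∈ before S.time t := fun ha hx z hz => (ha z hz).trans hx
  have k1 := indicator_later_ae_eq (t := t) (F := F) (b := b) (c := c) (ω := ω) .minusPlus
    (fun x m => (ins x m.1, m.2)) (fun _ _ => rfl) fun x m hm =>
    ⟨fun h => (ins_mem_before.1 h.1).1, fun h => ⟨ins_mem_before.2 ⟨h, hb hm.1 h⟩, hb hm.2 h⟩⟩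
  have k2 := indicator_later_ae_eq (t := t) (F := F) (b := b) (c := c) (ω := ω) .minusCirc
    (fun x m => (m.1, ins x m.2)) (fun _ _ => rfl) fun x m hm =>
    ⟨fun h => (ins_mem_before.1 h.2).1, fun h => ⟨hb hm.1 h, ins_mem_before.2 ⟨h, hb hm.2 h⟩⟩⟩
  have hp := measurableSet_past (S := S) t
  have hm : MeasurableSet {x | max b.last c.last < S.time x} :=
    measurableSet_lt measurable_const S.measurable_time
  obtain ⟨h1, h2, h3⟩ := integral_prod_vol_later S.measurable_time S.vol_time_eq
    (max b.last c.last) hf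
  refine ⟨(integrable_indicator_iff hp).1 (((integrable_indicator_iff hm).2 h1).congr k1),
    (integrable_indicator_iff hp).1 (((integrable_indicator_iff hm).2 h2).congr k2), ?_⟩
  refine h3.trans (congrArg₂ (fun u v : h => u + v) rfl (congrArg₂ (fun u v : h => u + v) ?_ ?_))
  · rw [← integral_indicator hm, ← integral_indicator hp]
    exact integral_congr_ae k1
  · rw [← integral_indicator hm, ← integral_indicator hp]
    exact integral_congr_ae k2

theorem kerOut_nil {ϑ : S.MChain}
    (hf : Integrable (fun m : S.Chain × S.Chain =>
      trunc t F ((m.1, m.2, nil S.mtime, nil S.mtime), ϑ)) (S.dChain.prod S.dChain)) :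
    kerOut t F (nil S.mtime, (nil S.mtime, ϑ)) =
      F ((nil S.time, nil S.time, nil S.mtime, nil S.mtime), ϑ) := by
  have h1 := setIntegral_before₂_zero S.measurable_time S.vol_time_eq hf
  have h2 : max (nil S.mtime).last (nil S.mtime).last = 0 := (max_self _).trans Finset.sup_empty
  refine Eq.trans ?_ (h1.trans (Set.indicator_of_mem ?_ F))
  · unfold kerOut
    rw [h2]
    rfl
  · exact ⟨⟨nil_mem_before t, nil_mem_before t, nil_mem_before t, nil_mem_before t⟩, trivial⟩

open Classical in
theorem lastTerm_kerOut (y : X × ℕ) (p : S.MChain × (S.MChain × S.MChain)) :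
    lastTerm (kerOut t F) y p = if S.mtime y < t then
      kerInt (S.mtime y) (insF .circPlus F y) p + kerInt (S.mtime y) (insF .circCirc F y) p
      else 0 := by
  obtain ⟨b, c, ω⟩ := p
  unfold lastTerm
  by_cases hbc : b ∈ before S.mtime (S.mtime y) ∧ c ∈ before S.mtime (S.mtime y)
  · rw [if_pos hbc]
    have hle : ∀ {a : S.MChain}, a ∈ before S.mtime (S.mtime y) → a.last ≤ S.mtime y :=
      fun ha => Finset.sup_le fun z hz => (ha z hz).le
    have h1 : max b.last (ins y c).last = S.mtime y := by
      rw [last_ins hbc.2, max_eq_right (hle hbc.1)]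
    have h2 : max (ins y b).last c.last = S.mtime y := by
      rw [last_ins hbc.1, max_eq_left (hle hbc.2)]
    have hb : ∀ {a : S.MChain}, a ∈ before S.mtime (S.mtime y) → S.mtime y < t →
      a ∈ before S.mtime t := fun ha hx z hz => (ha z hz).trans hx
    have hb' : ∀ {a : S.Chain}, a ∈ before S.time (S.mtime y) → S.mtime y < t →
      a ∈ before S.time t := fun ha hx z hz => (ha z hz).trans hx
    unfold kerOut
    simp only [h1, h2]
    by_cases hy : S.mtime y < t
    · rw [if_pos hy, kerInt_of_mem hbc.1 hbc.2, kerInt_of_mem hbc.1 hbc.2]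
      congr 1 <;> refine setIntegral_congr_fun (measurableSet_before₂ S.measurable_time _)
        fun m hm => Set.indicator_of_mem ?_ F
      exacts [⟨⟨hb' hm.1 hy, hb' hm.2 hy, hb hbc.1 hy, ins_mem_before.2 ⟨hy, hb hbc.2 hy⟩⟩, trivial⟩,
        ⟨⟨hb' hm.1 hy, hb' hm.2 hy, ins_mem_before.2 ⟨hy, hb hbc.1 hy⟩, hb hbc.2 hy⟩, trivial⟩]
    · rw [if_neg hy]
      refine (congrArg₂ (fun u v : h => u + v) ?_ ?_).trans (add_zero 0) <;>
        refine setIntegral_eq_zero_of_forall_eq_zero fun m _ => Set.indicator_of_notMem ?_ F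
      exacts [fun h => hy (ins_mem_before.1 h.1.2.2.2).1, fun h => hy (ins_mem_before.1 h.1.2.2.1).1]
  · rw [if_neg hbc, kerInt_of_notMem hbc, kerInt_of_notMem hbc, add_zero, ite_self]

/-- The multiple integral as the sum of its value at the empty table and single integrals. -/
theorem splitSum₂_kerInt_eq_add {ϑ : S.MChain} (hϑ : Set.InjOn S.mtime (ϑ.fin : Set (X × ℕ)))
    (hf : ∀ b : S.MChain, b.fin ⊆ ϑ.fin → ∀ c : S.MChain, c.fin ⊆ (sdiff ϑ b).fin →
      Integrable (fun m : S.Chain × S.Chain =>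
        trunc t F ((m.1, m.2, b, c), sdiff (sdiff ϑ b) c)) (S.dChain.prod S.dChain)) :
    IntegrableOn (fun x => pointVal .minusPlus F ((x, 0), ϑ)) (S.past t) S.vol ∧
    IntegrableOn (fun x => pointVal .minusCirc F ((x, 0), ϑ)) (S.past t) S.vol ∧
    splitSum₂ (kerInt t F) ϑ = F ((nil S.time, nil S.time, nil S.mtime, nil S.mtime), ϑ) +
      (∫ x in S.past t, pointVal .minusPlus F ((x, 0), ϑ) ∂S.vol +
        ∫ x in S.past t, pointVal .minusCirc F ((x, 0), ϑ) ∂S.vol +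
      ∑ y ∈ S.pastPart t ϑ.fin, (pointVal .circPlus F (y, sdiff ϑ (single S.mtime y)) +
        pointVal .circCirc F (y, sdiff ϑ (single S.mtime y)))) := by
  classical
  have h1 := fun b hb c hc => kerInt_eq_kerOut_add (hf b hb c hc)
  obtain ⟨a1, a2⟩ := integral_splitSum₂_param (ν := S.vol.restrict (S.past t)) (ϑ := ϑ)
    (G := fun x => kerInt (S.time x) (insF .minusPlus F (x, 0)))
    fun b hb c hc => (h1 b hb c hc).1
  obtain ⟨b1, b2⟩ := integral_splitSum₂_param (ν := S.vol.restrict (S.past t)) (ϑ := ϑ)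
    (G := fun x => kerInt (S.time x) (insF .minusCirc F (x, 0)))
    fun b hb c hc => (h1 b hb c hc).2.1
  refine ⟨a1, b1, ?_⟩
  have h2 : splitSum₂ (kerInt t F) ϑ = splitSum₂ (kerOut t F) ϑ +
      (∫ x in S.past t, pointVal .minusPlus F ((x, 0), ϑ) ∂S.vol +
        ∫ x in S.past t, pointVal .minusCirc F ((x, 0), ϑ) ∂S.vol) := by
    let W : S.MChain × (S.MChain × S.MChain) → h := fun y =>
      (∫ x in S.past t, kerInt (S.time x) (insF .minusPlus F (x, 0)) y ∂S.vol) +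
      ∫ x in S.past t, kerInt (S.time x) (insF .minusCirc F (x, 0)) y ∂S.vol
    refine (splitSum₂_congr (W' := fun y => kerOut t F y + W y)
      fun b hb c hc => (h1 b hb c hc).2.2).trans ?_
    refine (splitSum₂_add (kerOut t F) W ϑ).trans ?_
    refine congrArg₂ (fun u v : h => u + v) rfl ((splitSum₂_add _ _ ϑ).trans ?_)
    exact congrArg₂ (fun u v : h => u + v) a2.symm b2.symm
  have h3 : splitSum₂ (kerOut t F) ϑ = F ((nil S.time, nil S.time, nil S.mtime, nil S.mtime), ϑ) +
      ∑ y ∈ S.pastPart t ϑ.fin, (pointVal .circPlus F (y, sdiff ϑ (single S.mtime y)) +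
        pointVal .circCirc F (y, sdiff ϑ (single S.mtime y))) := by
    refine (splitSum₂_eq_last hϑ (kerOut t F)).trans ?_
    have h4 : ∀ ϑ : S.MChain, sdiff ϑ (nil S.mtime) = ϑ := fun ϑ => conf_ext fun x => by
      rw [mem_fin_sdiff]
      exact and_iff_left (Finset.notMem_empty x)
    have h5 := hf (nil S.mtime) (Finset.empty_subset _) (nil S.mtime) (Finset.empty_subset _)
    rw [h4, h4] at h5
    refine congrArg₂ (fun u v : h => u + v) (kerOut_nil h5) ?_
    refine Eq.trans (Finset.sum_congr rfl fun y _ => ?_) (Finset.sum_filter _ _).symm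
    have h6 : lastTerm (kerOut t F) y = fun p => if S.mtime y < t then
      kerInt (S.mtime y) (insF .circPlus F y) p + kerInt (S.mtime y) (insF .circCirc F y) p
      else 0 := funext fun p => lastTerm_kerOut y p
    rw [h6]
    by_cases hy : S.mtime y < t
    · simp only [if_pos hy]
      exact splitSum₂_add _ _ _
    · simp only [if_neg hy]
      exact splitSum₂_zero _
  rw [h2, h3]
  abel

end MultiIntegrand

namespace MultiIntegrand

open Conf EssOrderedSpace

variable {X : Type*} [MeasurableSpace X] {S : EssOrderedSpace X}
  {h : Type*} [NormedAddCommGroup h] [InnerProductSpace ℂ h] [CompleteSpace h] {q : X → ℝ≥0}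
  {M : MultiIntegrand S h q} {r s : X → ℝ≥0} {t : ℝ≥0} {χ ψ : S.MChain → h} {p : X → ℝ≥0}
  {F : Marking X → Base S × S.MChain → h}

theorem IsVersion.ae_eq_nil (hF : M.IsVersion Table.empty (fun _ => S.split ∅ (S.lift χ)) F) :
    ∀ᵐ ϑ ∂S.dMChain, F (noMarks X) ((nil S.time, nil S.time, nil S.mtime, nil S.mtime), ϑ) =
      S.app (M Table.empty) (S.lift χ) (noMarks X, ϑ) := by
  classical
  have h1 := (hF (noMarks X) (S.isMarking_empty_iff.2 rfl)).2
  have h2 := ae_vol_nil S.measurable_time (Measure.ae_ae_of_ae_prod h1)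
  have h3 := ae_vol_nil S.measurable_time (Measure.ae_ae_of_ae_prod h2)
  have h4 := ae_vol_nil S.measurable_mtime (Measure.ae_ae_of_ae_prod h3)
  have h5 := ae_vol_nil S.measurable_mtime h4
  filter_upwards [h5] with ϑ hϑ
  refine hϑ.trans ?_
  have e1 : (outTable (nil S.time, nil S.time, nil S.mtime, nil S.mtime)).union Table.empty =
      Table.empty := Table.union_empty _
  have e2 : join (noMarks X) (nil S.mtime) (nil S.mtime) = noMarks X := rfl
  have e3 : S.split ∅ (S.lift χ) =ᵐ[S.coeffMeasure (Table.empty : Table X).inp q] S.lift χ := by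
    refine S.ae_markProd_iff.2 fun a ha => .of_forall fun ω => (split_empty χ a ω).trans ?_
    have e4 : a = noMarks X := S.isMarking_empty_iff.1 ha
    refine congrArg χ (conf_ext fun y => mem_fin_un.trans ?_)
    rw [e4]
    exact or_iff_right (Finset.notMem_empty y)
  refine (congrArg₂ (fun (T : Table X) m => S.app (M T) (S.split ∅ (S.lift χ)) (m, ϑ)) e1 e2).trans ?_
  exact congrFun (S.app_congr (M Table.empty) e3) _

/-- The multiple integral is the sum of its value at the empty table and the single integral of its
point derivatives. -/
theorem IsRegular.isIntegral_derivative (H : M.IsRegular Table.empty r s)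
    (hM : ∀ k, ∀ᵐ x ∂S.vol, M.IsMeasurableField (Table.atom k x))
    (hfin : ∀ t, M.polyNorm r s t < ∞) (hp : AEMeasurable p S.vol)
    (hpq : r⁻¹ + s⁻¹ + q ≤ p) {v : X → ℝ≥0} (hv : AEMeasurable v S.vol) (hv0 : ∀ x, v x ≠ 0)
    (hχ : MemLp χ 2 (S.weighted (v + p))) {D : QSIntegrand S h p}
    (hD : ∀ k : QSIndex, ∀ᵐ x ∂S.vol, ∀ ξ : S.GT h (Table.atom k x).inp p,
      M.IsIntegral (Table.atom k x) (S.time x) ξ (D k x ξ))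
    (hψ : M.Represents t χ ψ) :
    D.IsIntegral t χ (fun ϑ => ψ ϑ -
      S.app (M Table.empty) (S.lift χ) ((∅ : Finset (X × ℕ)), ϑ)) := by
  classical
  have hχp : MemLp χ 2 (S.weighted (r⁻¹ + s⁻¹ + q)) :=
    hχ.mono_measure (S.weighted_mono (hpq.trans fun x => le_add_self))
  have hl : MemLp (S.lift χ) 2 (S.coeffMeasure (Table.empty : Table X).inp (r⁻¹ + s⁻¹ + q)) :=
    memLp_lift.2 hχp
  obtain ⟨F, hF⟩ := H.exists_version hl
  have hF' : M.IsVersion Table.empty (fun _ => S.split ∅ (S.lift χ)) F := hF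
  have h0 : S.IsMarking (Table.empty : Table X).out (noMarks X) := S.isMarking_empty_iff.2 rfl
  have hΦ := (hF _ h0).1
  have hfin' : M.polyNormAt Table.empty r s t < ∞ := by rw [polyNormAt_empty]; exact hfin t
  have hval := (H.isIntegral_iff hfin' hl hF).1 hψ _ h0
  have hint := ae_integrable_trunc hΦ (H.ae_absVal_lt_top hfin' hl hF h0)
  have hA := fun k => H.ae_app_eq_pointVal hfin (hM k) hp hpq hv hv0 hχ (hD k) hF'
  have hsc : ∀ k, (∀ x, (Table.atom k x).out = ∅) → ∀ᵐ x ∂S.vol, ∀ᵐ ϑ ∂S.dMChain,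
      S.app (D k x) (pointInp S k χ) (noMarks X, ϑ) =
        pointVal k (F (noMarks X)) ((x, 0), ϑ) := fun k hk => by
    filter_upwards [hA k] with x hx
    exact hx (noMarks X) (by rw [hk]; exact S.isMarking_empty_iff.2 rfl)
  have hvec : ∀ k, (∀ x, (Table.atom k x).out = {x}) → ∀ᵐ y ∂S.markedVol, ∀ᵐ ϑ ∂S.dMChain,
      S.app (D k y.1) (pointInp S k χ) (({y} : Finset (X × ℕ)), ϑ) =
        pointVal k (F (noMarks X)) (y, ϑ) := fun k hk => by
    filter_upwards [S.markedVol_fst (hA k), S.ae_markedVol_mem] with y hy hyi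
    have h1 : S.IsMarking {y.1} ({y} : Finset (X × ℕ)) := by
      refine ⟨Finset.image_singleton _ _, ?_, ?_⟩
      · simp
      · intro z hz
        rw [Finset.mem_singleton.1 hz]
        exact hyi
    have h2 := hy ({y} : Finset (X × ℕ)) (by rw [hk]; exact h1)
    have h3 : markOf (show Marking X from ({y} : Finset (X × ℕ))) = y.2 := Finset.sup_singleton
    filter_upwards [h2] with ϑ hϑ
    refine hϑ.trans ?_
    exact congrArg (fun j => pointVal k (F (noMarks X)) ((y.1, j), ϑ)) h3
  obtain ⟨v1, u1⟩ := isScalarVersion_pointVal (k := .minusPlus) hΦ rfl (hsc _ fun _ => rfl)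
  obtain ⟨v2, u2⟩ := isScalarVersion_pointVal (k := .minusCirc) hΦ rfl (hsc _ fun _ => rfl)
  obtain ⟨v3, u3⟩ := isVectorVersion_pointVal (k := .circPlus) hΦ rfl (hvec _ fun _ => rfl)
  obtain ⟨v4, u4⟩ := isVectorVersion_pointVal (k := .circCirc) hΦ rfl (hvec _ fun _ => rfl)
  refine ⟨⟨_, v1⟩, ⟨_, v2⟩, ⟨_, v3⟩, ⟨_, v4⟩, fun E₁ E₂ E₃ E₄ e1 e2 e3 e4 => ?_⟩
  filter_upwards [hval, hint, u1 E₁ e1, u2 E₂ e2, u3 E₃ e3, u4 E₄ e4,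
    ae_isChain (τ := S.mtime) (μ := S.markedVol), hF'.ae_eq_nil] with ϑ a1 a2 a3 a4 a5 a6 a7 a8
  obtain ⟨b1, b2, b3⟩ := splitSum₂_kerInt_eq_add a7 a2
  have c1 := ae_restrict_of_ae (s := S.past t) a3
  have c2 := ae_restrict_of_ae (s := S.past t) a4
  refine ⟨b1.congr (c1.mono fun x hx => hx.symm), b2.congr (c2.mono fun x hx => hx.symm), ?_⟩
  have a1' : ψ ϑ = splitSum₂ (kerInt t (F (noMarks X))) ϑ := a1
  have hsum : ∑ y ∈ S.pastPart t ϑ.fin, (E₃ (y, (show Finset (X × ℕ) from ϑ).erase y) +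
      E₄ (y, (show Finset (X × ℕ) from ϑ).erase y)) = ∑ y ∈ S.pastPart t ϑ.fin,
      (pointVal .circPlus (F (noMarks X)) (y, sdiff ϑ (single S.mtime y)) +
        pointVal .circCirc (F (noMarks X)) (y, sdiff ϑ (single S.mtime y))) := by
    refine Finset.sum_congr rfl fun y hy => ?_
    have hy' := (mem_pastPart.1 hy).1
    have d1 : (show S.MChain from (show Finset (X × ℕ) from ϑ).erase y) =
        sdiff ϑ (single S.mtime y) := conf_ext fun w => by
      refine Finset.mem_erase.trans (Iff.trans ?_ mem_fin_sdiff.symm)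
      rw [mem_fin_single, and_comm]
      rfl
    refine (congrArg (fun ω : S.MChain => E₃ (y, ω) + E₄ (y, ω)) d1).trans ?_
    exact congrArg₂ (fun u v : h => u + v) (a5 y hy') (a6 y hy')
  rw [a1', b3, integral_congr_ae c1, integral_congr_ae c2, a8]
  refine (add_sub_cancel_left _ _).trans ?_
  refine congrArg₂ (fun u v : h => u + v) rfl (Eq.trans hsum.symm ?_)
  congr!

end MultiIntegrand

end

theorem mainTheorem1 {X : Type*} [MeasurableSpace X] (S : EssOrderedSpace X)
    {h : Type*} [NormedAddCommGroup h] [InnerProductSpace ℂ h] [CompleteSpace h]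
    (P₀ : AddSubmonoid (X → ℝ≥0)) (hP₀ : ∀ q₀ ∈ P₀, AEMeasurable q₀ S.vol)
    (q r s : X → ℝ≥0) (hq : ∃ q₀ ∈ P₀, q = 1 + q₀)
    (hr_pos : ∀ x, 0 < r x) (hr : r⁻¹ ∈ P₀) (hs_pos : ∀ x, 0 < s x) (hs : s⁻¹ ∈ P₀)
    (M : MultiIntegrand S h q) (hM : M.IsMeasurable)
    (hM_int : ∀ t : ℝ≥0, M.polyNorm r s t < ∞) :
    (∀ u : Table X, S.IsAdjoint (M u.reflect) (M.star u)) ∧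
    (∀ t : ℝ≥0, M.star.polyNorm r s t = M.polyNorm r s t) ∧
    ∃ T T_star : ℝ≥0 → (S.Gplus h P₀ →ₗ[ℂ] S.Gminus h P₀),
      -- the operators `T_t = ı₀ᵗ(M)` and `T_t* = ı₀ᵗ(M⋆)`, continuous from `G_+` to `G_-`
      (∀ t χ, M.IsIntegral Table.empty t (S.lift χ.1) (S.lift (T t χ).1)) ∧
      (∀ t χ, M.star.IsIntegral Table.empty t (S.lift χ.1) (S.lift (T_star t χ).1)) ∧
      (∀ t, S.IsContinuousOp (T t) ∧ S.IsContinuousOp (T_star t)) ∧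
      (∀ t (η χ : S.Gplus h P₀), S.pairing η.1 (T t χ).1 = S.pairing (T_star t η).1 χ.1) ∧
      -- the estimate of the `p`-norms on `G_⋆(p)`
      (∀ p : X → ℝ≥0, AEMeasurable p S.vol → r⁻¹ + q + s⁻¹ ≤ p →
        ∀ t : ℝ≥0, ∃ Tp Tp_star : S.G h p →L[ℂ] S.G h p⁻¹,
          S.IsExtension (T t) Tp ∧ S.IsExtension (T_star t) Tp_star ∧
          (∀ χ : S.G h p, M.IsIntegral Table.empty t (S.lift χ) (S.lift (Tp χ))) ∧
          (∀ χ : S.G h p, M.star.IsIntegral Table.empty t (S.lift χ) (S.lift (Tp_star χ))) ∧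
          (∀ η χ : S.G h p, S.pairing η (Tp χ) = S.pairing (Tp_star η) χ) ∧
          ‖Tp‖ₑ ≤ M.polyNorm r s t ∧ ‖Tp_star‖ = ‖Tp‖) ∧
      -- the quantum stochastic derivatives `D^μ_ν(x)`
      (∀ p : X → ℝ≥0, AEMeasurable p S.vol → r⁻¹ + q + s⁻¹ ≤ p →
        ∃ D : QSIntegrand S h p,
          (∀ k : QSIndex, ∀ᵐ x ∂S.vol, ∀ ξ : S.GT h (Table.atom k x).inp p,
            M.IsIntegral (Table.atom k x) (S.time x) ξ (D k x ξ)) ∧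
          (∀ t : ℝ≥0,
            D.normOne .minusPlus t ≤ M.polyNorm r s t ∧
            D.normTwo .minusCirc r t ≤ M.polyNorm r s t ∧
            D.normTwo .circPlus r t ≤ M.polyNorm r s t ∧
            D.normTop .circCirc s t ≤ M.polyNorm r s t) ∧
          ((∃ p₀ ∈ P₀, p = 1 + p₀) → ∀ (t : ℝ≥0) (χ : S.Gplus h P₀),
            D.IsIntegral t χ.1 (fun ϑ => (T t χ).1 ϑ -
              S.app (M Table.empty) (S.lift χ.1) ((∅ : Finset (X × ℕ)), ϑ)))) := by
  classical
  obtain ⟨q₀, hq₀, hqe⟩ := hq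
  have hqm : AEMeasurable q S.vol := by rw [hqe]; exact aemeasurable_const.add (hP₀ q₀ hq₀)
  have hq0 : ∀ x, q x ≠ 0 := fun x => by simp [hqe]
  have hrm : AEMeasurable r S.vol := by simpa using (hP₀ _ hr).inv
  have hsm : AEMeasurable s S.vol := by simpa using (hP₀ _ hs).inv
  have H : M.IsRegular Table.empty r s :=
    { hq := hqm, hq0 := hq0, hr := hrm, hr0 := fun x => (hr_pos x).ne', hs := hsm,
      hs0 := fun x => (hs_pos x).ne', field := hM.field,
      norm := hM.norm.congr (.of_forall fun u => (MultiIntegrand.enorm_union_empty M _).symm) }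
  have Hs : M.star.IsRegular Table.empty r s := H.star hM.field_star
  have hfs : ∀ t, M.star.polyNorm r s t = M.polyNorm r s t := fun t => H.polyNorm_star
  have hM_int' : ∀ t, M.star.polyNorm r s t < ∞ := fun t => (hfs t).trans_lt (hM_int t)
  refine ⟨H.isAdjoint_star, hfs, ?_⟩
  have hw : r⁻¹ + s⁻¹ + q = r⁻¹ + q + s⁻¹ := add_right_comm _ _ _
  obtain ⟨w₀, hw₀, hwe⟩ : ∃ w₀ ∈ P₀, r⁻¹ + s⁻¹ + q = 1 + w₀ :=
    ⟨r⁻¹ + s⁻¹ + q₀, P₀.add_mem (P₀.add_mem hr hs) hq₀, by rw [hqe, add_left_comm]⟩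
  have hwm : AEMeasurable (1 + w₀) S.vol := aemeasurable_const.add (hP₀ w₀ hw₀)
  have hplus : ∀ χ : S.Gplus h P₀, MemLp χ.1 2 (S.weighted (r⁻¹ + s⁻¹ + q)) := fun χ => by
    rw [hwe]; exact χ.2 w₀ hw₀
  have hexists : ∀ N : MultiIntegrand S h q, N.IsRegular Table.empty r s →
      (∀ t, N.polyNorm r s t < ∞) → ∀ t, ∃ T : S.Gplus h P₀ →ₗ[ℂ] S.Gminus h P₀,
        (∀ χ, N.Represents t χ.1 (T χ).1) ∧ S.IsContinuousOp T := fun N HN hN t => by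
    obtain ⟨A, hA, -⟩ := HN.exists_scalar_operator (hN t) hwm hwe.le
    obtain ⟨T, hT, hTc⟩ := S.exists_continuousOp hw₀ hwm A
    refine ⟨T, fun χ => ?_, hTc⟩
    have h1 : MemLp χ.1 2 (S.weighted (1 + w₀)) := χ.2 w₀ hw₀
    exact HN.represents_congr (hN t) ((Lp.memLp h1.toLp).mono_measure (S.weighted_mono hwe.le))
      ((S.dMChain_ac hwm fun x => by simp).ae_le h1.coeFn_toLp) (hT χ h1) (hA h1.toLp)
  choose T hT hTc using hexists M H hM_int
  choose T' hT' hTc' using hexists M.star Hs hM_int'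
  refine ⟨T, T', hT, hT', fun t => ⟨hTc t, hTc' t⟩, fun t η χ =>
    H.pairing_star hM.field_star (hM_int t) (hplus χ) (hplus η) (hT t χ) (hT' t η), ?_, ?_⟩
  · intro p hp hpq t
    rw [← hw] at hpq
    have hp0 : ∀ x, p x ≠ 0 := fun x hx => H.weight_ne_zero x (le_zero_iff.1 (hx ▸ hpq x))
    have hle := S.weighted_mono hpq
    obtain ⟨A, hA, hAn⟩ := H.exists_scalar_operator (hM_int t) hp hpq
    obtain ⟨A', hA', -⟩ := Hs.exists_scalar_operator (hM_int' t) hp hpq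
    have hpair : ∀ η χ : S.G h p, S.pairing η (A χ) = S.pairing (A' η) χ := fun η χ =>
      H.pairing_star hM.field_star (hM_int t) ((Lp.memLp χ).mono_measure hle) ((Lp.memLp η).mono_measure hle)
        (hA χ) (hA' η)
    have hext : ∀ (N : MultiIntegrand S h q) (_ : N.IsRegular Table.empty r s)
        (_ : N.polyNorm r s t < ∞) (U : S.Gplus h P₀ →ₗ[ℂ] S.Gminus h P₀)
        (_ : ∀ χ, N.Represents t χ.1 (U χ).1) (B : S.G h p →L[ℂ] S.G h p⁻¹)
        (_ : ∀ χ : S.G h p, N.Represents t χ (B χ)), S.IsExtension U B :=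
      fun N HN hN U hU B hB χ hχ => by
        have h1 := (Lp.memLp hχ.toLp).mono_measure hle
        refine HN.represents_unique hN h1 (hB hχ.toLp) ?_
        exact HN.represents_congr hN (hplus χ)
          (Filter.EventuallyEq.symm ((S.dMChain_ac hp hp0).ae_le hχ.coeFn_toLp)) (.refl _ _) (hU χ)
    exact ⟨A, A', hext M H (hM_int t) _ (hT t) A hA, hext M.star Hs (hM_int' t) _ (hT' t) A' hA',
      hA, hA', hpair, hAn, S.norm_eq_of_pairing hp hp0 hpair⟩
  · intro p hp hpq
    rw [← hw] at hpq
    obtain ⟨D, hD, hDn⟩ := H.exists_derivative hM.derivative hM_int hp hpq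
    refine ⟨D, hD, hDn, ?_⟩
    rintro ⟨p₀, hp₀, hpe⟩ t χ
    refine H.isIntegral_derivative hM.derivative hM_int hp hpq (hP₀ _ hr)
      (fun x => inv_ne_zero (hr_pos x).ne') ?_ hD (hT t χ)
    rw [hpe, add_left_comm]
    exact χ.2 _ (P₀.add_mem hr hp₀)
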